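/- Let $k$ be an algebraically closed field and let $f\in k[x,y]$ be reduced with $f(0)=0$, divisible by neither $x$ nor $y$, and Newton non-degenerate: for every compact face $\Phi$ of its Newton polyhedron $\Gamma^+(f)$, $f_\Phi=\partial_xf_\Phi=\partial_yf_\Phi=0$ has no solution in $(k^\times)^2$. Put $\nu_\alpha(f)=\min\{\alpha\cdot d: d\in\mathrm{supp} f\}$; let $T(f)$ be the union of the rays of $\mathbf R^2_{\ge0}$ normal to the compact edges of the Newton polygon, $T_1,\dots,T_t$ these rays ordered from the lowest to the highest, and $r_i$ the number of branches $b$ of $f$ (irreducible factors in $k[[x,y]]$, up to units) with $T(b)=T_i$. **Jets.** For $m\ge 0$ let $\mathbf A^2_m$ be the space of pairs $x(t)=\sum_{i\le m}x^{(i)}t^i$, $y(t)=\sum_{i\le m}y^{(i)}t^i$, and let $\mathcal C^0_m\subset\mathbf A^2_m$ be the closed set of those with $x^{(0)}=y^{(0)}=0$ and $f(x(t),y(t))\equiv0 \bmod t^{m+1}$. For $\alpha\in\mathbf Z_{>0}^2$ let $\mathcal H^\alpha_m=\{x^{(i)}=y^{(j)}=0: i<\alpha_1,\ j<\alpha_2\}$.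 For a power series $g$ write $g(x(t),y(t))=\sum_j g^{(j)}t^j$ and let $G^\alpha_n\cap\mathbf A^2_m$ be the subset of $\mathcal H^\alpha_m$ where $x^{(\alpha_1)}\ne0$, $y^{(\alpha_2)}\neq0$ and $g^{(0)}=\dots=g^{(n)}=0$. The graph $Jet(f)$ has as vertices of level $m$ the irreducible components of $\mathcal C^0_m$; each is weighted by $(d,e)$, its Krull dimension and embedding dimension (least $e$ such that it is a closed subvariety of $\mathbf A^e$); $V$ of level $m$ and $V'$ of level $m+1$ are joined when the truncation of $V'$ lies in $V$. **The staircase walk $J_{SC}(f)$.** It consists of drawn points of $\mathbf Z_{>0}^2$, edges between them, the weight $\nu_\alpha(f)-1$ at each drawn point $\alpha$, and $r_i$ arrows above each drawn $\alpha\in T_i$. * $t=1$, $T(f)=\mathbf R_{\ge0}(p,q)$ with $p,q$ coprime, $p\le q$: let $SC(q/p)=[[d_1,\dots,d_s]]$, where $r_0=0$, $d_k$ and $r_k$ are quotient and remainder of $q+r_{k-1}$ by $p$, and $s\ge1$ is the first index with $r_s=0$. For each $\lambda=n(p,q)$, $n\ge0$, start at $\lambda+(1,1)$, make for $k=1,\dots,s-1$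 successively $d_k$ vertical unit steps and one horizontal unit step, and finally $d_s-1$ vertical steps. If $p>q$, use $SC(p/q)$ and exchange horizontal and vertical. * $t\ge2$: start at $(1,1)$. From a drawn point strictly between $T_1$ and $T_t$ draw the steps to $\alpha+(1,0)$ and to $\alpha+(0,1)$; from a point on or above $T_t$ the step to $\alpha+(1,0)$; from a point on or below $T_1$ the step to $\alpha+(0,1)$. A drawn point $\gamma$ of weight $w$ is *present at level $m$* if $m\le w$, $m\ge w'+1$ for every edge of the walk arriving at $\gamma$ from a point of weight $w'$, and $m>w'+1$ whenever $\gamma-(1,1)$ is a drawn point of weight $w'$ carrying arrows. The arrows above $\alpha$, of weight $w$, are present at level $m$ if $m\ge w+1$. **Theorem.** 1. If $\mathcal C=\{f=0\}$ is singular at the origin, the irreducible components of $\mathcal C^0_m$ can be read off from $J_{SC}(f)$ for all $m\ge0$. Precisely, $f$ is, up to a unit of $k[[x,y]]$, a product $b_1\cdots b_r$ of pairwise non-associated irreducible power series; the number of arrows above a drawn $\alpha$ is the number of $i$ with $\alpha\in T(b_i)$; and for every $m\geq 0$ the irreducible components of $\mathcal C^0_m$ are, without repetition, the sets $\mathcal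 H^\gamma_m$ for the points $\gamma$ present at level $m$ and the sets $\overline{\mathbf A^2_m\cap B^\alpha_{i,n}}$ with $n=\nu_\alpha(b_i)+m-\nu_\alpha(f)$, for the arrows present at level $m$, i.e. the pairs $(\alpha,i)$ such that the arrows above $\alpha$ are present at level $m$ and $\alpha\in T(b_i)$ (where $B^\alpha_{i,n}$ denotes $G^\alpha_n$ for $g=b_i$). 2. $J_{SC}(f)$ determines $Jet(f)$: if $g\in k[x,y]$ satisfies the same general hypotheses as $f$ (singular or not; in particular if $f,g$ define Newton plane branches) and $J_{SC}(f)=J_{SC}(g)$, then there is a bijection between the vertices of $Jet(f)$ and $Jet(g)$ that preserves levels, edges (in both directions) and Krull dimensions, and, if $k$ has characteristic $0$, embedding dimensions as well; so $Jet(f)=Jet(g)$ as weighted graphs in characteristic $0$. -/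

import Mathlib

noncomputable section

namespace NewtonJets

universe u

/-! ### Newton polygon, tropical variety, non-degeneracy -/

section Newton

variable {k : Type u} [Field k]

/-- The support of a power series in `x = X 0`, `y = X 1`. -/
def supp (φ : MvPowerSeries (Fin 2) k) : Set (Fin 2 →₀ ℕ) :=
  {d | MvPowerSeries.coeff d φ ≠ 0}

/-- `ν_α(φ)`, the minimum of `α · d` over the support of `φ`. -/
def nu (φ : MvPowerSeries (Fin 2) k) (α : ℕ × ℕ) : ℕ :=
  sInf ((fun d : Fin 2 →₀ ℕ => α.1 * d 0 + α.2 * d 1) '' supp φ)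

/-- An exponent as a point of the real plane. -/
def toPlane (d : Fin 2 →₀ ℕ) : ℝ × ℝ := ((d 0 : ℝ), (d 1 : ℝ))

/-- `Γ⁺(φ)`, the convex hull of `supp φ + ℝ²_{≥ 0}`. -/
def newtonPolyhedron (φ : MvPowerSeries (Fin 2) k) : Set (ℝ × ℝ) :=
  convexHull ℝ {v | ∃ d ∈ supp φ, ∃ w : ℝ × ℝ, 0 ≤ w.1 ∧ 0 ≤ w.2 ∧ v = toPlane d + w}

/-- The compact faces (vertices and compact edges) of `Γ⁺(φ)`: the faces of the Newton polygon. -/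
def IsNewtonFace (φ : MvPowerSeries (Fin 2) k) (Φ : Set (ℝ × ℝ)) : Prop :=
  Φ.Nonempty ∧ IsCompact Φ ∧ IsExposed ℝ (newtonPolyhedron φ) Φ

/-- The points of the tropical variety `T(φ)` in `ℕ_{>0}²`: those `α` for which some compact segment
of the Newton polygon lies on the supporting line `{v | α · v = ν_α(φ)}`. -/
def trop (φ : MvPowerSeries (Fin 2) k) : Set (ℕ × ℕ) :=
  {α | 0 < α.1 ∧ 0 < α.2 ∧ ∃ Φ, IsNewtonFace φ Φ ∧ Φ.Nontrivial ∧
    ∀ v ∈ Φ, (α.1 : ℝ) * v.1 + (α.2 : ℝ) * v.2 = (nu φ α : ℝ)}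

open Classical in
/-- `f_Φ`, the part of `f` supported on `Φ`. -/
def facePart (f : MvPolynomial (Fin 2) k) (Φ : Set (ℝ × ℝ)) : MvPolynomial (Fin 2) k :=
  ∑ d ∈ f.support.filter (fun d => toPlane d ∈ Φ), MvPolynomial.monomial d (f.coeff d)

/-- For every face `Φ` of the Newton polygon, `f_Φ` has no singular zero in the torus `(kˣ)²`. -/
def IsNewtonNondegenerate (f : MvPolynomial (Fin 2) k) : Prop :=
  ∀ Φ, IsNewtonFace (f : MvPowerSeries (Fin 2) k) Φ →
    ∀ a : Fin 2 → k, (∀ i, a i ≠ 0) →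
      ¬ (MvPolynomial.eval a (facePart f Φ) = 0 ∧
        ∀ i, MvPolynomial.eval a (MvPolynomial.pderiv i (facePart f Φ)) = 0)

/-- `f` is the reduced equation of a Newton non-degenerate plane curve through the origin, none of
whose components is a coordinate axis. -/
structure IsNewtonPlaneCurve (f : MvPolynomial (Fin 2) k) : Prop where
  reduced : Squarefree f
  origin : MvPolynomial.eval 0 f = 0
  nondegenerate : IsNewtonNondegenerate f
  not_axis : ∀ i, ¬ MvPolynomial.X i ∣ f

/-- The curve `f = 0` is singular at the origin. -/
def IsSingularAtOrigin (f : MvPolynomial (Fin 2) k) : Prop :=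
  MvPolynomial.eval 0 f = 0 ∧ ∀ i, MvPolynomial.eval 0 (MvPolynomial.pderiv i f) = 0

/-- The number of branches of `f` (irreducible factors in `k⟦x, y⟧` up to units) whose tropical
variety contains `α`. -/
def branchCount (f : MvPolynomial (Fin 2) k) (α : ℕ × ℕ) : ℕ :=
  Set.ncard {B : Associates (MvPowerSeries (Fin 2) k) | ∃ b : MvPowerSeries (Fin 2) k,
    Irreducible b ∧ b ∣ (f : MvPowerSeries (Fin 2) k) ∧ α ∈ trop b ∧ B = Associates.mk b}

end Newton

/-! ### The staircase continued fraction `SC(q/p)` -/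

/-- The remainders `r_k`, with `r_0 = 0` and `r_{k+1} = (q + r_k) mod p`. -/
def scRem (q p : ℕ) : ℕ → ℕ
  | 0 => 0
  | n + 1 => (q + scRem q p n) % p

/-- The number of divisions: the first `i ≥ 1` with `r_i = 0`. -/
def scLength (q p : ℕ) : ℕ := sInf {i | 1 ≤ i ∧ scRem q p i = 0}

/-- `SC(q/p) = [[d_1, …, d_i]]`, where `d_{n+1}` is the quotient of `q + r_n` by `p`. -/
def SC (q p : ℕ) : List ℕ :=
  (List.range (scLength q p)).map fun n => (q + scRem q p n) / p

/-- For `[[d_1, …, d_i]]`: for each `j < i`, `d_j` steps `v` followed by one step `h`; finally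
`d_i - 1` steps `v`. -/
def stairSteps (v h : ℕ × ℕ) : List ℕ → List (ℕ × ℕ)
  | [] => []
  | [d] => List.replicate (d - 1) v
  | d :: d' :: ds => List.replicate d v ++ h :: stairSteps v h (d' :: ds)

/-- The elementary steps of the walk attracted by the ray through `(p, q)`. -/
def raySteps (p q : ℕ) : List (ℕ × ℕ) :=
  if p ≤ q then stairSteps (0, 1) (1, 0) (SC q p) else stairSteps (1, 0) (0, 1) (SC p q)

/-- The points of the walk from `lam + (1,1)` (to `lam + (p,q)`). -/
def rayWalk (p q : ℕ) (lam : ℕ × ℕ) : List (ℕ × ℕ) :=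
  (raySteps p q).scanl (· + ·) (lam + (1, 1))

/-! ### The special staircase walk -/

/-- Weighted staircase walks: drawn lattice points, their weights, edges between drawn points, and
the number of (red) arrows above each lattice point. -/
@[ext] structure Staircase where
  points : Set (ℕ × ℕ)
  weight : ℕ × ℕ → ℕ
  edges : Set ((ℕ × ℕ) × (ℕ × ℕ))
  arrows : ℕ × ℕ → ℕ

/-- `β` lies strictly above the ray spanned by `α`. -/
def Above (β α : ℕ × ℕ) : Prop := α.2 * β.1 < α.1 * β.2

/-- `T` consists of the lattice points of the single ray spanned by the primitive vector
`(p, q)`. -/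
def IsSingleRay (T : Set (ℕ × ℕ)) (p q : ℕ) : Prop :=
  0 < p ∧ 0 < q ∧ Nat.Coprime p q ∧ T = {α | ∃ s : ℕ, 1 ≤ s ∧ α = (s * p, s * q)}

/-- The moves of the walk when the tropical variety, with lattice points `T`, has at least two
rays. -/
inductive Move (T : Set (ℕ × ℕ)) : ℕ × ℕ → ℕ × ℕ → Prop
  /-- strictly between the lowest and the highest ray: both moves -/
  | inside_right {α β γ : ℕ × ℕ} : β ∈ T → γ ∈ T → Above α β → Above γ α →
      Move T α (α + (1, 0))
  | inside_up {α β γ : ℕ × ℕ} : β ∈ T → γ ∈ T → Above α β → Above γ α →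
      Move T α (α + (0, 1))
  /-- on the highest ray -/
  | on_top {α : ℕ × ℕ} : α ∈ T → (∀ β ∈ T, ¬ Above β α) → Move T α (α + (1, 0))
  /-- above the highest ray -/
  | above {α : ℕ × ℕ} : (∀ β ∈ T, Above α β) → Move T α (α + (1, 0))
  /-- on the lowest ray -/
  | on_bottom {α : ℕ × ℕ} : α ∈ T → (∀ β ∈ T, ¬ Above α β) → Move T α (α + (0, 1))
  /-- below the lowest ray -/
  | below {α : ℕ × ℕ} : (∀ β ∈ T, Above β α) → Move T α (α + (0, 1))

/-- The drawn points. For a single ray through `(p, q)` the walk of `SC` is repeated from every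
lattice point `s(p, q)`, `s ≥ 0`, of the ray; otherwise one starts at `(1, 1)` and follows the
moves. -/
def walkPoints (T : Set (ℕ × ℕ)) : Set (ℕ × ℕ) :=
  {α | (∃ p q s : ℕ, IsSingleRay T p q ∧ α ∈ rayWalk p q (s * p, s * q)) ∨
    ((¬ ∃ p q : ℕ, IsSingleRay T p q) ∧ Relation.ReflTransGen (Move T) (1, 1) α)}

/-- The drawn edges, oriented in the direction of the walk. -/
def walkEdges (T : Set (ℕ × ℕ)) : Set ((ℕ × ℕ) × (ℕ × ℕ)) :=
  {e | (∃ p q s : ℕ, IsSingleRay T p q ∧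
      e ∈ (rayWalk p q (s * p, s * q)).zip (rayWalk p q (s * p, s * q)).tail) ∨
    ((¬ ∃ p q : ℕ, IsSingleRay T p q) ∧ e.1 ∈ walkPoints T ∧ Move T e.1 e.2)}

open Classical in
/-- The staircase walk `J_SC(f)`: a drawn point `α` has weight `ν_α(f) - 1`, and above a drawn point
of a ray of the tropical variety there is one arrow for each branch with that ray. -/
def JSC {k : Type u} [Field k] (f : MvPolynomial (Fin 2) k) : Staircase where
  points := walkPoints (trop (f : MvPowerSeries (Fin 2) k))
  weight α := if α ∈ walkPoints (trop (f : MvPowerSeries (Fin 2) k)) then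
    nu (f : MvPowerSeries (Fin 2) k) α - 1 else 0
  edges := walkEdges (trop (f : MvPowerSeries (Fin 2) k))
  arrows α := if α ∈ walkPoints (trop (f : MvPowerSeries (Fin 2) k)) then branchCount f α else 0

namespace Staircase

/-- The point `γ` of the walk is present at level `m`: its weight is at least `m`; the points from
which the walk moves to `γ` have vanished (a point of weight `w` vanishes at level `w + 1`); and, if
`γ = λ + (1,1)` for a point `λ` of weight `w` carrying arrows, the level is past `w + 1`. -/
def Present (J : Staircase) (m : ℕ) (γ : ℕ × ℕ) : Prop :=
  γ ∈ J.points ∧ m ≤ J.weight γ ∧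
    (∀ α, (α, γ) ∈ J.edges → J.weight α + 1 ≤ m) ∧
    (∀ lam ∈ J.points, 0 < J.arrows lam → γ = lam + (1, 1) → J.weight lam + 1 < m)

/-- The arrows above `α` are present at level `m`: these start when the point `α` vanishes and never
end. -/
def ArrowsPresent (J : Staircase) (m : ℕ) (α : ℕ × ℕ) : Prop :=
  α ∈ J.points ∧ 0 < J.arrows α ∧ J.weight α + 1 ≤ m

end Staircase

/-! ### Jets and irreducible components -/

section Jets

variable (k : Type u)

/-- The (closed) points of `𝐀²_m`: the coordinate `(0, i)` is `x^{(i)}`, and `(1, i)` is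
`y^{(i)}`. -/
abbrev JetSpace (m : ℕ) : Type u := Fin 2 × Fin (m + 1) → k

variable {k} [Field k]

/-- The series `x(t) = ∑ x^{(i)} t^i` and `y(t) = ∑ y^{(i)} t^i` of a jet. -/
def jetSeries {m : ℕ} (P : JetSpace k m) (i : Fin 2) : PowerSeries k :=
  PowerSeries.mk fun j => if h : j < m + 1 then P (i, ⟨j, h⟩) else 0

/-- `C^0_m`: the jets `(x(t), y(t))` at the origin with `f(x(t), y(t)) ≡ 0` modulo `t^{m+1}`. -/
def jetsAtOrigin (f : MvPolynomial (Fin 2) k) (m : ℕ) : Set (JetSpace k m) :=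
  {P | (∀ i, PowerSeries.coeff 0 (jetSeries P i) = 0) ∧
    ∀ j ≤ m, PowerSeries.coeff j (MvPolynomial.aeval (jetSeries P) f : PowerSeries k) = 0}

/-- Truncation of `m`-jets to `n`-jets (for `n ≤ m`). -/
def truncate {m : ℕ} (n : ℕ) (P : JetSpace k m) : JetSpace k n :=
  fun c => PowerSeries.coeff (c.2 : ℕ) (jetSeries P c.1)

/-- `H^α_m`: the jets with `x^{(i)} = 0` for `i < α₁` and `y^{(j)} = 0` for `j < α₂`. -/
def hyp (α : ℕ × ℕ) (m : ℕ) : Set (JetSpace k m) :=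
  {P | (∀ i < α.1, PowerSeries.coeff i (jetSeries P 0) = 0) ∧
    ∀ j < α.2, PowerSeries.coeff j (jetSeries P 1) = 0}

/-- `𝐀²_m ∩ G^α_n` for a power series `g`: the jets in `H^α_m` with `x^{(α₁)} ≠ 0`, `y^{(α₂)} ≠ 0`
and `g^{(j)} = 0` for `j ≤ n`. -/
def contact (g : MvPowerSeries (Fin 2) k) (α : ℕ × ℕ) (n m : ℕ) : Set (JetSpace k m) :=
  {P | P ∈ hyp α m ∧ PowerSeries.coeff α.1 (jetSeries P 0) ≠ 0 ∧
    PowerSeries.coeff α.2 (jetSeries P 1) ≠ 0 ∧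
    ∀ j ≤ n, PowerSeries.coeff j (MvPowerSeries.subst (jetSeries P) g : PowerSeries k) = 0}

/-- Zariski closure in the affine space of points `σ → k`. -/
def zariskiClosure {σ : Type} (S : Set (σ → k)) : Set (σ → k) :=
  MvPolynomial.zeroLocus k (MvPolynomial.vanishingIdeal k S)

/-- Irreducible Zariski closed subsets. -/
def IsIrreducibleClosed {σ : Type} (V : Set (σ → k)) : Prop :=
  zariskiClosure V = V ∧ (MvPolynomial.vanishingIdeal k V).IsPrime

/-- The irreducible components of a closed set: its maximal irreducible closed subsets. -/
def irr {σ : Type} (C : Set (σ → k)) : Set (Set (σ → k)) :=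
  {V | Maximal (fun W => IsIrreducibleClosed W ∧ W ⊆ C) V}

/-- The ring of regular functions of (the reduced scheme) `V`. -/
abbrev CoordRing {σ : Type} (V : Set (σ → k)) : Type u :=
  MvPolynomial σ k ⧸ MvPolynomial.vanishingIdeal k V

/-- The least `e` such that `V` is isomorphic to a closed subvariety of `𝐀^e`. -/
def embDim {σ : Type} (V : Set (σ → k)) : ℕ :=
  sInf {e | ∃ φ : MvPolynomial (Fin e) k →ₐ[k] CoordRing V, Function.Surjective φ}

/-- The vertices of the graph `Jet(f)`: a level and an irreducible component at this level. -/
abbrev JetVertex (f : MvPolynomial (Fin 2) k) : Type u :=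
  Σ m : ℕ, {V : Set (JetSpace k m) // V ∈ irr (jetsAtOrigin f m)}

/-- The edges of `Jet(f)`: a component at level `m + 1` is joined to each component at level `m`
that contains its truncation. -/
def JetEdge {f : MvPolynomial (Fin 2) k} (v w : JetVertex f) : Prop :=
  w.1 = v.1 + 1 ∧ ∀ P ∈ w.2.1, truncate v.1 P ∈ v.2.1

/-- The Krull dimension of a vertex. -/
def JetVertex.dim {f : MvPolynomial (Fin 2) k} (v : JetVertex f) : WithBot ℕ∞ :=
  ringKrullDim (CoordRing v.2.1)

/-- The embedding dimension of a vertex. -/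
def JetVertex.emb {f : MvPolynomial (Fin 2) k} (v : JetVertex f) : ℕ :=
  embDim v.2.1

/-- The labels of the components read off from `J_SC(f)` at level `m`, given the branches
`b i` of `f`: the points present at level `m`, and the pairs of a point with arrows present at level
`m` and a branch whose tropical variety passes through it. -/
def labels (f : MvPolynomial (Fin 2) k) {r : ℕ} (b : Fin r → MvPowerSeries (Fin 2) k) (m : ℕ) :
    Set ((ℕ × ℕ) ⊕ (ℕ × ℕ) × Fin r) :=
  {l | (∃ γ, l = Sum.inl γ ∧ (JSC f).Present m γ) ∨
    ∃ α i, l = Sum.inr (α, i) ∧ (JSC f).ArrowsPresent m α ∧ α ∈ trop (b i)}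

/-- The subset of `𝐀²_m` with a given label: `H^γ_m` for a point `γ`; for the arrow of the branch
`b i` above `α`, the closure of the set of jets of order `α` having contact
`ν_α(b i) + m - ν_α(f)` with this branch. -/
def component (f : MvPolynomial (Fin 2) k) {r : ℕ} (b : Fin r → MvPowerSeries (Fin 2) k) (m : ℕ) :
    (ℕ × ℕ) ⊕ (ℕ × ℕ) × Fin r → Set (JetSpace k m)
  | Sum.inl γ => hyp γ m
  | Sum.inr (α, i) =>
      zariskiClosure (contact (b i) α (nu (b i) α + m - nu (f : MvPowerSeries (Fin 2) k) α) m)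

end Jets

end NewtonJets

end

namespace NewtonJets

universe u

open PowerSeries (X C coeff constantCoeff)

local prefix:max "↟" => MvPolynomial.toMvPowerSeries

section

section Zariski

variable {k : Type u} [Field k] {σ ι τ : Type}

theorem eval_aeval (Θ : σ → MvPolynomial ι k) (a : ι → k) (p : MvPolynomial σ k) :
    MvPolynomial.eval a (MvPolynomial.aeval Θ p) =
      MvPolynomial.eval (fun c => MvPolynomial.eval a (Θ c)) p := by
  induction p using MvPolynomial.induction_on with
  | C r => simp
  | add p q hp hq => simp only [map_add, hp, hq]
  | mul_X p i hp => simp only [map_mul, hp, MvPolynomial.aeval_X, MvPolynomial.eval_X]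

theorem mem_vanishingIdeal {S : Set (σ → k)} {p : MvPolynomial σ k} :
    p ∈ MvPolynomial.vanishingIdeal k S ↔ ∀ P ∈ S, MvPolynomial.eval P p = 0 := by
  simp [MvPolynomial.mem_vanishingIdeal_iff]

theorem mem_zariskiClosure {S : Set (σ → k)} {P : σ → k} :
    P ∈ zariskiClosure S ↔ ∀ p : MvPolynomial σ k, (∀ Q ∈ S, MvPolynomial.eval Q p = 0) →
      MvPolynomial.eval P p = 0 := by
  simp [zariskiClosure, MvPolynomial.mem_zeroLocus_iff]

theorem subset_zariskiClosure (S : Set (σ → k)) : S ⊆ zariskiClosure S := fun P hP =>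
  mem_zariskiClosure.2 fun _ hp => hp P hP

theorem zariskiClosure_mono {S T : Set (σ → k)} (h : S ⊆ T) :
    zariskiClosure S ⊆ zariskiClosure T := fun _ hP =>
  mem_zariskiClosure.2 fun p hp => mem_zariskiClosure.1 hP p fun Q hQ => hp Q (h hQ)

theorem vanishingIdeal_zariskiClosure (S : Set (σ → k)) :
    MvPolynomial.vanishingIdeal k (zariskiClosure S) = MvPolynomial.vanishingIdeal k S := by
  ext p
  simp only [mem_vanishingIdeal]
  exact ⟨fun h P hP => h P (subset_zariskiClosure S hP),
    fun h P hP => mem_zariskiClosure.1 hP p h⟩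

theorem zariskiClosure_idem (S : Set (σ → k)) :
    zariskiClosure (zariskiClosure S) = zariskiClosure S := by
  unfold zariskiClosure
  exact congrArg _ (vanishingIdeal_zariskiClosure S)

theorem zariskiClosure_subset_iff {S V : Set (σ → k)} (hV : zariskiClosure V = V) :
    zariskiClosure S ⊆ V ↔ S ⊆ V :=
  ⟨(subset_zariskiClosure S).trans, fun h => (zariskiClosure_mono h).trans hV.le⟩

theorem IsIrreducibleClosed.nonempty {V : Set (σ → k)} (h : IsIrreducibleClosed V) :
    V.Nonempty := by
  by_contra hV
  rw [Set.not_nonempty_iff_eq_empty] at hV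
  subst hV
  exact h.2.ne_top (MvPolynomial.vanishingIdeal_empty)

/-- A common zero set of polynomials is Zariski closed. -/
theorem zariskiClosure_eq_of_forall {S : Set (σ → k)}
    (h : ∀ P, P ∉ S → ∃ p : MvPolynomial σ k, (∀ Q ∈ S, MvPolynomial.eval Q p = 0) ∧
      MvPolynomial.eval P p ≠ 0) : zariskiClosure S = S := by
  refine Set.Subset.antisymm (fun P hP => ?_) (subset_zariskiClosure S)
  by_contra hPS
  obtain ⟨p, hp, hne⟩ := h P hPS
  exact hne (mem_zariskiClosure.1 hP p hp)

theorem zariskiClosure_preimage {V : Set (τ → k)} (hV : zariskiClosure V = V)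
    (Θ : τ → MvPolynomial σ k) :
    zariskiClosure {P : σ → k | (fun c => MvPolynomial.eval P (Θ c)) ∈ V} =
      {P : σ → k | (fun c => MvPolynomial.eval P (Θ c)) ∈ V} := by
  refine zariskiClosure_eq_of_forall fun P hP => ?_
  have hP' : (fun c => MvPolynomial.eval P (Θ c)) ∉ zariskiClosure V := by rwa [hV]
  rw [mem_zariskiClosure] at hP'
  push Not at hP'
  obtain ⟨p, hp, hne⟩ := hP'
  exact ⟨MvPolynomial.aeval Θ p, fun Q hQ => by rw [eval_aeval]; exact hp _ hQ,
    by rwa [eval_aeval]⟩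

/-- A polynomial map carries the closure of a set into the closure of its image. -/
theorem mem_zariskiClosure_of_map {S : Set (σ → k)} {T : Set (τ → k)} (Θ : τ → MvPolynomial σ k)
    (h : ∀ P ∈ S, (fun c => MvPolynomial.eval P (Θ c)) ∈ zariskiClosure T) {P : σ → k}
    (hP : P ∈ zariskiClosure S) : (fun c => MvPolynomial.eval P (Θ c)) ∈ zariskiClosure T := by
  have := zariskiClosure_preimage (zariskiClosure_idem T) Θ
  have h2 : zariskiClosure S ⊆ {P : σ → k | (fun c => MvPolynomial.eval P (Θ c)) ∈
      zariskiClosure T} := by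
    rw [zariskiClosure_subset_iff this]
    exact h
  exact h2 hP

theorem exists_subset_of_subset_biUnion {W : Set (σ → k)}
    (hW : (MvPolynomial.vanishingIdeal k W).IsPrime) {L : Set τ} (hL : L.Finite)
    {Z : τ → Set (σ → k)} (hZ : ∀ l ∈ L, zariskiClosure (Z l) = Z l)
    (h : W ⊆ ⋃ l ∈ L, Z l) : ∃ l ∈ L, W ⊆ Z l := by
  classical
  by_contra hcon
  push Not at hcon
  have : ∀ l ∈ L, ∃ p : MvPolynomial σ k, (∀ Q ∈ Z l, MvPolynomial.eval Q p = 0) ∧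
      p ∉ MvPolynomial.vanishingIdeal k W := by
    intro l hl
    obtain ⟨P, hP, hPZ⟩ := Set.not_subset.1 (hcon l hl)
    rw [← hZ l hl, mem_zariskiClosure] at hPZ
    push Not at hPZ
    obtain ⟨p, hp, hne⟩ := hPZ
    exact ⟨p, hp, fun hmem => hne (mem_vanishingIdeal.1 hmem P hP)⟩
  choose! p hp hpW using this
  have hprod : (∏ l ∈ hL.toFinset, p l) ∈ MvPolynomial.vanishingIdeal k W := by
    rw [mem_vanishingIdeal]
    intro P hP
    obtain ⟨l, hl, hPl⟩ := Set.mem_iUnion₂.1 (h hP)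
    rw [map_prod]
    exact Finset.prod_eq_zero (hL.mem_toFinset.2 hl) (hp l hl P hPl)
  obtain ⟨l, hl, hmem⟩ := hW.prod_mem_iff.1 hprod
  exact hpW l (hL.mem_toFinset.1 hl) hmem

/-- The components of a finite union of pairwise incomparable irreducible closed sets. -/
theorem bijOn_irr {L : Set τ} (hL : L.Finite) {Z : τ → Set (σ → k)} {C : Set (σ → k)}
    (hZ : ∀ l ∈ L, IsIrreducibleClosed (Z l)) (hC : C = ⋃ l ∈ L, Z l)
    (hanti : ∀ l ∈ L, ∀ l' ∈ L, Z l ⊆ Z l' → l = l') : Set.BijOn Z L (irr C) := by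
  have hsub : ∀ l ∈ L, Z l ⊆ C := fun l hl => by
    rw [hC]; exact Set.subset_biUnion_of_mem (u := Z) hl
  have hfind : ∀ W, IsIrreducibleClosed W → W ⊆ C → ∃ l ∈ L, W ⊆ Z l := fun W hW hWC =>
    exists_subset_of_subset_biUnion hW.2 hL (fun l hl => (hZ l hl).1) (hC ▸ hWC)
  refine ⟨fun l hl => ⟨⟨hZ l hl, hsub l hl⟩, ?_⟩, fun l hl l' hl' h => hanti l hl l' hl' h.subset,
    ?_⟩
  · rintro W ⟨hW, hWC⟩ hle
    obtain ⟨l', hl', hsub'⟩ := hfind W hW hWC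
    have := hanti l hl l' hl' (hle.trans hsub')
    subst this
    exact hsub'
  · rintro W ⟨⟨hW, hWC⟩, hmax⟩
    obtain ⟨l, hl, hWl⟩ := hfind W hW hWC
    exact ⟨l, hl, Set.Subset.antisymm (hmax ⟨hZ l hl, hsub l hl⟩ hWl) hWl⟩

/-- The ideal of the image of the open set `D ≠ 0` under a polynomial map. -/
theorem vanishingIdeal_param [Infinite k] (Θ : σ → MvPolynomial ι k) {D : MvPolynomial ι k}
    (hD : D ≠ 0) :
    MvPolynomial.vanishingIdeal k {P : σ → k | ∃ a : ι → k, MvPolynomial.eval a D ≠ 0 ∧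
      P = fun c => MvPolynomial.eval a (Θ c)} = RingHom.ker (MvPolynomial.aeval (R := k) Θ) := by
  ext p
  rw [mem_vanishingIdeal, RingHom.mem_ker]
  constructor
  · intro h
    have : D * MvPolynomial.aeval Θ p = 0 := by
      refine MvPolynomial.funext fun a => ?_
      rw [map_mul, map_zero]
      by_cases ha : MvPolynomial.eval a D = 0
      · rw [ha, zero_mul]
      · rw [eval_aeval, h _ ⟨a, ha, rfl⟩, mul_zero]
    exact (mul_eq_zero.1 this).resolve_left hD
  · rintro h P ⟨a, -, rfl⟩
    rw [← eval_aeval, h, map_zero]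

theorem isIrreducibleClosed_param [Infinite k] (Θ : σ → MvPolynomial ι k) {D : MvPolynomial ι k}
    (hD : D ≠ 0) {S : Set (σ → k)} (hS : S = {P : σ → k | ∃ a : ι → k, MvPolynomial.eval a D ≠ 0 ∧
      P = fun c => MvPolynomial.eval a (Θ c)}) : IsIrreducibleClosed (zariskiClosure S) := by
  refine ⟨zariskiClosure_idem S, ?_⟩
  rw [vanishingIdeal_zariskiClosure, hS, vanishingIdeal_param Θ hD]
  exact RingHom.ker_isPrime _

/-- The image of every point of the parameter space lies in the closure. -/
theorem param_mem_zariskiClosure [Infinite k] (Θ : σ → MvPolynomial ι k) {D : MvPolynomial ι k}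
    (hD : D ≠ 0) {S : Set (σ → k)} (hS : ∀ a : ι → k, MvPolynomial.eval a D ≠ 0 →
      (fun c => MvPolynomial.eval a (Θ c)) ∈ S) (a : ι → k) :
    (fun c => MvPolynomial.eval a (Θ c)) ∈ zariskiClosure S := by
  have h : {P : σ → k | ∃ a : ι → k, MvPolynomial.eval a D ≠ 0 ∧
      P = fun c => MvPolynomial.eval a (Θ c)} ⊆ S := by
    rintro _ ⟨a, ha, rfl⟩
    exact hS a ha
  refine zariskiClosure_mono h (mem_zariskiClosure.2 fun p hp => ?_)
  have h2 : p ∈ RingHom.ker (MvPolynomial.aeval (R := k) Θ) := by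
    rw [← vanishingIdeal_param Θ hD, mem_vanishingIdeal]
    exact hp
  rw [← vanishingIdeal_param Θ (one_ne_zero), mem_vanishingIdeal] at h2
  exact h2 _ ⟨a, by simp, rfl⟩

/-- The coordinate ring of a parametrized variety. -/
noncomputable def coordRingEquivRange [Infinite k] (Θ : σ → MvPolynomial ι k) {D : MvPolynomial ι k}
    (hD : D ≠ 0) {S : Set (σ → k)} (hS : S = {P : σ → k | ∃ a : ι → k, MvPolynomial.eval a D ≠ 0 ∧
      P = fun c => MvPolynomial.eval a (Θ c)}) :
    CoordRing (zariskiClosure S) ≃ₐ[k] (MvPolynomial.aeval (R := k) Θ).range :=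
  (Ideal.quotientEquivAlgOfEq k (by
    rw [vanishingIdeal_zariskiClosure, hS, vanishingIdeal_param Θ hD])).trans
    (Ideal.quotientKerEquivRange (MvPolynomial.aeval (R := k) Θ))

end Zariski

section Dimension

variable {k : Type u} [Field k]

theorem ringKrullDim_eq_of_isIntegral {A B : Type*} [CommRing A] [CommRing B] [Algebra A B]
    [Nontrivial B] [IsDomain A] [Algebra.IsIntegral A B]
    (hinj : Function.Injective (algebraMap A B)) :
    ringKrullDim B = ringKrullDim A := by
  refine le_antisymm ?_ ?_
  · refine Order.krullDim_le_of_strictMono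
      (fun p : PrimeSpectrum B => PrimeSpectrum.comap (algebraMap A B) p) ?_
    intro p q hpq
    exact Ideal.IsIntegral.comap_lt_comap (I := p.asIdeal) (J := q.asIdeal) hpq
  · refine iSup_le fun l => ?_
    have hker : (⊥ : Ideal B).comap (algebraMap A B) ≤ l.head.asIdeal := by
      rw [← RingHom.ker_eq_comap_bot, (RingHom.injective_iff_ker_eq_bot _).1 hinj]
      exact bot_le
    obtain ⟨Q, -, hQ, hQc⟩ := Ideal.exists_ideal_over_prime_of_isIntegral
      (S := B) l.head.asIdeal ⊥ hker
    have : Q.LiesOver l.head.asIdeal := ⟨hQc.symm⟩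
    obtain ⟨L, hL, -, -⟩ := Ideal.exists_ltSeries_of_hasGoingUp (S := B) l Q
    rw [← hL]
    exact le_iSup (fun p : LTSeries (PrimeSpectrum B) => (p.length : WithBot ℕ∞)) L

theorem ringKrullDim_eq_trdeg {A : Type u} [CommRing A] [IsDomain A] [Algebra k A]
    [Algebra.FiniteType k A] {n : ℕ} (h : Algebra.trdeg k A = n) : ringKrullDim A = n := by
  obtain ⟨s, g, hg, hint⟩ := exists_integral_inj_algHom_of_fg k A
  let : Algebra (MvPolynomial (Fin s) k) A := g.toRingHom.toAlgebra
  have : IsScalarTower k (MvPolynomial (Fin s) k) A :=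
    IsScalarTower.of_algebraMap_eq fun x => (g.commutes x).symm
  have : Algebra.IsIntegral (MvPolynomial (Fin s) k) A := ⟨hint⟩
  have hinj : Function.Injective (algebraMap (MvPolynomial (Fin s) k) A) := hg
  have : FaithfulSMul (MvPolynomial (Fin s) k) A :=
    (faithfulSMul_iff_algebraMap_injective _ _).2 hinj
  have h1 := trdeg_add_eq k (MvPolynomial (Fin s) k) (A := A)
  rw [trdeg_eq_zero (R := MvPolynomial (Fin s) k), add_zero, MvPolynomial.trdeg_of_isDomain, h] at h1
  have h2 : s = n := by simpa using h1
  subst h2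
  rw [ringKrullDim_eq_of_isIntegral hinj, MvPolynomial.ringKrullDim_of_isNoetherianRing]
  simp

theorem ringKrullDim_mvPolynomial_field {ι : Type} [Fintype ι] :
    ringKrullDim (MvPolynomial ι k) = Fintype.card ι := by
  rw [MvPolynomial.ringKrullDim_of_isNoetherianRing]
  simp

variable {σ ι : Type} [Fintype ι]

theorem ringKrullDim_param [Infinite k] [Finite σ] (Θ : σ → MvPolynomial ι k) {D : MvPolynomial ι k}
    (hD : D ≠ 0) {S : Set (σ → k)} (hS : S = {P : σ → k | ∃ a : ι → k, MvPolynomial.eval a D ≠ 0 ∧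
      P = fun c => MvPolynomial.eval a (Θ c)})
    (halg : Algebra.IsAlgebraic (MvPolynomial.aeval (R := k) Θ).range (MvPolynomial ι k)) :
    ringKrullDim (CoordRing (zariskiClosure S)) = Fintype.card ι := by
  rw [ringKrullDim_eq_of_ringEquiv (coordRingEquivRange Θ hD hS).toRingEquiv]
  have : Algebra.FiniteType k (MvPolynomial.aeval (R := k) Θ).range :=
    Algebra.FiniteType.of_surjective (MvPolynomial.aeval (R := k) Θ).rangeRestrict
      (AlgHom.rangeRestrict_surjective _)
  refine ringKrullDim_eq_trdeg (k := k) ?_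
  have h1 := trdeg_add_eq k (MvPolynomial.aeval (R := k) Θ).range (A := MvPolynomial ι k)
  rw [trdeg_eq_zero (R := (MvPolynomial.aeval (R := k) Θ).range), add_zero, MvPolynomial.trdeg_of_isDomain] at h1
  rw [h1]; simp

/-- An irreducible closed proper subset has smaller dimension. -/
theorem ringKrullDim_add_one_le {V W : Set (σ → k)} (hW : IsIrreducibleClosed W)
    (hVc : zariskiClosure V = V) (h : V ⊆ W) (hne : V ≠ W) :
    ringKrullDim (CoordRing V) + 1 ≤ ringKrullDim (CoordRing W) := by
  have hle : MvPolynomial.vanishingIdeal k W ≤ MvPolynomial.vanishingIdeal k V :=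
    MvPolynomial.vanishingIdeal_anti_mono h
  have hnot : ¬ W ⊆ V := fun h' => hne (h.antisymm h')
  obtain ⟨P, hP, hPV⟩ := Set.not_subset.1 hnot
  rw [← hVc, mem_zariskiClosure] at hPV
  push Not at hPV
  obtain ⟨p, hp, hpP⟩ := hPV
  have := hW.2
  refine ringKrullDim_succ_le_of_surjective (Ideal.Quotient.factor hle)
    (Ideal.Quotient.factor_surjective hle) (r := Ideal.Quotient.mk _ p) ?_ ?_
  · rw [mem_nonZeroDivisors_iff_ne_zero, Ne, Ideal.Quotient.eq_zero_iff_mem, mem_vanishingIdeal]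
    exact fun h' => hpP (h' P hP)
  · rw [Ideal.Quotient.factor_mk, Ideal.Quotient.eq_zero_iff_mem, mem_vanishingIdeal]
    exact hp

theorem embDim_le {V : Set (σ → k)} (ψ : MvPolynomial ι k →ₐ[k] CoordRing V)
    (hψ : Function.Surjective ψ) : embDim V ≤ Fintype.card ι :=
  Nat.sInf_le ⟨ψ.comp (MvPolynomial.renameEquiv k (Fintype.equivFin ι).symm).toAlgHom,
    hψ.comp (MvPolynomial.renameEquiv k (Fintype.equivFin ι).symm).surjective⟩

theorem exists_embDim [Finite σ] (V : Set (σ → k)) :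
    ∃ φ : MvPolynomial (Fin (embDim V)) k →ₐ[k] CoordRing V, Function.Surjective φ := by
  cases nonempty_fintype σ
  have hne : {e | ∃ φ : MvPolynomial (Fin e) k →ₐ[k] CoordRing V,
      Function.Surjective φ}.Nonempty :=
    ⟨Fintype.card σ, (Ideal.Quotient.mkₐ k _).comp
      (MvPolynomial.renameEquiv k (Fintype.equivFin σ).symm).toAlgHom,
      (Ideal.Quotient.mkₐ_surjective k _).comp
        (MvPolynomial.renameEquiv k (Fintype.equivFin σ).symm).surjective⟩
  exact Nat.sInf_mem hne

theorem le_embDim_of_ringKrullDim [Finite σ] {V : Set (σ → k)} {n : ℕ}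
    (h : ringKrullDim (CoordRing V) = n) : n ≤ embDim V := by
  obtain ⟨φ, hφ⟩ := exists_embDim V
  have := ringKrullDim_le_of_surjective (φ : MvPolynomial (Fin (embDim V)) k →+* CoordRing V) hφ
  rw [h, ringKrullDim_mvPolynomial_field, Fintype.card_fin] at this
  exact_mod_cast this

/-- Lower bound for the embedding dimension through the tangent space at the origin: if all the
polynomials that vanish on `V` have no linear term in the coordinates of `T`, then the embedding
dimension is at least the number of these. -/
theorem card_le_embDim [Finite σ] {V : Set (σ → k)} (T : Finset σ)
    (hT : ∀ p : MvPolynomial σ k, (∀ Q ∈ V, MvPolynomial.eval Q p = 0) →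
      ∀ c ∈ T, MvPolynomial.eval 0 (MvPolynomial.pderiv c p) = 0) : T.card ≤ embDim V := by
  classical
  obtain ⟨φ, hφ⟩ := exists_embDim V
  -- lifts of the images of the variables
  choose y hy using fun j => Ideal.Quotient.mk_surjective (φ (MvPolynomial.X j))
  let Φ : MvPolynomial (Fin (embDim V)) k →ₐ[k] MvPolynomial σ k := MvPolynomial.aeval y
  have hΦ : ∀ q, Ideal.Quotient.mk (MvPolynomial.vanishingIdeal k V) (Φ q) = φ q := by
    intro q
    have : (Ideal.Quotient.mkₐ k (MvPolynomial.vanishingIdeal k V)).comp Φ = φ := by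
      ext j
      simp [Φ, hy]
    exact DFunLike.congr_fun this q
  -- each coordinate of `T` is, up to elements of the ideal, a polynomial in the `y j`
  have hlift : ∀ c : σ, ∃ q, MvPolynomial.X c - Φ q ∈ MvPolynomial.vanishingIdeal k V := by
    intro c
    obtain ⟨q, hq⟩ := hφ (Ideal.Quotient.mk _ (MvPolynomial.X c))
    exact ⟨q, by rw [← Ideal.Quotient.eq_zero_iff_mem, map_sub, hΦ, hq, sub_self]⟩
  choose q hq using hlift
  have hchain : ∀ c (r : MvPolynomial (Fin (embDim V)) k),
      MvPolynomial.eval 0 (MvPolynomial.pderiv c (Φ r)) =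
        ∑ j, MvPolynomial.eval (fun j => MvPolynomial.eval 0 (y j)) (MvPolynomial.pderiv j r) *
          MvPolynomial.eval 0 (MvPolynomial.pderiv c (y j)) := by
    intro c r
    induction r using MvPolynomial.induction_on with
    | C a => simp [Φ]
    | add r s hr hs =>
      simp only [map_add, hr, hs, add_mul, Finset.sum_add_distrib]
    | mul_X r j hr =>
      have hev : MvPolynomial.eval 0 (Φ r) =
          MvPolynomial.eval (fun j => MvPolynomial.eval 0 (y j)) r := eval_aeval y 0 r
      have hX : Φ (MvPolynomial.X j) = y j := by simp [Φ]
      simp only [map_mul, Derivation.leibniz, map_add, smul_eq_mul, hX, hr, hev,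
        MvPolynomial.eval_X, MvPolynomial.pderiv_X]
      simp only [Pi.single_apply, add_mul, Finset.sum_add_distrib, Finset.mul_sum]
      congr 1
      · rw [Finset.sum_eq_single j]
        · simp
        · intro i _ hij
          simp [hij.symm]
        · simp
      · exact Finset.sum_congr rfl fun i _ => by ring
  let M : Matrix T (Fin (embDim V)) k := fun c j =>
    MvPolynomial.eval 0 (MvPolynomial.pderiv (c : σ) (y j))
  let N : Matrix (Fin (embDim V)) T k := fun j c =>
    MvPolynomial.eval (fun j => MvPolynomial.eval 0 (y j)) (MvPolynomial.pderiv j (q c))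
  have hMN : M * N = 1 := by
    ext c d
    have h1 := hT _ (mem_vanishingIdeal.1 (hq (d : σ))) c c.2
    rw [map_sub, map_sub, hchain, sub_eq_zero, MvPolynomial.pderiv_X] at h1
    rw [Matrix.mul_apply]
    have h2 : ∑ j, M c j * N j d = ∑ j, MvPolynomial.eval (fun j => MvPolynomial.eval 0 (y j))
        (MvPolynomial.pderiv j (q d)) * MvPolynomial.eval 0 (MvPolynomial.pderiv (c : σ) (y j)) :=
      Finset.sum_congr rfl fun j _ => mul_comm _ _
    rw [h2, ← h1, Matrix.one_apply]
    by_cases hcd : c = d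
    · subst hcd; simp
    · have : (c : σ) ≠ d := fun h => hcd (Subtype.ext h)
      simp [hcd, this]
  have hle := Matrix.rank_mul_le_left M N
  rw [hMN, Matrix.rank_one] at hle
  simpa using hle.trans M.rank_le_card_width

/-- The closed sets that are graphs of polynomial maps. -/
theorem graph_facts [Infinite k] [Finite σ] {V : Set (σ → k)} (j : ι → σ) (Θ : σ → MvPolynomial ι k)
    (hj : ∀ i, Θ (j i) = MvPolynomial.X i)
    (hV : V = {P | ∃ a : ι → k, P = fun c => MvPolynomial.eval a (Θ c)}) :
    IsIrreducibleClosed V ∧ ringKrullDim (CoordRing V) = Fintype.card ι ∧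
      embDim V = Fintype.card ι := by
  have hV' : V = {P | ∃ a : ι → k, MvPolynomial.eval a (1 : MvPolynomial ι k) ≠ 0 ∧
      P = fun c => MvPolynomial.eval a (Θ c)} := by simpa using hV
  have hsurj : Function.Surjective (MvPolynomial.aeval (R := k) Θ) := by
    intro p
    refine ⟨MvPolynomial.rename j p, ?_⟩
    rw [MvPolynomial.aeval_rename]
    have : Θ ∘ j = MvPolynomial.X := funext hj
    rw [this, MvPolynomial.aeval_X_left_apply]
  have hcl : zariskiClosure V = V := by
    refine zariskiClosure_eq_of_forall fun P hP => ?_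
    by_contra hcon
    push Not at hcon
    refine hP ?_
    rw [hV]
    refine ⟨P ∘ j, funext fun c => ?_⟩
    have := hcon (MvPolynomial.X c - MvPolynomial.rename j (Θ c)) (by
      intro Q hQ
      rw [hV] at hQ
      obtain ⟨a, rfl⟩ := hQ
      simp only [map_sub, MvPolynomial.eval_X, MvPolynomial.eval_rename]
      rw [sub_eq_zero]
      congr 2
      funext i
      simp [hj])
    rw [map_sub, MvPolynomial.eval_X, MvPolynomial.eval_rename, sub_eq_zero] at this
    exact this
  have hirr : IsIrreducibleClosed V := by
    have := isIrreducibleClosed_param Θ one_ne_zero hV'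
    rwa [hcl] at this
  have e := coordRingEquivRange Θ one_ne_zero hV'
  rw [hcl, AlgHom.range_eq_top _ |>.2 hsurj] at e
  have e' : CoordRing V ≃ₐ[k] MvPolynomial ι k := e.trans Subalgebra.topEquiv
  have hdim : ringKrullDim (CoordRing V) = Fintype.card ι := by
    rw [ringKrullDim_eq_of_ringEquiv e'.toRingEquiv, ringKrullDim_mvPolynomial_field]
  exact ⟨hirr, hdim, (embDim_le e'.symm.toAlgHom e'.symm.surjective).antisymm
    (le_embDim_of_ringKrullDim hdim)⟩

end Dimension

end

section

section Order

variable {k : Type u} [Field k]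

/-- The weight of an exponent. -/
def dot (w : Fin 2 → ℕ) (d : Fin 2 →₀ ℕ) : ℕ := w 0 * d 0 + w 1 * d 1

/-- The order of a power series with respect to weights of the variables. -/
noncomputable def ord (φ : MvPowerSeries (Fin 2) k) (w : Fin 2 → ℕ) : ℕ := sInf (dot w '' supp φ)

theorem dot_add (w : Fin 2 → ℕ) (d e : Fin 2 →₀ ℕ) : dot w (d + e) = dot w d + dot w e := by
  simp only [dot, Finsupp.add_apply]; ring

theorem dot_eq_weight (w : Fin 2 → ℕ) (d : Fin 2 →₀ ℕ) : Finsupp.weight w d = dot w d := by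
  rw [Finsupp.weight_apply, Finsupp.sum_fintype _ _ (by simp), Fin.sum_univ_two, dot]
  simp [mul_comm]

theorem ord_le {φ : MvPowerSeries (Fin 2) k} {d : Fin 2 →₀ ℕ} (w : Fin 2 → ℕ)
    (h : MvPowerSeries.coeff d φ ≠ 0) : ord φ w ≤ dot w d :=
  Nat.sInf_le ⟨d, h, rfl⟩

theorem exists_ord {φ : MvPowerSeries (Fin 2) k} (h : φ ≠ 0) (w : Fin 2 → ℕ) :
    ∃ d, MvPowerSeries.coeff d φ ≠ 0 ∧ dot w d = ord φ w := by
  have hne : (dot w '' supp φ).Nonempty := by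
    obtain ⟨d, hd⟩ := (MvPowerSeries.ne_zero_iff_exists_coeff_ne_zero φ).1 h
    exact ⟨_, d, hd, rfl⟩
  obtain ⟨d, hd, hd'⟩ := Nat.sInf_mem hne
  exact ⟨d, hd, hd'⟩

theorem le_ord {φ : MvPowerSeries (Fin 2) k} (h : φ ≠ 0) {w : Fin 2 → ℕ} {n : ℕ}
    (hn : ∀ d, MvPowerSeries.coeff d φ ≠ 0 → n ≤ dot w d) : n ≤ ord φ w := by
  obtain ⟨d, hd, hd'⟩ := exists_ord h w
  exact hd' ▸ hn d hd

theorem weightedOrder_eq_ord {φ : MvPowerSeries (Fin 2) k} (h : φ ≠ 0) (w : Fin 2 → ℕ) :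
    φ.weightedOrder w = ord φ w := by
  refine (MvPowerSeries.weightedOrder_eq_nat w).2 ⟨?_, ?_⟩
  · obtain ⟨d, hd, hd'⟩ := exists_ord h w
    exact ⟨d, hd, by rw [dot_eq_weight, hd']⟩
  · intro d hd
    by_contra hne
    rw [dot_eq_weight] at hd
    exact (ord_le w hne).not_gt hd

theorem ord_mul {φ ψ : MvPowerSeries (Fin 2) k} (hφ : φ ≠ 0) (hψ : ψ ≠ 0) (w : Fin 2 → ℕ) :
    ord (φ * ψ) w = ord φ w + ord ψ w := by
  have := MvPowerSeries.weightedOrder_mul w φ ψ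
  rw [weightedOrder_eq_ord hφ, weightedOrder_eq_ord hψ, weightedOrder_eq_ord (mul_ne_zero hφ hψ)]
    at this
  exact_mod_cast this

theorem ord_eq_zero_of_isUnit {φ : MvPowerSeries (Fin 2) k} (h : IsUnit φ) (w : Fin 2 → ℕ) :
    ord φ w = 0 := by
  have h0 : MvPowerSeries.coeff 0 φ ≠ 0 := by
    rw [MvPowerSeries.isUnit_iff_constantCoeff] at h
    simpa using h.ne_zero
  simpa [dot] using ord_le w h0

/-- The exponents of a given weight (for positive weights). -/
noncomputable def level (w : Fin 2 → ℕ) (n : ℕ) : Finset (Fin 2 →₀ ℕ) :=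
  {d ∈ Finset.Iic (Finsupp.equivFunOnFinite.symm fun _ => n) | dot w d = n}

theorem mem_level {w : Fin 2 → ℕ} (hw : ∀ i, 0 < w i) {n : ℕ} {d : Fin 2 →₀ ℕ} :
    d ∈ level w n ↔ dot w d = n := by
  simp only [level, Finset.mem_filter, Finset.mem_Iic, and_iff_right_iff_imp]
  intro h i
  rw [← h]
  have h0 := Nat.le_mul_of_pos_left (d 0) (hw 0)
  have h1 := Nat.le_mul_of_pos_left (d 1) (hw 1)
  fin_cases i <;> simp [dot] <;> omega

/-- The part of weight `n` of a power series, as a function. -/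
noncomputable def homPart (φ : MvPowerSeries (Fin 2) k) (w : Fin 2 → ℕ) (n : ℕ) (u : Fin 2 → k) :
    k :=
  ∑ d ∈ level w n, MvPowerSeries.coeff d φ * (u 0 ^ d 0 * u 1 ^ d 1)

theorem prod_pow_eq {R : Type*} [CommSemiring R] (x : Fin 2 → R) (d : Fin 2 →₀ ℕ) :
    (d.prod fun i e => x i ^ e) = x 0 ^ d 0 * x 1 ^ d 1 := by
  rw [Finsupp.prod_fintype _ _ (by simp), Fin.prod_univ_two]

variable {w : Fin 2 → ℕ} {x : Fin 2 → PowerSeries k}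

theorem hasSubst_of_dvd (hw : ∀ i, 0 < w i) (hx : ∀ i, X ^ w i ∣ x i) :
    MvPowerSeries.HasSubst x := by
  refine MvPowerSeries.hasSubst_of_constantCoeff_zero fun i => ?_
  have : X ∣ x i := (dvd_pow_self _ (hw i).ne').trans (hx i)
  exact PowerSeries.X_dvd_iff.1 this

theorem monomial_eq (hx : ∀ i, X ^ w i ∣ x i) (d : Fin 2 →₀ ℕ) :
    ∃ z : PowerSeries k, x 0 ^ d 0 * x 1 ^ d 1 = X ^ dot w d * z ∧
      coeff 0 z =
        coeff (w 0) (x 0) ^ d 0 * coeff (w 1) (x 1) ^ d 1 := by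
  obtain ⟨y0, h0⟩ := hx 0
  obtain ⟨y1, h1⟩ := hx 1
  refine ⟨y0 ^ d 0 * y1 ^ d 1, ?_, ?_⟩
  · rw [h0, h1, dot, pow_add, pow_mul, pow_mul]; ring
  · have e0 : coeff (w 0) (x 0) = coeff 0 y0 := by
      rw [h0, PowerSeries.coeff_X_pow_mul']; simp
    have e1 : coeff (w 1) (x 1) = coeff 0 y1 := by
      rw [h1, PowerSeries.coeff_X_pow_mul']; simp
    rw [e0, e1]
    simp

theorem coeff_subst_eq (hx : MvPowerSeries.HasSubst x) (φ : MvPowerSeries (Fin 2) k) (n : ℕ) :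
    coeff n (MvPowerSeries.subst x φ : PowerSeries k) =
      ∑ᶠ d, MvPowerSeries.coeff d φ * coeff n (x 0 ^ d 0 * x 1 ^ d 1) := by
  have := MvPowerSeries.coeff_subst hx φ (Finsupp.single () n)
  rw [coeff, this]
  refine finsum_congr fun d => ?_
  rw [prod_pow_eq, smul_eq_mul]

theorem X_pow_dvd_subst (hw : ∀ i, 0 < w i) (hx : ∀ i, X ^ w i ∣ x i)
    {φ : MvPowerSeries (Fin 2) k} {n : ℕ}
    (hn : ∀ d, MvPowerSeries.coeff d φ ≠ 0 → n ≤ dot w d) :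
    X ^ n ∣ (MvPowerSeries.subst x φ : PowerSeries k) := by
  rw [PowerSeries.X_pow_dvd_iff]
  intro m hm
  rw [coeff_subst_eq (hasSubst_of_dvd hw hx)]
  refine finsum_eq_zero_of_forall_eq_zero fun d => ?_
  by_cases hd : MvPowerSeries.coeff d φ = 0
  · rw [hd, zero_mul]
  · obtain ⟨z, hz, -⟩ := monomial_eq hx d
    rw [hz, PowerSeries.coeff_X_pow_mul', if_neg (by have := hn d hd; omega), mul_zero]

theorem coeff_subst_eq_homPart (hw : ∀ i, 0 < w i) (hx : ∀ i, X ^ w i ∣ x i)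
    {φ : MvPowerSeries (Fin 2) k} {n : ℕ}
    (hn : ∀ d, MvPowerSeries.coeff d φ ≠ 0 → n ≤ dot w d) :
    coeff n (MvPowerSeries.subst x φ : PowerSeries k) =
      homPart φ w n fun i => coeff (w i) (x i) := by
  rw [coeff_subst_eq (hasSubst_of_dvd hw hx), homPart]
  have hterm : ∀ d, MvPowerSeries.coeff d φ * coeff n (x 0 ^ d 0 * x 1 ^ d 1) =
      if dot w d = n then MvPowerSeries.coeff d φ *
        (coeff (w 0) (x 0) ^ d 0 * coeff (w 1) (x 1) ^ d 1) else 0 := by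
    intro d
    obtain ⟨z, hz, hz0⟩ := monomial_eq hx d
    rw [hz, PowerSeries.coeff_X_pow_mul']
    split_ifs with h1 h2 h2
    · rw [h2, Nat.sub_self, hz0]
    · by_cases hd : MvPowerSeries.coeff d φ = 0
      · rw [hd, zero_mul]
      · have := hn d hd; omega
    · omega
    · rw [mul_zero]
  rw [finsum_congr hterm, finsum_eq_sum_of_support_subset (s := level w n)]
  · refine Finset.sum_congr rfl fun d hd => ?_
    rw [if_pos ((mem_level hw).1 hd)]
  · intro d hd
    rw [Finset.mem_coe, mem_level hw]
    by_contra h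
    simp [h] at hd

theorem psubst_mul (hx : MvPowerSeries.HasSubst x) (φ ψ : MvPowerSeries (Fin 2) k) :
    (MvPowerSeries.subst x (φ * ψ) : PowerSeries k) =
      (MvPowerSeries.subst x φ : PowerSeries k) * (MvPowerSeries.subst x ψ : PowerSeries k) :=
  MvPowerSeries.subst_mul hx φ ψ

/-- The jet with a single nonzero coefficient in each entry. -/
noncomputable def monoArc (w : Fin 2 → ℕ) (u : Fin 2 → k) : Fin 2 → PowerSeries k :=
  fun i => X ^ w i * C (u i)

theorem coeff_monoArc (w : Fin 2 → ℕ) (u : Fin 2 → k) (i : Fin 2) :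
    coeff (w i) (monoArc w u i) = u i := by
  simp [monoArc]

theorem homPart_mul (hw : ∀ i, 0 < w i) {φ ψ : MvPowerSeries (Fin 2) k} {n m : ℕ}
    (hn : ∀ d, MvPowerSeries.coeff d φ ≠ 0 → n ≤ dot w d)
    (hm : ∀ d, MvPowerSeries.coeff d ψ ≠ 0 → m ≤ dot w d) (u : Fin 2 → k) :
    homPart (φ * ψ) w (n + m) u = homPart φ w n u * homPart ψ w m u := by
  classical
  have hx : ∀ i, X ^ w i ∣ monoArc w u i := fun i => dvd_mul_right _ _
  have hnm : ∀ d, MvPowerSeries.coeff d (φ * ψ) ≠ 0 → n + m ≤ dot w d := by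
    intro d hd
    rw [MvPowerSeries.coeff_mul] at hd
    obtain ⟨⟨d1, d2⟩, hmem, hne⟩ := Finset.exists_ne_zero_of_sum_ne_zero hd
    rw [Finset.HasAntidiagonal.mem_antidiagonal] at hmem
    rw [← hmem, dot_add]
    exact Nat.add_le_add (hn _ (left_ne_zero_of_mul hne)) (hm _ (right_ne_zero_of_mul hne))
  have h1 := coeff_subst_eq_homPart hw hx hn
  have h2 := coeff_subst_eq_homPart hw hx hm
  have h3 := coeff_subst_eq_homPart hw hx hnm
  simp only [coeff_monoArc] at h1 h2 h3
  obtain ⟨a, ha⟩ := X_pow_dvd_subst hw hx hn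
  obtain ⟨b, hb⟩ := X_pow_dvd_subst hw hx hm
  have hmul : (MvPowerSeries.subst (monoArc w u) (φ * ψ) : PowerSeries k) =
      X ^ (n + m) * (a * b) := by
    rw [psubst_mul (hasSubst_of_dvd hw hx), ha, hb]
    ring
  have hu : (fun i => u i) = u := rfl
  rw [← hu, ← h1, ← h2, ← h3, hmul, ha, hb]
  simp [PowerSeries.coeff_X_pow_mul']

theorem homPart_congr {φ ψ : MvPowerSeries (Fin 2) k} {n : ℕ} (hw : ∀ i, 0 < w i)
    (h : ∀ d, dot w d = n → MvPowerSeries.coeff d φ = MvPowerSeries.coeff d ψ) (u : Fin 2 → k) :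
    homPart φ w n u = homPart ψ w n u :=
  Finset.sum_congr rfl fun d hd => by rw [h d ((mem_level hw).1 hd)]

/-- The initial form of a product. -/
theorem homPart_ord_mul (hw : ∀ i, 0 < w i) {φ ψ : MvPowerSeries (Fin 2) k} (hφ : φ ≠ 0)
    (hψ : ψ ≠ 0) (u : Fin 2 → k) :
    homPart (φ * ψ) w (ord (φ * ψ) w) u = homPart φ w (ord φ w) u * homPart ψ w (ord ψ w) u := by
  rw [ord_mul hφ hψ]
  exact homPart_mul hw (fun d hd => ord_le w hd) (fun d hd => ord_le w hd) u

theorem homPart_unit {φ : MvPowerSeries (Fin 2) k} (h : IsUnit φ) (hw : ∀ i, 0 < w i)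
    (u : Fin 2 → k) : homPart φ w (ord φ w) u ≠ 0 := by
  obtain ⟨ψ, hψ⟩ := h.exists_right_inv
  have hφ0 : φ ≠ 0 := h.ne_zero
  have hψ0 : ψ ≠ 0 := by rintro rfl; simp at hψ
  have := homPart_ord_mul hw hφ0 hψ0 u
  rw [hψ, ord_eq_zero_of_isUnit isUnit_one] at this
  have h1 : homPart (1 : MvPowerSeries (Fin 2) k) w 0 u = 1 := by
    have hl : level w 0 = {0} := by
      ext d
      rw [mem_level hw, Finset.mem_singleton, dot]
      have h0 := hw 0
      have h1 := hw 1
      constructor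
      · intro h
        have h2 : w 0 * d 0 = 0 := by omega
        have h3 : w 1 * d 1 = 0 := by omega
        ext i
        fin_cases i
        · simpa [h0.ne'] using h2
        · simpa [h1.ne'] using h3
      · rintro rfl; simp
    rw [homPart, hl]
    simp
  rw [h1] at this
  exact left_ne_zero_of_mul (this ▸ one_ne_zero)

end Order

section Hensel

variable {R : Type*} [CommRing R]

theorem powerSeries_eq_zero_of_forall_dvd {a : PowerSeries R} (h : ∀ n, X ^ n ∣ a) :
    a = 0 := by
  ext n
  exact PowerSeries.X_pow_dvd_iff.1 (h (n + 1)) n (Nat.lt_succ_self n)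

theorem eval_sub_eval_eq (P : Polynomial (PowerSeries R)) {z z' : PowerSeries R} {c : R}
    (hz : constantCoeff z = c) (hz' : constantCoeff z' = c)
    (hc : IsUnit ((P.map constantCoeff).derivative.eval c)) :
    ∃ q : PowerSeries R, IsUnit q ∧ P.eval z' - P.eval z = (z' - z) * q := by
  obtain ⟨κ, hκ⟩ := P.binomExpansion z (z' - z)
  rw [add_sub_cancel] at hκ
  refine ⟨P.derivative.eval z + κ * (z' - z), ?_, by rw [hκ]; ring⟩
  rw [PowerSeries.isUnit_iff_constantCoeff]
  simp only [map_add, map_mul, map_sub, hz, hz', sub_self, mul_zero, add_zero]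
  rw [Polynomial.derivative_map] at hc
  rw [← hz, Polynomial.eval_map, Polynomial.eval₂_hom] at hc
  exact hc

theorem dvd_eval_iff (P : Polynomial (PowerSeries R)) {z z' : PowerSeries R} {c : R}
    (hz : constantCoeff z = c) (hz' : constantCoeff z' = c)
    (hc : IsUnit ((P.map constantCoeff).derivative.eval c)) (h0 : P.eval z = 0)
    (n : ℕ) : X ^ n ∣ P.eval z' ↔ X ^ n ∣ z' - z := by
  obtain ⟨q, hq, h⟩ := eval_sub_eval_eq P hz hz' hc
  rw [h0, sub_zero] at h
  rw [h, hq.dvd_mul_right]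

theorem hensel_unique (P : Polynomial (PowerSeries R)) {z z' : PowerSeries R} {c : R}
    (hz : constantCoeff z = c) (hz' : constantCoeff z' = c)
    (hc : IsUnit ((P.map constantCoeff).derivative.eval c)) (h0 : P.eval z = 0)
    (h0' : P.eval z' = 0) : z' = z := by
  refine sub_eq_zero.1 (powerSeries_eq_zero_of_forall_dvd fun n => ?_)
  rw [← dvd_eval_iff P hz hz' hc h0, h0']
  exact dvd_zero _

/-- Hensel's lemma for power series. -/
theorem hensel_exists (P : Polynomial (PowerSeries R)) {c : R}
    (h0 : (P.map constantCoeff).eval c = 0)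
    (hc : IsUnit ((P.map constantCoeff).derivative.eval c)) :
    ∃ z : PowerSeries R, constantCoeff z = c ∧ P.eval z = 0 := by
  obtain ⟨δ, hδ⟩ := hc.exists_right_inv
  let Z : ℕ → PowerSeries R := fun n => Nat.rec (C c)
    (fun n z => z - X ^ (n + 1) * C
      (δ * coeff (n + 1) (P.eval z))) n
  have hZ0 : Z 0 = C c := rfl
  have hZs : ∀ n, Z (n + 1) = Z n - X ^ (n + 1) * C
      (δ * coeff (n + 1) (P.eval (Z n))) := fun _ => rfl
  have hconst : ∀ n, constantCoeff (Z n) = c := by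
    intro n
    induction n with
    | zero => simp [hZ0]
    | succ n ih => simp [hZs, ih]
  have hdvd : ∀ n, X ^ (n + 1) ∣ P.eval (Z n) := by
    intro n
    induction n with
    | zero =>
      rw [zero_add, pow_one, PowerSeries.X_dvd_iff, ← Polynomial.eval₂_hom, ← Polynomial.eval_map,
        hconst, h0]
    | succ n ih =>
      set a := coeff (n + 1) (P.eval (Z n)) with ha
      obtain ⟨κ, hκ⟩ := P.binomExpansion (Z n) (-(X ^ (n + 1) * C (δ * a)))
      rw [hZs, sub_eq_add_neg, hκ, PowerSeries.X_pow_dvd_iff]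
      intro m hm
      rcases Nat.lt_succ_iff_lt_or_eq.1 hm with h | h
      · refine PowerSeries.X_pow_dvd_iff.1 ?_ m h
        refine dvd_add (dvd_add ih ?_) ?_
        · exact ((dvd_mul_right _ _).neg_right).mul_left _
        · exact (dvd_pow ((dvd_mul_right _ _).neg_right) two_ne_zero).mul_left _
      · subst h
        have e1 : coeff (n + 1) (P.derivative.eval (Z n) *
            -(X ^ (n + 1) * C (δ * a))) = -a := by
          rw [mul_neg, mul_left_comm, map_neg, PowerSeries.coeff_X_pow_mul', if_pos le_rfl,
            Nat.sub_self, PowerSeries.coeff_zero_eq_constantCoeff_apply, map_mul,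
            PowerSeries.constantCoeff_C, ← Polynomial.eval₂_hom, ← Polynomial.eval_map, hconst,
            ← Polynomial.derivative_map, ← mul_assoc, hδ, one_mul]
        have e2 : coeff (n + 1) (κ *
            (-(X ^ (n + 1) * C (δ * a))) ^ 2) = 0 := by
          refine PowerSeries.X_pow_dvd_iff.1 (Dvd.dvd.mul_left ?_ _) (n + 1) (Nat.lt_succ_self _)
          rw [neg_sq, mul_pow, ← pow_mul]
          exact (pow_dvd_pow _ (by omega)).mul_right _
        rw [map_add, map_add, e1, e2, ← ha]
        ring
  let z : PowerSeries R := PowerSeries.mk fun n => coeff n (Z n)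
  have hstep : ∀ m n, n ≤ m → X ^ (n + 1) ∣ Z m - Z n := by
    intro m n hmn
    induction m, hmn using Nat.le_induction with
    | base => simp
    | succ m hm ih =>
      rw [hZs, sub_right_comm]
      exact dvd_sub ih ((pow_dvd_pow _ (by omega)).mul_right _)
  have hz : ∀ n, X ^ (n + 1) ∣ z - Z n := by
    intro n
    rw [PowerSeries.X_pow_dvd_iff]
    intro m hm
    have h1 := PowerSeries.X_pow_dvd_iff.1 (hstep n m (by omega)) m (by omega)
    rw [map_sub, sub_eq_zero] at h1 ⊢
    rw [PowerSeries.coeff_mk, h1]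
  refine ⟨z, ?_, powerSeries_eq_zero_of_forall_dvd fun n => ?_⟩
  · rw [← PowerSeries.coeff_zero_eq_constantCoeff_apply, PowerSeries.coeff_mk, hZ0]
    simp
  · have h1 : X ^ (n + 1) ∣ P.eval z - P.eval (Z n) :=
      (hz n).trans (Polynomial.sub_dvd_eval_sub z (Z n) P)
    have h2 := dvd_add h1 (hdvd n)
    rw [sub_add_cancel] at h2
    exact (pow_dvd_pow _ (Nat.le_succ n)).trans h2

end Hensel

end

section

section Newton

variable {k : Type u} [Field k]

/-- A lattice vector as a function on the coordinates. -/
def vec (α : ℕ × ℕ) : Fin 2 → ℕ := ![α.1, α.2]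

@[simp] theorem vec_zero (α : ℕ × ℕ) : vec α 0 = α.1 := rfl
@[simp] theorem vec_one (α : ℕ × ℕ) : vec α 1 = α.2 := rfl

theorem nu_eq_ord (φ : MvPowerSeries (Fin 2) k) (α : ℕ × ℕ) : nu φ α = ord φ (vec α) := rfl

/-- The exponents of `φ` where the weight `w` is minimal. -/
def IsMin (φ : MvPowerSeries (Fin 2) k) (w : Fin 2 → ℕ) (d : Fin 2 →₀ ℕ) : Prop :=
  MvPowerSeries.coeff d φ ≠ 0 ∧ dot w d = ord φ w

/-- The positive weights that are minimal at two exponents at least. -/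
def Trop (φ : MvPowerSeries (Fin 2) k) (w : Fin 2 → ℕ) : Prop :=
  (∀ i, 0 < w i) ∧ ∃ d d', d ≠ d' ∧ IsMin φ w d ∧ IsMin φ w d'

/-- The face on which `α` is minimal. -/
def faceOf (φ : MvPowerSeries (Fin 2) k) (α : ℕ × ℕ) : Set (ℝ × ℝ) :=
  {v | v ∈ newtonPolyhedron φ ∧ (α.1 : ℝ) * v.1 + (α.2 : ℝ) * v.2 = (nu φ α : ℝ)}

theorem newtonPolyhedron_subset {φ : MvPowerSeries (Fin 2) k} {α : ℕ × ℕ} (h1 : 0 < α.1)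
    (h2 : 0 < α.2) : newtonPolyhedron φ ⊆
      {v | (nu φ α : ℝ) < (α.1 : ℝ) * v.1 + (α.2 : ℝ) * v.2} ∪
        convexHull ℝ (toPlane '' {d | IsMin φ (vec α) d}) := by
  have hlow : ∀ v ∈ convexHull ℝ (toPlane '' {d | IsMin φ (vec α) d}),
      (α.1 : ℝ) * v.1 + (α.2 : ℝ) * v.2 = (nu φ α : ℝ) := by
    have hc : Convex ℝ {v : ℝ × ℝ | (α.1 : ℝ) * v.1 + (α.2 : ℝ) * v.2 = (nu φ α : ℝ)} := by
      intro x hx y hy a b _ _ hab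
      simp only [Set.mem_ofPred_eq, Prod.fst_add, Prod.smul_fst, Prod.snd_add, Prod.smul_snd,
        smul_eq_mul] at hx hy ⊢
      linear_combination a * hx + b * hy + (nu φ α : ℝ) * hab
    refine fun v hv => convexHull_min ?_ hc hv
    rintro _ ⟨d, hd, rfl⟩
    have := hd.2
    simp only [dot, vec_zero, vec_one] at this
    simp only [Set.mem_ofPred_eq, toPlane, nu_eq_ord]
    exact_mod_cast this
  refine convexHull_min ?_ ?_
  · rintro _ ⟨d, hd, w, hw1, hw2, rfl⟩
    have hle : ord φ (vec α) ≤ dot (vec α) d := ord_le _ hd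
    simp only [dot, vec_zero, vec_one] at hle
    have hle' : (nu φ α : ℝ) ≤ (α.1 : ℝ) * d 0 + (α.2 : ℝ) * d 1 := by
      rw [nu_eq_ord]; exact_mod_cast hle
    have a1 : (0 : ℝ) < α.1 := by exact_mod_cast h1
    have a2 : (0 : ℝ) < α.2 := by exact_mod_cast h2
    have m1 := mul_nonneg a1.le hw1
    have m2 := mul_nonneg a2.le hw2
    by_cases hlt : (nu φ α : ℝ) < (α.1 : ℝ) * (d 0 + w.1) + (α.2 : ℝ) * (d 1 + w.2)
    · left; simpa [toPlane] using hlt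
    · right
      have e1 : (α.1 : ℝ) * w.1 = 0 := by nlinarith
      have e2 : (α.2 : ℝ) * w.2 = 0 := by nlinarith
      have z1 : w.1 = 0 := (mul_eq_zero.1 e1).resolve_left a1.ne'
      have z2 : w.2 = 0 := (mul_eq_zero.1 e2).resolve_left a2.ne'
      have hw0 : w = 0 := Prod.ext z1 z2
      rw [hw0, add_zero]
      refine subset_convexHull ℝ _ ⟨d, ⟨hd, ?_⟩, rfl⟩
      have h3 : (α.1 : ℝ) * d 0 + (α.2 : ℝ) * d 1 ≤ (nu φ α : ℝ) := by
        rw [z1, z2] at hlt; simpa using hlt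
      rw [nu_eq_ord] at h3
      have h4 : α.1 * d 0 + α.2 * d 1 ≤ ord φ (vec α) := by exact_mod_cast h3
      exact le_antisymm h4 (ord_le _ hd)
  · rw [convex_iff_forall_pos]
    rintro x hx y hy a b ha hb hab
    by_cases h : x ∈ convexHull ℝ (toPlane '' {d | IsMin φ (vec α) d}) ∧
        y ∈ convexHull ℝ (toPlane '' {d | IsMin φ (vec α) d})
    · exact Or.inr (convex_convexHull ℝ _ h.1 h.2 ha.le hb.le hab)
    · left
      have key : ∀ z, z ∈ {v : ℝ × ℝ | (nu φ α : ℝ) < (α.1 : ℝ) * v.1 + (α.2 : ℝ) * v.2} ∪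
          convexHull ℝ (toPlane '' {d | IsMin φ (vec α) d}) →
          (nu φ α : ℝ) ≤ (α.1 : ℝ) * z.1 + (α.2 : ℝ) * z.2 := by
        rintro z (hz | hz)
        · exact le_of_lt hz
        · exact (hlow z hz).ge
      have kx := key x hx
      have ky := key y hy
      have hor : (nu φ α : ℝ) < (α.1 : ℝ) * x.1 + (α.2 : ℝ) * x.2 ∨
          (nu φ α : ℝ) < (α.1 : ℝ) * y.1 + (α.2 : ℝ) * y.2 := by
        rcases hx with hx | hx
        · exact Or.inl hx
        · rcases hy with hy | hy
          · exact Or.inr hy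
          · exact absurd ⟨hx, hy⟩ h
      have eb : b = 1 - a := by linarith
      simp only [Set.mem_ofPred_eq, Prod.fst_add, Prod.smul_fst, Prod.snd_add, Prod.smul_snd,
        smul_eq_mul]
      have hre : (α.1 : ℝ) * (a * x.1 + b * y.1) + (α.2 : ℝ) * (a * x.2 + b * y.2) =
          a * ((α.1 : ℝ) * x.1 + (α.2 : ℝ) * x.2) + b * ((α.1 : ℝ) * y.1 + (α.2 : ℝ) * y.2) := by
        ring
      rw [hre]
      have hn : (nu φ α : ℝ) = a * (nu φ α : ℝ) + b * (nu φ α : ℝ) := by rw [eb]; ring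
      rw [hn]
      rcases hor with h | h
      · exact add_lt_add_of_lt_of_le (mul_lt_mul_of_pos_left h ha)
          (mul_le_mul_of_nonneg_left ky hb.le)
      · exact add_lt_add_of_le_of_lt (mul_le_mul_of_nonneg_left kx ha.le)
          (mul_lt_mul_of_pos_left h hb)

theorem toPlane_injective : Function.Injective toPlane := by
  intro d e h
  simp only [toPlane, Prod.mk.injEq, Nat.cast_inj] at h
  ext i
  fin_cases i
  · exact h.1
  · exact h.2

theorem toPlane_mem_newtonPolyhedron {φ : MvPowerSeries (Fin 2) k} {d : Fin 2 →₀ ℕ}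
    (hd : MvPowerSeries.coeff d φ ≠ 0) : toPlane d ∈ newtonPolyhedron φ :=
  subset_convexHull ℝ _ ⟨d, hd, 0, le_rfl, le_rfl, (add_zero _).symm⟩

theorem toPlane_mem_faceOf {φ : MvPowerSeries (Fin 2) k} {α : ℕ × ℕ} {d : Fin 2 →₀ ℕ}
    (hd : MvPowerSeries.coeff d φ ≠ 0) : toPlane d ∈ faceOf φ α ↔ IsMin φ (vec α) d := by
  have : ((α.1 : ℝ) * (toPlane d).1 + (α.2 : ℝ) * (toPlane d).2 = (nu φ α : ℝ)) ↔
      dot (vec α) d = ord φ (vec α) := by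
    simp only [toPlane, dot, vec_zero, vec_one, nu_eq_ord]
    exact_mod_cast Iff.rfl
  exact ⟨fun h => ⟨hd, this.1 h.2⟩, fun h => ⟨toPlane_mem_newtonPolyhedron hd, this.2 h.2⟩⟩

theorem faceOf_eq {φ : MvPowerSeries (Fin 2) k} {α : ℕ × ℕ} (h1 : 0 < α.1) (h2 : 0 < α.2) :
    faceOf φ α = convexHull ℝ (toPlane '' {d | IsMin φ (vec α) d}) := by
  refine Set.Subset.antisymm ?_ (convexHull_min ?_ ?_)
  · rintro v ⟨hv, hv'⟩
    rcases newtonPolyhedron_subset h1 h2 hv with h | h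
    · exact absurd hv' (ne_of_gt h)
    · exact h
  · rintro _ ⟨d, hd, rfl⟩
    exact (toPlane_mem_faceOf hd.1).2 hd
  · intro x hx y hy a b ha hb hab
    refine ⟨convex_convexHull ℝ _ hx.1 hy.1 ha hb hab, ?_⟩
    have e1 := hx.2
    have e2 := hy.2
    simp only [Prod.fst_add, Prod.smul_fst, Prod.snd_add, Prod.smul_snd, smul_eq_mul]
    linear_combination a * e1 + b * e2 + (nu φ α : ℝ) * hab

theorem isNewtonFace_faceOf {φ : MvPowerSeries (Fin 2) k} (hφ : φ ≠ 0) {α : ℕ × ℕ} (h1 : 0 < α.1)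
    (h2 : 0 < α.2) : IsNewtonFace φ (faceOf φ α) := by
  have hw : ∀ i, 0 < vec α i := by intro i; fin_cases i <;> assumption
  refine ⟨?_, ?_, ?_⟩
  · obtain ⟨d, hd, hd'⟩ := exists_ord hφ (vec α)
    exact ⟨toPlane d, (toPlane_mem_faceOf hd).2 ⟨hd, hd'⟩⟩
  · rw [faceOf_eq h1 h2]
    refine Set.Finite.isCompact_convexHull ℝ (Set.Finite.image _ ?_)
    exact (level (vec α) (ord φ (vec α))).finite_toSet.subset fun d hd => (mem_level hw).2 hd.2
  · intro _
    refine ⟨-((α.1 : ℝ) • ContinuousLinearMap.fst ℝ ℝ ℝ + (α.2 : ℝ) •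
      ContinuousLinearMap.snd ℝ ℝ ℝ), ?_⟩
    have hmin : ∀ v ∈ newtonPolyhedron φ, (nu φ α : ℝ) ≤ (α.1 : ℝ) * v.1 + (α.2 : ℝ) * v.2 := by
      intro v hv
      rcases newtonPolyhedron_subset h1 h2 hv with h | h
      · exact le_of_lt h
      · rw [← faceOf_eq h1 h2] at h
        exact h.2.ge
    ext v
    simp only [faceOf, Set.mem_ofPred_eq, neg_apply,
      add_apply, smul_apply,
      ContinuousLinearMap.coe_fst', ContinuousLinearMap.coe_snd', smul_eq_mul, neg_le_neg_iff]
    refine and_congr_right fun hv => ⟨fun h y hy => h ▸ hmin y hy, fun h => ?_⟩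
    obtain ⟨d, hd, hd'⟩ := exists_ord hφ (vec α)
    have h3 := ((toPlane_mem_faceOf hd).2 ⟨hd, hd'⟩ : toPlane d ∈ faceOf φ α)
    exact le_antisymm ((h _ h3.1).trans h3.2.le) (hmin v hv)

theorem mem_trop_iff {φ : MvPowerSeries (Fin 2) k} {α : ℕ × ℕ} :
    α ∈ trop φ ↔ Trop φ (vec α) := by
  constructor
  · rintro ⟨h1, h2, Φ, hΦ, hnt, hline⟩
    refine ⟨fun i => by fin_cases i <;> assumption, ?_⟩
    obtain ⟨v, hv, v', hv', hne⟩ := hnt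
    have hsub : Φ ⊆ faceOf φ α := fun v hv => ⟨hΦ.2.2.subset hv, hline v hv⟩
    rw [faceOf_eq h1 h2] at hsub
    by_contra hcon
    push Not at hcon
    have hss : (toPlane '' {d | IsMin φ (vec α) d}).Subsingleton := by
      rintro _ ⟨d, hd, rfl⟩ _ ⟨d', hd', rfl⟩
      by_contra hdd
      exact hcon d d' (fun h => hdd (h ▸ rfl)) hd hd'
    rcases hss.eq_empty_or_singleton with h | ⟨y, h⟩
    · rw [h, convexHull_empty] at hsub
      exact hsub hv
    · rw [h, convexHull_singleton] at hsub
      exact hne ((hsub hv : v = y).trans (hsub hv' : v' = y).symm)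
  · rintro ⟨hw, d, d', hne, hd, hd'⟩
    have h1 : 0 < α.1 := hw 0
    have h2 : 0 < α.2 := hw 1
    have hφ : φ ≠ 0 := by rintro rfl; exact hd.1 (by simp)
    refine ⟨h1, h2, faceOf φ α, isNewtonFace_faceOf hφ h1 h2, ⟨toPlane d,
      (toPlane_mem_faceOf hd.1).2 hd, toPlane d', (toPlane_mem_faceOf hd'.1).2 hd',
      fun h => hne (toPlane_injective h)⟩, fun v hv => hv.2⟩

/-- Non-degeneracy on the face of a positive weight: the initial form has no singular zero in the
torus. -/
theorem IsNewtonNondegenerate.initial {f : MvPolynomial (Fin 2) k} (hf : IsNewtonNondegenerate f)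
    (hf0 : f ≠ 0) {w : Fin 2 → ℕ} (hw : ∀ i, 0 < w i) {u : Fin 2 → k} (hu : ∀ i, u i ≠ 0)
    (h0 : homPart ↟f w (ord ↟f w) u = 0) :
    ∃ i, ∑ d ∈ level w (ord ↟f w),
      (d i : k) * (f.coeff d * (u 0 ^ d 0 * u 1 ^ d 1)) ≠ 0 := by
  classical
  by_contra hcon
  push Not at hcon
  have hf0' : ↟f ≠ 0 := by
    simpa using hf0
  obtain ⟨α, rfl⟩ : ∃ α : ℕ × ℕ, w = vec α :=
    ⟨(w 0, w 1), by funext i; fin_cases i <;> rfl⟩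
  set F : MvPowerSeries (Fin 2) k := ↟f with hF
  set n := ord F (vec α) with hn
  have hface : facePart f (faceOf F α) =
      ∑ d ∈ level (vec α) n, MvPolynomial.monomial d (f.coeff d) := by
    rw [facePart]
    have hsub : f.support.filter (fun d => toPlane d ∈ faceOf F α) ⊆ level (vec α) n := by
      intro d hd
      rw [Finset.mem_filter, MvPolynomial.mem_support_iff] at hd
      have hd1 : MvPowerSeries.coeff d F ≠ 0 := by rw [hF, MvPolynomial.coeff_coe]; exact hd.1
      exact (mem_level hw).2 ((toPlane_mem_faceOf hd1).1 hd.2).2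
    convert Finset.sum_subset hsub ?_ using 2
    intro d hd hd'
    rw [MvPolynomial.monomial_eq_zero]
    by_contra hne
    refine hd' (Finset.mem_filter.2 ⟨MvPolynomial.mem_support_iff.2 hne, ?_⟩)
    have hd1 : MvPowerSeries.coeff d F ≠ 0 := by rw [hF, MvPolynomial.coeff_coe]; exact hne
    exact (toPlane_mem_faceOf hd1).2 ⟨hd1, (mem_level hw).1 hd⟩
  refine hf _ (isNewtonFace_faceOf hf0' (hw 0) (hw 1)) u hu ⟨?_, fun i => ?_⟩
  · rw [hface, map_sum, ← h0, homPart]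
    refine Finset.sum_congr rfl fun d _ => ?_
    rw [MvPolynomial.eval_monomial, prod_pow_eq, hF, MvPolynomial.coeff_coe]
  · have h1 : u i * MvPolynomial.eval u (MvPolynomial.pderiv i (facePart f (faceOf F α))) = 0 := by
      rw [← hcon i, hface, map_sum, map_sum, Finset.mul_sum]
      refine Finset.sum_congr rfl fun d _ => ?_
      rw [MvPolynomial.pderiv_monomial, MvPolynomial.eval_monomial, prod_pow_eq]
      rcases Nat.eq_zero_or_pos (d i) with h | h
      · simp [h]
      · obtain ⟨e, he⟩ : ∃ e, d i = e + 1 := ⟨d i - 1, by omega⟩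
        fin_cases i
        · simp only [Fin.zero_eta] at he ⊢
          simp [he, pow_succ]
          ring
        · simp only [Fin.mk_one] at he ⊢
          simp [he, pow_succ]
          ring
    exact (mul_eq_zero.1 h1).resolve_left (hu i)

end Newton

end

section

section Weights

variable {k : Type u} [Field k] {φ : MvPowerSeries (Fin 2) k} {i₀ i₁ : Fin 2}

theorem dot_eq (hi : i₀ ≠ i₁) (w : Fin 2 → ℕ) (d : Fin 2 →₀ ℕ) :
    dot w d = w i₀ * d i₀ + w i₁ * d i₁ := by
  fin_cases i₀ <;> fin_cases i₁ <;> simp_all [dot, add_comm]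

theorem eq_or_eq_of_ne (hi : i₀ ≠ i₁) (i : Fin 2) : i = i₀ ∨ i = i₁ := by
  fin_cases i₀ <;> fin_cases i₁ <;> fin_cases i <;> simp_all

theorem forall_iff_of_ne (hi : i₀ ≠ i₁) {p : Fin 2 → Prop} : (∀ i, p i) ↔ p i₀ ∧ p i₁ :=
  ⟨fun h => ⟨h _, h _⟩, fun h i => by rcases eq_or_eq_of_ne hi i with rfl | rfl; exacts [h.1, h.2]⟩

theorem funext_of_ne (hi : i₀ ≠ i₁) {α : Type*} {v w : Fin 2 → α} (h₀ : v i₀ = w i₀)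
    (h₁ : v i₁ = w i₁) : v = w :=
  funext ((forall_iff_of_ne hi).2 ⟨h₀, h₁⟩)

theorem finsupp_ext_of_ne (hi : i₀ ≠ i₁) {d e : Fin 2 →₀ ℕ} (h₀ : d i₀ = e i₀)
    (h₁ : d i₁ = e i₁) : d = e :=
  DFunLike.coe_injective (funext_of_ne hi h₀ h₁)

theorem IsMin.le {w : Fin 2 → ℕ} {d d' : Fin 2 →₀ ℕ} (hd : IsMin φ w d)
    (hd' : MvPowerSeries.coeff d' φ ≠ 0) : dot w d ≤ dot w d' :=
  hd.2.trans_le (ord_le w hd')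

theorem exists_isMin (hφ : φ ≠ 0) (w : Fin 2 → ℕ) : ∃ d, IsMin φ w d := exists_ord hφ w

theorem isMin_of_le {w : Fin 2 → ℕ} {d : Fin 2 →₀ ℕ} (hd : MvPowerSeries.coeff d φ ≠ 0)
    (h : ∀ d', MvPowerSeries.coeff d' φ ≠ 0 → dot w d ≤ dot w d') : IsMin φ w d :=
  ⟨hd, le_antisymm (le_ord (by rintro rfl; simp at hd) h) (ord_le w hd)⟩

theorem IsMin.ord_add_le (hi : i₀ ≠ i₁) {lam β : Fin 2 → ℕ} {d : Fin 2 →₀ ℕ} (hd : IsMin φ β d)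
    {a b : ℕ} (h₀ : β i₀ = lam i₀ + a) (h₁ : β i₁ = lam i₁ + b) :
    ord φ lam + (a * d i₀ + b * d i₁) ≤ ord φ β := by
  have h := ord_le lam hd.1
  rw [dot_eq hi] at h
  rw [← hd.2, dot_eq hi, h₀, h₁]
  linarith

theorem ord_mono (hφ : φ ≠ 0) {lam β : Fin 2 → ℕ} (h : lam ≤ β) : ord φ lam ≤ ord φ β := by
  obtain ⟨d, hd⟩ := exists_isMin hφ β
  rw [← hd.2]
  exact (ord_le lam hd.1).trans (add_le_add (Nat.mul_le_mul_right _ (h 0))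
    (Nat.mul_le_mul_right _ (h 1)))

theorem Trop.exists_pos (hi : i₀ ≠ i₁) {w : Fin 2 → ℕ} (h : Trop φ w) :
    ∃ d, IsMin φ w d ∧ 1 ≤ d i₀ := by
  obtain ⟨hw, d, d', hne, hd, hd'⟩ := h
  by_contra! hc
  have h0 : d i₀ = 0 := by have := hc d hd; omega
  have h0' : d' i₀ = 0 := by have := hc d' hd'; omega
  have e := hd.2.trans hd'.2.symm
  rw [dot_eq hi, dot_eq hi, h0, h0'] at e
  exact hne (finsupp_ext_of_ne hi (h0.trans h0'.symm)
    (Nat.eq_of_mul_eq_mul_left (hw i₁) (by linarith)))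

/-- A ray of the tropical variety lies below `α` in the direction of `i₁` exactly when no minimal
exponent at `α` is a power of `i₁`. -/
theorem exists_trop_iff (hi : i₀ ≠ i₁) {α : Fin 2 → ℕ} (hα : ∀ i, 0 < α i) {a : ℕ}
    (ha : MvPowerSeries.coeff (Finsupp.single i₁ a) φ ≠ 0) :
    (∃ β, Trop φ β ∧ β i₁ * α i₀ < β i₀ * α i₁) ↔ ∀ d, IsMin φ α d → 1 ≤ d i₀ := by
  classical
  constructor
  · rintro ⟨β, hβ, hlt⟩ d hd
    obtain ⟨e, he, he0⟩ := hβ.exists_pos hi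
    by_contra! hc
    have h0 : d i₀ = 0 := by omega
    have h1 := hd.le he.1
    have h2 := he.le hd.1
    rw [dot_eq hi, dot_eq hi, h0] at h1 h2
    have h3 := hα i₁
    have h4 := hβ.1 i₁
    have h5 : β i₁ * (α i₁ * d i₁) ≤ β i₁ * (α i₀ * e i₀ + α i₁ * e i₁) :=
      Nat.mul_le_mul_left _ (by linarith)
    have h6 : α i₁ * (β i₀ * e i₀ + β i₁ * e i₁) ≤ α i₁ * (β i₁ * d i₁) :=
      Nat.mul_le_mul_left _ (by linarith)
    have h7 : β i₁ * α i₀ * e i₀ < β i₀ * α i₁ * e i₀ := Nat.mul_lt_mul_of_pos_right hlt he0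
    nlinarith
  · intro h
    have hex : ∃ a, MvPowerSeries.coeff (Finsupp.single i₁ a) φ ≠ 0 := ⟨a, ha⟩
    obtain ⟨a, ha, hmin⟩ : ∃ a, MvPowerSeries.coeff (Finsupp.single i₁ a) φ ≠ 0 ∧
        ∀ c, MvPowerSeries.coeff (Finsupp.single i₁ c) φ ≠ 0 → a ≤ c :=
      ⟨Nat.find hex, Nat.find_spec hex, fun c hc => Nat.find_min' hex hc⟩
    have hφ : φ ≠ 0 := by rintro rfl; simp at ha
    have hpure : ∀ d : Fin 2 →₀ ℕ, d i₀ = 0 → d = Finsupp.single i₁ (d i₁) := fun d hd =>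
      finsupp_ext_of_ne hi (by simp [hd, hi]) (by simp)
    have hsa : dot α (Finsupp.single i₁ a) = α i₁ * a := by rw [dot_eq hi]; simp [hi]
    let S : Finset (Fin 2 →₀ ℕ) := ((Finset.range (α i₁ * a)).biUnion (level α)).filter
      fun d => MvPowerSeries.coeff d φ ≠ 0
    have hS : ∀ d, d ∈ S ↔ dot α d < α i₁ * a ∧ MvPowerSeries.coeff d φ ≠ 0 := by
      intro d
      simp [S, mem_level hα]
    have hpos : ∀ d ∈ S, 0 < d i₀ := by
      intro d hd
      rw [hS, dot_eq hi] at hd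
      rcases Nat.eq_zero_or_pos (d i₀) with h0 | h0
      · have := hmin (d i₁) (by rw [← hpure d h0]; exact hd.2)
        rw [h0] at hd
        have := Nat.mul_le_mul_left (α i₁) this
        omega
      · exact h0
    have hne : S.Nonempty := by
      obtain ⟨d, hd⟩ := exists_isMin hφ α
      refine ⟨d, (hS d).2 ⟨lt_of_le_of_ne ?_ ?_, hd.1⟩⟩
      · rw [← hsa]; exact hd.le ha
      · intro he
        have := h (Finsupp.single i₁ a) ⟨ha, by rw [hsa, ← he, hd.2]⟩
        simp [hi] at this
    obtain ⟨d, hd, hmax⟩ := S.exists_max_image (fun d => ((a : ℚ) - d i₁) / d i₀) hne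
    have hd' := (hS d).1 hd
    have hd0 := hpos d hd
    rw [dot_eq hi] at hd'
    have hlt : d i₁ < a := by
      by_contra! hc
      have := Nat.mul_le_mul_left (α i₁) hc
      have h8 : 0 ≤ α i₀ * d i₀ := Nat.zero_le _
      omega
    obtain ⟨c, rfl⟩ := Nat.exists_eq_add_of_lt hlt
    set β : Fin 2 → ℕ := fun i => if i = i₀ then c + 1 else d i₀ with hβ
    have hβ0 : β i₀ = c + 1 := by simp [hβ]
    have hβ1 : β i₁ = d i₀ := by simp [hβ, hi.symm]
    have hβd : dot β d = d i₀ * (d i₁ + c + 1) := by rw [dot_eq hi, hβ0, hβ1]; ring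
    have hβs : dot β (Finsupp.single i₁ (d i₁ + c + 1)) = d i₀ * (d i₁ + c + 1) := by
      rw [dot_eq hi, hβ1]; simp [hi]
    have hle : ∀ e, MvPowerSeries.coeff e φ ≠ 0 → d i₀ * (d i₁ + c + 1) ≤ dot β e := by
      intro e he
      rw [dot_eq hi, hβ0, hβ1]
      by_cases heS : e ∈ S
      · have h1 := hmax e heS
        have h2 : (0 : ℚ) < d i₀ := by exact_mod_cast hd0
        have h3 : (0 : ℚ) < e i₀ := by exact_mod_cast hpos e heS
        rw [div_le_div_iff₀ h3 h2] at h1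
        have : (d i₀ : ℚ) * (d i₁ + c + 1) ≤ (c + 1) * e i₀ + d i₀ * e i₁ := by
          push_cast at h1; linarith
        exact_mod_cast this
      · rw [hS, not_and'] at heS
        have h1 := heS he
        rw [dot_eq hi] at h1
        push Not at h1
        have h2 : d i₀ * (α i₁ * (d i₁ + c + 1)) ≤ d i₀ * (α i₀ * e i₀ + α i₁ * e i₁) :=
          Nat.mul_le_mul_left _ h1
        have h3 : e i₀ * (α i₀ * d i₀) ≤ e i₀ * (α i₁ * (c + 1)) :=
          Nat.mul_le_mul_left _ (by nlinarith [hd'.1])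
        refine Nat.le_of_mul_le_mul_left ?_ (hα i₁)
        nlinarith
    refine ⟨β, ⟨(forall_iff_of_ne hi).2 ⟨by omega, by omega⟩, d, _, ?_,
      isMin_of_le hd'.2 fun e he => hβd.trans_le (hle e he),
      isMin_of_le ha fun e he => hβs.trans_le (hle e he)⟩, ?_⟩
    · intro he
      rw [he] at hd0
      simp [hi] at hd0
    · rw [hβ0, hβ1]
      nlinarith [hd'.1]

theorem ord_lt_ord_add_single_iff (hi : i₀ ≠ i₁) (hφ : φ ≠ 0) (α : Fin 2 → ℕ) :
    ord φ α < ord φ (α + Pi.single i₀ 1) ↔ ∀ d, IsMin φ α d → 1 ≤ d i₀ := by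
  have key : ∀ d, dot (α + Pi.single i₀ 1) d = dot α d + d i₀ := by
    intro d
    rw [dot_eq hi, dot_eq hi]
    simp [hi.symm]
    ring
  constructor
  · intro h d hd
    have := ord_le (α + Pi.single i₀ 1) hd.1
    rw [key, hd.2] at this
    omega
  · intro h
    obtain ⟨d, hd⟩ := exists_isMin hφ (α + Pi.single i₀ 1)
    have h1 := hd.2
    rw [key] at h1
    rcases (ord_le α hd.1).lt_or_eq with h2 | h2
    · omega
    · have := h d ⟨hd.1, h2.symm⟩
      omega

theorem Trop.smul {w v : Fin 2 → ℕ} (h : Trop φ w) (hv : ∀ i, 0 < v i)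
    (hp : w 0 * v 1 = w 1 * v 0) : Trop φ v := by
  obtain ⟨hw, d, d', hne, hd, hd'⟩ := h
  have key : ∀ e, w 0 * dot v e = v 0 * dot w e := fun e => by
    unfold dot
    linear_combination (e 1 : ℕ) * hp
  have hm : ∀ e, IsMin φ w e → IsMin φ v e := fun e he => isMin_of_le he.1 fun e' he' => by
    refine Nat.le_of_mul_le_mul_left ?_ (hw 0)
    rw [key, key]
    exact Nat.mul_le_mul_left _ (he.le he')
  exact ⟨hv, d, d', hne, hm d hd, hm d' hd'⟩

theorem exists_trop (hi : i₀ ≠ i₁) (h0 : MvPowerSeries.coeff 0 φ = 0) {a b : ℕ}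
    (ha : MvPowerSeries.coeff (Finsupp.single i₁ a) φ ≠ 0)
    (hb : MvPowerSeries.coeff (Finsupp.single i₀ b) φ ≠ 0) : ∃ β, Trop φ β := by
  let α : Fin 2 → ℕ := fun i => if i = i₀ then 1 else b + 1
  have h1 : α i₀ = 1 := by simp [α]
  have h2 : α i₁ = b + 1 := by simp [α, hi.symm]
  refine ((exists_trop_iff hi (α := α) ((forall_iff_of_ne hi).2 ⟨by omega, by omega⟩) ha).2
    fun d hd => ?_).imp fun _ h => h.1
  by_contra! hc
  have hd0 : d i₀ = 0 := by omega
  have h3 := hd.le hb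
  rw [dot_eq hi, dot_eq hi, hd0, h1, h2] at h3
  simp [hi.symm] at h3
  rcases Nat.eq_zero_or_pos (d i₁) with h4 | h4
  · refine hd.1 ?_
    rw [show d = 0 from finsupp_ext_of_ne hi hd0 h4, h0]
  · nlinarith

end Weights

section Presence

variable {k : Type u} [Field k] {φ : MvPowerSeries (Fin 2) k} {i₀ i₁ : Fin 2}

/-- The numerical conditions under which `H^γ` is a component of the `m`-jets. -/
structure Pres (φ : MvPowerSeries (Fin 2) k) (m : ℕ) (γ : Fin 2 → ℕ) : Prop where
  pos : ∀ i, 0 < γ i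
  lt : m < ord φ γ
  pred : ∀ i β, (∀ j, 0 < β j) → β + Pi.single i 1 = γ →
    (∀ d, IsMin φ β d → 1 ≤ d i) ∧ ord φ β ≤ m
  diag : ∀ β, (∀ j, 0 < β j) → β + 1 = γ → ord φ β + 1 ≤ m

theorem Pres.exists_pred (hi : i₀ ≠ i₁) {m : ℕ} {γ : Fin 2 → ℕ} (h : Pres φ m γ)
    (hγ : 2 ≤ γ i₀) : ∃ β, (∀ j, 0 < β j) ∧ β i₀ + 1 = γ i₀ ∧ β i₁ = γ i₁ ∧
      (∀ d, IsMin φ β d → 1 ≤ d i₀) ∧ ord φ β ≤ m := by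
  have h1 : (Pi.single i₀ 1 : Fin 2 → ℕ) ≤ γ :=
    (forall_iff_of_ne hi).2 ⟨by simp; omega, by simp [hi.symm]⟩
  have h2 : ∀ j, 0 < (γ - Pi.single i₀ 1 : Fin 2 → ℕ) j := by
    refine (forall_iff_of_ne hi).2 ⟨by simp; omega, ?_⟩
    have := h.pos i₁
    simpa [hi.symm] using this
  exact ⟨γ - Pi.single i₀ 1, h2, by simp; omega, by simp [hi.symm],
    h.pred i₀ _ h2 (tsub_add_cancel_of_le h1)⟩

theorem Pres.exists_diag (hi : i₀ ≠ i₁) {m : ℕ} {γ : Fin 2 → ℕ} (h : Pres φ m γ)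
    (h₀ : 2 ≤ γ i₀) (h₁ : 2 ≤ γ i₁) : ∃ β, β i₀ + 1 = γ i₀ ∧ β i₁ + 1 = γ i₁ ∧
      ord φ β + 1 ≤ m := by
  have h2 : ∀ j, 0 < (γ - 1) j :=
    (forall_iff_of_ne hi).2 ⟨by simp; omega, by simp; omega⟩
  refine ⟨γ - 1, by simp; omega, by simp; omega, h.diag _ h2 (tsub_add_cancel_of_le ?_)⟩
  exact (forall_iff_of_ne hi).2 ⟨by simp; omega, by simp; omega⟩

theorem Pres.le_add_one (hφ : φ ≠ 0) {m : ℕ} {γ : Fin 2 → ℕ} (h : Pres φ m γ) (i : Fin 2) :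
    γ i ≤ m + 1 := by
  obtain ⟨j, hj⟩ : ∃ j : Fin 2, i ≠ j := ⟨1 - i, by fin_cases i <;> decide⟩
  by_contra! hc
  obtain ⟨β, -, h0, -, h2, h3⟩ := h.exists_pred hj (by omega)
  obtain ⟨d, hd⟩ := exists_isMin hφ β
  have h4 := hd.2
  rw [dot_eq hj] at h4
  have := h2 d hd
  nlinarith

theorem Trop.le_ord {α : Fin 2 → ℕ} (h : Trop φ α) (i : Fin 2) : α i ≤ ord φ α := by
  obtain ⟨j, hj⟩ : ∃ j : Fin 2, i ≠ j := ⟨1 - i, by fin_cases i <;> decide⟩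
  obtain ⟨d, hd, h1⟩ := h.exists_pos hj
  rw [← hd.2, dot_eq hj]
  nlinarith

/-- At a point of the tropical variety either some minimal exponent is divisible by both variables,
or there are two pure ones. -/
theorem Trop.cases (hi : i₀ ≠ i₁) {α : Fin 2 → ℕ} (h : Trop φ α) :
    (∃ d, IsMin φ α d ∧ 1 ≤ d i₀ ∧ 1 ≤ d i₁) ∨
      ∃ d d', IsMin φ α d ∧ IsMin φ α d' ∧ d i₁ = 0 ∧ d' i₀ = 0 := by
  obtain ⟨d, hd, h1⟩ := h.exists_pos hi
  obtain ⟨d', hd', h2⟩ := h.exists_pos hi.symm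
  by_cases h3 : 1 ≤ d i₁
  · exact Or.inl ⟨d, hd, h1, h3⟩
  · by_cases h4 : 1 ≤ d' i₀
    · exact Or.inl ⟨d', hd', h4, h2⟩
    · exact Or.inr ⟨d, d', hd, hd', by omega, by omega⟩

theorem Trop.add_le_ord (hi : i₀ ≠ i₁)
    (hs : ∀ d, MvPowerSeries.coeff d φ ≠ 0 → 2 ≤ d i₀ + d i₁) {α β : Fin 2 → ℕ} (h : Trop φ β)
    {a b : ℕ} (h₀ : β i₀ = α i₀ + a) (h₁ : β i₁ = α i₁ + b) :
    ord φ α + (a + b) ≤ ord φ β := by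
  rcases h.cases hi with ⟨d, hd, h1, h2⟩ | ⟨d, d', hd, hd', h1, h2⟩
  · have := hd.ord_add_le hi h₀ h₁
    nlinarith
  · have e := hd.ord_add_le hi h₀ h₁
    have e' := hd'.ord_add_le hi h₀ h₁
    have := hs d hd.1
    have := hs d' hd'.1
    rw [h1] at e
    rw [h2] at e'
    nlinarith

theorem Pres.add_le_of_pure (hi : i₀ ≠ i₁)
    (hφ : φ ≠ 0) (hs : ∀ d, MvPowerSeries.coeff d φ ≠ 0 → 2 ≤ d i₀ + d i₁) {m : ℕ}
    {lam γ : Fin 2 → ℕ} (h : Pres φ m γ) (hlam : ∀ i, 0 < lam i) {a b : ℕ}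
    (h₀ : γ i₀ = lam i₀ + (a + 1)) (h₁ : γ i₁ = lam i₁ + (b + 1))
    (h2 : ord φ lam + 2 * b + 1 ≤ m) : a + 1 + (b + 1) + ord φ lam ≤ m + 1 := by
  have hl := hlam i₀
  obtain ⟨β, -, e0, e1, h3, h4⟩ := h.exists_pred hi (by omega)
  obtain ⟨d, hd⟩ := exists_isMin hφ β
  have h5 := hd.ord_add_le hi (lam := lam) (a := a) (b := b + 1) (by omega) (by omega)
  have h6 := h3 d hd
  have h7 := hs d hd.1
  rcases Nat.eq_zero_or_pos (d i₁) with h8 | h8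
  · rw [h8] at h5 h7
    nlinarith
  · nlinarith

theorem Pres.add_le (hi : i₀ ≠ i₁) (hφ : φ ≠ 0)
    (hs : ∀ d, MvPowerSeries.coeff d φ ≠ 0 → 2 ≤ d i₀ + d i₁) {m : ℕ}
    {lam γ : Fin 2 → ℕ} (h : Pres φ m γ) (hlam : ∀ i, 0 < lam i) (hm : ord φ lam ≤ m) {a b : ℕ}
    (h₀ : γ i₀ = lam i₀ + a) (h₁ : γ i₁ = lam i₁ + b) :
    a + b + ord φ lam ≤ m + 1 := by
  have hl := hlam i₀
  have hl1 := hlam i₁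
  rcases a with _ | a <;> rcases b with _ | b
  · omega
  · obtain ⟨β, -, e0, e1, h3, h4⟩ := h.exists_pred hi.symm (by omega)
    obtain ⟨d, hd⟩ := exists_isMin hφ β
    have h5 := hd.ord_add_le hi (lam := lam) (a := 0) (b := b) (by omega) (by omega)
    have h6 := h3 d hd
    nlinarith
  · obtain ⟨β, -, e0, e1, h3, h4⟩ := h.exists_pred hi (by omega)
    obtain ⟨d, hd⟩ := exists_isMin hφ β
    have h5 := hd.ord_add_le hi (lam := lam) (a := a) (b := 0) (by omega) (by omega)
    have h6 := h3 d hd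
    nlinarith
  · obtain ⟨μ, e0, e1, h3⟩ := h.exists_diag hi (by omega) (by omega)
    obtain ⟨d, hd⟩ := exists_isMin hφ μ
    have h5 := hd.ord_add_le hi (lam := lam) (a := a) (b := b) (by omega) (by omega)
    have h6 := hs d hd.1
    rcases Nat.eq_zero_or_pos (d i₀) with h7 | h7
    · refine h.add_le_of_pure hi hφ hs hlam h₀ h₁ ?_
      rw [h7] at h5 h6
      nlinarith
    · rcases Nat.eq_zero_or_pos (d i₁) with h8 | h8
      · have := h.add_le_of_pure hi.symm hφ (fun d hd => by rw [add_comm]; exact hs d hd) hlam h₁ h₀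
          (by rw [h8] at h5 h6; nlinarith)
        omega
      · nlinarith

theorem Pres.three_mul_le (hi : i₀ ≠ i₁) (hφ : φ ≠ 0)
    (hs : ∀ d, MvPowerSeries.coeff d φ ≠ 0 → 3 ≤ d i₀ + d i₁) {m : ℕ}
    {α γ : Fin 2 → ℕ} (h : Pres φ (m + 1) γ) (hα : ∀ i, 0 < α i) {a b : ℕ}
    (h₀ : γ i₀ = α i₀ + 1 + a) (h₁ : γ i₁ = α i₁ + 1 + b)
    (hlt : m + 1 < a + 1 + (b + 1) + ord φ α) (ha : 1 ≤ a) : 3 * a + ord φ α ≤ m + 1 := by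
  have hl := hα i₀
  have hl1 := hα i₁
  obtain ⟨β, -, e0, e1, h3, h4⟩ := h.exists_pred hi (by omega)
  obtain ⟨d, hd⟩ := exists_isMin hφ β
  have h5 := hd.ord_add_le hi (lam := α) (a := a) (b := b + 1) (by omega) (by omega)
  have h6 := h3 d hd
  have h7 := hs d hd.1
  rcases Nat.eq_zero_or_pos (d i₁) with hc | hc
  · rw [hc] at h5 h7
    rw [add_zero] at h7
    have := Nat.mul_le_mul_left a h7
    omega
  · obtain ⟨x, hx⟩ := Nat.exists_eq_add_of_le h6
    obtain ⟨y, hy⟩ := Nat.exists_eq_add_of_le hc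
    rw [hx, hy] at h5 h7
    have h8 : x ≤ a * x := Nat.le_mul_of_pos_left _ ha
    have h9 : y ≤ (b + 1) * y := Nat.le_mul_of_pos_left _ (by omega)
    rw [mul_add, mul_add] at h5
    omega

theorem Pres.eq_add_one_of_lt (hi : i₀ ≠ i₁) (hφ : φ ≠ 0)
    (hs : ∀ d, MvPowerSeries.coeff d φ ≠ 0 → 3 ≤ d i₀ + d i₁) {m : ℕ}
    {α γ : Fin 2 → ℕ} (h : Pres φ (m + 1) γ) (hα : ∀ i, 0 < α i) {a b : ℕ}
    (h₀ : γ i₀ = α i₀ + 1 + a) (h₁ : γ i₁ = α i₁ + 1 + b)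
    (hlt : m + 1 < a + 1 + (b + 1) + ord φ α) : a = 0 ∧ b = 0 := by
  have hl := hα i₀
  have hl1 := hα i₁
  have A := h.three_mul_le hi hφ hs hα h₀ h₁ hlt
  have B := h.three_mul_le hi.symm hφ (fun d hd => by rw [add_comm]; exact hs d hd) hα h₁ h₀
    (by omega)
  obtain ⟨μ, e0, e1, h3⟩ := h.exists_diag hi (by omega) (by omega)
  obtain ⟨d, hd⟩ := exists_isMin hφ μ
  have h5 := hd.ord_add_le hi (lam := α) (a := a) (b := b) (by omega) (by omega)
  have h7 := hs d hd.1
  rcases Nat.eq_zero_or_pos a with ha | ha <;> rcases Nat.eq_zero_or_pos b with hb | hb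
  · exact ⟨ha, hb⟩
  · have := B hb
    omega
  · have := A ha
    omega
  · have h8 := A ha
    have h9 := B hb
    obtain ⟨rfl, rfl⟩ : a = 1 ∧ b = 1 := by omega
    omega

theorem Trop.add_lt_ord (hi : i₀ ≠ i₁) {w : Fin 2 → ℕ} (hw : ∀ i, 2 ≤ w i)
    (hcop : (w i₀).Coprime (w i₁))
    (hs : ∀ d, MvPowerSeries.coeff d φ ≠ 0 → w i₀ * w i₁ ≤ dot w d) {α β : Fin 2 → ℕ}
    (h : Trop φ β) {a b : ℕ} (h₀ : β i₀ = α i₀ + (a + 1)) (h₁ : β i₁ = α i₁ + (b + 1)) :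
    ord φ α + (a + 1 + (b + 1)) < ord φ β := by
  have hne : w i₀ ≠ w i₁ := by
    intro he
    rw [he, Nat.coprime_self] at hcop
    have := hw i₁
    omega
  have w0 := hw i₀
  have w1 := hw i₁
  rcases h.cases hi with ⟨d, hd, h1, h2⟩ | ⟨d, d', hd, hd', h1, h2⟩
  · have h3 := hd.ord_add_le hi h₀ h₁
    have h4 := hs d hd.1
    rw [dot_eq hi] at h4
    have : d i₀ ≠ 1 ∨ d i₁ ≠ 1 := by
      by_contra! hc
      rw [hc.1, hc.2] at h4
      rcases lt_or_gt_of_ne hne with h5 | h5 <;> nlinarith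
    rcases this with h5 | h5
    · have : 2 ≤ d i₀ := by omega
      nlinarith
    · have : 2 ≤ d i₁ := by omega
      nlinarith
  · have e := hd.ord_add_le hi h₀ h₁
    have e' := hd'.ord_add_le hi h₀ h₁
    have h4 := hs d hd.1
    have h4' := hs d' hd'.1
    rw [dot_eq hi] at h4 h4'
    rw [h1] at e h4
    rw [h2] at e' h4'
    have h5 : w i₁ ≤ d i₀ := Nat.le_of_mul_le_mul_left (by linarith) (by omega : 0 < w i₀)
    have h6 : w i₀ ≤ d' i₁ := Nat.le_of_mul_le_mul_left (by linarith) (by omega : 0 < w i₁)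
    rcases lt_or_gt_of_ne hne with h7 | h7
    · have : 3 ≤ d i₀ := by omega
      have : 2 ≤ d' i₁ := by omega
      nlinarith
    · have : 2 ≤ d i₀ := by omega
      have : 3 ≤ d' i₁ := by omega
      nlinarith

end Presence

end

section

section InitialForms

variable {k : Type u} [Field k]

theorem homPart_smul (φ : MvPowerSeries (Fin 2) k) {w : Fin 2 → ℕ} (hw : ∀ i, 0 < w i) (n : ℕ)
    (a : k) (u : Fin 2 → k) :
    homPart φ w n (fun i => a ^ w i * u i) = a ^ n * homPart φ w n u := by
  rw [homPart, homPart, Finset.mul_sum]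
  refine Finset.sum_congr rfl fun d hd => ?_
  rw [← (mem_level hw).1 hd, dot, pow_add, pow_mul, pow_mul]
  ring

theorem dot_smul (s : ℕ) (w : Fin 2 → ℕ) (d : Fin 2 →₀ ℕ) : dot (s • w) d = s * dot w d := by
  simp [dot, mul_add, mul_assoc]

theorem IsMin.smul {φ : MvPowerSeries (Fin 2) k} {w : Fin 2 → ℕ} {d : Fin 2 →₀ ℕ}
    (h : IsMin φ w d) (s : ℕ) : IsMin φ (s • w) d :=
  isMin_of_le h.1 fun d' hd' => by
    rw [dot_smul, dot_smul]
    exact Nat.mul_le_mul_left _ (h.le hd')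

theorem ord_smul {φ : MvPowerSeries (Fin 2) k} (hφ : φ ≠ 0) (s : ℕ) (w : Fin 2 → ℕ) :
    ord φ (s • w) = s * ord φ w := by
  obtain ⟨d, hd⟩ := exists_isMin hφ w
  rw [← (hd.smul s).2, dot_smul, hd.2]

theorem homPart_smul_weight (φ : MvPowerSeries (Fin 2) k) {w : Fin 2 → ℕ} (hw : ∀ i, 0 < w i)
    {s : ℕ} (hs : 0 < s) (n : ℕ) (u : Fin 2 → k) :
    homPart φ (s • w) (s * n) u = homPart φ w n u := by
  have : level (s • w) (s * n) = level w n := by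
    ext d
    rw [mem_level hw, mem_level fun i => by simpa using ⟨hs, hw i⟩, dot_smul,
      Nat.mul_right_inj hs.ne']
  rw [homPart, homPart, this]

/-- The initial form along the orbit of the `i`-th coordinate. -/
noncomputable def initPoly (φ : MvPowerSeries (Fin 2) k) (w : Fin 2 → ℕ) (u : Fin 2 → k)
    (i : Fin 2) : Polynomial k :=
  ∑ d ∈ level w (ord φ w), Polynomial.C (MvPowerSeries.coeff d φ * (u 0 ^ d 0 * u 1 ^ d 1)) *
    Polynomial.X ^ d i

theorem eval_initPoly (φ : MvPowerSeries (Fin 2) k) (w : Fin 2 → ℕ) (u : Fin 2 → k) (i : Fin 2)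
    (t : k) : (initPoly φ w u i).eval t =
      homPart φ w (ord φ w) (fun j => if j = i then t * u j else u j) := by
  rw [initPoly, Polynomial.eval_finsetSum, homPart]
  refine Finset.sum_congr rfl fun d _ => ?_
  fin_cases i <;> simp <;> ring

theorem initPoly_mul [Infinite k] {φ ψ : MvPowerSeries (Fin 2) k} (hφ : φ ≠ 0) (hψ : ψ ≠ 0)
    {w : Fin 2 → ℕ} (hw : ∀ i, 0 < w i) (u : Fin 2 → k) (i : Fin 2) :
    initPoly (φ * ψ) w u i = initPoly φ w u i * initPoly ψ w u i := by
  refine Polynomial.funext fun t => ?_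
  rw [Polynomial.eval_mul, eval_initPoly, eval_initPoly, eval_initPoly, homPart_ord_mul hw hφ hψ]

/-- The roots of the initial forms of a non-degenerate polynomial are simple. -/
theorem IsNewtonNondegenerate.ne_zero_of_mul [Infinite k] {f : MvPolynomial (Fin 2) k}
    (hf : IsNewtonNondegenerate f) (hf0 : f ≠ 0) {w : Fin 2 → ℕ} (hw : ∀ i, 0 < w i)
    {u : Fin 2 → k} (hu : ∀ i, u i ≠ 0) {φ ψ : MvPowerSeries (Fin 2) k}
    (h : ↟f = φ * ψ) (h0 : homPart φ w (ord φ w) u = 0) :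
    homPart ψ w (ord ψ w) u ≠ 0 := by
  intro h1
  have hf0' : φ * ψ ≠ 0 := by rw [← h]; simpa using hf0
  have hφ := left_ne_zero_of_mul hf0'
  have hψ := right_ne_zero_of_mul hf0'
  obtain ⟨i, hi⟩ := hf.initial hf0 hw hu (by rw [h, homPart_ord_mul hw hφ hψ, h0, zero_mul])
  refine hi ?_
  have key : ∀ χ : MvPowerSeries (Fin 2) k, homPart χ w (ord χ w) u = 0 →
      (initPoly χ w u i).eval 1 = 0 := by
    intro χ hχ
    rw [eval_initPoly, ← hχ]
    congr 1
    funext j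
    simp
  have hder : (initPoly ↟f w u i).derivative.eval 1 = 0 := by
    rw [h, initPoly_mul hφ hψ hw, Polynomial.derivative_mul]
    simp [key φ h0, key ψ h1]
  rw [← hder, initPoly, Polynomial.derivative_sum, Polynomial.eval_finsetSum]
  refine Finset.sum_congr rfl fun d _ => ?_
  rw [Polynomial.derivative_C_mul_X_pow]
  simp only [Polynomial.eval_mul, Polynomial.eval_C, Polynomial.eval_pow, Polynomial.eval_X,
    one_pow, mul_one, MvPolynomial.coeff_coe]
  ring

theorem exists_homPart_eq_zero [IsAlgClosed k] {φ : MvPowerSeries (Fin 2) k} {w : Fin 2 → ℕ}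
    (h : Trop φ w) : ∃ u : Fin 2 → k, (∀ i, u i ≠ 0) ∧ homPart φ w (ord φ w) u = 0 := by
  classical
  obtain ⟨hw, d, d', hne, hd, hd'⟩ := h
  have hinj : ∀ e e' : Fin 2 →₀ ℕ, dot w e = dot w e' → e 1 = e' 1 → e = e' := by
    intro e e' h1 h2
    refine finsupp_ext_of_ne (i₀ := 0) (i₁ := 1) (by decide) ?_ h2
    rw [dot, dot, h2] at h1
    exact Nat.eq_of_mul_eq_mul_left (hw 0) (by omega)
  set p : Polynomial k := initPoly φ w (fun _ => 1) 1 with hp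
  have hcoeff : ∀ e, IsMin φ w e → p.coeff (e 1) ≠ 0 := by
    intro e he
    rw [hp, initPoly, Polynomial.finsetSum_coeff, Finset.sum_eq_single e]
    · simpa using he.1
    · intro b hb hbe
      rw [Polynomial.coeff_C_mul, Polynomial.coeff_X_pow, if_neg, mul_zero]
      intro h1
      exact hbe (hinj _ _ (by rw [(mem_level hw).1 hb, he.2]) h1.symm)
    · intro h1
      exact absurd ((mem_level hw).2 he.2) h1
  have hne1 : d 1 ≠ d' 1 := fun h1 => hne (hinj _ _ (hd.2.trans hd'.2.symm) h1)
  have hp0 : p ≠ 0 := fun h0 => hcoeff d hd (by rw [h0]; simp)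
  by_contra! hcon
  have hroot : ∀ t, t ≠ 0 → p.eval t ≠ 0 := by
    intro t ht h0
    rw [hp, eval_initPoly] at h0
    refine hcon _ (fun i => ?_) h0
    fin_cases i <;> simp [ht]
  obtain ⟨q, hq, hq0⟩ := p.exists_eq_pow_rootMultiplicity_mul_and_not_dvd hp0 0
  have hq1 : q.degree ≤ 0 := by
    by_contra! hc
    obtain ⟨t, ht⟩ := IsAlgClosed.exists_root q hc.ne'
    refine hroot t ?_ (by rw [hq, Polynomial.eval_mul, ht, mul_zero])
    rintro rfl
    exact hq0 (Polynomial.dvd_iff_isRoot.2 ht)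
  rw [Polynomial.eq_C_of_degree_le_zero hq1, map_zero, sub_zero] at hq
  have h1 : ∀ e, IsMin φ w e → e 1 = p.rootMultiplicity 0 := by
    intro e he
    by_contra hne2
    refine hcoeff e he ?_
    rw [hq, mul_comm, Polynomial.coeff_C_mul, Polynomial.coeff_X_pow, if_neg hne2, mul_zero]
  exact hne1 ((h1 d hd).trans (h1 d' hd').symm)

theorem trop_of_homPart_eq_zero {φ : MvPowerSeries (Fin 2) k} (hφ : φ ≠ 0) {w : Fin 2 → ℕ}
    (hw : ∀ i, 0 < w i) {u : Fin 2 → k} (hu : ∀ i, u i ≠ 0)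
    (h : homPart φ w (ord φ w) u = 0) : Trop φ w := by
  obtain ⟨d, hd⟩ := exists_isMin hφ w
  refine ⟨hw, ?_⟩
  by_contra! hc
  have h1 : ∀ d', IsMin φ w d' → d = d' := fun d' hd' => by
    by_contra hne
    exact hc d d' hne hd hd'
  rw [homPart, Finset.sum_eq_single d] at h
  · simp [hd.1, hu] at h
  · intro b hb hbd
    by_cases hb0 : MvPowerSeries.coeff b φ = 0
    · rw [hb0, zero_mul]
    · exact absurd (h1 b ⟨hb0, (mem_level hw).1 hb⟩).symm hbd
  · intro h2
    exact absurd ((mem_level hw).2 hd.2) h2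

end InitialForms

section Chart

variable {k : Type u} [Field k] {R : Type u} [CommRing R] [Algebra k R]

/-- The strict transform of `f` in the chart `x_i = ξ ^ w_i * ζ ^ e_i`. -/
noncomputable def strict (f : MvPolynomial (Fin 2) k) (w e : Fin 2 → ℕ) (ξ : PowerSeries R) :
    Polynomial (PowerSeries R) :=
  ∑ d ∈ f.support, Polynomial.C (algebraMap k (PowerSeries R) (f.coeff d) *
    ξ ^ (dot w d - ord ↟f w)) * Polynomial.X ^ dot e d

theorem aeval_chart (f : MvPolynomial (Fin 2) k) (w e : Fin 2 → ℕ) (ξ z : PowerSeries R) :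
    MvPolynomial.aeval (fun i => ξ ^ w i * z ^ e i) f =
      ξ ^ ord ↟f w * (strict f w e ξ).eval z := by
  rw [MvPolynomial.aeval_def, MvPolynomial.eval₂_eq', strict, Polynomial.eval_finsetSum,
    Finset.mul_sum]
  refine Finset.sum_congr rfl fun d hd => ?_
  have h : ord ↟f w ≤ dot w d :=
    ord_le w (by simpa using hd)
  obtain ⟨c, hc⟩ := Nat.exists_eq_add_of_le h
  rw [Fin.prod_univ_two]
  simp only [Polynomial.eval_mul, Polynomial.eval_C, Polynomial.eval_pow, Polynomial.eval_X]
  rw [hc, Nat.add_sub_cancel_left]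
  have h2 : (ξ ^ w 0 * z ^ e 0) ^ d 0 * (ξ ^ w 1 * z ^ e 1) ^ d 1 =
      ξ ^ dot w d * z ^ dot e d := by
    rw [dot, dot, pow_add, pow_add, pow_mul, pow_mul, pow_mul, pow_mul]
    ring
  rw [h2, hc, pow_add]
  ring

/-- The restriction of the strict transform to the exceptional curve. -/
noncomputable def strictInit (f : MvPolynomial (Fin 2) k) (w e : Fin 2 → ℕ) : Polynomial k :=
  ∑ d ∈ level w (ord ↟f w), Polynomial.C (f.coeff d) *
    Polynomial.X ^ dot e d

theorem strict_map (f : MvPolynomial (Fin 2) k) {w : Fin 2 → ℕ} (hw : ∀ i, 0 < w i)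
    (e : Fin 2 → ℕ) {ξ : PowerSeries R} (hξ : constantCoeff ξ = 0) :
    (strict f w e ξ).map constantCoeff =
      (strictInit f w e).map (algebraMap k R) := by
  classical
  rw [strict, strictInit, Polynomial.map_sum, Polynomial.map_sum]
  have h1 : ∀ d ∈ f.support, Polynomial.map constantCoeff
      (Polynomial.C (algebraMap k (PowerSeries R) (f.coeff d) *
        ξ ^ (dot w d - ord ↟f w)) * Polynomial.X ^ dot e d) =
      if dot w d = ord ↟f w then
        Polynomial.map (algebraMap k R) (Polynomial.C (f.coeff d) * Polynomial.X ^ dot e d)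
      else 0 := by
    intro d hd
    have h : ord ↟f w ≤ dot w d :=
      ord_le w (by simpa using hd)
    split_ifs with h2
    · rw [h2]
      simp [PowerSeries.algebraMap_apply]
    · simp [hξ, zero_pow (show dot w d - ord ↟f w ≠ 0 by omega)]
  rw [Finset.sum_congr rfl h1, ← Finset.sum_filter]
  refine Finset.sum_subset (fun d hd => ?_) fun d hd hd' => ?_
  · exact (mem_level hw).2 (Finset.mem_filter.1 hd).2
  · have : f.coeff d = 0 := by
      by_contra h0
      exact hd' (Finset.mem_filter.2 ⟨by simpa using h0, (mem_level hw).1 hd⟩)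
    simp [this]

theorem eval_strictInit (f : MvPolynomial (Fin 2) k) (w e : Fin 2 → ℕ) (c : k) :
    (strictInit f w e).eval c =
      homPart ↟f w (ord ↟f w)
        (fun i => c ^ e i) := by
  rw [strictInit, Polynomial.eval_finsetSum, homPart]
  refine Finset.sum_congr rfl fun d _ => ?_
  rw [dot, pow_add, pow_mul, pow_mul]
  simp

/-- A root of the initial form is a point of the exceptional curve where the strict transform is
transversal to it. -/
structure IsChartRoot (f : MvPolynomial (Fin 2) k) (w e : Fin 2 → ℕ) (c : k) : Prop where
  pos : ∀ i, 0 < w i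
  ne_zero : c ≠ 0
  root : (strictInit f w e).eval c = 0
  simple : (strictInit f w e).derivative.eval c ≠ 0

theorem IsNewtonNondegenerate.isChartRoot {f : MvPolynomial (Fin 2) k}
    (hf : IsNewtonNondegenerate f) (hf0 : f ≠ 0) {w e : Fin 2 → ℕ} (hw : ∀ i, 0 < w i)
    (hdet : (w 0 : k) * e 1 - w 1 * e 0 ≠ 0) {c : k} (hc : c ≠ 0)
    (h0 : homPart ↟f w (ord ↟f w)
        (fun i => c ^ e i) = 0) : IsChartRoot f w e c := by
  refine ⟨hw, hc, by rw [eval_strictInit, h0], fun hs => ?_⟩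
  obtain ⟨i, hi⟩ := hf.initial hf0 hw (u := fun i => c ^ e i) (fun i => pow_ne_zero _ hc) h0
  set n := ord ↟f w with hn
  let E : Fin 2 → k := fun i => ∑ d ∈ level w n,
      (d i : k) * (f.coeff d * ((c ^ e 0) ^ d 0 * (c ^ e 1) ^ d 1))
  have h1 : (w 0 : k) * E 0 + w 1 * E 1 = 0 := by
    have : (n : k) * homPart ↟f w n (fun i => c ^ e i) =
        w 0 * E 0 + w 1 * E 1 := by
      simp only [E, homPart]
      rw [Finset.mul_sum, Finset.mul_sum, Finset.mul_sum, ← Finset.sum_add_distrib]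
      refine Finset.sum_congr rfl fun d hd => ?_
      rw [← (mem_level hw).1 hd, dot, MvPolynomial.coeff_coe]
      push_cast
      ring
    rw [← this, h0, mul_zero]
  have h2 : (e 0 : k) * E 0 + e 1 * E 1 = 0 := by
    have : (strictInit f w e).derivative.eval c * c = e 0 * E 0 + e 1 * E 1 := by
      simp only [E, strictInit]
      rw [Polynomial.derivative_sum, Polynomial.eval_finsetSum, Finset.sum_mul, Finset.mul_sum,
        Finset.mul_sum, ← Finset.sum_add_distrib]
      refine Finset.sum_congr rfl fun d _ => ?_
      have h3 : (dot e d : k) * (c ^ (dot e d - 1) * c) = dot e d * c ^ dot e d := by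
        rcases Nat.eq_zero_or_pos (dot e d) with h4 | h4
        · rw [h4]; simp
        · rw [← pow_succ, Nat.sub_add_cancel h4]
      rw [Polynomial.derivative_C_mul_X_pow]
      simp only [Polynomial.eval_mul, Polynomial.eval_C, Polynomial.eval_pow, Polynomial.eval_X]
      rw [mul_assoc, mul_assoc, h3, dot, pow_add, pow_mul, pow_mul]
      push_cast
      ring
    rw [← this, hs, zero_mul]
  have e0 : ((w 0 : k) * e 1 - w 1 * e 0) * E 0 = 0 := by
    linear_combination (e 1 : k) * h1 - (w 1 : k) * h2
  have e1 : ((w 0 : k) * e 1 - w 1 * e 0) * E 1 = 0 := by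
    linear_combination (w 0 : k) * h2 - (e 0 : k) * h1
  have h3 : ∀ j, E j = 0 := (forall_iff_of_ne (i₀ := 0) (i₁ := 1) (by decide)).2
    ⟨(mul_eq_zero.1 e0).resolve_left hdet, (mul_eq_zero.1 e1).resolve_left hdet⟩
  exact hi (h3 i)

namespace IsChartRoot

variable {f : MvPolynomial (Fin 2) k} {w e : Fin 2 → ℕ} {c : k}

theorem isUnit_derivative (h : IsChartRoot f w e c) {ξ : PowerSeries R}
    (hξ : constantCoeff ξ = 0) :
    IsUnit (((strict f w e ξ).map constantCoeff).derivative.eval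
      (algebraMap k R c)) := by
  rw [strict_map f h.pos e hξ, Polynomial.derivative_map, Polynomial.eval_map_algebraMap,
    Polynomial.aeval_algebraMap_apply]
  exact (IsUnit.mk0 _ h.simple).map _

theorem exists_root (h : IsChartRoot f w e c) {ξ : PowerSeries R}
    (hξ : constantCoeff ξ = 0) :
    ∃ z : PowerSeries R, constantCoeff z = algebraMap k R c ∧
      (strict f w e ξ).eval z = 0 := by
  refine hensel_exists _ ?_ (h.isUnit_derivative hξ)
  rw [strict_map f h.pos e hξ, Polynomial.eval_map_algebraMap, Polynomial.aeval_algebraMap_apply,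
    Polynomial.coe_aeval_eq_eval, h.root, map_zero]

theorem dvd_eval_iff (h : IsChartRoot f w e c) {ξ z z' : PowerSeries R}
    (hξ : constantCoeff ξ = 0) (hz : constantCoeff z = algebraMap k R c)
    (hz' : constantCoeff z' = algebraMap k R c) (h0 : (strict f w e ξ).eval z = 0)
    (n : ℕ) : X ^ n ∣ (strict f w e ξ).eval z' ↔ X ^ n ∣ z' - z :=
  NewtonJets.dvd_eval_iff _ hz hz' (h.isUnit_derivative hξ) h0 n

theorem root_unique (h : IsChartRoot f w e c) {ξ z z' : PowerSeries R}
    (hξ : constantCoeff ξ = 0) (hz : constantCoeff z = algebraMap k R c)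
    (hz' : constantCoeff z' = algebraMap k R c) (h0 : (strict f w e ξ).eval z = 0)
    (h0' : (strict f w e ξ).eval z' = 0) : z' = z :=
  hensel_unique _ hz hz' (h.isUnit_derivative hξ) h0 h0'

end IsChartRoot

/-- Monomial coordinates on a torus. -/
theorem exists_chart {G : Type*} [CommGroup G] {i₀ i₁ : Fin 2} (hi : i₀ ≠ i₁) {w e : Fin 2 → ℕ}
    (hdet : w i₀ * e i₁ = w i₁ * e i₀ + 1) (v : Fin 2 → G) :
    ∃ ξ ζ : G, ∀ i, v i = ξ ^ w i * ζ ^ e i := by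
  have h : (w i₀ : ℤ) * e i₁ = w i₁ * e i₀ + 1 := by exact_mod_cast hdet
  refine ⟨v i₀ ^ (e i₁ : ℤ) * v i₁ ^ (-(e i₀ : ℤ)), v i₀ ^ (-(w i₁ : ℤ)) * v i₁ ^ (w i₀ : ℤ),
    (forall_iff_of_ne hi).2 ⟨?_, ?_⟩⟩
  · rw [← zpow_natCast, ← zpow_natCast, mul_zpow, mul_zpow, ← zpow_mul, ← zpow_mul, ← zpow_mul,
      ← zpow_mul, mul_mul_mul_comm, ← zpow_add, ← zpow_add,
      show (e i₁ : ℤ) * w i₀ + -(w i₁ : ℤ) * e i₀ = 1 by linarith,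
      show -(e i₀ : ℤ) * w i₀ + w i₀ * e i₀ = 0 by ring]
    simp
  · rw [← zpow_natCast, ← zpow_natCast, mul_zpow, mul_zpow, ← zpow_mul, ← zpow_mul, ← zpow_mul,
      ← zpow_mul, mul_mul_mul_comm, ← zpow_add, ← zpow_add,
      show (e i₁ : ℤ) * w i₁ + -(w i₁ : ℤ) * e i₁ = 0 by ring,
      show -(e i₀ : ℤ) * w i₁ + w i₀ * e i₁ = 1 by linarith]
    simp

/-- Monomial coordinates in a commutative monoid, multiplicatively inverted. -/
theorem chart_eq {M : Type*} [CommMonoid M] {i₀ i₁ : Fin 2} {w e : Fin 2 → ℕ}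
    (hdet : w i₀ * e i₁ = w i₁ * e i₀ + 1) {v : Fin 2 → M} {ξ ζ : M}
    (h : ∀ i, v i = ξ ^ w i * ζ ^ e i) :
    v i₀ ^ e i₁ = ξ * v i₁ ^ e i₀ ∧ v i₁ ^ w i₀ = ζ * v i₀ ^ w i₁ := by
  rw [h, h]
  constructor
  · rw [mul_pow, mul_pow, ← pow_mul, ← pow_mul, ← pow_mul, ← pow_mul, hdet, pow_succ,
      mul_comm (e i₀) (e i₁), mul_comm (ξ ^ _) ξ, mul_assoc]
  · rw [mul_pow, mul_pow, ← pow_mul, ← pow_mul, ← pow_mul, ← pow_mul, mul_comm (e i₁) (w i₀), hdet,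
      pow_succ, mul_comm (w i₀) (w i₁), mul_comm (w i₁) (e i₀), mul_left_comm,
      mul_comm _ ζ, mul_left_comm ζ, mul_comm ζ, mul_left_comm, mul_comm ζ]

/-- The second column of a unimodular chart. -/
theorem exists_det {i₀ i₁ : Fin 2} {w : Fin 2 → ℕ} (hi : i₀ ≠ i₁) (hw : ∀ i, 0 < w i)
    (hcop : (w i₀).Coprime (w i₁)) : ∃ e : Fin 2 → ℕ, w i₀ * e i₁ = w i₁ * e i₀ + 1 := by
  obtain ⟨a, b, hab⟩ : ∃ a b, w i₀ * a = w i₁ * b + 1 := by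
    obtain ⟨x, y, hxy⟩ := Nat.exists_add_mul_eq_of_gcd_dvd_of_mul_pred_le (w i₀) (w i₁)
      (w i₀ * w i₁ + 1) (by rw [hcop]; exact one_dvd _)
      ((Nat.mul_le_mul (Nat.pred_le _) (Nat.pred_le _)).trans (Nat.le_succ _))
    have h0 := hw i₀
    have h1 := hw i₁
    rcases le_or_gt y (w i₀) with hy | hy
    · obtain ⟨b, hb⟩ := Nat.exists_eq_add_of_le hy
      refine ⟨x, b, ?_⟩
      have : w i₀ * w i₁ = (y + b) * w i₁ := by rw [← hb]
      nlinarith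
    · refine ⟨1, w i₀ - 1, ?_⟩
      have : w i₁ = 1 := by nlinarith
      rw [this]
      omega
  refine ⟨fun i => if i = i₀ then b else a, ?_⟩
  simpa [hi.symm] using hab

end Chart

end

section

section Limits

variable {k : Type u} [Field k]

theorem exists_seq {A B : Type*} [AddCommGroup A] [AddCommGroup B] (L : B →+ A) {P : ℕ → A → Prop}
    {Q : ℕ → B → Prop} (step : ∀ n g, P n g → ∃ q, Q n q ∧ P (n + 1) (g - L q)) {g₀ : A}
    (h0 : P 0 g₀) :
    ∃ s : ℕ → B, ∀ n, Q n (s n) ∧ P n (g₀ - L (∑ j ∈ Finset.range n, s j)) := by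
  choose! t ht using step
  let G : ℕ → A := fun n => Nat.rec g₀ (fun n g => g - L (t n g)) n
  have hG : ∀ n, G n = g₀ - L (∑ j ∈ Finset.range n, t j (G j)) := by
    intro n
    induction n with
    | zero => simp [G]
    | succ n ih =>
      have h1 : G (n + 1) = G n - L (t n (G n)) := rfl
      rw [Finset.sum_range_succ, map_add, ← sub_sub, ← ih, h1]
  have hP : ∀ n, P n (G n) := by
    intro n
    induction n with
    | zero => exact h0
    | succ n ih => exact (ht n _ ih).2
  exact ⟨fun n => t n (G n), fun n => ⟨(ht n _ (hP n)).1, by rw [← hG]; exact hP n⟩⟩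

theorem exists_limit {w : Fin 2 → ℕ} {N : ℕ} {s : ℕ → MvPowerSeries (Fin 2) k}
    (hs : ∀ n d, dot w d + N < n → MvPowerSeries.coeff d (s n) = 0) :
    ∃ S : MvPowerSeries (Fin 2) k, (∀ d, MvPowerSeries.coeff d S =
      ∑ j ∈ Finset.range (dot w d + N + 1), MvPowerSeries.coeff d (s j)) ∧ ∀ n d, dot w d + N < n →
      MvPowerSeries.coeff d (S - ∑ j ∈ Finset.range n, s j) = 0 := by
  let S : MvPowerSeries (Fin 2) k := fun d =>
    ∑ j ∈ Finset.range (dot w d + N + 1), MvPowerSeries.coeff d (s j)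
  have hS : ∀ d, MvPowerSeries.coeff d S =
    ∑ j ∈ Finset.range (dot w d + N + 1), MvPowerSeries.coeff d (s j) := fun d => rfl
  refine ⟨S, hS, fun n d hd => ?_⟩
  rw [map_sub, map_sum, sub_eq_zero, hS]
  refine Finset.sum_subset (fun j hj => ?_) fun j _ hj => ?_
  · rw [Finset.mem_range] at hj ⊢
    omega
  · rw [Finset.mem_range] at hj
    exact hs j d (by omega)

end Limits

section BranchOfArc

variable {k : Type u} [Field k] {i₀ i₁ : Fin 2}

theorem pow_mul_pow_eq (hi : i₀ ≠ i₁) {R : Type*} [CommMonoid R] (x : Fin 2 → R) (d : Fin 2 →₀ ℕ) :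
    x 0 ^ d 0 * x 1 ^ d 1 = x i₀ ^ d i₀ * x i₁ ^ d i₁ := by
  fin_cases i₀ <;> fin_cases i₁ <;> simp_all [mul_comm]

theorem homPart_monomial {w : Fin 2 → ℕ} (hw : ∀ i, 0 < w i) (d : Fin 2 →₀ ℕ) (a : k)
    (u : Fin 2 → k) : homPart (MvPowerSeries.monomial d a) w (dot w d) u =
      a * (u 0 ^ d 0 * u 1 ^ d 1) := by
  classical
  rw [homPart, Finset.sum_eq_single d]
  · rw [MvPowerSeries.coeff_monomial_same]
  · intro b _ hb
    rw [MvPowerSeries.coeff_monomial_ne hb, zero_mul]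
  · intro h
    exact absurd ((mem_level hw).2 rfl) h

theorem homPart_sub (φ ψ : MvPowerSeries (Fin 2) k) (w : Fin 2 → ℕ) (n : ℕ) (u : Fin 2 → k) :
    homPart (φ - ψ) w n u = homPart φ w n u - homPart ψ w n u := by
  rw [homPart, homPart, homPart, ← Finset.sum_sub_distrib]
  refine Finset.sum_congr rfl fun d _ => ?_
  rw [map_sub, sub_mul]

theorem X_pow_succ_dvd_subst {w : Fin 2 → ℕ} {a : Fin 2 → PowerSeries k} (hw : ∀ i, 0 < w i)
    (ha : ∀ i, X ^ w i ∣ a i) {φ : MvPowerSeries (Fin 2) k} {n : ℕ}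
    (hn : ∀ d, MvPowerSeries.coeff d φ ≠ 0 → n ≤ dot w d)
    (h0 : homPart φ w n (fun i => coeff (w i) (a i)) = 0) :
    X ^ (n + 1) ∣ (MvPowerSeries.subst a φ : PowerSeries k) := by
  rw [PowerSeries.X_pow_dvd_iff]
  intro m hm
  rcases Nat.lt_succ_iff_lt_or_eq.1 hm with h | rfl
  · exact PowerSeries.X_pow_dvd_iff.1 (X_pow_dvd_subst hw ha hn) m h
  · rw [coeff_subst_eq_homPart hw ha hn, h0]

/-- `b` is an equation of the arc with orders `w` and leading coefficients `u`. -/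
structure IsEquation (b : MvPowerSeries (Fin 2) k) (w : Fin 2 → ℕ) (u : Fin 2 → k) (i₀ i₁ : Fin 2) :
    Prop where
  coeff_one : MvPowerSeries.coeff (Finsupp.single i₁ (w i₀)) b = 1
  coeff_zero : MvPowerSeries.coeff (Finsupp.single i₀ (w i₁)) b = -(u i₁ ^ w i₀ / u i₀ ^ w i₁)
  lt : ∀ d, MvPowerSeries.coeff d b ≠ 0 → d = Finsupp.single i₁ (w i₀) ∨
    d = Finsupp.single i₀ (w i₁) ∨ w i₀ * w i₁ < dot w d

theorem dot_single_one (hi : i₀ ≠ i₁) (w : Fin 2 → ℕ) :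
    dot w (Finsupp.single i₁ (w i₀)) = w i₀ * w i₁ := by
  rw [dot_eq hi]; simp [hi, mul_comm]

theorem dot_single_zero (hi : i₀ ≠ i₁) (w : Fin 2 → ℕ) :
    dot w (Finsupp.single i₀ (w i₁)) = w i₀ * w i₁ := by
  rw [dot_eq hi]; simp [hi.symm]

theorem single_ne_single (hi : i₀ ≠ i₁) {w : Fin 2 → ℕ} (hw : ∀ i, 0 < w i) :
    (Finsupp.single i₁ (w i₀) : Fin 2 →₀ ℕ) ≠ Finsupp.single i₀ (w i₁) := by
  intro h
  have := DFunLike.congr_fun h i₁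
  simp [hi] at this
  exact (hw i₀).ne' this

variable {w : Fin 2 → ℕ} {a : Fin 2 → PowerSeries k}

theorem IsEquation.le (hi : i₀ ≠ i₁) {b : MvPowerSeries (Fin 2) k} {u : Fin 2 → k}
    (h : IsEquation b w u i₀ i₁) (d : Fin 2 →₀ ℕ) (hd : MvPowerSeries.coeff d b ≠ 0) :
    w i₀ * w i₁ ≤ dot w d := by
  rcases h.lt d hd with rfl | rfl | h1
  · exact (dot_single_one hi w).ge
  · exact (dot_single_zero hi w).ge
  · exact h1.le

/-- The equation of an arc with coprime orders. -/
theorem exists_isEquation (hi : i₀ ≠ i₁) (hw : ∀ i, 0 < w i) (hcop : (w i₀).Coprime (w i₁))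
    (ha : ∀ i, X ^ w i ∣ a i) (hu : ∀ i, coeff (w i) (a i) ≠ 0) :
    ∃ b : MvPowerSeries (Fin 2) k, (MvPowerSeries.subst a b : PowerSeries k) = 0 ∧
      IsEquation b w (fun i => coeff (w i) (a i)) i₀ i₁ := by
  set u : Fin 2 → k := fun i => coeff (w i) (a i) with hudef
  set N := w i₀ * w i₁ with hN
  set c := u i₁ ^ w i₀ / u i₀ ^ w i₁ with hc
  have hsub := hasSubst_of_dvd hw ha
  let ρ : MvPowerSeries (Fin 2) k →ₐ[k] PowerSeries k := MvPowerSeries.substAlgHom hsub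
  have hρ : ∀ φ, ρ φ = (MvPowerSeries.subst a φ : PowerSeries k) := fun φ =>
    MvPowerSeries.substAlgHom_apply hsub φ
  let g₀ : MvPowerSeries (Fin 2) k := MvPowerSeries.monomial (Finsupp.single i₁ (w i₀)) 1 -
    MvPowerSeries.monomial (Finsupp.single i₀ (w i₁)) c
  have hg₀ : ∀ d, MvPowerSeries.coeff d g₀ ≠ 0 → d = Finsupp.single i₁ (w i₀) ∨
      d = Finsupp.single i₀ (w i₁) := by
    intro d hd
    by_contra! hcon
    refine hd ?_
    rw [map_sub, MvPowerSeries.coeff_monomial_ne hcon.1, MvPowerSeries.coeff_monomial_ne hcon.2,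
      sub_zero]
  have hg₀1 : ∀ d, MvPowerSeries.coeff d g₀ ≠ 0 → dot w d = N := by
    intro d hd
    rcases hg₀ d hd with rfl | rfl
    · exact dot_single_one hi w
    · exact dot_single_zero hi w
  have hstep : ∀ n (g : MvPowerSeries (Fin 2) k), X ^ (N + 1 + n) ∣ ρ g →
      ∃ t : MvPowerSeries (Fin 2) k, (∀ d, MvPowerSeries.coeff d t ≠ 0 → dot w d = N + 1 + n) ∧
        X ^ (N + 1 + (n + 1)) ∣ ρ (g - AddMonoidHom.id _ t) := by
    intro n g hg
    obtain ⟨x, y, hxy⟩ := Nat.exists_add_mul_eq_of_gcd_dvd_of_mul_pred_le (w i₀) (w i₁)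
      (N + 1 + n) (by rw [hcop]; exact one_dvd _) (by
        have := Nat.mul_le_mul (Nat.pred_le (w i₀)) (Nat.pred_le (w i₁))
        simp only [hN]
        omega)
    let d : Fin 2 →₀ ℕ := Finsupp.single i₀ x + Finsupp.single i₁ y
    have hd : dot w d = N + 1 + n := by
      rw [dot_eq hi, ← hxy]
      simp [d, hi, hi.symm]
      ring
    set r := coeff (N + 1 + n) (ρ g) with hr
    have hud : u 0 ^ d 0 * u 1 ^ d 1 ≠ 0 := mul_ne_zero (pow_ne_zero _ (hu 0)) (pow_ne_zero _ (hu 1))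
    let t : MvPowerSeries (Fin 2) k := MvPowerSeries.monomial d (r / (u 0 ^ d 0 * u 1 ^ d 1))
    have ht : ∀ d', MvPowerSeries.coeff d' t ≠ 0 → dot w d' = N + 1 + n := by
      intro d' hd'
      rw [← hd]
      by_contra hne
      exact hd' (MvPowerSeries.coeff_monomial_ne (fun h => hne (by rw [h])) _)
    refine ⟨t, ht, ?_⟩
    rw [AddMonoidHom.id_apply, map_sub, ← add_assoc, PowerSeries.X_pow_dvd_iff]
    intro m hm
    have h1 : X ^ (N + 1 + n) ∣ ρ t := by
      rw [hρ]
      exact X_pow_dvd_subst hw ha fun d' hd' => (ht d' hd').ge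
    rcases Nat.lt_succ_iff_lt_or_eq.1 hm with h | rfl
    · exact PowerSeries.X_pow_dvd_iff.1 (dvd_sub hg h1) m h
    · have e : homPart t w (N + 1 + n) u = r := by
        rw [← hd, homPart_monomial hw, div_mul_cancel₀ _ hud]
      rw [map_sub, ← hr, hρ t, coeff_subst_eq_homPart hw ha fun d' hd' => (ht d' hd').ge]
      exact sub_eq_zero.2 e.symm
  have hbase : X ^ (N + 1 + 0) ∣ ρ g₀ := by
    rw [hρ]
    refine X_pow_succ_dvd_subst hw ha (fun d hd => (hg₀1 d hd).ge) ?_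
    have e1 : homPart (MvPowerSeries.monomial (Finsupp.single i₁ (w i₀)) 1) w N u =
        u i₁ ^ w i₀ := by
      rw [hN, ← dot_single_one hi w, homPart_monomial hw, pow_mul_pow_eq hi]
      simp [hi]
    have e2 : homPart (MvPowerSeries.monomial (Finsupp.single i₀ (w i₁)) c) w N u =
        c * u i₀ ^ w i₁ := by
      rw [hN, ← dot_single_zero hi w, homPart_monomial hw, pow_mul_pow_eq hi]
      simp [hi.symm]
    rw [homPart_sub, e1, e2, hc, div_mul_cancel₀ _ (pow_ne_zero _ (hu i₀)), sub_self]
  obtain ⟨s, hs⟩ := exists_seq (AddMonoidHom.id _)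
    (P := fun n g => X ^ (N + 1 + n) ∣ ρ g) hstep hbase
  obtain ⟨S, hS1, hS2⟩ := exists_limit (w := w) (N := 0) (s := s) (by
    intro n d hd
    by_contra h
    have := (hs n).1 d h
    omega)
  have hSN : ∀ d, MvPowerSeries.coeff d S ≠ 0 → N < dot w d := by
    intro d hd
    rw [hS1] at hd
    obtain ⟨j, -, hj⟩ := Finset.exists_ne_zero_of_sum_ne_zero hd
    have := (hs j).1 d hj
    omega
  have hS0 : ∀ d, dot w d = N → MvPowerSeries.coeff d S = 0 := by
    intro d hd
    by_contra h
    have := hSN d h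
    omega
  refine ⟨g₀ - S, powerSeries_eq_zero_of_forall_dvd fun n => ?_, ?_, ?_, ?_⟩
  · have h1 := (hs n).2
    have h2 : X ^ n ∣ ρ (S - ∑ j ∈ Finset.range n, s j) := by
      rw [hρ]
      refine X_pow_dvd_subst hw ha fun d hd => ?_
      by_contra hcon
      exact hd (hS2 n d (by omega))
    have h3 := dvd_sub ((pow_dvd_pow _ (by omega : n ≤ N + 1 + n)).trans h1) h2
    rw [← map_sub, AddMonoidHom.id_apply, sub_sub_sub_cancel_right, hρ] at h3
    exact h3
  · rw [map_sub, hS0 _ (dot_single_one hi w), map_sub, MvPowerSeries.coeff_monomial_same,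
      MvPowerSeries.coeff_monomial_ne (single_ne_single hi hw)]
    simp
  · rw [map_sub, hS0 _ (dot_single_zero hi w), map_sub, MvPowerSeries.coeff_monomial_same,
      MvPowerSeries.coeff_monomial_ne (single_ne_single hi hw).symm]
    simp [hc]
  · intro d hd
    rw [map_sub] at hd
    by_cases h1 : MvPowerSeries.coeff d g₀ = 0
    · rw [h1, zero_sub, neg_ne_zero] at hd
      exact Or.inr (Or.inr (hSN d hd))
    · rcases hg₀ d h1 with h2 | h2
      · exact Or.inl h2
      · exact Or.inr (Or.inl h2)

theorem IsEquation.exists_normalForm (hi : i₀ ≠ i₁) (hw : ∀ i, 0 < w i)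
    {b : MvPowerSeries (Fin 2) k} {u : Fin 2 → k} (hb : IsEquation b w u i₀ i₁) (n M : ℕ) :
    ∀ φ : MvPowerSeries (Fin 2) k, (∀ d, dot w d < n → MvPowerSeries.coeff d φ = 0) →
      (∀ d, dot w d = n → MvPowerSeries.coeff d φ ≠ 0 → d i₁ < M) →
      ∃ q : MvPowerSeries (Fin 2) k,
        (∀ d, dot w d + w i₀ * w i₁ < n → MvPowerSeries.coeff d q = 0) ∧
        (∀ d, dot w d < n → MvPowerSeries.coeff d (φ - b * q) = 0) ∧
        (∀ d, dot w d = n → MvPowerSeries.coeff d (φ - b * q) ≠ 0 → d i₁ < w i₀) := by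
  classical
  induction M with
  | zero =>
    intro φ h1 h2
    exact ⟨0, by simp, by simpa using h1, fun d hd hd' =>
      absurd (h2 d hd (by simpa using hd')) (by omega)⟩
  | succ M ih =>
    intro φ h1 h2
    by_cases hex : ∃ d, dot w d = n ∧ MvPowerSeries.coeff d φ ≠ 0 ∧ d i₁ = M ∧ w i₀ ≤ M
    · obtain ⟨d, hdn, hd0, hdM, hM⟩ := hex
      have hle : (Finsupp.single i₁ (w i₀) : Fin 2 →₀ ℕ) ≤ d := by
        rw [Finsupp.single_le_iff, hdM]
        exact hM
      obtain ⟨δ, rfl⟩ := le_iff_exists_add.1 hle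
      rw [dot_add, dot_single_one hi] at hdn
      set r := MvPowerSeries.coeff (Finsupp.single i₁ (w i₀) + δ) φ with hr
      have hbm : ∀ d', MvPowerSeries.coeff d' (b * MvPowerSeries.monomial δ r) =
          if δ ≤ d' then MvPowerSeries.coeff (d' - δ) b * r else 0 := fun d' =>
        MvPowerSeries.coeff_mul_monomial _ _ _ _
      have hlow : ∀ d', MvPowerSeries.coeff d' (b * MvPowerSeries.monomial δ r) ≠ 0 →
          d' = Finsupp.single i₁ (w i₀) + δ ∨ d' = Finsupp.single i₀ (w i₁) + δ ∨
            n < dot w d' := by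
        intro d' hd'
        rw [hbm] at hd'
        split_ifs at hd' with hle'
        · obtain ⟨η, rfl⟩ := le_iff_exists_add.1 hle'
          rw [add_tsub_cancel_left] at hd'
          rcases hb.lt η (left_ne_zero_of_mul hd') with h | h | h
          · exact Or.inl (by rw [h, add_comm])
          · exact Or.inr (Or.inl (by rw [h, add_comm]))
          · refine Or.inr (Or.inr ?_)
            rw [dot_add]
            omega
        · exact absurd rfl hd'
      have hM' : M = w i₀ + δ i₁ := by rw [← hdM]; simp
      obtain ⟨q, hq1, hq2, hq3⟩ := ih (φ - b * MvPowerSeries.monomial δ r) (by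
        intro d' hd'
        rw [map_sub, h1 d' hd', zero_sub, neg_eq_zero]
        by_contra hne
        rcases hlow d' hne with rfl | rfl | h
        · rw [dot_add, dot_single_one hi] at hd'
          omega
        · rw [dot_add, dot_single_zero hi] at hd'
          omega
        · omega) (by
        intro d' hd' hne
        have hw0 := hw i₀
        by_cases hz : MvPowerSeries.coeff d' (b * MvPowerSeries.monomial δ r) = 0
        · rw [map_sub, hz, sub_zero] at hne
          refine lt_of_le_of_ne (Nat.lt_succ_iff.1 (h2 d' hd' hne)) fun he => ?_
          have : d' = Finsupp.single i₁ (w i₀) + δ := by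
            have e1 : d' i₁ = (Finsupp.single i₁ (w i₀) + δ) i₁ := by rw [he, hdM]
            refine finsupp_ext_of_ne hi ?_ e1
            have e2 := hd'.trans hdn.symm
            rw [← dot_single_one hi w, ← dot_add, dot_eq hi, dot_eq hi, e1] at e2
            exact Nat.eq_of_mul_eq_mul_left (hw i₀) (by omega)
          rw [this, hbm, if_pos (le_add_self), add_tsub_cancel_right, hb.coeff_one, one_mul] at hz
          exact hd0 hz
        · rcases hlow d' hz with rfl | rfl | h
          · exfalso
            rw [map_sub, hbm, if_pos (le_add_self), add_tsub_cancel_right, hb.coeff_one, one_mul,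
              ← hr, sub_self] at hne
            exact hne rfl
          · simp [hi, hM', hw0]
          · omega)
      refine ⟨MvPowerSeries.monomial δ r + q, ?_, ?_, ?_⟩
      · intro d' hd'
        rw [map_add, hq1 d' hd', add_zero]
        refine MvPowerSeries.coeff_monomial_ne ?_ _
        rintro rfl
        omega
      · intro d' hd'
        rw [mul_add, ← sub_sub]
        exact hq2 d' hd'
      · intro d' hd' hne
        rw [mul_add, ← sub_sub] at hne
        exact hq3 d' hd' hne
    · by_cases hM : w i₀ ≤ M
      · refine ih φ h1 fun d hd hd0 => lt_of_le_of_ne (Nat.lt_succ_iff.1 (h2 d hd hd0)) fun he => ?_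
        exact hex ⟨d, hd, hd0, he, hM⟩
      · refine ⟨0, by simp, by simpa using h1, fun d hd hd' => ?_⟩
        have := h2 d hd (by simpa using hd')
        omega

theorem IsEquation.dvd (hi : i₀ ≠ i₁) (hw : ∀ i, 0 < w i) (hcop : (w i₀).Coprime (w i₁))
    (ha : ∀ i, X ^ w i ∣ a i) (hu : ∀ i, coeff (w i) (a i) ≠ 0)
    {b : MvPowerSeries (Fin 2) k}
    (hb : IsEquation b w (fun i => coeff (w i) (a i)) i₀ i₁)
    (hb0 : (MvPowerSeries.subst a b : PowerSeries k) = 0) {g : MvPowerSeries (Fin 2) k}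
    (hg : (MvPowerSeries.subst a g : PowerSeries k) = 0) : b ∣ g := by
  classical
  set u : Fin 2 → k := fun i => coeff (w i) (a i) with hudef
  set N := w i₀ * w i₁ with hN
  have hsub := hasSubst_of_dvd hw ha
  let ρ : MvPowerSeries (Fin 2) k →ₐ[k] PowerSeries k := MvPowerSeries.substAlgHom hsub
  have hρ : ∀ φ, ρ φ = (MvPowerSeries.subst a φ : PowerSeries k) := fun φ =>
    MvPowerSeries.substAlgHom_apply hsub φ
  have hstep : ∀ n (g : MvPowerSeries (Fin 2) k),
      (ρ g = 0 ∧ ∀ d, dot w d < n → MvPowerSeries.coeff d g = 0) →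
      ∃ q : MvPowerSeries (Fin 2) k, (∀ d, dot w d + N < n → MvPowerSeries.coeff d q = 0) ∧
        (ρ (g - AddMonoidHom.mulLeft b q) = 0 ∧
          ∀ d, dot w d < n + 1 → MvPowerSeries.coeff d (g - AddMonoidHom.mulLeft b q) = 0) := by
    rintro n g ⟨h1, h2⟩
    obtain ⟨q, hq1, hq2, hq3⟩ := hb.exists_normalForm hi hw n (n + 1) g h2 (by
      intro d hd _
      have := Nat.le_mul_of_pos_left (d i₁) (hw i₁)
      rw [dot_eq hi] at hd
      omega)
    have hρ0 : ρ (g - b * q) = 0 := by rw [map_sub, map_mul, h1, hρ b, hb0, zero_mul, sub_zero]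
    refine ⟨q, hq1, hρ0, fun d hd => ?_⟩
    rcases Nat.lt_succ_iff_lt_or_eq.1 hd with h | h
    · exact hq2 d h
    by_contra hne
    have hhom := coeff_subst_eq_homPart hw ha (φ := g - b * q) (n := n) fun d' hd' => by
      by_contra hcon
      exact hd' (hq2 d' (by omega))
    rw [← hρ, hρ0, map_zero, homPart, Finset.sum_eq_single d] at hhom
    · exact mul_ne_zero hne (mul_ne_zero (pow_ne_zero _ (hu 0)) (pow_ne_zero _ (hu 1))) hhom.symm
    · intro d' hd' hdd
      rw [mem_level hw] at hd'
      by_contra hcon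
      have hne' := left_ne_zero_of_mul hcon
      have l1 := hq3 d h hne
      have l2 := hq3 d' hd' hne'
      have e := h.trans hd'.symm
      rw [dot_eq hi, dot_eq hi] at e
      have hmod : w i₁ * d i₁ ≡ w i₁ * d' i₁ [MOD w i₀] := by
        have e1 : (w i₀ * d i₀ + w i₁ * d i₁) % w i₀ = (w i₀ * d' i₀ + w i₁ * d' i₁) % w i₀ := by
          rw [e]
        rwa [Nat.mul_add_mod, Nat.mul_add_mod] at e1
      have h4 : d i₁ = d' i₁ := by
        have := Nat.ModEq.cancel_left_of_coprime (by rwa [Nat.Coprime] at hcop) hmod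
        rwa [Nat.ModEq, Nat.mod_eq_of_lt l1, Nat.mod_eq_of_lt l2] at this
      rw [h4] at e
      exact hdd (finsupp_ext_of_ne hi (Nat.eq_of_mul_eq_mul_left (hw i₀) (by omega)).symm h4.symm)
    · intro hcon
      exact absurd ((mem_level hw).2 h) hcon
  obtain ⟨s, hs⟩ := exists_seq (AddMonoidHom.mulLeft b) (P := fun n g =>
    ρ g = 0 ∧ ∀ d, dot w d < n → MvPowerSeries.coeff d g = 0) hstep (g₀ := g)
    ⟨by rw [hρ, hg], by simp⟩
  obtain ⟨S, -, hS⟩ := exists_limit fun n => (hs n).1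
  refine ⟨S, sub_eq_zero.1 (MvPowerSeries.ext fun d => ?_)⟩
  set n := dot w d + N + 1 with hn
  have h1 : g - b * S = (g - b * ∑ j ∈ Finset.range n, s j) -
      b * (S - ∑ j ∈ Finset.range n, s j) := by ring
  have h2 : MvPowerSeries.coeff d (g - b * ∑ j ∈ Finset.range n, s j) = 0 :=
    (hs n).2.2 d (by omega)
  rw [h1, map_sub, map_zero, h2, zero_sub, neg_eq_zero, MvPowerSeries.coeff_mul]
  refine Finset.sum_eq_zero fun p hp => ?_
  rw [Finset.HasAntidiagonal.mem_antidiagonal] at hp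
  rw [hS n p.2, mul_zero]
  rw [← hp, dot_add] at hn
  omega

end BranchOfArc

end

section

section Branches

variable {k : Type u} [Field k]

theorem exists_primitive {α : Fin 2 → ℕ} (hα : ∀ i, 0 < α i) :
    ∃ (s : ℕ) (w : Fin 2 → ℕ), 0 < s ∧ (∀ i, 0 < w i) ∧ (w 0).Coprime (w 1) ∧ α = s • w := by
  have hg : 0 < Nat.gcd (α 0) (α 1) := Nat.gcd_pos_of_pos_left _ (hα 0)
  obtain ⟨a, ha⟩ := Nat.gcd_dvd_left (α 0) (α 1)
  obtain ⟨b, hb⟩ := Nat.gcd_dvd_right (α 0) (α 1)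
  refine ⟨Nat.gcd (α 0) (α 1), ![a, b], hg, ?_, ?_, ?_⟩
  · have h0 := hα 0
    have h1 := hα 1
    rw [ha] at h0
    rw [hb] at h1
    intro i
    fin_cases i
    exacts [Nat.pos_of_mul_pos_left h0, Nat.pos_of_mul_pos_left h1]
  · have := Nat.coprime_div_gcd_div_gcd hg
    rwa [Nat.div_eq_of_eq_mul_right hg ha, Nat.div_eq_of_eq_mul_right hg hb] at this
  · funext i
    fin_cases i
    exacts [ha, hb]

theorem trop_iff_exists_root [IsAlgClosed k] {φ : MvPowerSeries (Fin 2) k} (hφ : φ ≠ 0)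
    {w : Fin 2 → ℕ} (hw : ∀ i, 0 < w i) :
    Trop φ w ↔ ∃ u : Fin 2 → k, (∀ i, u i ≠ 0) ∧ homPart φ w (ord φ w) u = 0 :=
  ⟨exists_homPart_eq_zero, fun ⟨_, hu, h⟩ => trop_of_homPart_eq_zero hφ hw hu h⟩

theorem trop_mul [IsAlgClosed k] {φ ψ : MvPowerSeries (Fin 2) k} (hφ : φ ≠ 0) (hψ : ψ ≠ 0)
    (w : Fin 2 → ℕ) : Trop (φ * ψ) w ↔ Trop φ w ∨ Trop ψ w := by
  by_cases hw : ∀ i, 0 < w i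
  · rw [trop_iff_exists_root hφ hw, trop_iff_exists_root hψ hw,
      trop_iff_exists_root (mul_ne_zero hφ hψ) hw, ← exists_or]
    refine exists_congr fun u => ?_
    rw [homPart_ord_mul hw hφ hψ, mul_eq_zero, and_or_left]
  · exact ⟨fun h => absurd h.1 hw, fun h => h.elim (fun h => absurd h.1 hw) fun h => absurd h.1 hw⟩

theorem not_trop_of_isUnit [IsAlgClosed k] {φ : MvPowerSeries (Fin 2) k} (h : IsUnit φ)
    (w : Fin 2 → ℕ) : ¬ Trop φ w := fun ht => by
  obtain ⟨u, -, hu⟩ := exists_homPart_eq_zero ht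
  exact homPart_unit h ht.1 u hu

theorem trop_congr_of_associated [IsAlgClosed k] {φ ψ : MvPowerSeries (Fin 2) k} (hφ : φ ≠ 0)
    (h : Associated φ ψ) (w : Fin 2 → ℕ) : Trop ψ w ↔ Trop φ w := by
  obtain ⟨v, rfl⟩ := h
  rw [trop_mul hφ v.ne_zero]
  exact or_iff_left (not_trop_of_isUnit v.isUnit w)

theorem homPart_eq_zero_of_associated {φ ψ : MvPowerSeries (Fin 2) k} (hφ : φ ≠ 0)
    (h : Associated φ ψ) {w : Fin 2 → ℕ} (hw : ∀ i, 0 < w i) (u : Fin 2 → k) :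
    homPart ψ w (ord ψ w) u = 0 ↔ homPart φ w (ord φ w) u = 0 := by
  obtain ⟨v, rfl⟩ := h
  rw [homPart_ord_mul hw hφ v.ne_zero, mul_eq_zero]
  exact or_iff_left (homPart_unit v.isUnit hw u)

namespace IsEquation

variable {b : MvPowerSeries (Fin 2) k} {w : Fin 2 → ℕ} {u : Fin 2 → k} {i₀ i₁ : Fin 2}

theorem ne_zero (h : IsEquation b w u i₀ i₁) : b ≠ 0 := by
  rintro rfl
  simpa using h.coeff_one

theorem not_isUnit (hi : i₀ ≠ i₁) (hw : ∀ i, 0 < w i) (h : IsEquation b w u i₀ i₁) :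
    ¬ IsUnit b := by
  rw [MvPowerSeries.isUnit_iff_constantCoeff]
  intro hu
  have h0 := h.le hi 0 (by simpa using hu.ne_zero)
  have := Nat.mul_pos (hw i₀) (hw i₁)
  simp [dot] at h0
  rcases h0 with h0 | h0 <;> simp [h0] at this

theorem isMin_one (hi : i₀ ≠ i₁) (h : IsEquation b w u i₀ i₁) :
    IsMin b w (Finsupp.single i₁ (w i₀)) :=
  isMin_of_le (by rw [h.coeff_one]; exact one_ne_zero) fun d hd => by
    rw [dot_single_one hi]; exact h.le hi d hd

theorem isMin_zero (hi : i₀ ≠ i₁) (hu : ∀ i, u i ≠ 0) (h : IsEquation b w u i₀ i₁) :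
    IsMin b w (Finsupp.single i₀ (w i₁)) :=
  isMin_of_le (by
    rw [h.coeff_zero, neg_ne_zero]
    exact div_ne_zero (pow_ne_zero _ (hu _)) (pow_ne_zero _ (hu _))) fun d hd => by
    rw [dot_single_zero hi]; exact h.le hi d hd

theorem ord_eq (hi : i₀ ≠ i₁) (h : IsEquation b w u i₀ i₁) : ord b w = w i₀ * w i₁ := by
  rw [← (h.isMin_one hi).2, dot_single_one hi]

theorem trop_iff (hi : i₀ ≠ i₁) (hw : ∀ i, 0 < w i) (hcop : (w i₀).Coprime (w i₁))
    (hu : ∀ i, u i ≠ 0) (h : IsEquation b w u i₀ i₁) (β : Fin 2 → ℕ) :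
    Trop b β ↔ ∃ s, 0 < s ∧ β = s • w := by
  constructor
  · intro hβ
    have key : β i₀ * w i₁ = β i₁ * w i₀ := by
      refine le_antisymm ?_ ?_
      · obtain ⟨d, hd, hd0⟩ := hβ.exists_pos hi
        have h1 := hd.le (h.isMin_one hi).1
        rw [dot_eq hi, dot_eq hi] at h1
        simp [hi] at h1
        have h2 := h.le hi d hd.1
        rw [dot_eq hi] at h2
        by_contra! hc
        have h3 : β i₁ * (w i₀ * w i₁) ≤ β i₁ * (w i₀ * d i₀ + w i₁ * d i₁) :=
          Nat.mul_le_mul_left _ h2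
        have h4 : w i₁ * (β i₀ * d i₀ + β i₁ * d i₁) ≤ w i₁ * (β i₁ * w i₀) :=
          Nat.mul_le_mul_left _ h1
        have h5 : β i₁ * w i₀ * d i₀ < β i₀ * w i₁ * d i₀ := Nat.mul_lt_mul_of_pos_right hc hd0
        nlinarith
      · obtain ⟨d, hd, hd0⟩ := hβ.exists_pos hi.symm
        have h1 := hd.le (h.isMin_zero hi hu).1
        rw [dot_eq hi, dot_eq hi] at h1
        simp [hi.symm] at h1
        have h2 := h.le hi d hd.1
        rw [dot_eq hi] at h2
        by_contra! hc
        have h3 : β i₀ * (w i₀ * w i₁) ≤ β i₀ * (w i₀ * d i₀ + w i₁ * d i₁) :=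
          Nat.mul_le_mul_left _ h2
        have h4 : w i₀ * (β i₀ * d i₀ + β i₁ * d i₁) ≤ w i₀ * (β i₀ * w i₁) :=
          Nat.mul_le_mul_left _ h1
        have h5 : β i₀ * w i₁ * d i₁ < β i₁ * w i₀ * d i₁ := Nat.mul_lt_mul_of_pos_right hc hd0
        nlinarith
    obtain ⟨s, hs⟩ : w i₀ ∣ β i₀ := hcop.dvd_of_dvd_mul_right (Dvd.intro_left _ key.symm)
    have hs1 : β i₁ = s * w i₁ := by
      rw [hs] at key
      refine Nat.eq_of_mul_eq_mul_left (hw i₀) ?_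
      linarith
    refine ⟨s, ?_, funext_of_ne hi (by simp [hs, mul_comm]) (by simp [hs1])⟩
    have := hβ.1 i₀
    rw [hs] at this
    exact Nat.pos_of_mul_pos_left this
  · rintro ⟨s, hs, rfl⟩
    have ht : Trop b w := ⟨hw, _, _, single_ne_single hi hw, h.isMin_one hi, h.isMin_zero hi hu⟩
    exact ht.smul (fun i => by simpa using ⟨hs, hw i⟩) (by simp; ring)

theorem homPart_eq_zero_iff (hi : i₀ ≠ i₁) (hw : ∀ i, 0 < w i) (hu : ∀ i, u i ≠ 0)
    (h : IsEquation b w u i₀ i₁) (v : Fin 2 → k) :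
    homPart b w (ord b w) v = 0 ↔ v i₁ ^ w i₀ * u i₀ ^ w i₁ = u i₁ ^ w i₀ * v i₀ ^ w i₁ := by
  have e1 : homPart b w (ord b w) v = homPart (MvPowerSeries.monomial (Finsupp.single i₁ (w i₀)) 1 -
      MvPowerSeries.monomial (Finsupp.single i₀ (w i₁)) (u i₁ ^ w i₀ / u i₀ ^ w i₁)) w
      (ord b w) v := by
    refine homPart_congr hw (fun d hd => ?_) v
    rw [h.ord_eq hi] at hd
    by_cases h1 : d = Finsupp.single i₁ (w i₀)
    · rw [h1, h.coeff_one, map_sub, MvPowerSeries.coeff_monomial_same,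
        MvPowerSeries.coeff_monomial_ne (single_ne_single hi hw), sub_zero]
    · by_cases h2 : d = Finsupp.single i₀ (w i₁)
      · rw [h2, h.coeff_zero, map_sub, MvPowerSeries.coeff_monomial_same,
          MvPowerSeries.coeff_monomial_ne (single_ne_single hi hw).symm, zero_sub]
      · rw [map_sub, MvPowerSeries.coeff_monomial_ne h1, MvPowerSeries.coeff_monomial_ne h2, sub_zero]
        by_contra hne
        rcases h.lt d hne with h3 | h3 | h3
        exacts [h1 h3, h2 h3, by omega]
  have e2 := homPart_monomial hw (Finsupp.single i₁ (w i₀)) (1 : k) v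
  have e3 := homPart_monomial hw (Finsupp.single i₀ (w i₁)) (u i₁ ^ w i₀ / u i₀ ^ w i₁) v
  rw [dot_single_one hi, pow_mul_pow_eq hi] at e2
  rw [dot_single_zero hi, pow_mul_pow_eq hi] at e3
  rw [e1, homPart_sub, h.ord_eq hi, e2, e3]
  have := pow_ne_zero (w i₁) (hu i₀)
  simp only [Finsupp.single_eq_same, Finsupp.single_eq_of_ne hi, Finsupp.single_eq_of_ne hi.symm,
    pow_zero, one_mul, mul_one]
  rw [sub_eq_zero, div_mul_eq_mul_div, eq_div_iff this]

end IsEquation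

/-- The shape of a branch of a non-degenerate curve: one ray, one orbit of initial
coefficients. -/
structure IsBranch (b : MvPowerSeries (Fin 2) k) (w : Fin 2 → ℕ) (u : Fin 2 → k) : Prop where
  pos : ∀ i, 0 < w i
  coprime : (w 0).Coprime (w 1)
  torus : ∀ i, u i ≠ 0
  trop_iff : ∀ β, Trop b β ↔ ∃ s, 0 < s ∧ β = s • w
  root_iff : ∀ v : Fin 2 → k, homPart b w (ord b w) v = 0 ↔
    v 1 ^ w 0 * u 0 ^ w 1 = u 1 ^ w 0 * v 0 ^ w 1

theorem IsEquation.isBranch [IsAlgClosed k] {b b' : MvPowerSeries (Fin 2) k} {w : Fin 2 → ℕ}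
    {u : Fin 2 → k} (h : IsEquation b w u 0 1) (hw : ∀ i, 0 < w i) (hcop : (w 0).Coprime (w 1))
    (hu : ∀ i, u i ≠ 0) (hb : Associated b b') : IsBranch b' w u := by
  have hi : (0 : Fin 2) ≠ 1 := by decide
  refine ⟨hw, hcop, hu, fun β => ?_, fun v => ?_⟩
  · rw [trop_congr_of_associated h.ne_zero hb, h.trop_iff hi hw hcop hu]
  · rw [homPart_eq_zero_of_associated h.ne_zero hb hw, h.homPart_eq_zero_iff hi hw hu]

/-- A root of the initial form of a non-degenerate polynomial lifts to an arc on the curve. -/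
theorem IsNewtonNondegenerate.exists_arc {f : MvPolynomial (Fin 2) k}
    (hf : IsNewtonNondegenerate f) (hf0 : f ≠ 0) {w : Fin 2 → ℕ} (hw : ∀ i, 0 < w i)
    (hcop : (w 0).Coprime (w 1)) {u : Fin 2 → k} (hu : ∀ i, u i ≠ 0)
    (h0 : homPart ↟f w (ord ↟f w) u = 0) :
    ∃ a : Fin 2 → PowerSeries k, (∀ i, X ^ w i ∣ a i) ∧
      (fun i => coeff (w i) (a i)) = u ∧ MvPolynomial.aeval a f = 0 := by
  have hi : (0 : Fin 2) ≠ 1 := by decide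
  obtain ⟨e, he⟩ := exists_det hi hw hcop
  obtain ⟨x, c, hxc⟩ := exists_chart hi he fun i => Units.mk0 (u i) (hu i)
  have hxc' : u = fun i => (x : k) ^ w i * (c : k) ^ e i := by
    funext i
    have := congrArg Units.val (hxc i)
    simpa using this
  have hdet : (w 0 : k) * e 1 - w 1 * e 0 ≠ 0 := by
    have : (w 0 : k) * e 1 = w 1 * e 0 + 1 := by exact_mod_cast congrArg (Nat.cast (R := k)) he
    rw [this, add_sub_cancel_left]
    exact one_ne_zero
  have hroot : IsChartRoot f w e (c : k) := by
    refine hf.isChartRoot hf0 hw hdet c.ne_zero ?_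
    rw [hxc', homPart_smul _ hw] at h0
    exact (mul_eq_zero.1 h0).resolve_left (pow_ne_zero _ x.ne_zero)
  let ξ : PowerSeries k := X * C (x : k)
  obtain ⟨z, hz, hz0⟩ := hroot.exists_root (ξ := ξ) (by simp [ξ])
  refine ⟨fun i => ξ ^ w i * z ^ e i, fun i => ?_, ?_, ?_⟩
  · simp only [ξ, mul_pow, mul_assoc]
    exact dvd_mul_right _ _
  · rw [hxc']
    funext i
    simp only [ξ, mul_pow, mul_assoc]
    rw [PowerSeries.coeff_X_pow_mul']
    simp [hz]
  · rw [aeval_chart, hz0, mul_zero]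

theorem coe_ne_zero {f : MvPolynomial (Fin 2) k} (hf0 : f ≠ 0) :
    ↟f ≠ 0 := by simpa using hf0

/-- The irreducible factors through a given initial root are all associated. -/
theorem IsNewtonNondegenerate.exists_equation [Infinite k] {f : MvPolynomial (Fin 2) k}
    (hf : IsNewtonNondegenerate f) (hf0 : f ≠ 0) {w : Fin 2 → ℕ} (hw : ∀ i, 0 < w i)
    (hcop : (w 0).Coprime (w 1)) {u : Fin 2 → k} (hu : ∀ i, u i ≠ 0)
    (h0 : homPart ↟f w (ord ↟f w) u = 0) :
    ∃ b₀, IsEquation b₀ w u 0 1 ∧ ∀ b, Irreducible b → b ∣ ↟f →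
      homPart b w (ord b w) u = 0 → Associated b₀ b := by
  have hi : (0 : Fin 2) ≠ 1 := by decide
  obtain ⟨a, ha, rfl, haf⟩ := hf.exists_arc hf0 hw hcop hu h0
  obtain ⟨b₀, hb₀, hb₀'⟩ := exists_isEquation hi hw hcop ha hu
  refine ⟨b₀, hb₀', ?_⟩
  rintro b hb ⟨h, hbh⟩ hroot
  have hh := hf.ne_zero_of_mul hf0 hw hu hbh hroot
  have hsub := hasSubst_of_dvd hw ha
  have h1 : (MvPowerSeries.subst a ↟f : PowerSeries k) = 0 := by
    rw [← haf]
    exact MvPowerSeries.subst_coe f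
  rw [hbh, psubst_mul hsub, mul_eq_zero] at h1
  have h2 : (MvPowerSeries.subst a b : PowerSeries k) = 0 := by
    refine h1.resolve_right fun h2 => hh ?_
    rw [← coeff_subst_eq_homPart hw ha fun d hd => ord_le w hd, h2, map_zero]
  exact ((hb.dvd_iff.1 (hb₀'.dvd hi hw hcop ha hu hb₀ h2)).resolve_left
    (hb₀'.not_isUnit hi hw)).symm

theorem ne_zero_of_dvd_coe {f : MvPolynomial (Fin 2) k} (hf0 : f ≠ 0)
    {b : MvPowerSeries (Fin 2) k} (h : b ∣ ↟f) : b ≠ 0 :=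
  ne_zero_of_dvd_ne_zero (coe_ne_zero hf0) h

theorem exists_pure_of_mul {φ ψ : MvPowerSeries (Fin 2) k} {i : Fin 2} {a : ℕ}
    (h : MvPowerSeries.coeff (Finsupp.single i a) (φ * ψ) ≠ 0) :
    ∃ c, MvPowerSeries.coeff (Finsupp.single i c) φ ≠ 0 := by
  classical
  rw [MvPowerSeries.coeff_mul] at h
  obtain ⟨⟨p, q⟩, hpq, hne⟩ := Finset.exists_ne_zero_of_sum_ne_zero h
  rw [Finset.HasAntidiagonal.mem_antidiagonal] at hpq
  refine ⟨p i, ?_⟩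
  have : p = Finsupp.single i (p i) := by
    ext j
    by_cases hj : j = i
    · subst hj; simp
    · have h1 := DFunLike.congr_fun hpq j
      simp [Finsupp.single_eq_of_ne hj] at h1
      rw [Finsupp.single_eq_of_ne hj, h1.1]
  rw [← this]
  exact left_ne_zero_of_mul hne

theorem IsNewtonPlaneCurve.ne_zero {f : MvPolynomial (Fin 2) k} (hf : IsNewtonPlaneCurve f) :
    f ≠ 0 := by
  rintro rfl
  exact hf.not_axis 0 (dvd_zero _)

theorem IsNewtonPlaneCurve.exists_pure {f : MvPolynomial (Fin 2) k} (hf : IsNewtonPlaneCurve f)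
    (i : Fin 2) :
    ∃ a, MvPowerSeries.coeff (Finsupp.single i a) ↟f ≠ 0 := by
  obtain ⟨j, hj⟩ : ∃ j : Fin 2, i ≠ j := ⟨1 - i, by fin_cases i <;> decide⟩
  by_contra! hcon
  refine hf.not_axis j (MvPolynomial.X_dvd_iff_modMonomial_eq_zero.2 ?_)
  ext d
  by_cases hd : Finsupp.single j 1 ≤ d
  · rw [MvPolynomial.coeff_modMonomial_of_le _ hd, MvPolynomial.coeff_zero]
  · rw [MvPolynomial.coeff_modMonomial_of_not_le _ hd, MvPolynomial.coeff_zero]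
    have h1 : d = Finsupp.single i (d i) := by
      rw [Finsupp.single_le_iff] at hd
      refine finsupp_ext_of_ne hj (by simp) ?_
      rw [Finsupp.single_eq_of_ne hj.symm]
      omega
    have := hcon (d i)
    rwa [← h1, MvPolynomial.coeff_coe] at this

theorem IsNewtonPlaneCurve.coeff_zero {f : MvPolynomial (Fin 2) k} (hf : IsNewtonPlaneCurve f) :
    MvPowerSeries.coeff 0 ↟f = 0 := by
  have := hf.origin
  rw [MvPolynomial.coeff_coe]
  rwa [← MvPolynomial.constantCoeff_eq, ← MvPolynomial.eval_zero]

theorem exists_trop_of_dvd {f : MvPolynomial (Fin 2) k} (hf : IsNewtonPlaneCurve f)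
    {b : MvPowerSeries (Fin 2) k} (hb : ¬ IsUnit b) (h : b ∣ ↟f) :
    ∃ β, Trop b β := by
  obtain ⟨a, rfl'⟩ := h
  obtain ⟨m, hm⟩ := hf.exists_pure 0
  obtain ⟨n, hn⟩ := hf.exists_pure 1
  rw [rfl'] at hm hn
  obtain ⟨m, hm⟩ := exists_pure_of_mul hm
  obtain ⟨n, hn⟩ := exists_pure_of_mul hn
  refine exists_trop (i₀ := 0) (i₁ := 1) (by decide) ?_ hn hm
  by_contra h0
  exact hb (MvPowerSeries.isUnit_iff_constantCoeff.2 (IsUnit.mk0 _ (by simpa using h0)))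

/-- An irreducible factor of a non-degenerate polynomial has a primitive ray, on which it has a
root. -/
theorem IsNewtonPlaneCurve.exists_root [IsAlgClosed k] {f : MvPolynomial (Fin 2) k}
    (hf : IsNewtonPlaneCurve f) {b : MvPowerSeries (Fin 2) k} (hb : ¬ IsUnit b)
    (h : b ∣ ↟f) :
    ∃ w u, (∀ i, 0 < w i) ∧ (w 0).Coprime (w 1) ∧ (∀ i, u i ≠ 0) ∧
      homPart b w (ord b w) u = 0 := by
  obtain ⟨β, hβ⟩ := exists_trop_of_dvd hf hb h
  obtain ⟨s, w, hs, hw, hcop, rfl⟩ := exists_primitive hβ.1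
  obtain ⟨u, hu, h0⟩ := exists_homPart_eq_zero (hβ.smul hw (by simp; ring))
  exact ⟨w, u, hw, hcop, hu, h0⟩

theorem homPart_eq_zero_of_dvd {φ ψ : MvPowerSeries (Fin 2) k} (hψ : ψ ≠ 0) (h : φ ∣ ψ)
    {w : Fin 2 → ℕ} (hw : ∀ i, 0 < w i) {u : Fin 2 → k} (h0 : homPart φ w (ord φ w) u = 0) :
    homPart ψ w (ord ψ w) u = 0 := by
  obtain ⟨χ, rfl⟩ := h
  rw [homPart_ord_mul hw (left_ne_zero_of_mul hψ) (right_ne_zero_of_mul hψ), h0, zero_mul]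

theorem IsNewtonPlaneCurve.exists_isBranch [IsAlgClosed k] {f : MvPolynomial (Fin 2) k}
    (hf : IsNewtonPlaneCurve f) {b : MvPowerSeries (Fin 2) k} (hb : Irreducible b)
    (h : b ∣ ↟f) : ∃ w u, IsBranch b w u := by
  obtain ⟨w, u, hw, hcop, hu, h0⟩ := hf.exists_root hb.not_isUnit h
  obtain ⟨b₀, h1, h2⟩ := hf.nondegenerate.exists_equation hf.ne_zero hw hcop hu
    (homPart_eq_zero_of_dvd (coe_ne_zero hf.ne_zero) h hw h0)
  exact ⟨w, u, h1.isBranch hw hcop hu (h2 b hb h h0)⟩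

theorem one_le_ord_of_not_isUnit {φ : MvPowerSeries (Fin 2) k} (h0 : φ ≠ 0) (h : ¬ IsUnit φ) :
    1 ≤ ord φ 1 := by
  refine le_ord h0 fun d hd => ?_
  by_contra hc
  have : d = 0 := by
    simp only [dot, Pi.one_apply, one_mul] at hc
    exact finsupp_ext_of_ne (i₀ := 0) (i₁ := 1) (by decide) (by simp; omega) (by simp; omega)
  rw [this] at hd
  exact h (MvPowerSeries.isUnit_iff_constantCoeff.2 (IsUnit.mk0 _ (by simpa using hd)))

theorem exists_multiset_irreducible (n : ℕ) : ∀ φ : MvPowerSeries (Fin 2) k, φ ≠ 0 → ord φ 1 ≤ n →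
    ∃ s : Multiset (MvPowerSeries (Fin 2) k), (∀ b ∈ s, Irreducible b) ∧ Associated φ s.prod := by
  induction n with
  | zero =>
    intro φ h0 hn
    have : IsUnit φ := by
      by_contra h
      have := one_le_ord_of_not_isUnit h0 h
      omega
    exact ⟨0, by simp, by simpa using associated_one_iff_isUnit.2 this⟩
  | succ n ih =>
    intro φ h0 hn
    by_cases hu : IsUnit φ
    · exact ⟨0, by simp, by simpa using associated_one_iff_isUnit.2 hu⟩
    by_cases hirr : Irreducible φ
    · exact ⟨{φ}, by simpa using hirr, by simp⟩
    rw [irreducible_iff] at hirr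
    push Not at hirr
    obtain ⟨a, b, rfl, ha, hb⟩ := hirr hu
    have ha0 := left_ne_zero_of_mul h0
    have hb0 := right_ne_zero_of_mul h0
    have h1 := one_le_ord_of_not_isUnit ha0 ha
    have h2 := one_le_ord_of_not_isUnit hb0 hb
    rw [ord_mul ha0 hb0] at hn
    obtain ⟨s, hs, hs'⟩ := ih a ha0 (by omega)
    obtain ⟨t, ht, ht'⟩ := ih b hb0 (by omega)
    refine ⟨s + t, fun c hc => (Multiset.mem_add.1 hc).elim (hs c) (ht c), ?_⟩
    rw [Multiset.prod_add]
    exact hs'.mul_mul ht'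

theorem IsNewtonPlaneCurve.not_associated_of_mul_dvd [IsAlgClosed k] {f : MvPolynomial (Fin 2) k}
    (hf : IsNewtonPlaneCurve f) {b c : MvPowerSeries (Fin 2) k} (hb : Irreducible b)
    (h : b * c ∣ ↟f) : ¬ Associated b c := by
  intro hbc
  obtain ⟨w, u, hw, hcop, hu, h0⟩ := hf.exists_root hb.not_isUnit (dvd_of_mul_right_dvd h)
  obtain ⟨χ, hχ⟩ := h
  rw [mul_assoc] at hχ
  refine hf.nondegenerate.ne_zero_of_mul hf.ne_zero hw hu hχ h0 ?_
  have hne : b * (c * χ) ≠ 0 := by rw [← hχ]; exact coe_ne_zero hf.ne_zero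
  exact homPart_eq_zero_of_dvd (right_ne_zero_of_mul hne) (hbc.dvd.mul_right χ) hw h0

/-- `b` is the family of branches of `f`. -/
structure IsFactorization (f : MvPolynomial (Fin 2) k) {r : ℕ}
    (b : Fin r → MvPowerSeries (Fin 2) k) : Prop where
  irreducible : ∀ i, Irreducible (b i)
  pairwise : Pairwise fun i j => ¬ Associated (b i) (b j)
  associated : Associated ↟f (∏ i, b i)

theorem IsNewtonPlaneCurve.exists_factorization [IsAlgClosed k] {f : MvPolynomial (Fin 2) k}
    (hf : IsNewtonPlaneCurve f) :
    ∃ (r : ℕ) (b : Fin r → MvPowerSeries (Fin 2) k), IsFactorization f b := by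
  obtain ⟨s, hs, hfs⟩ := exists_multiset_irreducible _ ↟f
    (coe_ne_zero hf.ne_zero) le_rfl
  obtain ⟨l, rfl⟩ := Quot.exists_rep s
  have hprod : ∏ i : Fin l.length, l.get i = l.prod := by
    rw [← List.prod_ofFn, List.ofFn_get]
  have hfs' : Associated ↟f (∏ i, l.get i) := by
    rw [hprod]; simpa using hfs
  refine ⟨l.length, l.get, fun i => hs _ (by simp), fun i j hij => ?_, hfs'⟩
  refine hf.not_associated_of_mul_dvd (hs _ (by simp)) (dvd_trans ?_ hfs'.symm.dvd)
  rw [← Finset.mul_prod_erase Finset.univ l.get (Finset.mem_univ i)]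
  exact mul_dvd_mul_left _ (Finset.dvd_prod_of_mem _ (by simp [hij.symm]))

namespace IsFactorization

variable {f : MvPolynomial (Fin 2) k} {r : ℕ} {b : Fin r → MvPowerSeries (Fin 2) k}

theorem dvd (h : IsFactorization f b) (i : Fin r) : b i ∣ ↟f :=
  (Finset.dvd_prod_of_mem b (Finset.mem_univ i)).trans h.associated.symm.dvd

theorem mul_dvd (h : IsFactorization f b) {i j : Fin r} (hij : i ≠ j) :
    b i * b j ∣ ↟f := by
  refine dvd_trans ?_ h.associated.symm.dvd
  rw [← Finset.mul_prod_erase Finset.univ b (Finset.mem_univ i)]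
  exact mul_dvd_mul_left _ (Finset.dvd_prod_of_mem _ (by simp [hij.symm]))

theorem exists_root (hf : IsNewtonPlaneCurve f) (h : IsFactorization f b) {w : Fin 2 → ℕ}
    (hw : ∀ i, 0 < w i) {u : Fin 2 → k}
    (h0 : homPart ↟f w (ord ↟f w) u = 0) :
    ∃ i, homPart (b i) w (ord (b i) w) u = 0 := by
  rw [← homPart_eq_zero_of_associated (coe_ne_zero hf.ne_zero) h.associated hw] at h0
  have key : ∀ s : Finset (Fin r), homPart (∏ i ∈ s, b i) w (ord (∏ i ∈ s, b i) w) u = 0 →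
      ∃ i, homPart (b i) w (ord (b i) w) u = 0 := by
    classical
    intro s
    induction s using Finset.induction_on with
    | empty => exact fun hs => absurd hs (homPart_unit (by simp) hw u)
    | insert i s hi ih =>
      intro hs
      rw [Finset.prod_insert hi, homPart_ord_mul hw (h.irreducible i).ne_zero
        (Finset.prod_ne_zero_iff.2 fun j _ => (h.irreducible j).ne_zero), mul_eq_zero] at hs
      exact hs.elim (fun hs => ⟨i, hs⟩) ih
  exact key _ h0

theorem root_unique [IsAlgClosed k] (hf : IsNewtonPlaneCurve f) (h : IsFactorization f b)
    {w : Fin 2 → ℕ} (hw : ∀ i, 0 < w i) {u : Fin 2 → k} (hu : ∀ i, u i ≠ 0) {i j : Fin r}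
    (hi : homPart (b i) w (ord (b i) w) u = 0) (hj : homPart (b j) w (ord (b j) w) u = 0) :
    i = j := by
  by_contra hij
  obtain ⟨χ, hχ⟩ := h.mul_dvd hij
  rw [mul_assoc] at hχ
  refine hf.nondegenerate.ne_zero_of_mul hf.ne_zero hw hu hχ hi ?_
  have hne : b i * (b j * χ) ≠ 0 := by rw [← hχ]; exact coe_ne_zero hf.ne_zero
  exact homPart_eq_zero_of_dvd (right_ne_zero_of_mul hne) (dvd_mul_right _ _) hw hj

theorem trop_iff [IsAlgClosed k] (hf : IsNewtonPlaneCurve f) (h : IsFactorization f b)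
    (w : Fin 2 → ℕ) : Trop ↟f w ↔ ∃ i, Trop (b i) w := by
  constructor
  · intro ht
    obtain ⟨u, hu, h0⟩ := exists_homPart_eq_zero ht
    obtain ⟨i, hi⟩ := h.exists_root hf ht.1 h0
    exact ⟨i, trop_of_homPart_eq_zero (h.irreducible i).ne_zero ht.1 hu hi⟩
  · rintro ⟨i, ht⟩
    obtain ⟨χ, hχ⟩ := h.dvd i
    have hne : b i * χ ≠ 0 := by rw [← hχ]; exact coe_ne_zero hf.ne_zero
    rw [hχ, trop_mul (left_ne_zero_of_mul hne) (right_ne_zero_of_mul hne)]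
    exact Or.inl ht

theorem exists_associated [IsAlgClosed k] (hf : IsNewtonPlaneCurve f) (h : IsFactorization f b)
    {c : MvPowerSeries (Fin 2) k} (hc : Irreducible c) (hcf : c ∣ ↟f) :
    ∃ i, Associated (b i) c := by
  obtain ⟨w, u, hw, hcop, hu, h0⟩ := hf.exists_root hc.not_isUnit hcf
  have h1 := homPart_eq_zero_of_dvd (coe_ne_zero hf.ne_zero) hcf hw h0
  obtain ⟨b₀, -, h2⟩ := hf.nondegenerate.exists_equation hf.ne_zero hw hcop hu h1
  obtain ⟨i, hi⟩ := h.exists_root hf hw h1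
  exact ⟨i, (h2 _ (h.irreducible i) (h.dvd i) hi).symm.trans (h2 c hc hcf h0)⟩

theorem branchCount_eq [IsAlgClosed k] (hf : IsNewtonPlaneCurve f) (h : IsFactorization f b)
    (α : ℕ × ℕ) : branchCount f α = Set.ncard {i | α ∈ trop (b i)} := by
  rw [branchCount, ← Set.ncard_image_of_injective (f := fun i => Associates.mk (b i))]
  · congr 1
    ext B
    constructor
    · rintro ⟨c, hc, hcf, hα, rfl⟩
      obtain ⟨i, hi⟩ := h.exists_associated hf hc hcf
      refine ⟨i, ?_, Associates.mk_eq_mk_iff_associated.2 hi⟩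
      rw [mem_trop_iff, trop_congr_of_associated (h.irreducible i).ne_zero hi] at hα
      exact mem_trop_iff.2 hα
    · rintro ⟨i, hi, rfl⟩
      exact ⟨b i, h.irreducible i, h.dvd i, hi, rfl⟩
  · intro i j hij
    by_contra hne
    exact h.pairwise hne (Associates.mk_eq_mk_iff_associated.1 hij)

end IsFactorization

end Branches

end

section

section JetBasics

variable {k : Type u} [Field k] {m : ℕ}

theorem coeff_jetSeries (P : JetSpace k m) (i : Fin 2) (j : ℕ) :
    coeff j (jetSeries P i) = if h : j < m + 1 then P (i, ⟨j, h⟩) else 0 := by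
  rw [jetSeries, PowerSeries.coeff_mk]

theorem coeff_jetSeries_fin (P : JetSpace k m) (i : Fin 2) (j : Fin (m + 1)) :
    coeff (j : ℕ) (jetSeries P i) = P (i, j) := by
  rw [coeff_jetSeries, dif_pos j.2]

theorem mem_hyp_iff {α : ℕ × ℕ} {P : JetSpace k m} :
    P ∈ hyp α m ↔ ∀ i, X ^ vec α i ∣ jetSeries P i := by
  simp only [PowerSeries.X_pow_dvd_iff]
  rw [forall_iff_of_ne (i₀ := 0) (i₁ := 1) (by decide)]
  rfl

theorem mem_hyp_iff_forall {α : ℕ × ℕ} {P : JetSpace k m} :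
    P ∈ hyp α m ↔ ∀ c : Fin 2 × Fin (m + 1), (c.2 : ℕ) < vec α c.1 → P c = 0 := by
  rw [mem_hyp_iff]
  constructor
  · rintro h ⟨i, j⟩ hj
    rw [← coeff_jetSeries_fin P i j]
    exact PowerSeries.X_pow_dvd_iff.1 (h i) j hj
  · intro h i
    rw [PowerSeries.X_pow_dvd_iff]
    intro j hj
    rw [coeff_jetSeries]
    split_ifs with hjm
    · exact h (i, ⟨j, hjm⟩) hj
    · rfl

theorem mem_jetsAtOrigin_iff {f : MvPolynomial (Fin 2) k} {P : JetSpace k m} :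
    P ∈ jetsAtOrigin f m ↔ (∀ i, X ∣ jetSeries P i) ∧
      X ^ (m + 1) ∣ (MvPolynomial.aeval (jetSeries P) f : PowerSeries k) := by
  rw [PowerSeries.X_pow_dvd_iff]
  simp only [PowerSeries.X_dvd_iff, ← PowerSeries.coeff_zero_eq_constantCoeff_apply, Nat.lt_succ_iff]
  rfl

/-- The jets of order `α` with `f ≡ 0` modulo `t ^ n` and initial coefficients on the
branch `b` of `f`. -/
def onBranch (f : MvPolynomial (Fin 2) k) (b : MvPowerSeries (Fin 2) k) (α : ℕ × ℕ) (n m : ℕ) :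
    Set (JetSpace k m) :=
  {P | (∀ i, X ^ vec α i ∣ jetSeries P i) ∧
    (∀ i, coeff (vec α i) (jetSeries P i) ≠ 0) ∧
    homPart b (vec α) (ord b (vec α)) (fun i => coeff (vec α i) (jetSeries P i)) = 0 ∧
    X ^ n ∣ (MvPolynomial.aeval (jetSeries P) f : PowerSeries k)}

theorem contact_eq_onBranch [Infinite k] {f : MvPolynomial (Fin 2) k}
    (hf : IsNewtonPlaneCurve f) {b : MvPowerSeries (Fin 2) k}
    (hbf : b ∣ ↟f) {α : ℕ × ℕ} (hα : ∀ i, 0 < vec α i)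
    (hm : ord ↟f (vec α) ≤ m) :
    contact b α (nu b α + m - nu ↟f α) m = onBranch f b α (m + 1) m := by
  obtain ⟨h, hbh⟩ := hbf
  have hne : b * h ≠ 0 := by rw [← hbh]; exact coe_ne_zero hf.ne_zero
  have hb0 := left_ne_zero_of_mul hne
  have hh0 := right_ne_zero_of_mul hne
  have hord := ord_mul hb0 hh0 (vec α)
  rw [← hbh] at hord
  rw [nu_eq_ord, nu_eq_ord]
  set ν := ord ↟f (vec α) with hν
  ext P
  have hc : (coeff α.1 (jetSeries P 0) ≠ 0 ∧ coeff α.2 (jetSeries P 1) ≠ 0) ↔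
      ∀ i, coeff (vec α i) (jetSeries P i) ≠ 0 := by
    rw [forall_iff_of_ne (i₀ := 0) (i₁ := 1) (by decide)]
    rfl
  have hd : (∀ j ≤ ord b (vec α) + m - ν, coeff j
      (MvPowerSeries.subst (jetSeries P) b : PowerSeries k) = 0) ↔
      X ^ (ord b (vec α) + m - ν + 1) ∣
        (MvPowerSeries.subst (jetSeries P) b : PowerSeries k) := by
    rw [PowerSeries.X_pow_dvd_iff]
    simp only [Nat.lt_succ_iff]
  change (P ∈ hyp α m ∧ _ ∧ _ ∧ _) ↔ _
  rw [← and_assoc (a := coeff α.1 (jetSeries P 0) ≠ 0), hc, hd, mem_hyp_iff]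
  refine and_congr_right fun hx => and_congr_right fun hu => ?_
  have hsub := hasSubst_of_dvd hα hx
  have hfa : (MvPolynomial.aeval (jetSeries P) f : PowerSeries k) =
      (MvPowerSeries.subst (jetSeries P) b : PowerSeries k) *
        (MvPowerSeries.subst (jetSeries P) h : PowerSeries k) := by
    rw [← psubst_mul hsub, ← hbh]
    exact (MvPowerSeries.subst_coe f).symm
  obtain ⟨y, hy⟩ := X_pow_dvd_subst hα hx (φ := h) (n := ord h (vec α)) fun d hd => ord_le _ hd
  have hyc : constantCoeff y = homPart h (vec α) (ord h (vec α))
      (fun i => coeff (vec α i) (jetSeries P i)) := by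
    rw [← coeff_subst_eq_homPart hα hx fun d hd => ord_le _ hd, hy,
      PowerSeries.coeff_X_pow_mul', if_pos le_rfl, Nat.sub_self,
      PowerSeries.coeff_zero_eq_constantCoeff_apply]
  rw [hfa, hy]
  constructor
  · intro hdvd
    refine ⟨?_, ?_⟩
    · rw [← coeff_subst_eq_homPart hα hx fun d hd => ord_le _ hd]
      exact PowerSeries.X_pow_dvd_iff.1 hdvd _ (by omega)
    · have := mul_dvd_mul hdvd (dvd_mul_right (X ^ ord h (vec α)) y)
      rw [← pow_add, show ord b (vec α) + m - ν + 1 + ord h (vec α) = m + 1 by omega] at this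
      exact this
  · rintro ⟨hroot, hdvd⟩
    have hunit : IsUnit y := by
      rw [PowerSeries.isUnit_iff_constantCoeff, hyc]
      exact IsUnit.mk0 _ (hf.nondegenerate.ne_zero_of_mul hf.ne_zero hα hu hbh hroot)
    rw [← mul_assoc, hunit.dvd_mul_right, mul_comm,
      show m + 1 = ord h (vec α) + (ord b (vec α) + m - ν + 1) by omega, pow_add] at hdvd
    exact (mul_dvd_mul_iff_left (pow_ne_zero _ PowerSeries.X_ne_zero)).1 hdvd

end JetBasics

section Quotient

variable {R : Type u} [CommRing R]

/-- Reduction of power series modulo `X ^ M`. -/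
noncomputable abbrev modX (R : Type u) [CommRing R] (M : ℕ) :
    PowerSeries R →+* PowerSeries R ⧸ Ideal.span {(X : PowerSeries R) ^ M} :=
  Ideal.Quotient.mk _

theorem modX_eq_iff {M : ℕ} {a b : PowerSeries R} :
    modX R M a = modX R M b ↔ X ^ M ∣ a - b := by
  rw [Ideal.Quotient.mk_eq_mk_iff_sub_mem, Ideal.mem_span_singleton]

theorem modX_eq_iff_coeff {M : ℕ} {a b : PowerSeries R} :
    modX R M a = modX R M b ↔ ∀ j < M, coeff j a = coeff j b := by
  rw [modX_eq_iff, PowerSeries.X_pow_dvd_iff]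
  simp only [map_sub, sub_eq_zero]

theorem modX_eq_zero_iff {M : ℕ} {a : PowerSeries R} :
    modX R M a = 0 ↔ X ^ M ∣ a := by
  rw [Ideal.Quotient.eq_zero_iff_mem, Ideal.mem_span_singleton]

theorem constantCoeff_eq_of_modX {M : ℕ} (hM : 0 < M) {a b : PowerSeries R}
    (h : modX R M a = modX R M b) :
    constantCoeff a = constantCoeff b := by
  simpa using modX_eq_iff_coeff.1 h 0 hM

end Quotient

section ChartJets

variable {k : Type u} [Field k]

theorem eval_strict {R : Type u} [CommRing R] [Algebra k R] (f : MvPolynomial (Fin 2) k)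
    (w e : Fin 2 → ℕ) (ξ z : PowerSeries R) :
    (strict f w e ξ).eval z = ∑ d ∈ f.support, algebraMap k (PowerSeries R) (f.coeff d) *
      ξ ^ (dot w d - ord ↟f w) * z ^ dot e d := by
  rw [strict, Polynomial.eval_finsetSum]
  simp

theorem modX_eval_strict {R : Type u} [CommRing R] [Algebra k R] (f : MvPolynomial (Fin 2) k)
    (w e : Fin 2 → ℕ) {M : ℕ} {ξ ξ' : PowerSeries R} (h : modX R M ξ = modX R M ξ')
    (z : PowerSeries R) :
    modX R M ((strict f w e ξ).eval z) = modX R M ((strict f w e ξ').eval z) := by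
  rw [eval_strict, eval_strict, map_sum, map_sum]
  refine Finset.sum_congr rfl fun d _ => ?_
  rw [map_mul, map_mul, map_pow, map_mul, map_mul, map_pow, map_pow, h]

theorem map_eval_strict {R S : Type u} [CommRing R] [Algebra k R] [CommRing S] [Algebra k S]
    (f : MvPolynomial (Fin 2) k) (w e : Fin 2 → ℕ) (φ : R →ₐ[k] S) (ξ z : PowerSeries R) :
    PowerSeries.map (φ : R →+* S) ((strict f w e ξ).eval z) =
      (strict f w e (PowerSeries.map (φ : R →+* S) ξ)).eval (PowerSeries.map (φ : R →+* S) z) := by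
  rw [eval_strict, eval_strict, map_sum]
  refine Finset.sum_congr rfl fun d _ => ?_
  simp only [map_mul, map_pow, PowerSeries.algebraMap_apply, PowerSeries.map_C]
  simp

variable {f : MvPolynomial (Fin 2) k} {w e : Fin 2 → ℕ} {c : k} {i₀ i₁ : Fin 2}

/-- The condition for a jet given in chart coordinates to lie on the curve. -/
theorem IsChartRoot.dvd_aeval_iff (h : IsChartRoot f w e c) {s n M : ℕ} (hs : 0 < s)
    (hM : n = s * ord ↟f w + M)
    {ξ ξ' z z' : PowerSeries k} (hξ' : constantCoeff ξ' ≠ 0)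
    (hξ : modX k M ξ' = modX k M ξ) (hz : constantCoeff z = c)
    (hz' : constantCoeff z' = c)
    (h0 : (strict f w e (X ^ s * ξ)).eval z = 0) :
    X ^ n ∣ (MvPolynomial.aeval
      (fun i => (X ^ s * ξ') ^ w i * z' ^ e i) f : PowerSeries k) ↔
      modX k M z' = modX k M z := by
  have hu : IsUnit (ξ' ^ ord ↟f w) :=
    (PowerSeries.isUnit_iff_constantCoeff.2 (IsUnit.mk0 _ hξ')).pow _
  rw [aeval_chart, hM, pow_add, mul_pow, ← pow_mul, mul_assoc,
    mul_dvd_mul_iff_left (pow_ne_zero _ PowerSeries.X_ne_zero), hu.dvd_mul_left,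
    ← modX_eq_zero_iff, modX_eval_strict f w e (show modX k M (X ^ s * ξ') =
      modX k M (X ^ s * ξ) by rw [map_mul, map_mul, hξ]), modX_eq_zero_iff,
    h.dvd_eval_iff (by simp [hs.ne']) hz hz' h0, modX_eq_iff]

/-- Power series with nonzero constant coefficients in chart coordinates. -/
theorem exists_chart_series (hi : i₀ ≠ i₁) (hdet : w i₀ * e i₁ = w i₁ * e i₀ + 1)
    {V : Fin 2 → PowerSeries k} (hV : ∀ i, constantCoeff (V i) ≠ 0) :
    ∃ ξ ζ : PowerSeries k, constantCoeff ξ ≠ 0 ∧ constantCoeff ζ ≠ 0 ∧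
      ∀ i, V i = ξ ^ w i * ζ ^ e i := by
  have hu : ∀ i, IsUnit (V i) := fun i =>
    PowerSeries.isUnit_iff_constantCoeff.2 (IsUnit.mk0 _ (hV i))
  obtain ⟨x, z, hxz⟩ := exists_chart hi hdet fun i => (hu i).unit
  refine ⟨x, z, ?_, ?_, fun i => ?_⟩
  · exact (PowerSeries.isUnit_iff_constantCoeff.1 x.isUnit).ne_zero
  · exact (PowerSeries.isUnit_iff_constantCoeff.1 z.isUnit).ne_zero
  · have := congrArg Units.val (hxz i)
    simpa using this

theorem modX_chart (hdet : w i₀ * e i₁ = w i₁ * e i₀ + 1) {M : ℕ} {ξ ζ ξ' ζ' : PowerSeries k}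
    (hξ : constantCoeff ξ ≠ 0) (hζ : constantCoeff ζ ≠ 0)
    (h : ∀ i, modX k M (ξ' ^ w i * ζ' ^ e i) = modX k M (ξ ^ w i * ζ ^ e i)) :
    modX k M ξ' = modX k M ξ ∧ modX k M ζ' = modX k M ζ := by
  set π := modX k M with hπ
  have hu : ∀ i, IsUnit (π (ξ ^ w i * ζ ^ e i)) := fun i => by
    refine IsUnit.map _ (IsUnit.mul (IsUnit.pow _ ?_) (IsUnit.pow _ ?_)) <;>
      rw [PowerSeries.isUnit_iff_constantCoeff] <;> exact IsUnit.mk0 _ ‹_›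
  have h1 := chart_eq hdet (v := fun i => π (ξ ^ w i * ζ ^ e i)) (ξ := π ξ) (ζ := π ζ)
    fun i => by rw [map_mul, map_pow, map_pow]
  have h2 := chart_eq hdet (v := fun i => π (ξ ^ w i * ζ ^ e i)) (ξ := π ξ') (ζ := π ζ')
    fun i => by rw [← h, map_mul, map_pow, map_pow]
  exact ⟨((hu i₁).pow _).mul_right_cancel (h2.1.symm.trans h1.1),
    ((hu i₀).pow _).mul_right_cancel (h2.2.symm.trans h1.2)⟩

theorem modX_chart_congr {M : ℕ} {ξ ζ ξ' ζ' : PowerSeries k} (hξ : modX k M ξ' = modX k M ξ)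
    (hζ : modX k M ζ' = modX k M ζ) (i : Fin 2) :
    modX k M (ξ' ^ w i * ζ' ^ e i) = modX k M (ξ ^ w i * ζ ^ e i) := by
  rw [map_mul, map_mul, map_pow, map_pow, map_pow, map_pow, hξ, hζ]

end ChartJets

end

section

section ChartSet

variable {k : Type u} [Field k]

/-- The jets on `f` that are given by series `ξ`, `ζ` in a chart, where `ζ` starts with `c`. -/
def chartSet (f : MvPolynomial (Fin 2) k) (w e : Fin 2 → ℕ) (c : k) (s n m : ℕ) :
    Set (JetSpace k m) :=
  {P | (∃ ξ ζ : PowerSeries k, constantCoeff ξ ≠ 0 ∧ constantCoeff ζ = c ∧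
    ∀ i, jetSeries P i = (X ^ s * ξ) ^ w i * ζ ^ e i) ∧
    X ^ n ∣ (MvPolynomial.aeval (jetSeries P) f : PowerSeries k)}

theorem IsBranch.root_iff_of_ne {b : MvPowerSeries (Fin 2) k} {w : Fin 2 → ℕ} {u : Fin 2 → k}
    (h : IsBranch b w u) {i₀ i₁ : Fin 2} (hi : i₀ ≠ i₁) (v : Fin 2 → k) :
    homPart b w (ord b w) v = 0 ↔ v i₁ ^ w i₀ * u i₀ ^ w i₁ = u i₁ ^ w i₀ * v i₀ ^ w i₁ := by
  rw [h.root_iff]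
  fin_cases i₀ <;> fin_cases i₁
  · exact absurd rfl hi
  · rfl
  · change _ ↔ v 0 ^ w 1 * u 1 ^ w 0 = u 0 ^ w 1 * v 1 ^ w 0
    rw [eq_comm, mul_comm (u 1 ^ w 0), mul_comm (u 0 ^ w 1)]
  · exact absurd rfl hi

/-- Chart coordinates of the root of a branch. -/
theorem IsBranch.exists_chart_root {b : MvPowerSeries (Fin 2) k} {w : Fin 2 → ℕ} {u : Fin 2 → k}
    (h : IsBranch b w u) {i₀ i₁ : Fin 2} (hi : i₀ ≠ i₁) {e : Fin 2 → ℕ}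
    (hdet : w i₀ * e i₁ = w i₁ * e i₀ + 1) :
    ∃ c : k, c ≠ 0 ∧ ∀ x z : k, x ≠ 0 → z ≠ 0 →
      (homPart b w (ord b w) (fun i => x ^ w i * z ^ e i) = 0 ↔ z = c) := by
  obtain ⟨x₀, c, hxc⟩ := exists_chart hi hdet fun i => Units.mk0 (u i) (h.torus i)
  have hu : ∀ i, u i = (x₀ : k) ^ w i * (c : k) ^ e i := by
    intro i
    have := congrArg Units.val (hxc i)
    simpa using this
  refine ⟨c, c.ne_zero, fun x z hx hz => ?_⟩
  have hk := chart_eq hdet (v := fun i => x ^ w i * z ^ e i) (ξ := x) (ζ := z) fun _ => rfl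
  have hk' := chart_eq hdet hu
  rw [h.root_iff_of_ne hi]
  rw [hk.2, hk'.2]
  have h1 : (x ^ w i₀ * z ^ e i₀) ^ w i₁ * u i₀ ^ w i₁ ≠ 0 :=
    mul_ne_zero (pow_ne_zero _ (mul_ne_zero (pow_ne_zero _ hx) (pow_ne_zero _ hz)))
      (pow_ne_zero _ (h.torus _))
  constructor
  · intro he
    refine mul_right_cancel₀ h1 ?_
    linear_combination he
  · rintro rfl
    ring

theorem coeff_pow_of_X_pow_dvd {a V : PowerSeries k} {n : ℕ} (h : a = X ^ n * V) :
    coeff n a = constantCoeff V := by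
  rw [h, PowerSeries.coeff_X_pow_mul', if_pos le_rfl, Nat.sub_self,
    PowerSeries.coeff_zero_eq_constantCoeff_apply]

theorem vec_eta (w : Fin 2 → ℕ) : vec (w 0, w 1) = w := by
  funext i
  fin_cases i <;> rfl

theorem onBranch_eq_chartSet {f : MvPolynomial (Fin 2) k} {b : MvPowerSeries (Fin 2) k}
    (hb0 : b ≠ 0) {w : Fin 2 → ℕ} {u : Fin 2 → k} (h : IsBranch b w u) {i₀ i₁ : Fin 2}
    (hi : i₀ ≠ i₁) {e : Fin 2 → ℕ} (hdet : w i₀ * e i₁ = w i₁ * e i₀ + 1) {c : k} (hc : c ≠ 0)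
    (hroot : ∀ x z : k, x ≠ 0 → z ≠ 0 →
      (homPart b w (ord b w) (fun i => x ^ w i * z ^ e i) = 0 ↔ z = c)) {s n m : ℕ} (hs : 0 < s)
    {α : ℕ × ℕ} (hα : vec α = s • w) : onBranch f b α n m = chartSet f w e c s n m := by
  have hv : ∀ i, vec α i = s * w i := fun i => by rw [hα]; simp
  have hhom : ∀ v, homPart b (vec α) (ord b (vec α)) v = homPart b w (ord b w) v := fun v => by
    rw [hα, ord_smul hb0, homPart_smul_weight b h.pos hs]
  ext P
  constructor
  · rintro ⟨h1, h2, h3, h4⟩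
    refine ⟨?_, h4⟩
    choose V hV using h1
    have hV' := fun i => coeff_pow_of_X_pow_dvd (hV i)
    obtain ⟨ξ, ζ, hξ, hζ, hξζ⟩ := exists_chart_series hi hdet (V := V) fun i => by
      rw [← hV']; exact h2 i
    refine ⟨ξ, ζ, hξ, ?_, fun i => ?_⟩
    · rw [hhom] at h3
      refine (hroot _ _ hξ hζ).1 ?_
      rw [← h3]
      congr 1
      funext i
      rw [hV', hξζ]
      simp
    · rw [hV, hξζ, hv, mul_pow, ← pow_mul]
      ring
  · rintro ⟨⟨ξ, ζ, hξ, hζ, h1⟩, h2⟩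
    have hV : ∀ i, jetSeries P i = X ^ vec α i * (ξ ^ w i * ζ ^ e i) := fun i => by
      rw [h1, hv, mul_pow, ← pow_mul]
      ring
    have hV' := fun i => coeff_pow_of_X_pow_dvd (hV i)
    refine ⟨fun i => ⟨_, hV i⟩, fun i => ?_, ?_, h2⟩
    · rw [hV']
      simp [hξ, hζ, hc]
    · rw [hhom, ← (hroot _ _ hξ hc).2 rfl]
      congr 1
      funext i
      rw [hV']
      simp [hζ]

variable (w : Fin 2 → ℕ) (s m M : ℕ)

/-- The parameters for the jets on a branch: the first coefficients of `ξ`, and the coefficients of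
the jet that are not constrained. -/
abbrev ChartIdx : Type := Fin M ⊕ {p : Fin 2 × Fin (m + 1) // s * w p.1 + M ≤ p.2}

/-- The generic series `ξ`. -/
noncomputable def genSeries (k : Type u) [Field k] :
    PowerSeries (MvPolynomial (ChartIdx w s m M) k) :=
  PowerSeries.mk fun l => if h : l < M then MvPolynomial.X (Sum.inl ⟨l, h⟩) else 0

variable {w s m M}

/-- The generic jet on a branch, given by the coordinate `z` on the chart. -/
noncomputable def genJet (e : Fin 2 → ℕ) (z : PowerSeries (MvPolynomial (ChartIdx w s m M) k))
    (p : Fin 2 × Fin (m + 1)) : MvPolynomial (ChartIdx w s m M) k :=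
  if h : s * w p.1 + M ≤ p.2 then MvPolynomial.X (Sum.inr ⟨p, h⟩)
  else if s * w p.1 ≤ p.2 then
    coeff (p.2 - s * w p.1) (genSeries w s m M k ^ w p.1 * z ^ e p.1)
  else 0

theorem exists_eq_shift {P : JetSpace k m} {n : ℕ} {i : Fin 2} {A : PowerSeries k}
    (hM : n + M ≤ m + 1)
    (h : ∀ j : Fin (m + 1), (j : ℕ) < n + M → P (i, j) =
      if n ≤ (j : ℕ) then coeff (j - n) A else 0) :
    ∃ V : PowerSeries k, jetSeries P i = X ^ n * V ∧ modX k M V = modX k M A := by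
  have h1 : X ^ n ∣ jetSeries P i := by
    rw [PowerSeries.X_pow_dvd_iff]
    intro j hj
    rw [coeff_jetSeries, dif_pos (by omega), h _ (by simp; omega), if_neg (by simp; omega)]
  obtain ⟨V, hV⟩ := h1
  refine ⟨V, hV, modX_eq_iff_coeff.2 fun j hj => ?_⟩
  have h2 : coeff (n + j) (jetSeries P i) = coeff j V := by
    rw [hV, PowerSeries.coeff_X_pow_mul', if_pos (by omega), Nat.add_sub_cancel_left]
  rw [← h2, coeff_jetSeries, dif_pos (by omega), h _ (by simp; omega), if_pos (by simp)]
  simp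

variable {f : MvPolynomial (Fin 2) k} {e : Fin 2 → ℕ} {c : k} {i₀ i₁ : Fin 2}

theorem eval_genJet (a : ChartIdx w s m M → k)
    (z : PowerSeries (MvPolynomial (ChartIdx w s m M) k)) (p : Fin 2 × Fin (m + 1)) :
    MvPolynomial.eval a (genJet e z p) =
      if h : s * w p.1 + M ≤ p.2 then a (Sum.inr ⟨p, h⟩)
      else if s * w p.1 ≤ p.2 then
        coeff (p.2 - s * w p.1)
          (PowerSeries.map (MvPolynomial.eval a) (genSeries w s m M k) ^ w p.1 *
            PowerSeries.map (MvPolynomial.eval a) z ^ e p.1)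
      else 0 := by
  rw [genJet]
  split_ifs with h1 h2
  · simp
  · rw [← map_pow, ← map_pow, ← map_mul, PowerSeries.coeff_map]
  · simp

theorem coeff_map_genSeries (a : ChartIdx w s m M → k) (l : ℕ) :
    coeff l (PowerSeries.map (MvPolynomial.eval a) (genSeries w s m M k)) =
      if h : l < M then a (Sum.inl ⟨l, h⟩) else 0 := by
  rw [PowerSeries.coeff_map, genSeries, PowerSeries.coeff_mk]
  split_ifs <;> simp

/-- The jets on a branch are parametrized by the generic jet. -/
theorem chartSet_eq_param (h : IsChartRoot f w e c) (hi : i₀ ≠ i₁)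
    (hdet : w i₀ * e i₁ = w i₁ * e i₀ + 1) (hs : 0 < s) (hM0 : 0 < M)
    {n : ℕ} (hnm : n ≤ m + 1) (hM : n = s * ord ↟f w + M)
    (hle : ∀ i, w i ≤ ord ↟f w)
    {z : PowerSeries (MvPolynomial (ChartIdx w s m M) k)}
    (hz : constantCoeff z = MvPolynomial.C c)
    (hz0 : (strict f w e (X ^ s * genSeries w s m M k)).eval z = 0) :
    chartSet f w e c s n m = {P | ∃ a : ChartIdx w s m M → k,
      MvPolynomial.eval a (MvPolynomial.X (Sum.inl ⟨0, hM0⟩)) ≠ 0 ∧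
        P = fun p => MvPolynomial.eval a (genJet e z p)} := by
  have hle' : ∀ i, s * w i + M ≤ m + 1 := fun i => by
    refine le_trans ?_ hnm
    rw [hM]
    exact Nat.add_le_add_right (Nat.mul_le_mul_left _ (hle i)) _
  have hspec : ∀ a : ChartIdx w s m M → k,
      constantCoeff (PowerSeries.map (MvPolynomial.eval a) (genSeries w s m M k)) =
        a (Sum.inl ⟨0, hM0⟩) ∧
      constantCoeff (PowerSeries.map (MvPolynomial.eval a) z) = c ∧
      (strict f w e (X ^ s * PowerSeries.map (MvPolynomial.eval a)
        (genSeries w s m M k))).eval (PowerSeries.map (MvPolynomial.eval a) z) = 0 := by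
    intro a
    refine ⟨?_, ?_, ?_⟩
    · rw [← PowerSeries.coeff_zero_eq_constantCoeff_apply, coeff_map_genSeries, dif_pos hM0]
    · rw [← PowerSeries.coeff_zero_eq_constantCoeff_apply, PowerSeries.coeff_map,
        PowerSeries.coeff_zero_eq_constantCoeff_apply, hz, MvPolynomial.eval_C]
    · have := map_eval_strict f w e (MvPolynomial.aeval a : MvPolynomial _ k →ₐ[k] k)
        (X ^ s * genSeries w s m M k) z
      rw [hz0, map_zero] at this
      have hae : ((MvPolynomial.aeval a : MvPolynomial (ChartIdx w s m M) k →ₐ[k] k) :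
          MvPolynomial (ChartIdx w s m M) k →+* k) = MvPolynomial.eval a := by
        ext <;> simp
      rw [hae, map_mul, map_pow, PowerSeries.map_X] at this
      exact this.symm
  ext P
  constructor
  · rintro ⟨⟨ξ', z', hξ', hz', hP⟩, hdvd⟩
    let a : ChartIdx w s m M → k :=
      Sum.elim (fun l => coeff (l : ℕ) ξ') fun p => P p.1
    obtain ⟨s1, s2, s3⟩ := hspec a
    set ξ := PowerSeries.map (MvPolynomial.eval a) (genSeries w s m M k) with hξ
    set ζ := PowerSeries.map (MvPolynomial.eval a) z with hζ
    have e1 : modX k M ξ' = modX k M ξ := modX_eq_iff_coeff.2 fun j hj => by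
      rw [coeff_map_genSeries, dif_pos hj]
      rfl
    have e2 : modX k M z' = modX k M ζ := by
      refine (h.dvd_aeval_iff hs hM hξ' e1 s2 hz' s3).1 ?_
      rwa [show (fun i => (X ^ s * ξ') ^ w i * z' ^ e i) = jetSeries P from
        funext fun i => (hP i).symm]
    refine ⟨a, ?_, ?_⟩
    · rw [MvPolynomial.eval_X]
      simpa [a] using hξ'
    · funext p
      rw [eval_genJet]
      have hp : P p = coeff (p.2 : ℕ) (X ^ (s * w p.1) *
          (ξ' ^ w p.1 * z' ^ e p.1)) := by
        rw [← coeff_jetSeries_fin P p.1 p.2, hP, mul_pow, ← pow_mul, mul_assoc]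
      split_ifs with h1 h2
      · rfl
      · rw [hp, PowerSeries.coeff_X_pow_mul', if_pos h2]
        exact modX_eq_iff_coeff.1 (modX_chart_congr e1 e2 p.1) _ (by omega)
      · rw [hp, PowerSeries.coeff_X_pow_mul', if_neg h2]
  · rintro ⟨a, ha, rfl⟩
    rw [MvPolynomial.eval_X] at ha
    obtain ⟨s1, s2, s3⟩ := hspec a
    set ξ := PowerSeries.map (MvPolynomial.eval a) (genSeries w s m M k) with hξ
    set ζ := PowerSeries.map (MvPolynomial.eval a) z with hζ
    set P : JetSpace k m := fun p => MvPolynomial.eval a (genJet e z p) with hP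
    have hshift : ∀ i, ∃ V : PowerSeries k, jetSeries P i = X ^ (s * w i) * V ∧
        modX k M V = modX k M (ξ ^ w i * ζ ^ e i) := by
      intro i
      have := hle' i
      refine exists_eq_shift this fun j hj => ?_
      rw [hP]
      simp only
      rw [eval_genJet, dif_neg (by simp only; omega)]
    choose V hV hVm using hshift
    have hξ0 : constantCoeff ξ ≠ 0 := by rw [s1]; exact ha
    have hζ0 : constantCoeff ζ ≠ 0 := by rw [s2]; exact h.ne_zero
    obtain ⟨ξ', z', hξ', -, hVc⟩ := exists_chart_series hi hdet (V := V) fun i => by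
      rw [constantCoeff_eq_of_modX hM0 (hVm i)]
      simp [hξ0, hζ0]
    obtain ⟨e1, e2⟩ := modX_chart hdet hξ0 hζ0 fun i => by rw [← hVc]; exact hVm i
    have hz' : constantCoeff z' = c := by
      rw [constantCoeff_eq_of_modX hM0 e2, s2]
    have hPx : ∀ i, jetSeries P i = (X ^ s * ξ') ^ w i * z' ^ e i := fun i => by
      rw [hV, hVc, mul_pow, ← pow_mul, mul_assoc]
    refine ⟨⟨ξ', z', hξ', hz', hPx⟩, ?_⟩
    rw [show jetSeries P = fun i => (X ^ s * ξ') ^ w i * z' ^ e i from funext hPx]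
    exact (h.dvd_aeval_iff hs hM hξ' e1 s2 hz' s3).2 e2

end ChartSet

end

section

section Counting

theorem card_fin_le (n a : ℕ) : Fintype.card {j : Fin n // a ≤ (j : ℕ)} = n - a := by
  rw [← Fintype.card_fin (n - a)]
  refine Fintype.card_congr ⟨fun j => ⟨j.1 - a, by have := j.1.2; have := j.2; omega⟩,
    fun j => ⟨⟨j + a, by omega⟩, by simp⟩, fun j => ?_, fun j => ?_⟩
  · ext
    have := j.2
    simp only
    omega
  · ext
    simp

theorem card_idx {m : ℕ} {a : Fin 2 → ℕ} (h : ∀ i, a i ≤ m + 1) :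
    Fintype.card {p : Fin 2 × Fin (m + 1) // a p.1 ≤ p.2} + a 0 + a 1 = 2 * (m + 1) := by
  let E : {p : Fin 2 × Fin (m + 1) // a p.1 ≤ p.2} ≃ Σ i : Fin 2, {j : Fin (m + 1) // a i ≤ j} :=
    ⟨fun p => ⟨p.1.1, p.1.2, p.2⟩, fun p => ⟨(p.1, p.2.1), p.2.2⟩, fun _ => rfl, fun _ => rfl⟩
  rw [Fintype.card_congr E, Fintype.card_sigma, Fin.sum_univ_two, card_fin_le, card_fin_le]
  have := h 0
  have := h 1
  omega

end Counting

section Hyp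

variable {k : Type u} [Field k] {m : ℕ}

theorem hyp_eq_param (α : ℕ × ℕ) :
    hyp α m = {P : JetSpace k m | ∃ a : {p : Fin 2 × Fin (m + 1) // vec α p.1 ≤ p.2} → k,
      P = fun c => MvPolynomial.eval a
        (if h : vec α c.1 ≤ c.2 then MvPolynomial.X ⟨c, h⟩ else 0)} := by
  ext P
  rw [mem_hyp_iff_forall]
  constructor
  · intro h
    refine ⟨fun p => P p.1, funext fun c => ?_⟩
    split_ifs with hc
    · simp
    · simpa using h c (by omega)
  · rintro ⟨a, rfl⟩ c hc
    simp only
    rw [dif_neg (by omega), map_zero]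

theorem hyp_facts [Infinite k] {α : ℕ × ℕ} (h : ∀ i, vec α i ≤ m + 1) :
    IsIrreducibleClosed (hyp α m : Set (JetSpace k m)) ∧ ∃ d : ℕ,
      ringKrullDim (CoordRing (hyp α m : Set (JetSpace k m))) = d ∧
      embDim (hyp α m : Set (JetSpace k m)) = d ∧ d + vec α 0 + vec α 1 = 2 * (m + 1) := by
  obtain ⟨h1, h2, h3⟩ := graph_facts (k := k) (ι := {p : Fin 2 × Fin (m + 1) // vec α p.1 ≤ p.2})
    (fun i => i.1) _ (fun i => dif_pos i.2) (hyp_eq_param (k := k) (m := m) α)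
  exact ⟨h1, _, h2, h3, card_idx h⟩

end Hyp

section ChartFacts

variable {k : Type u} [Field k] {w e : Fin 2 → ℕ} {s m M n : ℕ}

theorem coeff_pow_mem {R : Type*} [CommRing R] (A : Subring R) {U : PowerSeries R} {M : ℕ}
    (hU : ∀ j < M, coeff j U ∈ A) (n : ℕ) :
    ∀ j < M, coeff j (U ^ n) ∈ A := by
  induction n with
  | zero =>
    intro j _
    rw [pow_zero, PowerSeries.coeff_one]
    split_ifs
    exacts [A.one_mem, A.zero_mem]
  | succ n ih =>
    intro j hj
    rw [pow_succ, PowerSeries.coeff_mul]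
    refine A.sum_mem fun p hp => ?_
    rw [Finset.HasAntidiagonal.mem_antidiagonal] at hp
    exact A.mul_mem (ih _ (by omega)) (hU _ (by omega))

/-- The parameters of the generic jet are algebraic over its coordinates. -/
theorem isAlgebraic_genJet {i₀ i₁ : Fin 2}
    (hdet : w i₀ * e i₁ = w i₁ * e i₀ + 1) (hM0 : 0 < M)
    (hle : ∀ i, s * w i + M ≤ m + 1) {c : k} (hc : c ≠ 0)
    {z : PowerSeries (MvPolynomial (ChartIdx w s m M) k)}
    (hz : constantCoeff z = MvPolynomial.C c) :
    Algebra.IsAlgebraic (MvPolynomial.aeval (R := k) (genJet (m := m) e z)).range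
      (MvPolynomial (ChartIdx w s m M) k) := by
  classical
  set A := (MvPolynomial.aeval (R := k) (genJet (m := m) e z)).range with hA
  have hgen : ∀ p, genJet (m := m) e z p ∈ A := fun p => ⟨MvPolynomial.X p, by simp⟩
  set ξ := genSeries w s m M k with hξ
  let U : Fin 2 → PowerSeries (MvPolynomial (ChartIdx w s m M) k) := fun i => ξ ^ w i * z ^ e i
  have hU : ∀ i, ∀ j < M, coeff j (U i) ∈ A.toSubring := by
    intro i j hj
    have h1 := hle i
    have h2 := hgen (i, ⟨s * w i + j, by omega⟩)
    rw [genJet, dif_neg (by simp only; omega), if_pos (by simp)] at h2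
    simpa using h2
  have h0 : coeff 0 (U i₁ ^ e i₀) ≠ 0 := by
    have h1 : constantCoeff ξ = MvPolynomial.X (Sum.inl ⟨0, hM0⟩) := by
      rw [← PowerSeries.coeff_zero_eq_constantCoeff_apply, hξ, genSeries, PowerSeries.coeff_mk,
        dif_pos hM0]
    rw [PowerSeries.coeff_zero_eq_constantCoeff_apply, map_pow]
    refine pow_ne_zero _ ?_
    simp only [U, map_mul, map_pow, h1, hz]
    exact mul_ne_zero (pow_ne_zero _ (MvPolynomial.X_ne_zero _))
      (pow_ne_zero _ (by simpa using hc))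
  have halgA : ∀ x ∈ A, IsAlgebraic A x := fun x hx =>
    isAlgebraic_algebraMap (⟨x, hx⟩ : A)
  have key : ∀ l, l < M → IsAlgebraic A (coeff l ξ) := by
    intro l
    induction l using Nat.strong_induction_on with
    | _ l ih =>
      intro hl
      have hk := (chart_eq hdet (v := U) fun _ => rfl).1
      have h1 := congrArg (coeff l) hk
      rw [PowerSeries.coeff_mul, ← Finset.add_sum_erase _ _
        (Finset.HasAntidiagonal.mem_antidiagonal.2 (add_zero l) :
          (l, 0) ∈ Finset.HasAntidiagonal.antidiagonal l)] at h1
      have h2 : IsAlgebraic A (coeff l ξ * coeff 0 (U i₁ ^ e i₀)) := by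
        have h1' : coeff l ξ * coeff 0 (U i₁ ^ e i₀) = _ - _ :=
          eq_sub_of_add_eq h1.symm
        rw [h1']
        refine (halgA _ (coeff_pow_mem A.toSubring (hU i₀) _ l hl)).sub ?_
        refine (Subalgebra.algebraicClosure A _).sum_mem fun p hp => ?_
        rw [Finset.mem_erase, Finset.HasAntidiagonal.mem_antidiagonal] at hp
        have hp1 : p.1 ≠ l := fun h => hp.1 (Prod.ext h (by have := hp.2; simp only; omega))
        exact (ih p.1 (by omega) (by omega)).mul
          (halgA _ (coeff_pow_mem A.toSubring (hU i₁) _ p.2 (by omega)))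
      rw [mul_comm] at h2
      exact IsAlgebraic.of_mul (mem_nonZeroDivisors_of_ne_zero h0)
        (halgA _ (coeff_pow_mem A.toSubring (hU i₁) _ 0 hM0)) h2
  refine ⟨fun p => ?_⟩
  induction p using MvPolynomial.induction_on with
  | C a => exact halgA _ ⟨MvPolynomial.C a, by simp [MvPolynomial.algebraMap_eq]⟩
  | add p q hp hq => exact hp.add hq
  | mul_X p i hp =>
    refine hp.mul ?_
    rcases i with l | p
    · have := key l l.2
      rwa [hξ, genSeries, PowerSeries.coeff_mk, dif_pos l.2] at this
    · have := hgen p.1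
      rw [genJet, dif_pos p.2] at this
      exact halgA _ this

theorem IsChartRoot.exists_genRoot {f : MvPolynomial (Fin 2) k} {c : k}
    (h : IsChartRoot f w e c) (hs : 0 < s) :
    ∃ z : PowerSeries (MvPolynomial (ChartIdx w s m M) k),
      constantCoeff z = MvPolynomial.C c ∧
      (strict f w e (X ^ s * genSeries w s m M k)).eval z = 0 :=
  h.exists_root (by simp [hs.ne'])

theorem chartSet_facts [Infinite k] {f : MvPolynomial (Fin 2) k} {c : k} {i₀ i₁ : Fin 2}
    (h : IsChartRoot f w e c) (hi : i₀ ≠ i₁)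
    (hdet : w i₀ * e i₁ = w i₁ * e i₀ + 1) (hs : 0 < s) (hM0 : 0 < M)
    (hnm : n ≤ m + 1) (hM : n = s * ord ↟f w + M)
    (hle : ∀ i, w i ≤ ord ↟f w) :
    IsIrreducibleClosed (zariskiClosure (chartSet f w e c s n m)) ∧ ∃ d : ℕ,
      ringKrullDim (CoordRing (zariskiClosure (chartSet f w e c s n m))) = d ∧
      d + M + s * w 0 + s * w 1 = 2 * (m + 1) := by
  obtain ⟨z, hz, hz0⟩ := h.exists_genRoot (m := m) (M := M) hs
  have hle' : ∀ i, s * w i + M ≤ m + 1 := fun i => by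
    refine le_trans ?_ hnm
    rw [hM]
    exact Nat.add_le_add_right (Nat.mul_le_mul_left _ (hle i)) _
  have hS := chartSet_eq_param h hi hdet hs hM0 hnm hM hle hz hz0
  have hD : (MvPolynomial.X (Sum.inl ⟨0, hM0⟩) : MvPolynomial (ChartIdx w s m M) k) ≠ 0 :=
    MvPolynomial.X_ne_zero _
  refine ⟨isIrreducibleClosed_param _ hD hS, _,
    ringKrullDim_param _ hD hS (isAlgebraic_genJet hdet hM0 hle' h.ne_zero hz), ?_⟩
  have := card_idx (m := m) (a := fun i => s * w i + M) hle'
  rw [Fintype.card_sum, Fintype.card_fin]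
  omega

end ChartFacts

section Graph

variable {k : Type u} [Field k] {w e : Fin 2 → ℕ} {s m M n : ℕ} {i₀ i₁ : Fin 2}

/-- The bounds for the free coordinates of a jet on a smooth branch. -/
def graphBound (w : Fin 2 → ℕ) (s M : ℕ) (i₀ : Fin 2) (i : Fin 2) : ℕ :=
  if i = i₀ then s else s * w i + M

/-- The free coordinates of a jet on a smooth branch. -/
abbrev GraphIdx (w : Fin 2 → ℕ) (s m M : ℕ) (i₀ : Fin 2) : Type :=
  {p : Fin 2 × Fin (m + 1) // graphBound w s M i₀ p.1 ≤ p.2}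

/-- The generic series in the coordinate `i₀`. -/
noncomputable def graphSeries (k : Type u) [Field k] (w : Fin 2 → ℕ) (s m M : ℕ) (i₀ : Fin 2) :
    PowerSeries (MvPolynomial (GraphIdx w s m M i₀) k) :=
  PowerSeries.mk fun l => if h : l < m + 1 then
    if h' : graphBound w s M i₀ i₀ ≤ l then MvPolynomial.X ⟨(i₀, ⟨l, h⟩), h'⟩ else 0 else 0

/-- The generic jet on a smooth branch. -/
noncomputable def graphJet (z : PowerSeries (MvPolynomial (GraphIdx w s m M i₀) k))
    (p : Fin 2 × Fin (m + 1)) : MvPolynomial (GraphIdx w s m M i₀) k :=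
  if h : graphBound w s M i₀ p.1 ≤ p.2 then MvPolynomial.X ⟨p, h⟩
  else if p.1 = i₀ then 0
  else coeff (p.2 : ℕ) (graphSeries k w s m M i₀ ^ w p.1 * z)

theorem eval_graphJet (a : GraphIdx w s m M i₀ → k)
    (z : PowerSeries (MvPolynomial (GraphIdx w s m M i₀) k)) (p : Fin 2 × Fin (m + 1)) :
    MvPolynomial.eval a (graphJet z p) =
      if h : graphBound w s M i₀ p.1 ≤ p.2 then a ⟨p, h⟩
      else if p.1 = i₀ then 0
      else coeff (p.2 : ℕ)
        (PowerSeries.map (MvPolynomial.eval a) (graphSeries k w s m M i₀) ^ w p.1 *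
          PowerSeries.map (MvPolynomial.eval a) z) := by
  rw [graphJet]
  split_ifs with h1 h2
  · simp
  · simp
  · rw [← map_pow, ← map_mul, PowerSeries.coeff_map]

theorem map_graphSeries (a : GraphIdx w s m M i₀ → k) {P : JetSpace k m}
    (h0 : ∀ p (h : graphBound w s M i₀ p.1 ≤ p.2), P p = a ⟨p, h⟩)
    (h1 : X ^ s ∣ jetSeries P i₀) :
    PowerSeries.map (MvPolynomial.eval a) (graphSeries k w s m M i₀) = jetSeries P i₀ := by
  ext l
  rw [PowerSeries.coeff_map, graphSeries, PowerSeries.coeff_mk]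
  by_cases hl : l < m + 1
  · rw [dif_pos hl]
    split_ifs with h
    · rw [MvPolynomial.eval_X, ← h0 _ h, coeff_jetSeries, dif_pos hl]
    · rw [map_zero, PowerSeries.X_pow_dvd_iff.1 h1 l (by simpa [graphBound] using h)]
  · rw [dif_neg hl, coeff_jetSeries, dif_neg hl, map_zero]

/-- The closed set of jets on a smooth branch is a graph. -/
theorem exists_graph [Infinite k] {f : MvPolynomial (Fin 2) k} {c : k}
    (h : IsChartRoot f w e c) (hi : i₀ ≠ i₁) (hw : w i₀ = 1) (he : e i₀ = 0) (he' : e i₁ = 1)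
    (hs : 0 < s) (hM0 : 0 < M)
    (hnm : n ≤ m + 1) (hM : n = s * ord ↟f w + M)
    (hle : ∀ i, w i ≤ ord ↟f w) :
    ∃ z : PowerSeries (MvPolynomial (GraphIdx w s m M i₀) k),
      constantCoeff z = MvPolynomial.C c ∧
      (∀ a : GraphIdx w s m M i₀ → k,
        constantCoeff (PowerSeries.map (MvPolynomial.eval a) z) = c ∧
        (strict f w e (PowerSeries.map (MvPolynomial.eval a)
          (graphSeries k w s m M i₀))).eval (PowerSeries.map (MvPolynomial.eval a) z) = 0) ∧
      zariskiClosure (chartSet f w e c s n m) = {P | ∃ a : GraphIdx w s m M i₀ → k,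
        P = fun p => MvPolynomial.eval a (graphJet z p)} := by
  have hle' : ∀ i, s * w i + M ≤ m + 1 := fun i => by
    refine le_trans ?_ hnm
    rw [hM]
    exact Nat.add_le_add_right (Nat.mul_le_mul_left _ (hle i)) _
  have hl0 := hle' i₀
  have hl1 := hle' i₁
  rw [hw, mul_one] at hl0
  have hb0 : graphBound w s M i₀ i₀ = s := by simp [graphBound]
  have hb1 : graphBound w s M i₀ i₁ = s * w i₁ + M := by simp [graphBound, hi.symm]
  have hxs : constantCoeff (graphSeries k w s m M i₀) = 0 := by
    rw [← PowerSeries.coeff_zero_eq_constantCoeff_apply, graphSeries, PowerSeries.coeff_mk]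
    rw [dif_pos (by omega), dif_neg (by omega)]
  obtain ⟨z, hz, hz0⟩ := h.exists_root hxs
  have hz : constantCoeff z = MvPolynomial.C c := hz
  suffices H : (∀ a : GraphIdx w s m M i₀ → k, _) ∧ _ from ⟨z, hz, H⟩
  let D : MvPolynomial (GraphIdx w s m M i₀) k :=
    MvPolynomial.X ⟨(i₀, ⟨s, by omega⟩), by simp [hb0]⟩
  have hD : D ≠ 0 := MvPolynomial.X_ne_zero _
  have hspec : ∀ a : GraphIdx w s m M i₀ → k,
      constantCoeff (PowerSeries.map (MvPolynomial.eval a) z) = c ∧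
      (strict f w e (PowerSeries.map (MvPolynomial.eval a)
        (graphSeries k w s m M i₀))).eval (PowerSeries.map (MvPolynomial.eval a) z) = 0 := by
    intro a
    refine ⟨?_, ?_⟩
    · rw [← PowerSeries.coeff_zero_eq_constantCoeff_apply, PowerSeries.coeff_map,
        PowerSeries.coeff_zero_eq_constantCoeff_apply, hz, MvPolynomial.eval_C]
    · have := map_eval_strict f w e (MvPolynomial.aeval a : MvPolynomial _ k →ₐ[k] k)
        (graphSeries k w s m M i₀) z
      rw [hz0, map_zero] at this
      have hae : ((MvPolynomial.aeval a : MvPolynomial (GraphIdx w s m M i₀) k →ₐ[k] k) :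
          MvPolynomial (GraphIdx w s m M i₀) k →+* k) = MvPolynomial.eval a := by
        ext <;> simp
      rw [hae] at this
      exact this.symm
  have hS : chartSet f w e c s n m = {P | ∃ a : GraphIdx w s m M i₀ → k,
      MvPolynomial.eval a D ≠ 0 ∧ P = fun p => MvPolynomial.eval a (graphJet z p)} := by
    ext P
    constructor
    · rintro ⟨⟨ξ', z', hξ', hz', hP⟩, hdvd⟩
      let a : GraphIdx w s m M i₀ → k := fun p => P p.1
      have hP0 : jetSeries P i₀ = X ^ s * ξ' := by rw [hP, hw, he]; simp
      have hP1 : jetSeries P i₁ = X ^ (s * w i₁) * (ξ' ^ w i₁ * z') := by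
        rw [hP, he', mul_pow, ← pow_mul]; ring
      have hmap : PowerSeries.map (MvPolynomial.eval a) (graphSeries k w s m M i₀) =
          X ^ s * ξ' := by
        rw [← hP0]
        exact map_graphSeries a (fun _ _ => rfl) (by rw [hP0]; exact dvd_mul_right _ _)
      obtain ⟨s2, s3⟩ := hspec a
      set ζ := PowerSeries.map (MvPolynomial.eval a) z with hζ
      have e2 : modX k M z' = modX k M ζ := by
        rw [hmap] at s3
        refine (h.dvd_aeval_iff hs hM hξ' rfl s2 hz' s3).1 ?_
        rwa [show (fun i => (X ^ s * ξ') ^ w i * z' ^ e i) = jetSeries P from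
          funext fun i => (hP i).symm]
      refine ⟨a, ?_, funext ?_⟩
      · rw [MvPolynomial.eval_X]
        have := coeff_pow_of_X_pow_dvd hP0
        rw [coeff_jetSeries, dif_pos (by omega)] at this
        simpa [a, this] using hξ'
      · rintro ⟨i, j⟩
        rw [eval_graphJet]
        split_ifs with h1 h2
        · rfl
        · simp only at h1 h2
          subst h2
          rw [← coeff_jetSeries_fin P i j, hP0, PowerSeries.coeff_X_pow_mul', if_neg (by omega)]
        · simp only at h1 h2
          obtain rfl : i = i₁ := (eq_or_eq_of_ne hi i).resolve_left h2
          rw [← coeff_jetSeries_fin P i j, hP1, hmap, mul_pow, ← pow_mul, mul_assoc,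
            PowerSeries.coeff_X_pow_mul', PowerSeries.coeff_X_pow_mul']
          split_ifs with h3
          · refine (modX_eq_iff_coeff (M := M)).1 ?_ _ (by omega)
            rw [map_mul, map_mul, e2]
          · rfl
    · rintro ⟨a, ha, rfl⟩
      rw [MvPolynomial.eval_X] at ha
      set P : JetSpace k m := fun p => MvPolynomial.eval a (graphJet z p) with hP
      have hPa : ∀ p (h : graphBound w s M i₀ p.1 ≤ p.2), P p = a ⟨p, h⟩ := fun p hp => by
        simp only [hP]
        rw [eval_graphJet, dif_pos hp]
      have hd0 : X ^ s ∣ jetSeries P i₀ := by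
        rw [PowerSeries.X_pow_dvd_iff]
        intro j hj
        rw [coeff_jetSeries, dif_pos (by omega)]
        simp only [hP]
        rw [eval_graphJet, dif_neg (by simp only; omega), if_pos rfl]
      obtain ⟨ξ', hξ'⟩ := hd0
      have hξ0 : constantCoeff ξ' ≠ 0 := by
        rw [← coeff_pow_of_X_pow_dvd hξ', coeff_jetSeries, dif_pos (by omega), hPa _ (by simp [hb0])]
        exact ha
      have hmap := map_graphSeries a hPa ⟨ξ', hξ'⟩
      rw [hξ'] at hmap
      obtain ⟨s2, s3⟩ := hspec a
      set ζ := PowerSeries.map (MvPolynomial.eval a) z with hζ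
      rw [hmap] at s3
      obtain ⟨V, hV, hVm⟩ := exists_eq_shift (P := P) (n := s * w i₁) (i := i₁)
        (A := ξ' ^ w i₁ * ζ) hl1 fun j hj => by
          simp only [hP]
          rw [eval_graphJet, dif_neg (by simp only; omega), if_neg hi.symm, hmap, mul_pow,
            ← pow_mul, mul_assoc, PowerSeries.coeff_X_pow_mul']
      obtain ⟨y, hy⟩ : ∃ y, ξ' * y = 1 :=
        (PowerSeries.isUnit_iff_constantCoeff.2 (IsUnit.mk0 _ hξ0)).exists_right_inv
      have hy' : ξ' ^ w i₁ * y ^ w i₁ = 1 := by rw [← mul_pow, hy, one_pow]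
      have e2 : modX k M (V * y ^ w i₁) = modX k M ζ := by
        rw [map_mul, hVm, ← map_mul, mul_right_comm, hy', one_mul]
      have hz' : constantCoeff (V * y ^ w i₁) = c := by
        rw [constantCoeff_eq_of_modX hM0 e2, s2]
      have hPx : ∀ i, jetSeries P i = (X ^ s * ξ') ^ w i * (V * y ^ w i₁) ^ e i := by
        refine (forall_iff_of_ne hi).2 ⟨?_, ?_⟩
        · rw [hξ', hw, he]; simp
        · rw [hV, he', pow_one, mul_pow, ← pow_mul]
          linear_combination (-(X ^ (s * w i₁) * V)) * hy'
      refine ⟨⟨ξ', _, hξ0, hz', hPx⟩, ?_⟩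
      rw [show jetSeries P = fun i => (X ^ s * ξ') ^ w i * (V * y ^ w i₁) ^ e i from
        funext hPx]
      exact (h.dvd_aeval_iff hs hM hξ0 rfl s2 hz' s3).2 e2
  refine ⟨hspec, ?_⟩
  have hgr := graph_facts (k := k) (σ := Fin 2 × Fin (m + 1))
    (V := {P | ∃ a : GraphIdx w s m M i₀ → k, P = fun p => MvPolynomial.eval a (graphJet z p)})
    (fun i => i.1) (graphJet z) (fun i => by rw [graphJet, dif_pos i.2]) rfl
  refine Set.Subset.antisymm ?_ ?_
  · rw [zariskiClosure_subset_iff hgr.1.1, hS]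
    rintro P ⟨a, -, rfl⟩
    exact ⟨a, rfl⟩
  · rintro P ⟨a, rfl⟩
    exact param_mem_zariskiClosure (graphJet z) hD (fun a ha => by rw [hS]; exact ⟨a, ha, rfl⟩) a

end Graph

end

section

section SingleRay

theorem scRem_eq (q p n : ℕ) : scRem q p n = (n * q) % p := by
  induction n with
  | zero => simp [scRem]
  | succ n ih => rw [scRem, ih, Nat.add_mod_mod, Nat.succ_mul, Nat.add_comm]

theorem scLength_eq {q p : ℕ} (hp : 0 < p) (h : Nat.Coprime p q) : scLength q p = p := by
  refine le_antisymm (Nat.sInf_le ⟨hp, by rw [scRem_eq, Nat.mul_mod_right]⟩) ?_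
  refine le_csInf ⟨p, hp, by rw [scRem_eq, Nat.mul_mod_right]⟩ ?_
  rintro i ⟨hi, h0⟩
  rw [scRem_eq] at h0
  exact Nat.le_of_dvd hi (h.dvd_of_dvd_mul_right (Nat.dvd_of_mod_eq_zero h0))

theorem scQuot_eq (q p n : ℕ) : n * q / p + (q + scRem q p n) / p = (n + 1) * q / p := by
  rcases Nat.eq_zero_or_pos p with rfl | hp
  · simp
  rw [scRem_eq]
  have h := Nat.div_add_mod (n * q) p
  have h1 : (n + 1) * q = (q + n * q % p) + p * (n * q / p) := by rw [Nat.succ_mul]; omega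
  rw [h1, Nat.add_mul_div_left _ _ hp, add_comm]

theorem forall_mem_scanl_replicate {Q : ℕ × ℕ → Prop} {v : ℕ × ℕ} {l : List (ℕ × ℕ)} (d : ℕ) :
    ∀ a : ℕ × ℕ, (∀ i ≤ d, Q (a + i • v)) → (∀ z ∈ l.scanl (· + ·) (a + d • v), Q z) →
      ∀ z ∈ (List.replicate d v ++ l).scanl (· + ·) a, Q z := by
  induction d with
  | zero => intro a _ h2; simpa using h2
  | succ d ih =>
    intro a h1 h2 z hz
    rw [List.replicate_succ, List.cons_append, List.scanl_cons, List.mem_cons] at hz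
    rcases hz with rfl | hz
    · simpa using h1 0 (Nat.zero_le _)
    · have e : ∀ i : ℕ, a + v + i • v = a + (i + 1) • v := fun i => by
        rw [succ_nsmul', add_assoc]
      refine ih (a + v) (fun i hi => ?_) (fun z hz => ?_) z hz
      · rw [e]; exact h1 _ (by omega)
      · rw [e] at hz; exact h2 z hz

theorem stairSteps_cons {v h : ℕ × ℕ} {d : ℕ} {l : List ℕ} (hl : l ≠ []) :
    stairSteps v h (d :: l) = List.replicate d v ++ h :: stairSteps v h l := by
  cases l with
  | nil => exact absurd rfl hl
  | cons d' l => rfl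

/-- The walk of `SC(q/p)` passes through the unit squares which the ray crosses. -/
theorem stairSteps_spec {p q : ℕ} (hp : 0 < p) (hq : 0 < q) (hpq : Nat.Coprime p q) (v h base : ℕ × ℕ) (j : ℕ) :
    ∀ n, n + j + 1 = p →
      (∀ z ∈ (stairSteps v h ((List.range' n (j + 1)).map fun n => (q + scRem q p n) / p)).scanl
        (· + ·) (base + n • h + (n * q / p) • v), ∃ x y, z = base + x • h + y • v ∧
        q * x < p * (y + 1) ∧ p * y < q * (x + 1) ∧ x < p ∧ y < q) ∧
      (stairSteps v h ((List.range' n (j + 1)).map fun n => (q + scRem q p n) / p)).length +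
        n * q / p + 1 = j + q := by
  have hcol : ∀ n i, n < p → n * q / p + i ≤ (n + 1) * q / p → p * (n * q / p + i) ≠ (n + 1) * q →
      q * n < p * (n * q / p + i + 1) ∧ p * (n * q / p + i) < q * (n + 1) := by
    intro n i _ hi hne
    have h1 := Nat.lt_mul_div_succ (n * q) hp
    have h2 := Nat.mul_div_le ((n + 1) * q) p
    have h3 := Nat.mul_le_mul_left p hi
    constructor
    · have : p * (n * q / p + 1) ≤ p * (n * q / p + i + 1) := Nat.mul_le_mul_left _ (by omega)
      nlinarith
    · rw [mul_comm q]
      omega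
  have hpt : ∀ n i, n < p → n * q / p + i ≤ (n + 1) * q / p →
      p * (n * q / p + i) ≠ (n + 1) * q →
      ∃ x y, base + n • h + (n * q / p) • v + i • v = base + x • h + y • v ∧
        q * x < p * (y + 1) ∧ p * y < q * (x + 1) ∧ x < p ∧ y < q := by
    intro n i hn hi hne
    obtain ⟨h1, h2⟩ := hcol n i hn hi hne
    refine ⟨n, n * q / p + i, by rw [add_nsmul, add_assoc], h1, h2, hn, ?_⟩
    have : q * (n + 1) ≤ q * p := Nat.mul_le_mul_left _ hn
    exact Nat.lt_of_mul_lt_mul_left (a := p) (by linarith)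
  induction j with
  | zero =>
    intro n hn
    have hd := scQuot_eq q p n
    have hnp : n + 1 = p := by omega
    have hlt : n * q / p < q := by
      rw [Nat.div_lt_iff_lt_mul hp, mul_comm]
      exact Nat.mul_lt_mul_of_pos_left (by omega) hq
    have hd' := hd
    rw [hnp, Nat.mul_div_cancel_left _ hp] at hd'
    constructor
    · have := forall_mem_scanl_replicate (Q := fun z => ∃ x y, z = base + x • h + y • v ∧
        q * x < p * (y + 1) ∧ p * y < q * (x + 1) ∧ x < p ∧ y < q) (v := v) (l := [])
        ((q + scRem q p n) / p - 1) (base + n • h + (n * q / p) • v)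
      rw [List.append_nil] at this
      refine this (fun i hi => hpt n i (by omega) (by omega) ?_) (fun z hz => ?_)
      · rw [hnp]
        intro he
        have := Nat.eq_of_mul_eq_mul_left hp he
        omega
      · rw [List.scanl_nil, List.mem_singleton] at hz
        subst hz
        refine hpt n _ (by omega) (by omega) ?_
        rw [hnp]
        intro he
        have := Nat.eq_of_mul_eq_mul_left hp he
        omega
    · change (List.replicate ((q + scRem q p n) / p - 1) v).length + _ + _ = _
      rw [List.length_replicate]
      omega
  | succ j ih =>
    intro n hn
    obtain ⟨ih1, ih2⟩ := ih (n + 1) (by omega)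
    have hd := scQuot_eq q p n
    rw [List.range'_succ, List.map_cons, stairSteps_cons (by simp)]
    have hne : ∀ i, p * (n * q / p + i) ≠ (n + 1) * q := by
      intro i he
      have := Nat.le_of_dvd (Nat.succ_pos n) (hpq.dvd_of_dvd_mul_right (Dvd.intro _ he))
      omega
    constructor
    · refine forall_mem_scanl_replicate _ _ (fun i hi => hpt n i (by omega) (by omega) (hne i))
        (fun z hz => ?_)
      rw [List.scanl_cons, List.mem_cons] at hz
      rcases hz with rfl | hz
      · exact hpt n _ (by omega) (by omega) (hne _)
      · refine ih1 z ?_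
        convert hz using 2
        rw [← hd, add_nsmul, add_nsmul, one_nsmul]
        abel
    · rw [List.length_append, List.length_replicate, List.length_cons]
      omega

theorem length_raySteps {p q : ℕ} (hp : 0 < p) (hq : 0 < q) (hpq : Nat.Coprime p q) :
    (raySteps p q).length + 2 = p + q := by
  rw [raySteps]
  split_ifs with h
  · have := (stairSteps_spec hp hq hpq (0, 1) (1, 0) 0 (p - 1) 0 (by omega)).2
    rw [SC, scLength_eq hp hpq, List.range_eq_range']
    rw [show p - 1 + 1 = p by omega] at this
    simp only [zero_mul, Nat.zero_div] at this
    omega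
  · have := (stairSteps_spec hq hp hpq.symm (1, 0) (0, 1) 0 (q - 1) 0 (by omega)).2
    rw [SC, scLength_eq hq hpq.symm, List.range_eq_range']
    rw [show q - 1 + 1 = q by omega] at this
    simp only [zero_mul, Nat.zero_div] at this
    omega

theorem mem_stairSteps {v h : ℕ × ℕ} : ∀ (l : List ℕ), ∀ z ∈ stairSteps v h l, z = v ∨ z = h := by
  intro l
  induction l with
  | nil => intro z hz; simp [stairSteps] at hz
  | cons d l ih =>
    intro z hz
    by_cases hl : l = []
    · subst hl
      exact Or.inl (List.eq_of_mem_replicate hz)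
    · rw [stairSteps_cons hl, List.mem_append, List.mem_cons] at hz
      rcases hz with hz | hz | hz
      · exact Or.inl (List.eq_of_mem_replicate hz)
      · exact Or.inr hz
      · exact ih z hz

theorem mem_raySteps {p q : ℕ} {z : ℕ × ℕ} (hz : z ∈ raySteps p q) : z = (1, 0) ∨ z = (0, 1) := by
  rw [raySteps] at hz
  split_ifs at hz
  · exact (mem_stairSteps _ z hz).symm
  · exact mem_stairSteps _ z hz

theorem mem_rayWalk_spec {p q : ℕ} (hp : 0 < p) (hq : 0 < q) (hpq : Nat.Coprime p q) {s : ℕ}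
    {z : ℕ × ℕ} (hz : z ∈ rayWalk p q (s * p, s * q)) : ∃ x y, z = (s * p + x + 1, s * q + y + 1) ∧
      q * x < p * (y + 1) ∧ p * y < q * (x + 1) ∧ x < p ∧ y < q := by
  rw [rayWalk, raySteps] at hz
  split_ifs at hz with h
  · have := (stairSteps_spec hp hq hpq (0, 1) (1, 0) ((s * p, s * q) + (1, 1)) (p - 1) 0
      (by omega)).1 z
    rw [show p - 1 + 1 = p by omega] at this
    rw [SC, scLength_eq hp hpq, List.range_eq_range'] at hz
    obtain ⟨x, y, h1, h2⟩ := this (by simpa using hz)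
    refine ⟨x, y, ?_, h2⟩
    rw [h1]
    ext <;> simp <;> ring
  · have := (stairSteps_spec hq hp hpq.symm (1, 0) (0, 1) ((s * p, s * q) + (1, 1)) (q - 1) 0
      (by omega)).1 z
    rw [show q - 1 + 1 = q by omega] at this
    rw [SC, scLength_eq hq hpq.symm, List.range_eq_range'] at hz
    obtain ⟨x, y, h1, h2, h3, h4, h5⟩ := this (by simpa using hz)
    refine ⟨y, x, ?_, h3, h2, h5, h4⟩
    rw [h1]
    ext <;> simp <;> ring

theorem length_rayWalk {p q : ℕ} (hp : 0 < p) (hq : 0 < q) (hpq : Nat.Coprime p q) (lam : ℕ × ℕ) :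
    (rayWalk p q lam).length + 1 = p + q := by
  have := length_raySteps hp hq hpq
  rw [rayWalk, List.length_scanl]
  omega

theorem rayWalk_succ {p q : ℕ} {lam : ℕ × ℕ} {i : ℕ} (hi : i + 1 < (rayWalk p q lam).length) :
    (rayWalk p q lam)[i + 1] = (rayWalk p q lam)[i] + (1, 0) ∨
      (rayWalk p q lam)[i + 1] = (rayWalk p q lam)[i] + (0, 1) := by
  have h : i < (raySteps p q).length := by
    rw [rayWalk, List.length_scanl] at hi
    omega
  have h1 : (rayWalk p q lam)[i + 1] = (rayWalk p q lam)[i] + (raySteps p q)[i] := by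
    simp only [rayWalk]
    rw [List.getElem_succ_scanl]
  rcases mem_raySteps (List.getElem_mem h) with h2 | h2
  · exact Or.inl (by rw [h1, h2])
  · exact Or.inr (by rw [h1, h2])

theorem rayWalk_sum {p q : ℕ} {lam : ℕ × ℕ} (i : ℕ) (hi : i < (rayWalk p q lam).length) :
    (rayWalk p q lam)[i].1 + (rayWalk p q lam)[i].2 = lam.1 + lam.2 + 2 + i := by
  induction i with
  | zero =>
    simp [rayWalk]
    omega
  | succ i ih =>
    have := ih (by omega)
    rcases rayWalk_succ hi with h | h <;> rw [h] <;> simp <;> omega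

theorem crossed_unique {p q x y x' y' : ℕ} (h : x + y = x' + y')
    (h1 : q * x < p * (y + 1)) (h2 : p * y < q * (x + 1))
    (h1' : q * x' < p * (y' + 1)) (h2' : p * y' < q * (x' + 1)) : x = x' := by
  rcases lt_trichotomy x x' with hlt | he | hlt
  · have := Nat.mul_le_mul_left q (show x + 1 ≤ x' by omega)
    have := Nat.mul_le_mul_left p (show y' + 1 ≤ y by omega)
    omega
  · exact he
  · have := Nat.mul_le_mul_left q (show x' + 1 ≤ x by omega)
    have := Nat.mul_le_mul_left p (show y + 1 ≤ y' by omega)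
    omega

theorem mem_rayWalk_iff {p q : ℕ} (hp : 0 < p) (hq : 0 < q) (hpq : Nat.Coprime p q) {s : ℕ}
    {z : ℕ × ℕ} : z ∈ rayWalk p q (s * p, s * q) ↔ ∃ x y, z = (s * p + x + 1, s * q + y + 1) ∧
      q * x < p * (y + 1) ∧ p * y < q * (x + 1) ∧ x < p ∧ y < q := by
  refine ⟨mem_rayWalk_spec hp hq hpq, ?_⟩
  rintro ⟨x, y, rfl, h1, h2, h3, h4⟩
  have hlen := length_rayWalk hp hq hpq (s * p, s * q)
  have hi : x + y < (rayWalk p q (s * p, s * q)).length := by omega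
  have hsum := rayWalk_sum (x + y) hi
  obtain ⟨x', y', e, h1', h2', -, -⟩ := mem_rayWalk_spec hp hq hpq (List.getElem_mem hi)
  rw [e] at hsum
  simp only at hsum
  have hxx := crossed_unique (by omega) h1 h2 h1' h2'
  have hyy : y = y' := by omega
  rw [hxx, hyy, ← e]
  exact List.getElem_mem hi

theorem mem_zip_tail {β : Type*} {l : List β} {a b : β} :
    (a, b) ∈ l.zip l.tail ↔ ∃ (i : ℕ) (h : i + 1 < l.length), l[i] = a ∧ l[i + 1] = b := by
  rw [List.mem_iff_getElem]
  constructor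
  · rintro ⟨i, hi, h⟩
    rw [List.getElem_zip, Prod.mk.injEq, List.getElem_tail] at h
    rw [List.length_zip, List.length_tail] at hi
    exact ⟨i, by omega, h⟩
  · rintro ⟨i, hi, h1, h2⟩
    refine ⟨i, by rw [List.length_zip, List.length_tail]; omega, ?_⟩
    rw [List.getElem_zip, Prod.mk.injEq, List.getElem_tail]
    exact ⟨h1, h2⟩

theorem mem_rayWalk_zip {p q : ℕ} {lam a b : ℕ × ℕ} :
    (a, b) ∈ (rayWalk p q lam).zip (rayWalk p q lam).tail ↔
      a ∈ rayWalk p q lam ∧ b ∈ rayWalk p q lam ∧ (b = a + (1, 0) ∨ b = a + (0, 1)) := by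
  rw [mem_zip_tail]
  constructor
  · rintro ⟨i, hi, rfl, rfl⟩
    exact ⟨List.getElem_mem _, List.getElem_mem _, rayWalk_succ hi⟩
  · rintro ⟨ha, hb, hab⟩
    obtain ⟨i, hi, rfl⟩ := List.mem_iff_getElem.1 ha
    obtain ⟨j, hj, rfl⟩ := List.mem_iff_getElem.1 hb
    have h1 := rayWalk_sum i hi
    have h2 := rayWalk_sum j hj
    have : j = i + 1 := by
      rcases hab with h | h <;> rw [h] at h2 <;> simp at h2 <;> omega
    subst this
    exact ⟨i, hj, rfl, rfl⟩

end SingleRay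

end

section

section Walk

/-- Rays of `T` pass strictly below the upper left corner and strictly above the lower right corner
of the unit square at `μ`. -/
def Crossed (T : Set (ℕ × ℕ)) (μ : ℕ × ℕ) : Prop :=
  (∃ β ∈ T, β.2 * μ.1 < β.1 * (μ.2 + 1)) ∧ ∃ β ∈ T, β.1 * μ.2 < β.2 * (μ.1 + 1)

/-- A nonempty set of positive lattice vectors, stable under proportionality. -/
structure IsFan (T : Set (ℕ × ℕ)) : Prop where
  nonempty : T.Nonempty
  pos : ∀ β ∈ T, 0 < β.1 ∧ 0 < β.2
  smul : ∀ β ∈ T, ∀ v : ℕ × ℕ, 0 < v.1 → 0 < v.2 → β.1 * v.2 = β.2 * v.1 → v ∈ T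

variable {T : Set (ℕ × ℕ)}

theorem crossed_singleRay {p q : ℕ} (h : IsSingleRay T p q) (μ : ℕ × ℕ) :
    Crossed T μ ↔ q * μ.1 < p * (μ.2 + 1) ∧ p * μ.2 < q * (μ.1 + 1) := by
  have hT := h.2.2.2
  constructor
  · rintro ⟨⟨β, hβ, h1⟩, β', hβ', h2⟩
    rw [hT] at hβ hβ'
    obtain ⟨s, hs, rfl⟩ := hβ
    obtain ⟨s', hs', rfl⟩ := hβ'
    exact ⟨Nat.lt_of_mul_lt_mul_left (a := s) (by simpa only [mul_assoc] using h1),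
      Nat.lt_of_mul_lt_mul_left (a := s') (by simpa only [mul_assoc] using h2)⟩
  · rintro ⟨h1, h2⟩
    have hm : (p, q) ∈ T := by rw [hT]; exact ⟨1, le_rfl, by simp⟩
    exact ⟨⟨_, hm, h1⟩, _, hm, h2⟩

theorem Crossed.mem_rayWalk {p q : ℕ} (h : IsSingleRay T p q) {μ : ℕ × ℕ} (hμ : Crossed T μ) :
    μ + (1, 1) ∈ rayWalk p q (μ.1 / p * p, μ.1 / p * q) := by
  rw [crossed_singleRay h] at hμ
  obtain ⟨h1, h2⟩ := hμ
  obtain ⟨hp, hq, hpq, -⟩ := h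
  rw [mem_rayWalk_iff hp hq hpq]
  have e := Nat.div_add_mod μ.1 p
  have hm := Nat.mod_lt μ.1 hp
  set s := μ.1 / p
  set x := μ.1 % p
  have h3 : s * q ≤ μ.2 := by
    have : p * (s * q) < p * (μ.2 + 1) := by nlinarith
    have := Nat.lt_of_mul_lt_mul_left this
    omega
  obtain ⟨y, hy⟩ := Nat.exists_eq_add_of_le h3
  rw [hy, ← e] at h1 h2
  refine ⟨x, y, ?_, by nlinarith, by nlinarith, hm, ?_⟩
  · ext
    · simp only [Prod.fst_add]; rw [← e, mul_comm p]
    · simp only [Prod.snd_add]; rw [hy]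
  · have : p * y < p * q := by nlinarith
    exact Nat.lt_of_mul_lt_mul_left this

theorem crossed_of_mem_rayWalk {p q s : ℕ} (h : IsSingleRay T p q) {γ : ℕ × ℕ}
    (hγ : γ ∈ rayWalk p q (s * p, s * q)) : ∃ μ, γ = μ + (1, 1) ∧ Crossed T μ := by
  rw [mem_rayWalk_iff h.1 h.2.1 h.2.2.1] at hγ
  obtain ⟨x, y, rfl, h1, h2, -⟩ := hγ
  refine ⟨(s * p + x, s * q + y), rfl, ?_⟩
  rw [crossed_singleRay h]
  simp only
  constructor <;> nlinarith

theorem IsFan.exists_above (hT : IsFan T) (hns : ¬ ∃ p q, IsSingleRay T p q) {α : ℕ × ℕ}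
    (h1 : 0 < α.1) (h2 : 0 < α.2) : (∃ β ∈ T, Above α β) ∨ ∃ β ∈ T, Above β α := by
  by_contra hc
  push Not at hc
  refine hns ?_
  have hprop : ∀ β ∈ T, β.2 * α.1 = β.1 * α.2 := by
    intro β hβ
    have a1 := hc.1 β hβ
    have a2 := hc.2 β hβ
    rw [Above] at a1 a2
    nlinarith
  obtain ⟨s, w, hs, hw, hcop, hα⟩ := exists_primitive (α := vec α)
    ((forall_iff_of_ne (i₀ := 0) (i₁ := 1) (by decide)).2 ⟨h1, h2⟩)
  have e1 : α.1 = s * w 0 := by simpa using congrFun hα 0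
  have e2 : α.2 = s * w 1 := by simpa using congrFun hα 1
  refine ⟨w 0, w 1, hw 0, hw 1, hcop, ?_⟩
  ext β
  constructor
  · intro hβ
    have h3 := hprop β hβ
    rw [e1, e2] at h3
    have h4 : β.2 * w 0 = β.1 * w 1 := Nat.eq_of_mul_eq_mul_left hs (by linarith)
    obtain ⟨t, ht⟩ : w 0 ∣ β.1 := hcop.dvd_of_dvd_mul_right ⟨β.2, by linarith⟩
    have h5 : β.2 = t * w 1 := Nat.eq_of_mul_eq_mul_left (hw 0) (by rw [ht] at h4; linarith)
    refine ⟨t, ?_, Prod.ext (by rw [ht, mul_comm]) h5⟩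
    have := (hT.pos β hβ).1
    by_contra h0
    obtain rfl : t = 0 := by omega
    omega
  · rintro ⟨t, ht, rfl⟩
    obtain ⟨β, hβ⟩ := hT.nonempty
    have h3 := hprop β hβ
    rw [e1, e2] at h3
    have h4 : β.2 * w 0 = β.1 * w 1 := Nat.eq_of_mul_eq_mul_left hs (by linarith)
    exact hT.smul β hβ _ (Nat.mul_pos ht (hw 0)) (Nat.mul_pos ht (hw 1)) (by simp only; nlinarith)

theorem IsFan.move_iff (hT : IsFan T) (hns : ¬ ∃ p q, IsSingleRay T p q) {α γ : ℕ × ℕ}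
    (h1 : 0 < α.1) (h2 : 0 < α.2) : Move T α γ ↔
      (γ = α + (1, 0) ∧ ∃ β ∈ T, Above α β) ∨ (γ = α + (0, 1) ∧ ∃ β ∈ T, Above β α) := by
  obtain ⟨β₀, hβ₀⟩ := hT.nonempty
  have hex := hT.exists_above hns h1 h2
  constructor
  · intro h
    cases h with
    | inside_right hβ hγ ha hb => exact Or.inl ⟨rfl, _, hβ, ha⟩
    | inside_up hβ hγ ha hb => exact Or.inr ⟨rfl, _, hγ, hb⟩
    | on_top hα hn => exact Or.inl ⟨rfl, hex.resolve_right fun ⟨β, hβ, hb⟩ => hn β hβ hb⟩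
    | above hn => exact Or.inl ⟨rfl, _, hβ₀, hn _ hβ₀⟩
    | on_bottom hα hn => exact Or.inr ⟨rfl, hex.resolve_left fun ⟨β, hβ, hb⟩ => hn β hβ hb⟩
    | below hn => exact Or.inr ⟨rfl, _, hβ₀, hn _ hβ₀⟩
  · rintro (⟨rfl, β, hβ, ha⟩ | ⟨rfl, β, hβ, hb⟩)
    · by_cases hB : ∃ δ ∈ T, Above δ α
      · obtain ⟨δ, hδ, hb⟩ := hB
        exact Move.inside_right hβ hδ ha hb
      · push Not at hB
        by_cases hA : ∀ δ ∈ T, Above α δ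
        · exact Move.above hA
        · push Not at hA
          obtain ⟨δ, hδ, hd⟩ := hA
          have := hB δ hδ
          rw [Above] at this hd
          exact Move.on_top (hT.smul δ hδ α h1 h2 (by nlinarith)) hB
    · by_cases hA : ∃ δ ∈ T, Above α δ
      · obtain ⟨δ, hδ, ha⟩ := hA
        exact Move.inside_up hδ hβ ha hb
      · push Not at hA
        by_cases hB : ∀ δ ∈ T, Above δ α
        · exact Move.below hB
        · push Not at hB
          obtain ⟨δ, hδ, hd⟩ := hB
          have := hA δ hδ
          rw [Above] at this hd
          exact Move.on_bottom (hT.smul δ hδ α h1 h2 (by nlinarith)) hA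

theorem IsFan.crossed_of_reach (hT : IsFan T) (hns : ¬ ∃ p q, IsSingleRay T p q) {γ : ℕ × ℕ}
    (h : Relation.ReflTransGen (Move T) (1, 1) γ) : ∃ μ, γ = μ + (1, 1) ∧ Crossed T μ := by
  induction h with
  | refl =>
    obtain ⟨β, hβ⟩ := hT.nonempty
    have := hT.pos β hβ
    exact ⟨(0, 0), rfl, ⟨β, hβ, by simpa using this.1⟩, β, hβ, by simpa using this.2⟩
  | tail _ hm ih =>
    obtain ⟨μ, rfl, ⟨β, hβ, h1⟩, β', hβ', h2⟩ := ih
    rcases (hT.move_iff hns (by simp) (by simp)).1 hm with ⟨rfl, δ, hδ, h3⟩ | ⟨rfl, δ, hδ, h3⟩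
    · refine ⟨μ + (1, 0), by abel, ⟨δ, hδ, ?_⟩, β', hβ', ?_⟩
      · simpa [Above] using h3
      · simp only [Prod.fst_add, Prod.snd_add]
        nlinarith
    · refine ⟨μ + (0, 1), by abel, ⟨β, hβ, ?_⟩, δ, hδ, ?_⟩
      · simp only [Prod.fst_add, Prod.snd_add]
        nlinarith
      · simpa [Above, mul_comm] using h3

theorem IsFan.reach_of_crossed (hT : IsFan T) (hns : ¬ ∃ p q, IsSingleRay T p q) (n : ℕ) :
    ∀ μ : ℕ × ℕ, μ.1 + μ.2 = n → Crossed T μ →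
      Relation.ReflTransGen (Move T) (1, 1) (μ + (1, 1)) := by
  induction n with
  | zero =>
    rintro ⟨x, y⟩ hn -
    obtain ⟨rfl, rfl⟩ : x = 0 ∧ y = 0 := by simp only at hn; omega
    exact Relation.ReflTransGen.refl
  | succ n ih =>
    rintro ⟨x, y⟩ hn ⟨⟨β, hβ, h1⟩, β', hβ', h2⟩
    simp only at hn h1 h2
    have hright : ∀ x', x = x' + 1 → (∃ δ ∈ T, δ.1 * y < δ.2 * (x' + 1)) →
        Relation.ReflTransGen (Move T) (1, 1) ((x, y) + (1, 1)) := by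
      rintro x' rfl hδ
      refine (ih (x', y) (by simp only; omega) ⟨⟨β, hβ, by simp only; nlinarith⟩, hδ⟩).tail ?_
      exact (hT.move_iff hns (by simp) (by simp)).2 (Or.inl ⟨rfl, β, hβ, h1⟩)
    have hup : ∀ y', y = y' + 1 → (∃ δ ∈ T, δ.2 * x < δ.1 * (y' + 1)) →
        Relation.ReflTransGen (Move T) (1, 1) ((x, y) + (1, 1)) := by
      rintro y' rfl hδ
      refine (ih (x, y') (by simp only; omega) ⟨hδ, ⟨β', hβ', by simp only; nlinarith⟩⟩).tail ?_
      exact (hT.move_iff hns (by simp) (by simp)).2 (Or.inr ⟨rfl, β', hβ', by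
        simpa [Above, mul_comm] using h2⟩)
    rcases Nat.eq_zero_or_pos x with rfl | hx
    · refine hup (y - 1) (by omega) ⟨β, hβ, ?_⟩
      have := (hT.pos β hβ).1
      have := Nat.mul_pos this (show 0 < y - 1 + 1 by omega)
      omega
    rcases Nat.eq_zero_or_pos y with rfl | hy
    · refine hright (x - 1) (by omega) ⟨β, hβ, ?_⟩
      have := (hT.pos β hβ).2
      have := Nat.mul_pos this (show 0 < x - 1 + 1 by omega)
      omega
    rcases hT.exists_above hns (α := (x, y)) hx hy with ⟨δ, hδ, h⟩ | ⟨δ, hδ, h⟩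
    · refine hup (y - 1) (by omega) ⟨δ, hδ, ?_⟩
      rw [Nat.sub_add_cancel hy]
      exact h
    · refine hright (x - 1) (by omega) ⟨δ, hδ, ?_⟩
      rw [Nat.sub_add_cancel hx, mul_comm, mul_comm δ.2]
      simpa [Above, mul_comm] using h

theorem IsFan.mem_walkPoints_iff (hT : IsFan T) {γ : ℕ × ℕ} :
    γ ∈ walkPoints T ↔ ∃ μ, γ = μ + (1, 1) ∧ Crossed T μ := by
  by_cases hs : ∃ p q, IsSingleRay T p q
  · constructor
    · rintro (⟨p, q, s, h, hγ⟩ | ⟨h, -⟩)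
      · exact crossed_of_mem_rayWalk h hγ
      · exact absurd hs h
    · rintro ⟨μ, rfl, hμ⟩
      obtain ⟨p, q, h⟩ := hs
      exact Or.inl ⟨p, q, _, h, hμ.mem_rayWalk h⟩
  · constructor
    · rintro (⟨p, q, s, h, hγ⟩ | ⟨-, h⟩)
      · exact absurd ⟨p, q, h⟩ hs
      · exact hT.crossed_of_reach hs h
    · rintro ⟨μ, rfl, hμ⟩
      exact Or.inr ⟨hs, hT.reach_of_crossed hs _ μ rfl hμ⟩

theorem IsFan.mem_walkEdges_iff (hT : IsFan T) {α γ : ℕ × ℕ} :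
    (α, γ) ∈ walkEdges T ↔ α ∈ walkPoints T ∧ γ ∈ walkPoints T ∧
      (γ = α + (1, 0) ∨ γ = α + (0, 1)) := by
  by_cases hs : ∃ p q, IsSingleRay T p q
  · constructor
    · rintro (⟨p, q, s, h, he⟩ | ⟨h, -⟩)
      · rw [mem_rayWalk_zip] at he
        exact ⟨Or.inl ⟨p, q, s, h, he.1⟩, Or.inl ⟨p, q, s, h, he.2.1⟩, he.2.2⟩
      · exact absurd hs h
    · rintro ⟨ha, hc, hac⟩
      obtain ⟨p, q, h⟩ := hs
      obtain ⟨μ, rfl, hμ⟩ := hT.mem_walkPoints_iff.1 ha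
      obtain ⟨μ', rfl, hμ'⟩ := hT.mem_walkPoints_iff.1 hc
      refine Or.inl ⟨p, q, μ.1 / p, h, mem_rayWalk_zip.2 ⟨hμ.mem_rayWalk h, ?_, hac⟩⟩
      have hw := hμ'.mem_rayWalk h
      suffices μ'.1 / p = μ.1 / p by rwa [this] at hw
      rw [crossed_singleRay h] at hμ hμ'
      have hp := h.1
      have hq := h.2.1
      rcases hac with hac | hac
      · have e : μ' = μ + (1, 0) := by
          simp only [Prod.ext_iff, Prod.fst_add, Prod.snd_add] at hac ⊢
          omega
        rw [e] at hμ' ⊢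
        simp only [Prod.fst_add, Prod.snd_add, add_zero] at hμ' ⊢
        rw [Nat.succ_div, if_neg, add_zero]
        rintro ⟨t, ht⟩
        rw [ht] at hμ hμ'
        have h1 : p * (q * t) < p * (μ.2 + 1) := by linarith [hμ'.1]
        have h2 : p * μ.2 < p * (q * t) := by linarith [hμ.2]
        have := Nat.lt_of_mul_lt_mul_left h1
        have := Nat.lt_of_mul_lt_mul_left h2
        omega
      · have e : μ' = μ + (0, 1) := by
          simp only [Prod.ext_iff, Prod.fst_add, Prod.snd_add] at hac ⊢
          omega
        rw [e]
        simp
  · constructor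
    · rintro (⟨p, q, s, h, he⟩ | ⟨h, ha, hm⟩)
      · exact absurd ⟨p, q, h⟩ hs
      · refine ⟨ha, ?_, ?_⟩
        · rcases ha with ⟨p, q, s, h', -⟩ | ⟨-, hr⟩
          · exact absurd ⟨p, q, h'⟩ hs
          · exact Or.inr ⟨hs, hr.tail hm⟩
        · obtain ⟨μ, hμ, -⟩ := hT.mem_walkPoints_iff.1 ha
          simp only at hμ hm
          subst hμ
          rcases (hT.move_iff hs (by simp) (by simp)).1 hm with h | h
          exacts [Or.inl h.1, Or.inr h.1]
    · rintro ⟨ha, hc, hac⟩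
      refine Or.inr ⟨hs, ha, ?_⟩
      obtain ⟨μ, rfl, hμ⟩ := hT.mem_walkPoints_iff.1 ha
      obtain ⟨μ', hμe, ⟨β, hβ, h1⟩, β', hβ', h2⟩ := hT.mem_walkPoints_iff.1 hc
      refine (hT.move_iff hs (by simp) (by simp)).2 ?_
      rcases hac with rfl | rfl
      · refine Or.inl ⟨rfl, β, hβ, ?_⟩
        simp only [Prod.ext_iff, Prod.fst_add, Prod.snd_add] at hμe
        simp only [Above, Prod.fst_add, Prod.snd_add]
        rwa [show μ'.1 = μ.1 + 1 by omega, show μ'.2 = μ.2 by omega] at h1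
      · refine Or.inr ⟨rfl, β', hβ', ?_⟩
        simp only [Prod.ext_iff, Prod.fst_add, Prod.snd_add] at hμe
        simp only [Above, Prod.fst_add, Prod.snd_add]
        rw [show μ'.1 = μ.1 by omega, show μ'.2 = μ.2 + 1 by omega] at h2
        linarith

theorem IsFan.mem_walkPoints (hT : IsFan T) {α : ℕ × ℕ} (h : α ∈ T) : α ∈ walkPoints T := by
  have hp := hT.pos α h
  refine hT.mem_walkPoints_iff.2 ⟨(α.1 - 1, α.2 - 1), ?_, ⟨α, h, ?_⟩, α, h, ?_⟩
  · ext <;> simp <;> omega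
  · simp only
    rw [Nat.sub_add_cancel hp.2, mul_comm α.2]
    exact Nat.mul_lt_mul_of_pos_right (by omega) hp.2
  · simp only
    rw [Nat.sub_add_cancel hp.1, mul_comm α.1]
    exact Nat.mul_lt_mul_of_pos_right (by omega) hp.1

end Walk

end

section

section Present

variable {k : Type u} [Field k] {f : MvPolynomial (Fin 2) k}

theorem one_le_ord {φ : MvPowerSeries (Fin 2) k} (hφ : φ ≠ 0) (h0 : MvPowerSeries.coeff 0 φ = 0)
    {α : Fin 2 → ℕ} (hα : ∀ i, 0 < α i) : 1 ≤ ord φ α := by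
  refine le_ord hφ fun d hd => ?_
  by_contra hc
  have h1 := Nat.mul_le_mul_right (d 0) (hα 0)
  have h2 := Nat.mul_le_mul_right (d 1) (hα 1)
  simp only [dot] at hc
  refine hd ?_
  rw [show d = 0 from finsupp_ext_of_ne (i₀ := 0) (i₁ := 1) (by decide) (by simp; omega)
    (by simp; omega), h0]

theorem IsNewtonPlaneCurve.isFan (hf : IsNewtonPlaneCurve f) :
    IsFan (trop ↟f) where
  nonempty := by
    obtain ⟨a, ha⟩ := hf.exists_pure 1
    obtain ⟨b, hb⟩ := hf.exists_pure 0
    obtain ⟨β, hβ⟩ := exists_trop (i₀ := 0) (i₁ := 1) (by decide) hf.coeff_zero ha hb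
    exact ⟨(β 0, β 1), mem_trop_iff.2 (by rwa [vec_eta])⟩
  pos β hβ := ⟨(mem_trop_iff.1 hβ).1 0, (mem_trop_iff.1 hβ).1 1⟩
  smul β hβ v h0 h1 h := mem_trop_iff.2 ((mem_trop_iff.1 hβ).smul
    ((forall_iff_of_ne (i₀ := 0) (i₁ := 1) (by decide)).2 ⟨h0, h1⟩) h)

theorem IsNewtonPlaneCurve.crossed_iff (hf : IsNewtonPlaneCurve f) (μ : ℕ × ℕ) :
    Crossed (trop ↟f) μ ↔ ∀ i β, (∀ j, 0 < β j) →
      β + Pi.single i 1 = vec (μ + (1, 1)) →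
        ∀ d, IsMin ↟f β d → 1 ≤ d i := by
  have h01 : (0 : Fin 2) ≠ 1 := by decide
  have hf0 := coe_ne_zero hf.ne_zero
  have key : ∀ i : Fin 2, ∀ j, i ≠ j → ∀ x y, vec μ i = x → vec μ j = y →
      ((∃ β, Trop ↟f β ∧ β j * x < β i * (y + 1)) ↔
        ∀ β, (∀ j, 0 < β j) → β + Pi.single i 1 = vec (μ + (1, 1)) →
        ∀ d, IsMin ↟f β d → 1 ≤ d i) := by
    intro i j hij x y hx hy
    have hv : ∀ l, vec (μ + (1, 1)) l = vec μ l + 1 := fun l => by fin_cases l <;> rfl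
    obtain ⟨a, ha⟩ := hf.exists_pure j
    rcases Nat.eq_zero_or_pos x with rfl | hxp
    · refine iff_of_true ?_ fun β hβ h => ?_
      · obtain ⟨β, hβ⟩ := hf.isFan.nonempty
        refine ⟨vec β, mem_trop_iff.1 hβ, ?_⟩
        rw [mul_zero]
        exact Nat.mul_pos ((mem_trop_iff.1 hβ).1 i) (Nat.succ_pos y)
      · have := congrFun h i
        rw [hv, hx] at this
        simp at this
        have := hβ i
        omega
    · set β : Fin 2 → ℕ := fun l => if l = i then x else y + 1 with hβ
      have hβi : β i = x := by simp [hβ]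
      have hβj : β j = y + 1 := by simp [hβ, hij.symm]
      have hpos : ∀ l, 0 < β l := (forall_iff_of_ne hij).2 ⟨by omega, by omega⟩
      have e := exists_trop_iff hij (α := β) hpos ha
      rw [hβi, hβj] at e
      rw [e]
      constructor
      · intro h β' _ h'
        suffices β' = β by rwa [this]
        refine funext_of_ne hij ?_ ?_
        · have := congrFun h' i
          rw [hv] at this
          simp at this
          omega
        · have := congrFun h' j
          rw [hv] at this
          simp [hij.symm] at this
          omega
      · intro h
        refine h β hpos (funext_of_ne hij ?_ ?_)
        · rw [hv]; simp [hβi, hx]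
        · rw [hv]; simp [hβj, hy, hij.symm]
  rw [forall_iff_of_ne h01, ← key 0 1 h01 _ _ rfl rfl, ← key 1 0 h01.symm _ _ rfl rfl, Crossed]
  refine and_congr ?_ ?_
  · exact ⟨fun ⟨β, hβ, h⟩ => ⟨vec β, mem_trop_iff.1 hβ, h⟩,
      fun ⟨β, hβ, h⟩ => ⟨(β 0, β 1), mem_trop_iff.2 (by rwa [vec_eta]), h⟩⟩
  · exact ⟨fun ⟨β, hβ, h⟩ => ⟨vec β, mem_trop_iff.1 hβ, h⟩,
      fun ⟨β, hβ, h⟩ => ⟨(β 0, β 1), mem_trop_iff.2 (by rwa [vec_eta]), h⟩⟩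

theorem IsNewtonPlaneCurve.mem_points_iff (hf : IsNewtonPlaneCurve f) (γ : ℕ × ℕ) :
    γ ∈ (JSC f).points ↔ (∀ i, 0 < vec γ i) ∧ ∀ i β, (∀ j, 0 < β j) →
      β + Pi.single i 1 = vec γ → ∀ d, IsMin ↟f β d → 1 ≤ d i := by
  refine hf.isFan.mem_walkPoints_iff.trans ⟨?_, ?_⟩
  · rintro ⟨μ, rfl, hμ⟩
    exact ⟨(forall_iff_of_ne (i₀ := 0) (i₁ := 1) (by decide)).2 ⟨by simp, by simp⟩,
      (hf.crossed_iff μ).1 hμ⟩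
  · rintro ⟨hp, h⟩
    have h0 : 0 < γ.1 := hp 0
    have h1 : 0 < γ.2 := hp 1
    have e : γ = (γ.1 - 1, γ.2 - 1) + (1, 1) := by ext <;> simp <;> omega
    exact ⟨_, e, (hf.crossed_iff _).2 (by rwa [← e])⟩

theorem IsNewtonPlaneCurve.weight_add_one (hf : IsNewtonPlaneCurve f) {γ : ℕ × ℕ}
    (hγ : γ ∈ (JSC f).points) :
    (JSC f).weight γ + 1 = ord ↟f (vec γ) := by
  have h1 : (JSC f).weight γ = nu ↟f γ - 1 := if_pos hγ
  rw [h1, nu_eq_ord]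
  exact Nat.sub_add_cancel
    (one_le_ord (coe_ne_zero hf.ne_zero) hf.coeff_zero ((hf.mem_points_iff γ).1 hγ).1)

theorem IsNewtonPlaneCurve.arrows_pos_iff [IsAlgClosed k] (hf : IsNewtonPlaneCurve f) (α : ℕ × ℕ) :
    0 < (JSC f).arrows α ↔ α ∈ trop ↟f := by
  obtain ⟨r, b, hb⟩ := hf.exists_factorization
  have key : 0 < branchCount f α ↔ α ∈ trop ↟f := by
    rw [hb.branchCount_eq hf, Set.ncard_pos (Set.toFinite _), mem_trop_iff, hb.trop_iff hf]
    exact exists_congr fun i => mem_trop_iff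
  by_cases hα : α ∈ (JSC f).points
  · have h1 : (JSC f).arrows α = branchCount f α := if_pos hα
    rw [h1, key]
  · have h1 : (JSC f).arrows α = 0 := if_neg hα
    rw [h1]
    exact iff_of_false (lt_irrefl _) fun h => hα (hf.isFan.mem_walkPoints h)

theorem IsNewtonPlaneCurve.arrowsPresent_iff [IsAlgClosed k] (hf : IsNewtonPlaneCurve f) (m : ℕ) (α : ℕ × ℕ) :
    (JSC f).ArrowsPresent m α ↔ α ∈ trop ↟f ∧
      ord ↟f (vec α) ≤ m := by
  constructor
  · rintro ⟨h1, h2, h3⟩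
    exact ⟨(hf.arrows_pos_iff α).1 h2, by rwa [← hf.weight_add_one h1]⟩
  · rintro ⟨h1, h2⟩
    have h3 : α ∈ (JSC f).points := hf.isFan.mem_walkPoints h1
    exact ⟨h3, (hf.arrows_pos_iff α).2 h1, by rwa [hf.weight_add_one h3]⟩

theorem IsMin.add_single {φ : MvPowerSeries (Fin 2) k} {w : Fin 2 → ℕ} {d : Fin 2 →₀ ℕ}
    (hd : IsMin φ w d) {i : Fin 2} (h0 : d i = 0) : IsMin φ (w + Pi.single i 1) d := by
  obtain ⟨j, hj⟩ : ∃ j : Fin 2, i ≠ j := ⟨1 - i, by fin_cases i <;> decide⟩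
  refine isMin_of_le hd.1 fun e he => ?_
  have h1 := hd.le he
  rw [dot_eq hj, dot_eq hj] at *
  simp [hj.symm, h0] at *
  nlinarith

theorem IsMin.ord_add_single {φ : MvPowerSeries (Fin 2) k} {w : Fin 2 → ℕ} {d : Fin 2 →₀ ℕ}
    (hd : IsMin φ w d) {i : Fin 2} (h0 : d i = 0) : ord φ (w + Pi.single i 1) = ord φ w := by
  obtain ⟨j, hj⟩ : ∃ j : Fin 2, i ≠ j := ⟨1 - i, by fin_cases i <;> decide⟩
  rw [← (hd.add_single h0).2, ← hd.2, dot_eq hj, dot_eq hj]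
  simp [hj.symm, h0]

theorem IsNewtonPlaneCurve.exists_of_not_mem_points (hf : IsNewtonPlaneCurve f) {β : Fin 2 → ℕ}
    (hβ : ∀ j, 0 < β j) (h : (β 0, β 1) ∉ (JSC f).points) {i : Fin 2}
    (hi : ∀ d, IsMin ↟f β d → 1 ≤ d i) {j : Fin 2} (hij : i ≠ j) :
    ∃ lam : Fin 2 → ℕ, (∀ l, 0 < lam l) ∧ lam + Pi.single j 1 = β ∧
      ∃ d, IsMin ↟f lam d ∧ d j = 0 := by
  rw [hf.mem_points_iff, vec_eta, not_and] at h
  have h' := h hβ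
  push Not at h'
  obtain ⟨l, lam, h1, rfl, d, hd, h0⟩ := h'
  rw [Nat.lt_one_iff] at h0
  rcases eq_or_eq_of_ne hij l with rfl | rfl
  · have := hi d (hd.add_single h0)
    omega
  · exact ⟨lam, h1, rfl, d, hd, h0⟩

theorem IsNewtonPlaneCurve.present_iff [IsAlgClosed k] (hf : IsNewtonPlaneCurve f) (m : ℕ)
    (γ : ℕ × ℕ) : (JSC f).Present m γ ↔ Pres ↟f m (vec γ) := by
  have hf0 := coe_ne_zero hf.ne_zero
  have hadj : ∀ i (β : Fin 2 → ℕ), β + Pi.single i 1 = vec γ →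
      (γ = (β 0, β 1) + (1, 0) ∨ γ = (β 0, β 1) + (0, 1)) := by
    intro i β h
    have e0 := congrFun h 0
    have e1 := congrFun h 1
    fin_cases i
    · left; ext <;> simp at e0 e1 ⊢ <;> omega
    · right; ext <;> simp at e0 e1 ⊢ <;> omega
  constructor
  · rintro ⟨h1, h2, h3, h4⟩
    obtain ⟨hpos, hel⟩ := (hf.mem_points_iff γ).1 h1
    have hw := hf.weight_add_one h1
    have hdrawn : ∀ i (β : Fin 2 → ℕ), β + Pi.single i 1 = vec γ →
        (β 0, β 1) ∈ (JSC f).points → ord ↟f β ≤ m := by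
      intro i β h hβ
      have := h3 _ (hf.isFan.mem_walkEdges_iff.2 ⟨hβ, h1, hadj i β h⟩)
      rwa [hf.weight_add_one hβ, vec_eta] at this
    have hdiag : ∀ β, Trop ↟f β → β + 1 = vec γ →
        ord ↟f β + 1 ≤ m := by
      intro β hβ h
      have ht : (β 0, β 1) ∈ trop ↟f :=
        mem_trop_iff.2 (by rwa [vec_eta])
      have hp : (β 0, β 1) ∈ (JSC f).points := hf.isFan.mem_walkPoints ht
      have := h4 _ hp ((hf.arrows_pos_iff _).2 ht) (by
        have e0 := congrFun h 0
        have e1 := congrFun h 1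
        ext <;> simp at e0 e1 ⊢ <;> omega)
      rwa [hf.weight_add_one hp, vec_eta] at this
    have hpred : ∀ i (β : Fin 2 → ℕ), (∀ j, 0 < β j) → β + Pi.single i 1 = vec γ →
        ord ↟f β ≤ m := by
      intro i β hβ h
      by_cases hd : (β 0, β 1) ∈ (JSC f).points
      · exact hdrawn i β h hd
      obtain ⟨j, hj⟩ : ∃ j : Fin 2, i ≠ j := ⟨1 - i, by fin_cases i <;> decide⟩
      obtain ⟨lam, hl, rfl, d, hmin, hd0⟩ := hf.exists_of_not_mem_points hβ hd (hel i β hβ h) hj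
      rw [hmin.ord_add_single hd0]
      have h' : lam + Pi.single i 1 + Pi.single j 1 = vec γ := by rw [← h]; abel
      have hle : lam ≤ (lam + Pi.single i 1 : Fin 2 → ℕ) := le_self_add
      have hδ : ∀ l, 0 < (lam + Pi.single i 1 : Fin 2 → ℕ) l := fun l => (hl l).trans_le (hle l)
      by_cases hd' : ((lam + Pi.single i 1 : Fin 2 → ℕ) 0, (lam + Pi.single i 1 : Fin 2 → ℕ) 1) ∈
          (JSC f).points
      · exact (ord_mono hf0 hle).trans (hdrawn j _ h' hd')
      · obtain ⟨lam', -, he, d', hmin', hd0'⟩ :=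
          hf.exists_of_not_mem_points hδ hd' (hel j _ hδ h') hj.symm
        obtain rfl : lam' = lam := add_right_cancel he
        have hne : d ≠ d' := by
          rintro rfl
          refine hmin.1 ?_
          rw [show d = 0 from finsupp_ext_of_ne hj hd0' hd0, hf.coeff_zero]
        have := hdiag lam' ⟨hl, d, d', hne, hmin, hmin'⟩ (by
          rw [← h]
          refine funext_of_ne hj ?_ ?_
          · simp [hj]
          · simp [hj.symm])
        omega
    refine ⟨hpos, by omega, fun i β hβ h => ⟨hel i β hβ h, hpred i β hβ h⟩, fun β hβ h => ?_⟩
    by_cases ht : Trop ↟f β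
    · exact hdiag β ht h
    obtain ⟨d, hd⟩ := exists_isMin hf0 β
    have huniq : ∀ d', IsMin ↟f β d' → d' = d := by
      intro d' hd'
      by_contra hne
      exact ht ⟨hβ, d', d, hne, hd', hd⟩
    obtain ⟨i, hi⟩ : ∃ i, 1 ≤ d i := by
      by_contra! hc
      refine hd.1 ?_
      rw [show d = 0 from DFunLike.ext _ _ fun i => by have := hc i; simp; omega, hf.coeff_zero]
    obtain ⟨j, hj⟩ : ∃ j : Fin 2, i ≠ j := ⟨1 - i, by fin_cases i <;> decide⟩
    have hlt := (ord_lt_ord_add_single_iff hj hf0 β).2 fun d' hd' => by rwa [huniq d' hd']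
    have hle : β ≤ (β + Pi.single i 1 : Fin 2 → ℕ) := le_self_add
    have := hpred j (β + Pi.single i 1) (fun l => (hβ l).trans_le (hle l)) (by
      rw [← h]
      refine funext_of_ne hj ?_ ?_
      · simp [hj]
      · simp [hj.symm])
    omega
  · intro h
    have h1 : γ ∈ (JSC f).points :=
      (hf.mem_points_iff γ).2 ⟨h.pos, fun i β hβ hγ => (h.pred i β hβ hγ).1⟩
    have hw := hf.weight_add_one h1
    have hlt := h.lt
    refine ⟨h1, by omega, fun α hα => ?_, fun lam hl _ he => ?_⟩
    · obtain ⟨hα, -, hαγ⟩ := hf.isFan.mem_walkEdges_iff.1 hα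
      have hp := ((hf.mem_points_iff α).1 hα).1
      rw [hf.weight_add_one hα]
      rcases hαγ with rfl | rfl
      · exact (h.pred 0 _ hp (funext_of_ne (i₀ := 0) (i₁ := 1) (by decide) (by simp) (by simp))).2
      · exact (h.pred 1 _ hp (funext_of_ne (i₀ := 0) (i₁ := 1) (by decide) (by simp) (by simp))).2
    · have hp := ((hf.mem_points_iff lam).1 hl).1
      have := h.diag _ hp (by subst he; funext l; fin_cases l <;> rfl)
      rw [hf.weight_add_one hl]
      omega

end Present

end

section

section Closed

variable {k : Type u} [Field k] {m : ℕ}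

/-- The generic jet. -/
noncomputable def univSeries (k : Type u) [Field k] (m : ℕ) (i : Fin 2) :
    PowerSeries (MvPolynomial (Fin 2 × Fin (m + 1)) k) :=
  PowerSeries.mk fun j => if h : j < m + 1 then MvPolynomial.X (i, ⟨j, h⟩) else 0

theorem map_univSeries (P : JetSpace k m) (i : Fin 2) :
    PowerSeries.map (MvPolynomial.eval P) (univSeries k m i) = jetSeries P i := by
  ext j
  rw [PowerSeries.coeff_map, univSeries, PowerSeries.coeff_mk, coeff_jetSeries]
  split_ifs <;> simp

theorem eval_coeff_aeval_univSeries (f : MvPolynomial (Fin 2) k) (P : JetSpace k m) (j : ℕ) :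
    MvPolynomial.eval P (coeff j
      (MvPolynomial.aeval (univSeries k m) f : PowerSeries (MvPolynomial (Fin 2 × Fin (m + 1)) k))) =
      coeff j (MvPolynomial.aeval (jetSeries P) f : PowerSeries k) := by
  rw [← PowerSeries.coeff_map]
  congr 1
  rw [MvPolynomial.aeval_def, MvPolynomial.aeval_def, MvPolynomial.eval₂_eq',
    MvPolynomial.eval₂_eq', map_sum]
  refine Finset.sum_congr rfl fun d _ => ?_
  rw [map_mul, map_prod]
  simp only [map_pow, map_univSeries]
  congr 1
  rw [PowerSeries.algebraMap_apply, PowerSeries.map_C]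
  simp

theorem zariskiClosure_jetsAtOrigin (f : MvPolynomial (Fin 2) k) (m : ℕ) :
    zariskiClosure (jetsAtOrigin f m) = jetsAtOrigin f m := by
  refine zariskiClosure_eq_of_forall fun P hP => ?_
  by_cases h0 : ∀ i, coeff 0 (jetSeries P i) = 0
  · have : ¬ ∀ j ≤ m, coeff j (MvPolynomial.aeval (jetSeries P) f : PowerSeries k) = 0 :=
      fun h => hP ⟨h0, h⟩
    push Not at this
    obtain ⟨j, hj, hne⟩ := this
    exact ⟨_, fun Q hQ => by rw [eval_coeff_aeval_univSeries]; exact hQ.2 j hj,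
      by rwa [eval_coeff_aeval_univSeries]⟩
  · push Not at h0
    obtain ⟨i, hi⟩ := h0
    have e : ∀ Q : JetSpace k m, MvPolynomial.eval Q (MvPolynomial.X (i, 0)) =
        coeff 0 (jetSeries Q i) := fun Q => by
      rw [MvPolynomial.eval_X]
      exact (coeff_jetSeries_fin Q i 0).symm
    exact ⟨MvPolynomial.X (i, 0), fun Q hQ => by rw [e]; exact hQ.1 i, by rwa [e]⟩

theorem zariskiClosure_hyp (α : ℕ × ℕ) (m : ℕ) :
    zariskiClosure (hyp α m : Set (JetSpace k m)) = hyp α m := by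
  refine zariskiClosure_eq_of_forall fun P hP => ?_
  rw [mem_hyp_iff_forall] at hP
  push Not at hP
  obtain ⟨c, hc, hne⟩ := hP
  exact ⟨MvPolynomial.X c, fun Q hQ => by
    rw [MvPolynomial.eval_X]; exact mem_hyp_iff_forall.1 hQ c hc, by rwa [MvPolynomial.eval_X]⟩

theorem zariskiClosure_homPart (φ : MvPowerSeries (Fin 2) k) (w : Fin 2 → ℕ) (n : ℕ) :
    zariskiClosure {u : Fin 2 → k | homPart φ w n u = 0} = {u : Fin 2 → k | homPart φ w n u = 0} := by
  have e : ∀ u : Fin 2 → k, MvPolynomial.eval u (∑ d ∈ level w n, MvPolynomial.C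
      (MvPowerSeries.coeff d φ) * (MvPolynomial.X 0 ^ d 0 * MvPolynomial.X 1 ^ d 1)) =
      homPart φ w n u := fun u => by
    rw [map_sum, homPart]
    simp
  exact zariskiClosure_eq_of_forall fun u hu => ⟨_, fun v hv => (e v).trans hv, by rwa [e u]⟩

theorem X_pow_ord_dvd_aeval {f : MvPolynomial (Fin 2) k} {α : Fin 2 → ℕ} (hα : ∀ i, 0 < α i)
    {x : Fin 2 → PowerSeries k} (hx : ∀ i, X ^ α i ∣ x i) :
    X ^ ord ↟f α ∣
      (MvPolynomial.aeval x f : PowerSeries k) := by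
  rw [← MvPowerSeries.subst_coe]
  exact X_pow_dvd_subst hα hx fun d hd => ord_le _ hd

theorem coeff_ord_aeval {f : MvPolynomial (Fin 2) k} {α : Fin 2 → ℕ} (hα : ∀ i, 0 < α i)
    {x : Fin 2 → PowerSeries k} (hx : ∀ i, X ^ α i ∣ x i) :
    coeff (ord ↟f α) (MvPolynomial.aeval x f : PowerSeries k) =
      homPart ↟f α (ord ↟f α)
        (fun i => coeff (α i) (x i)) := by
  rw [← MvPowerSeries.subst_coe]
  exact coeff_subst_eq_homPart hα hx fun d hd => ord_le _ hd

theorem IsSingularAtOrigin.two_le {f : MvPolynomial (Fin 2) k} (h : IsSingularAtOrigin f)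
    (d : Fin 2 →₀ ℕ) (hd : MvPowerSeries.coeff d ↟f ≠ 0) :
    2 ≤ d 0 + d 1 := by
  rw [MvPolynomial.coeff_coe] at hd
  by_contra hc
  have h00 : ∀ p : MvPolynomial (Fin 2) k, MvPolynomial.eval 0 p = p.coeff 0 := fun p => by
    rw [← MvPolynomial.constantCoeff_eq, ← MvPolynomial.eval_zero]
  rcases Nat.eq_zero_or_pos (d 0 + d 1) with h0 | h0
  · refine hd ?_
    rw [show d = 0 from finsupp_ext_of_ne (i₀ := 0) (i₁ := 1) (by decide) (by simp; omega)
      (by simp; omega), ← h00, h.1]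
  · have hs : ∀ i, MvPolynomial.coeff (Finsupp.single i 1) f = 0 := fun i => by
      have := h.2 i
      rw [h00, MvPolynomial.coeff_pderiv] at this
      simpa using this
    rcases Nat.eq_zero_or_pos (d 0) with h1 | h1
    · refine hd ?_
      rw [show d = Finsupp.single 1 1 from finsupp_ext_of_ne (i₀ := 0) (i₁ := 1) (by decide)
        (by simp; omega) (by simp; omega), hs]
    · refine hd ?_
      rw [show d = Finsupp.single 0 1 from finsupp_ext_of_ne (i₀ := 0) (i₁ := 1) (by decide)
        (by simp; omega) (by simp; omega), hs]

theorem le_of_mem_hyp {α γ : ℕ × ℕ} {P : JetSpace k m} (hP : P ∈ hyp γ m) {i : Fin 2}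
    (h : coeff (vec α i) (jetSeries P i) ≠ 0) : vec γ i ≤ vec α i := by
  by_contra hc
  exact h (PowerSeries.X_pow_dvd_iff.1 (mem_hyp_iff.1 hP i) _ (by omega))

theorem hyp_subset_hyp {α γ : ℕ × ℕ} (h : vec γ ≤ vec α) :
    (hyp α m : Set (JetSpace k m)) ⊆ hyp γ m := fun _ hP =>
  mem_hyp_iff.2 fun i => (pow_dvd_pow _ (h i)).trans (mem_hyp_iff.1 hP i)

theorem le_of_hyp_subset {α γ : ℕ × ℕ} (hγ : ∀ i, vec γ i ≤ m + 1)
    (h : (hyp α m : Set (JetSpace k m)) ⊆ hyp γ m) : vec γ ≤ vec α := by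
  intro i
  by_contra! hc
  have hc : vec α i < vec γ i := hc
  have hi := hγ i
  let P : JetSpace k m := fun c => if vec α c.1 ≤ c.2 then 1 else 0
  have hP : P ∈ hyp α m := mem_hyp_iff_forall.2 fun c hc => if_neg (not_le.2 hc)
  refine absurd (le_of_mem_hyp (h hP) (α := α) (i := i) ?_) (not_le.2 hc)
  rw [coeff_jetSeries, dif_pos (by omega)]
  simp [P]

theorem hyp_subset_jetsAtOrigin {f : MvPolynomial (Fin 2) k} {γ : ℕ × ℕ} (hγ : ∀ i, 0 < vec γ i)
    (h : m < ord ↟f (vec γ)) :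
    (hyp γ m : Set (JetSpace k m)) ⊆ jetsAtOrigin f m := fun P hP => by
  rw [mem_hyp_iff] at hP
  exact mem_jetsAtOrigin_iff.2 ⟨fun i => (dvd_pow_self _ (hγ i).ne').trans (hP i),
    (pow_dvd_pow _ h).trans (X_pow_ord_dvd_aeval hγ hP)⟩

theorem onBranch_subset_hyp {f : MvPolynomial (Fin 2) k} {b : MvPowerSeries (Fin 2) k} {α : ℕ × ℕ}
    {n : ℕ} : (onBranch f b α n m : Set (JetSpace k m)) ⊆ hyp α m := fun _ hP => mem_hyp_iff.2 hP.1

theorem closure_onBranch_subset_hyp {f : MvPolynomial (Fin 2) k} {b : MvPowerSeries (Fin 2) k}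
    {α : ℕ × ℕ} {n : ℕ} : zariskiClosure (onBranch f b α n m : Set (JetSpace k m)) ⊆ hyp α m :=
  (zariskiClosure_subset_iff (zariskiClosure_hyp α m)).2 onBranch_subset_hyp

theorem onBranch_subset_jetsAtOrigin {f : MvPolynomial (Fin 2) k} {b : MvPowerSeries (Fin 2) k}
    {α : ℕ × ℕ} (hα : ∀ i, 0 < vec α i) :
    (onBranch f b α (m + 1) m : Set (JetSpace k m)) ⊆ jetsAtOrigin f m := fun _ hP =>
  mem_jetsAtOrigin_iff.2 ⟨fun i => (dvd_pow_self _ (hα i).ne').trans (hP.1 i), hP.2.2.2⟩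

/-- The initial form of a branch vanishes at the leading coefficients, also in the closure. -/
theorem homPart_eq_zero_of_mem_closure {f : MvPolynomial (Fin 2) k} {b : MvPowerSeries (Fin 2) k}
    {α : ℕ × ℕ} {n : ℕ} (hα : ∀ i, vec α i ≤ m) {P : JetSpace k m}
    (hP : P ∈ zariskiClosure (onBranch f b α n m)) : homPart b (vec α) (ord b (vec α))
      (fun i => coeff (vec α i) (jetSeries P i)) = 0 := by
  have e : ∀ Q : JetSpace k m, (fun i => coeff (vec α i) (jetSeries Q i)) =
      fun i => MvPolynomial.eval Q (MvPolynomial.X (R := k)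
        ((i, ⟨vec α i, Nat.lt_succ_iff.2 (hα i)⟩) : Fin 2 × Fin (m + 1))) := fun Q => by
    funext i
    rw [MvPolynomial.eval_X]
    exact coeff_jetSeries_fin Q i ⟨vec α i, Nat.lt_succ_iff.2 (hα i)⟩
  have h := mem_zariskiClosure_of_map (T := {u : Fin 2 → k | homPart b (vec α) (ord b (vec α)) u = 0})
    _ (fun Q (hQ : Q ∈ onBranch f b α n m) => subset_zariskiClosure _ (by
      rw [Set.mem_ofPred_eq, ← e]; exact hQ.2.2.1)) hP
  rw [zariskiClosure_homPart, ← e] at h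
  exact h

theorem nonempty_of_isIrreducibleClosed {σ : Type} {S : Set (σ → k)}
    (h : IsIrreducibleClosed (zariskiClosure S)) : S.Nonempty := by
  by_contra hc
  rw [Set.not_nonempty_iff_eq_empty] at hc
  subst hc
  obtain ⟨P, hP⟩ := h.nonempty
  simpa using mem_zariskiClosure.1 hP 1 (by simp)

theorem IsBranch.trop {b : MvPowerSeries (Fin 2) k} {w : Fin 2 → ℕ}
    {u : Fin 2 → k} (h : IsBranch b w u) : Trop b w := (h.trop_iff w).2 ⟨1, one_pos, by simp⟩

theorem eq_of_subset_of_ringKrullDim_le {σ : Type} {V W : Set (σ → k)} (hW : IsIrreducibleClosed W)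
    (hV : zariskiClosure V = V) (h : V ⊆ W) {d e : ℕ} (hd : ringKrullDim (CoordRing V) = d)
    (he : ringKrullDim (CoordRing W) = e) (hle : e ≤ d) : V = W := by
  by_contra hne
  have h1 := ringKrullDim_add_one_le hW hV h hne
  rw [hd, he] at h1
  have : d + 1 ≤ e := by exact_mod_cast h1
  omega

end Closed

section BranchData

variable {k : Type u} [Field k] {f : MvPolynomial (Fin 2) k} {m : ℕ}

theorem IsNewtonPlaneCurve.exists_isChartRoot (hf : IsNewtonPlaneCurve f)
    {b : MvPowerSeries (Fin 2) k} (hbf : b ∣ ↟f) {w : Fin 2 → ℕ}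
    {u : Fin 2 → k} (h : IsBranch b w u) {i₀ i₁ : Fin 2} (hi : i₀ ≠ i₁) {e : Fin 2 → ℕ}
    (hdet : w i₀ * e i₁ = w i₁ * e i₀ + 1) :
    ∃ c, IsChartRoot f w e c ∧ (∀ x z : k, x ≠ 0 → z ≠ 0 →
      (homPart b w (ord b w) (fun i => x ^ w i * z ^ e i) = 0 ↔ z = c)) ∧
      ∀ {s n m : ℕ} {α : ℕ × ℕ}, 0 < s → vec α = s • w →
      (onBranch f b α n m : Set (JetSpace k m)) = chartSet f w e c s n m := by
  obtain ⟨c, hc, hroot⟩ := h.exists_chart_root hi hdet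
  have hb0 := ne_zero_of_dvd_coe hf.ne_zero hbf
  refine ⟨c, hf.nondegenerate.isChartRoot hf.ne_zero h.pos ?_ hc ?_, hroot, fun hs hα =>
    onBranch_eq_chartSet hb0 h hi hdet hc hroot hs hα⟩
  · have hk : (w i₀ : k) * e i₁ = w i₁ * e i₀ + 1 := by
      rw [← Nat.cast_mul, hdet]; push_cast; rfl
    fin_cases i₀ <;> fin_cases i₁
    · exact absurd rfl hi
    · change (w 0 : k) * e 1 = w 1 * e 0 + 1 at hk
      rw [hk]; simp
    · change (w 1 : k) * e 0 = w 0 * e 1 + 1 at hk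
      rw [hk]; simp
    · exact absurd rfl hi
  · refine homPart_eq_zero_of_dvd (coe_ne_zero hf.ne_zero) hbf h.pos ?_
    have := (hroot 1 c one_ne_zero hc).2 rfl
    simpa using this

variable [IsAlgClosed k]

theorem trop_of_dvd {φ ψ : MvPowerSeries (Fin 2) k} (hψ : ψ ≠ 0) (h : φ ∣ ψ) {w : Fin 2 → ℕ}
    (hw : Trop φ w) : Trop ψ w := by
  obtain ⟨χ, rfl⟩ := h
  exact (trop_mul (left_ne_zero_of_mul hψ) (right_ne_zero_of_mul hψ) w).2 (Or.inl hw)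

theorem IsNewtonPlaneCurve.onBranch_facts (hf : IsNewtonPlaneCurve f)
    {b : MvPowerSeries (Fin 2) k} (hb : Irreducible b) (hbf : b ∣ ↟f)
    {α : ℕ × ℕ} (hα : Trop b (vec α)) {n : ℕ}
    (hn : ord ↟f (vec α) < n) (hnm : n ≤ m + 1) :
    IsIrreducibleClosed (zariskiClosure (onBranch f b α n m : Set (JetSpace k m))) ∧ ∃ d : ℕ,
      ringKrullDim (CoordRing (zariskiClosure (onBranch f b α n m : Set (JetSpace k m)))) = d ∧
      d + n + vec α 0 + vec α 1 = 2 * (m + 1) + ord ↟f (vec α) := by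
  have hi : (0 : Fin 2) ≠ 1 := by decide
  have hf0 := coe_ne_zero hf.ne_zero
  obtain ⟨w, u, h⟩ := hf.exists_isBranch hb hbf
  obtain ⟨s, hs, hs'⟩ := (h.trop_iff _).1 hα
  obtain ⟨e, he⟩ := exists_det hi h.pos h.coprime
  obtain ⟨c, hc, -, hset⟩ := hf.exists_isChartRoot hbf h hi he
  have ho : ord ↟f (vec α) =
      s * ord ↟f w := by rw [hs', ord_smul hf0]
  rw [hset hs hs']
  rw [ho] at hn ⊢
  obtain ⟨h1, d, h2, h3⟩ := chartSet_facts hc hi he hs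
    (M := n - s * ord ↟f w) (by omega) hnm (by omega)
    (fun i => (trop_of_dvd hf0 hbf h.trop).le_ord i)
  refine ⟨h1, d, h2, ?_⟩
  have e0 : vec α 0 = s * w 0 := by rw [hs']; simp
  have e1 : vec α 1 = s * w 1 := by rw [hs']; simp
  omega

end BranchData

end

section

section Components

variable {k : Type u} [Field k] [IsAlgClosed k] {f : MvPolynomial (Fin 2) k} {m r : ℕ}
  {b : Fin r → MvPowerSeries (Fin 2) k}

theorem mem_labels_inl (hf : IsNewtonPlaneCurve f) {γ : ℕ × ℕ} :
    Sum.inl γ ∈ labels f b m ↔ Pres ↟f m (vec γ) := by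
  simp only [labels, Set.mem_ofPred_eq, Sum.inl.injEq, reduceCtorEq, false_and, exists_false,
    or_false, exists_eq_left', hf.present_iff]

theorem mem_labels_inr (hf : IsNewtonPlaneCurve f) (hb : IsFactorization f b) {α : ℕ × ℕ}
    {i : Fin r} : Sum.inr (α, i) ∈ labels f b m ↔
      Trop (b i) (vec α) ∧ ord ↟f (vec α) ≤ m := by
  simp only [labels, Set.mem_ofPred_eq, reduceCtorEq, false_and, exists_false, false_or,
    Sum.inr.injEq, Prod.mk.injEq, hf.arrowsPresent_iff, mem_trop_iff, hb.trop_iff hf]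
  constructor
  · rintro ⟨α', i', ⟨rfl, rfl⟩, ⟨-, h⟩, h'⟩
    exact ⟨h', h⟩
  · rintro ⟨h, h'⟩
    exact ⟨α, i, ⟨rfl, rfl⟩, ⟨⟨i, h⟩, h'⟩, h⟩

theorem component_inr (hf : IsNewtonPlaneCurve f) (hb : IsFactorization f b) {α : ℕ × ℕ}
    {i : Fin r} (h : Sum.inr (α, i) ∈ labels f b m) :
    component f b m (Sum.inr (α, i)) =
      zariskiClosure (onBranch f (b i) α (m + 1) m : Set (JetSpace k m)) := by
  rw [mem_labels_inr hf hb] at h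
  rw [component, contact_eq_onBranch hf (hb.dvd i) h.1.1 h.2]

theorem finite_labels (hf : IsNewtonPlaneCurve f) (hb : IsFactorization f b) :
    (labels f b m).Finite := by
  have hf0 := coe_ne_zero hf.ne_zero
  refine (((Set.finite_Iic (m + 1, m + 1)).image Sum.inl).union
    (((Set.finite_Iic (m, m)).prod (Set.finite_univ (α := Fin r))).image Sum.inr)).subset ?_
  rintro (γ | ⟨α, i⟩) h
  · rw [mem_labels_inl hf] at h
    exact Or.inl ⟨γ, ⟨h.le_add_one hf0 0, h.le_add_one hf0 1⟩, rfl⟩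
  · rw [mem_labels_inr hf hb] at h
    have ht := trop_of_dvd hf0 (hb.dvd i) h.1
    exact Or.inr ⟨(α, i), ⟨⟨(ht.le_ord 0).trans h.2, (ht.le_ord 1).trans h.2⟩, trivial⟩, rfl⟩

theorem isIrreducibleClosed_component (hf : IsNewtonPlaneCurve f) (hb : IsFactorization f b)
    {l : (ℕ × ℕ) ⊕ (ℕ × ℕ) × Fin r} (hl : l ∈ labels f b m) :
    IsIrreducibleClosed (component f b m l) := by
  rcases l with γ | ⟨α, i⟩
  · rw [mem_labels_inl hf] at hl
    exact (hyp_facts fun i => hl.le_add_one (coe_ne_zero hf.ne_zero) i).1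
  · rw [component_inr hf hb hl]
    rw [mem_labels_inr hf hb] at hl
    exact (hf.onBranch_facts (hb.irreducible i) (hb.dvd i) hl.1 (by omega) le_rfl).1

theorem component_subset (hf : IsNewtonPlaneCurve f) (hb : IsFactorization f b)
    {l : (ℕ × ℕ) ⊕ (ℕ × ℕ) × Fin r} (hl : l ∈ labels f b m) :
    component f b m l ⊆ jetsAtOrigin f m := by
  rcases l with γ | ⟨α, i⟩
  · rw [mem_labels_inl hf] at hl
    exact hyp_subset_jetsAtOrigin hl.pos hl.lt
  · rw [component_inr hf hb hl, zariskiClosure_subset_iff (zariskiClosure_jetsAtOrigin f m)]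
    rw [mem_labels_inr hf hb] at hl
    exact onBranch_subset_jetsAtOrigin hl.1.1

/-- The jets that vanish to order `lam + (1, 1)` are limits of jets on a branch through `lam`. -/
theorem IsNewtonPlaneCurve.hyp_subset_closure (hf : IsNewtonPlaneCurve f)
    {c : MvPowerSeries (Fin 2) k} (hc : c ∣ ↟f) {lam : ℕ × ℕ}
    (ht : Trop c (vec lam)) (hm : ord ↟f (vec lam) = m) :
    (hyp (lam + (1, 1)) m : Set (JetSpace k m)) ⊆
      zariskiClosure (onBranch f c lam (m + 1) m) := by
  have hf0 := coe_ne_zero hf.ne_zero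
  intro P hP
  obtain ⟨u, hu, h0⟩ := exists_homPart_eq_zero ht
  have hle : ∀ i, vec lam i ≤ m := fun i => hm ▸ (trop_of_dvd hf0 hc ht).le_ord i
  have hv : ∀ i, vec (lam + (1, 1)) i = vec lam i + 1 := fun i => by fin_cases i <;> rfl
  rw [mem_hyp_iff_forall] at hP
  let Θ : Fin 2 × Fin (m + 1) → MvPolynomial Unit k := fun c => MvPolynomial.C (P c) +
    if (c.2 : ℕ) = vec lam c.1 then MvPolynomial.X () ^ vec lam c.1 * MvPolynomial.C (u c.1) else 0
  have hΘ : ∀ (a : Unit → k) c, MvPolynomial.eval a (Θ c) =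
      P c + if (c.2 : ℕ) = vec lam c.1 then a () ^ vec lam c.1 * u c.1 else 0 := fun a c => by
    simp only [Θ]
    split_ifs <;> simp
  have hcl := param_mem_zariskiClosure Θ (D := MvPolynomial.X ()) (MvPolynomial.X_ne_zero _)
    (S := onBranch f c lam (m + 1) m) (fun a ha => ?_) (fun _ => 0)
  · convert hcl using 1
    funext c
    rw [hΘ, zero_pow (ht.1 c.1).ne', zero_mul, ite_self, add_zero]
  · rw [MvPolynomial.eval_X] at ha
    have h1 : ∀ i, X ^ vec lam i ∣
        jetSeries (fun c => MvPolynomial.eval a (Θ c)) i := mem_hyp_iff.1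
      (mem_hyp_iff_forall.2 fun c hc => by
        rw [hΘ, hP c (by rw [hv]; omega), if_neg (by omega), add_zero])
    have h2 : (fun i => coeff (vec lam i)
        (jetSeries (fun c => MvPolynomial.eval a (Θ c)) i)) =
        fun i => a () ^ vec lam i * u i := by
      funext i
      rw [coeff_jetSeries, dif_pos (Nat.lt_succ_iff.2 (hle i)), hΘ, hP _ (by rw [hv]; simp),
        if_pos rfl, zero_add]
    have h3 := congrFun h2
    refine ⟨h1, fun i => ?_, ?_, ?_⟩
    · rw [h3]
      exact mul_ne_zero (pow_ne_zero _ ha) (hu i)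
    · rw [h2, homPart_smul _ ht.1, h0, mul_zero]
    · have h4 := X_pow_ord_dvd_aeval (f := f) ht.1 h1
      have h5 := coeff_ord_aeval (f := f) ht.1 h1
      rw [h2, homPart_smul _ ht.1, homPart_eq_zero_of_dvd hf0 hc ht.1 h0, mul_zero, hm] at h5
      rw [hm] at h4
      rw [PowerSeries.X_pow_dvd_iff] at h4 ⊢
      intro j hj
      rcases Nat.lt_succ_iff_lt_or_eq.1 hj with hj | rfl
      exacts [h4 j hj, h5]

theorem exists_component_of_mem_hyp (hf : IsNewtonPlaneCurve f) (hb : IsFactorization f b)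
    {P : JetSpace k m} (n : ℕ) : ∀ β : ℕ × ℕ, β.1 + β.2 ≤ n → (∀ i, 0 < vec β i) →
      m < ord ↟f (vec β) → P ∈ hyp β m →
      ∃ l ∈ labels f b m, P ∈ component f b m l := by
  have h01 : (0 : Fin 2) ≠ 1 := by decide
  have hf0 := coe_ne_zero hf.ne_zero
  induction n with
  | zero =>
    intro β hn hβ
    have : 0 < β.1 := hβ 0
    omega
  | succ n ih =>
    intro β hn hβ hlt hP
    by_contra hcon
    have hrec : ∀ lam : Fin 2 → ℕ, (∀ i, 0 < lam i) → lam ≤ vec β → lam ≠ vec β →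
        ¬ m < ord ↟f lam := by
      intro lam hl hle hne hlt'
      refine hcon (ih (lam 0, lam 1) ?_ (by rwa [vec_eta]) (by rwa [vec_eta])
        (hyp_subset_hyp (by rwa [vec_eta]) hP))
      have h0 : lam 0 ≤ β.1 := hle 0
      have h1 : lam 1 ≤ β.2 := hle 1
      have : ¬ (lam 0 = β.1 ∧ lam 1 = β.2) := fun h => hne (funext_of_ne h01 h.1 h.2)
      simp only
      omega
    have hpred : ∀ i (lam : Fin 2 → ℕ), (∀ i, 0 < lam i) → lam + Pi.single i 1 = vec β →
        ord ↟f lam ≤ m := by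
      intro i lam hl h
      refine not_lt.1 (hrec lam hl (by rw [← h]; exact le_self_add) ?_)
      rintro rfl
      have := congrFun h i
      simp at this
    refine hcon ⟨Sum.inl β, (mem_labels_inl hf).2 ⟨hβ, hlt, fun i lam hl h => ⟨?_, hpred i lam hl h⟩,
      fun lam hl h => ?_⟩, hP⟩
    · intro d hd
      by_contra! h0
      have h1 := hpred i lam hl h
      rw [← hd.ord_add_single (Nat.lt_one_iff.1 h0), h] at h1
      omega
    · by_contra! hm
      have hle : lam ≤ vec β := by rw [← h]; exact le_self_add
      have hne : lam ≠ vec β := by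
        rintro rfl
        have := congrFun h 0
        simp at this
      have hm' := hrec lam hl hle hne
      have hordm : ord ↟f lam = m := by omega
      by_cases ht : Trop ↟f lam
      · obtain ⟨i, hi⟩ := (hb.trop_iff hf lam).1 ht
        rw [← vec_eta lam] at hi hordm
        have hl : Sum.inr ((lam 0, lam 1), i) ∈ labels f b m :=
          (mem_labels_inr hf hb).2 ⟨hi, hordm.le⟩
        refine hcon ⟨_, hl, ?_⟩
        rw [component_inr hf hb hl]
        refine hf.hyp_subset_closure (hb.dvd i) hi hordm (hyp_subset_hyp ?_ hP)
        rw [← h]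
        intro i
        fin_cases i <;> exact le_rfl
      · obtain ⟨d, hd⟩ := exists_isMin hf0 lam
        have huniq : ∀ d', IsMin ↟f lam d' → d' = d := by
          intro d' hd'
          by_contra hne
          exact ht ⟨hl, d', d, hne, hd', hd⟩
        obtain ⟨i, hi⟩ : ∃ i, 1 ≤ d i := by
          by_contra! hc
          refine hd.1 ?_
          rw [show d = 0 from DFunLike.ext _ _ fun i => by have := hc i; simp; omega,
            hf.coeff_zero]
        obtain ⟨j, hj⟩ : ∃ j : Fin 2, i ≠ j := ⟨1 - i, by fin_cases i <;> decide⟩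
        have hlt' := (ord_lt_ord_add_single_iff hj hf0 lam).2 fun d' hd' => by rwa [huniq d' hd']
        have hle' : lam ≤ (lam + Pi.single i 1 : Fin 2 → ℕ) := le_self_add
        refine hrec _ (fun l => (hl l).trans_le (hle' l)) ?_ ?_ (hordm ▸ hlt')
        · rw [← h]
          exact (forall_iff_of_ne hj).2 ⟨by simp, by simp [hj.symm]⟩
        · intro he
          rw [← h] at he
          have := congrFun he j
          simp [hj.symm] at this

theorem exists_component_of_mem (hf : IsNewtonPlaneCurve f) (hb : IsFactorization f b)
    {P : JetSpace k m} (hP : P ∈ jetsAtOrigin f m) :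
    ∃ l ∈ labels f b m, P ∈ component f b m l := by
  have hf0 := coe_ne_zero hf.ne_zero
  rw [mem_jetsAtOrigin_iff] at hP
  have hord : ∀ i, ∃ n, 0 < n ∧ X ^ n ∣ jetSeries P i ∧
      (coeff n (jetSeries P i) = 0 → m < n) := by
    intro i
    by_cases h0 : jetSeries P i = 0
    · exact ⟨m + 1, Nat.succ_pos m, by rw [h0]; exact dvd_zero _, fun _ => Nat.lt_succ_self m⟩
    · have hex : ∃ n, coeff n (jetSeries P i) ≠ 0 := by
        by_contra! hc
        exact h0 (PowerSeries.ext hc)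
      classical
      refine ⟨Nat.find hex, ?_, PowerSeries.X_pow_dvd_iff.2 fun j hj => ?_,
        fun h => absurd h (Nat.find_spec hex)⟩
      · rw [Nat.find_pos]
        have := PowerSeries.X_dvd_iff.1 (hP.1 i)
        simpa using this
      · by_contra hc
        exact Nat.find_min hex hj hc
  choose β hβ hdvd hβm using hord
  rcases lt_or_ge m (ord ↟f β) with hlt | hle
  · exact exists_component_of_mem_hyp hf hb _ (β 0, β 1) le_rfl (by rwa [vec_eta])
      (by rwa [vec_eta]) (mem_hyp_iff.2 (by rwa [vec_eta]))
  have hroot : homPart ↟f β (ord ↟f β)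
      (fun i => coeff (β i) (jetSeries P i)) = 0 := by
    rw [← coeff_ord_aeval hβ hdvd]
    exact PowerSeries.X_pow_dvd_iff.1 hP.2 _ (by omega)
  by_cases ht : Trop ↟f β
  · obtain ⟨i, hi⟩ := hb.exists_root hf hβ hroot
    have hne : ∀ i, coeff (β i) (jetSeries P i) ≠ 0 := fun i h => by
      have := hβm i h
      have := ht.le_ord i
      omega
    have hti : Trop (b i) β := trop_of_homPart_eq_zero (hb.irreducible i).ne_zero hβ hne hi
    have hl : Sum.inr ((β 0, β 1), i) ∈ labels f b m :=
      (mem_labels_inr hf hb).2 (by rw [vec_eta]; exact ⟨hti, hle⟩)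
    refine ⟨_, hl, ?_⟩
    rw [component_inr hf hb hl]
    refine subset_zariskiClosure _ ?_
    rw [onBranch, Set.mem_ofPred_eq, vec_eta]
    exact ⟨hdvd, hne, hi, hP.2⟩
  · exfalso
    obtain ⟨d, hd⟩ := exists_isMin hf0 β
    have huniq : ∀ d', IsMin ↟f β d' → d' = d := by
      intro d' hd'
      by_contra hne
      exact ht ⟨hβ, d', d, hne, hd', hd⟩
    rw [homPart, Finset.sum_eq_single d (fun d' hd' hne => ?_)
      (fun h => absurd ((mem_level hβ).2 hd.2) h)] at hroot
    · have h := (mul_eq_zero.1 hroot).resolve_left hd.1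
      have : ∃ i, coeff (β i) (jetSeries P i) = 0 ∧ 1 ≤ d i := by
        rcases mul_eq_zero.1 h with h | h
        · exact ⟨0, not_not.1 fun hc => pow_ne_zero _ hc h,
            Nat.one_le_iff_ne_zero.2 fun h0 => by simp [h0] at h⟩
        · exact ⟨1, not_not.1 fun hc => pow_ne_zero _ hc h,
            Nat.one_le_iff_ne_zero.2 fun h0 => by simp [h0] at h⟩
      obtain ⟨i, hi, hdi⟩ := this
      have h1 := hβm i hi
      obtain ⟨j, hj⟩ : ∃ j : Fin 2, i ≠ j := ⟨1 - i, by fin_cases i <;> decide⟩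
      rw [← hd.2, dot_eq hj] at hle
      nlinarith
    · by_cases hc : MvPowerSeries.coeff d' ↟f = 0
      · rw [hc, zero_mul]
      · exact absurd (huniq d' ⟨hc, (mem_level hβ).1 hd'⟩) hne

theorem onBranch_injective (hf : IsNewtonPlaneCurve f) (hb : IsFactorization f b) {α : ℕ × ℕ}
    (hα : ∀ i, vec α i ≤ m) {n n' : ℕ} {i j : Fin r} {P : JetSpace k m}
    (hP : P ∈ onBranch f (b i) α n m) (hα' : ∀ i, 0 < vec α i)
    (hj : P ∈ zariskiClosure (onBranch f (b j) α n' m)) : i = j :=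
  hb.root_unique hf hα' hP.2.1 hP.2.2.1 (homPart_eq_zero_of_mem_closure hα hj)

theorem component_antichain (hf : IsNewtonPlaneCurve f) (hb : IsFactorization f b)
    (hs : IsSingularAtOrigin f) {l l' : (ℕ × ℕ) ⊕ (ℕ × ℕ) × Fin r} (hl : l ∈ labels f b m)
    (hl' : l' ∈ labels f b m) (h : component f b m l ⊆ component f b m l') : l = l' := by
  have h01 : (0 : Fin 2) ≠ 1 := by decide
  have hf0 := coe_ne_zero hf.ne_zero
  have hcl := (isIrreducibleClosed_component hf hb hl).1
  have hirr := isIrreducibleClosed_component hf hb hl'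
  rcases l with γ | ⟨α, i⟩ <;> rcases l' with γ' | ⟨β, j⟩
  · have hp := (mem_labels_inl hf).1 hl
    have hp' := (mem_labels_inl hf).1 hl'
    have hle : vec γ' ≤ vec γ := le_of_hyp_subset (fun i => hp'.le_add_one hf0 i) h
    by_contra hne
    have hne' : vec γ' ≠ vec γ := fun he => hne (by
      rw [show γ = γ' from Prod.ext (congrFun he 0).symm (congrFun he 1).symm])
    obtain ⟨i, hi⟩ : ∃ i, vec γ' i < vec γ i := by
      by_contra! hc
      exact hne' (le_antisymm hle hc)
    obtain ⟨j, hj⟩ : ∃ j : Fin 2, i ≠ j := ⟨1 - i, by fin_cases i <;> decide⟩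
    obtain ⟨β, -, e0, e1, -, h3⟩ := hp.exists_pred hj (by have := hp'.pos i; omega)
    have h5 : vec γ' i ≤ β i := by omega
    have h6 : vec γ' j ≤ β j := (hle j).trans e1.ge
    have h4 : vec γ' ≤ β := fun l => by rcases eq_or_eq_of_ne hj l with rfl | rfl <;> assumption
    have := (ord_mono hf0 h4).trans h3
    have := hp'.lt
    omega
  · exfalso
    have hp := (mem_labels_inl hf).1 hl
    obtain ⟨ht, hm⟩ := (mem_labels_inr hf hb).1 hl'
    have hle := fun i => (trop_of_dvd hf0 (hb.dvd j) ht).le_ord i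
    rw [component_inr hf hb hl'] at h hirr
    have hβγ : vec β ≤ vec γ := le_of_hyp_subset (fun i => by have := hle i; omega)
      (h.trans closure_onBranch_subset_hyp)
    obtain ⟨-, d, hd, -, hd'⟩ := hyp_facts (k := k) fun i => hp.le_add_one hf0 i
    obtain ⟨hc, e, he, he'⟩ := hf.onBranch_facts (m := m) (hb.irreducible j) (hb.dvd j) ht
      (n := m + 1) (by omega) le_rfl
    obtain ⟨x, hx⟩ := Nat.exists_eq_add_of_le (hβγ 0)
    obtain ⟨y, hy⟩ := Nat.exists_eq_add_of_le (hβγ 1)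
    have hadd := hp.add_le h01 hf0 hs.two_le ht.1 hm hx hy
    have heq' : hyp γ m = _ := eq_of_subset_of_ringKrullDim_le hirr hcl h hd he (by omega)
    obtain ⟨P, hP⟩ := nonempty_of_isIrreducibleClosed hc
    have hPγ : P ∈ hyp γ m := heq' ▸ subset_zariskiClosure _ hP
    have hγβ : vec γ ≤ vec β := fun i => le_of_mem_hyp hPγ (hP.2.1 i)
    have := hp.lt
    rw [le_antisymm hγβ hβγ] at this
    omega
  · exfalso
    have hp' := (mem_labels_inl hf).1 hl'
    obtain ⟨ht, hm⟩ := (mem_labels_inr hf hb).1 hl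
    rw [component_inr hf hb hl] at h
    obtain ⟨hc, -⟩ := hf.onBranch_facts (m := m) (hb.irreducible i) (hb.dvd i) ht
      (n := m + 1) (by omega) le_rfl
    obtain ⟨P, hP⟩ := nonempty_of_isIrreducibleClosed hc
    have hγα : vec γ' ≤ vec α :=
      fun i => le_of_mem_hyp (h (subset_zariskiClosure _ hP)) (hP.2.1 i)
    have := ord_mono hf0 hγα
    have := hp'.lt
    omega
  · obtain ⟨ht, hm⟩ := (mem_labels_inr hf hb).1 hl
    obtain ⟨ht', hm'⟩ := (mem_labels_inr hf hb).1 hl'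
    rw [component_inr hf hb hl, component_inr hf hb hl'] at h
    obtain ⟨hc, d, hd, hd'⟩ := hf.onBranch_facts (m := m) (hb.irreducible i) (hb.dvd i) ht
      (n := m + 1) (by omega) le_rfl
    obtain ⟨hc', e, he, he'⟩ := hf.onBranch_facts (m := m) (hb.irreducible j) (hb.dvd j) ht'
      (n := m + 1) (by omega) le_rfl
    obtain ⟨P, hP⟩ := nonempty_of_isIrreducibleClosed hc
    have hβα : vec β ≤ vec α := fun i =>
      le_of_mem_hyp (closure_onBranch_subset_hyp (h (subset_zariskiClosure _ hP))) (hP.2.1 i)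
    obtain ⟨x, hx⟩ := Nat.exists_eq_add_of_le (hβα 0)
    obtain ⟨y, hy⟩ := Nat.exists_eq_add_of_le (hβα 1)
    have hadd := (trop_of_dvd hf0 (hb.dvd i) ht).add_le_ord h01 hs.two_le hx hy
    have heq' := eq_of_subset_of_ringKrullDim_le hc' (zariskiClosure_idem _) h hd he (by omega)
    obtain ⟨Q, hQ⟩ := nonempty_of_isIrreducibleClosed hc'
    have hαβ : vec α ≤ vec β := fun i => le_of_mem_hyp (closure_onBranch_subset_hyp
      (heq' ▸ subset_zariskiClosure _ hQ)) (hQ.2.1 i)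
    have hv := le_antisymm hαβ hβα
    obtain rfl : α = β := Prod.ext (congrFun hv 0) (congrFun hv 1)
    rw [onBranch_injective hf hb
      (fun i => ((trop_of_dvd hf0 (hb.dvd _) ht).le_ord i).trans hm) hP ht.1
      (h (subset_zariskiClosure _ hP))]

theorem bijOn_component (hf : IsNewtonPlaneCurve f) (hb : IsFactorization f b)
    (hs : IsSingularAtOrigin f) (m : ℕ) :
    Set.BijOn (component f b m) (labels f b m) (irr (jetsAtOrigin f m)) := by
  refine bijOn_irr (finite_labels hf hb) (fun l hl => isIrreducibleClosed_component hf hb hl) ?_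
    fun l hl l' hl' => component_antichain hf hb hs hl hl'
  refine Set.Subset.antisymm (fun P hP => ?_) (Set.iUnion₂_subset fun l hl =>
    component_subset hf hb hl)
  obtain ⟨l, hl, hP⟩ := exists_component_of_mem hf hb hP
  exact Set.mem_biUnion hl hP

end Components

end

section

section JetOf

variable {k : Type u} [Field k] {m : ℕ}

/-- The `m`-jet of an arc. -/
noncomputable def jetOf (m : ℕ) (x : Fin 2 → PowerSeries k) : JetSpace k m :=
  fun c => coeff (c.2 : ℕ) (x c.1)

theorem truncate_eq_jetOf {n : ℕ} (P : JetSpace k m) : truncate n P = jetOf n (jetSeries P) := rfl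

theorem coeff_jetSeries_jetOf (x : Fin 2 → PowerSeries k) (i : Fin 2) (j : ℕ) :
    coeff j (jetSeries (jetOf m x) i) =
      if j < m + 1 then coeff j (x i) else 0 := by
  rw [coeff_jetSeries]
  split_ifs <;> rfl

theorem modX_jetSeries_jetOf (x : Fin 2 → PowerSeries k) (i : Fin 2) :
    modX k (m + 1) (jetSeries (jetOf m x) i) = modX k (m + 1) (x i) :=
  modX_eq_iff_coeff.2 fun j hj => by rw [coeff_jetSeries_jetOf, if_pos hj]

theorem modX_mono {M N : ℕ} (h : M ≤ N) {a b : PowerSeries k} (hab : modX k N a = modX k N b) :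
    modX k M a = modX k M b := by
  rw [modX_eq_iff] at *
  exact (pow_dvd_pow _ h).trans hab

theorem jetOf_jetSeries (P : JetSpace k m) : jetOf m (jetSeries P) = P :=
  funext fun c => coeff_jetSeries_fin P c.1 c.2

theorem truncate_jetOf {n : ℕ} (h : n ≤ m) (x : Fin 2 → PowerSeries k) :
    truncate n (jetOf m x) = jetOf n x := funext fun c => by
  rw [truncate_eq_jetOf]
  change coeff (c.2 : ℕ) (jetSeries (jetOf m x) c.1) = _
  rw [coeff_jetSeries_jetOf, if_pos (by have := c.2.2; omega)]
  rfl

theorem X_pow_dvd_congr {M N : ℕ} (h : M ≤ N) {a b : PowerSeries k}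
    (hab : modX k N a = modX k N b) : X ^ M ∣ a ↔ X ^ M ∣ b := by
  rw [← modX_eq_zero_iff, ← modX_eq_zero_iff, modX_mono h hab]

theorem modX_aeval (f : MvPolynomial (Fin 2) k) {M : ℕ} {x y : Fin 2 → PowerSeries k}
    (h : ∀ i, modX k M (x i) = modX k M (y i)) :
    modX k M (MvPolynomial.aeval x f) = modX k M (MvPolynomial.aeval y f) := by
  rw [MvPolynomial.aeval_def, MvPolynomial.aeval_def, MvPolynomial.eval₂_eq',
    MvPolynomial.eval₂_eq', map_sum, map_sum]
  refine Finset.sum_congr rfl fun d _ => ?_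
  rw [map_mul, map_mul, map_prod, map_prod]
  simp only [map_pow, h]

theorem jetOf_mem_hyp_iff {x : Fin 2 → PowerSeries k} {γ : ℕ × ℕ} (hγ : ∀ i, vec γ i ≤ m + 1) :
    jetOf m x ∈ hyp γ m ↔ ∀ i, X ^ vec γ i ∣ x i := by
  rw [mem_hyp_iff]
  exact forall_congr' fun i => X_pow_dvd_congr (hγ i) (modX_jetSeries_jetOf x i)

theorem jetOf_mem_onBranch_iff {f : MvPolynomial (Fin 2) k} {b : MvPowerSeries (Fin 2) k}
    {x : Fin 2 → PowerSeries k} {α : ℕ × ℕ} {n : ℕ} (hα : ∀ i, vec α i ≤ m) (hn : n ≤ m + 1) :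
    jetOf m x ∈ onBranch f b α n m ↔ (∀ i, X ^ vec α i ∣ x i) ∧
      (∀ i, coeff (vec α i) (x i) ≠ 0) ∧
      homPart b (vec α) (ord b (vec α)) (fun i => coeff (vec α i) (x i)) = 0 ∧
      X ^ n ∣ (MvPolynomial.aeval x f : PowerSeries k) := by
  have e : ∀ i, coeff (vec α i) (jetSeries (jetOf m x) i) =
      coeff (vec α i) (x i) := fun i => by
    rw [coeff_jetSeries_jetOf, if_pos (Nat.lt_succ_iff.2 (hα i))]
  rw [onBranch, Set.mem_ofPred_eq]
  simp only [e]
  rw [X_pow_dvd_congr hn (modX_aeval f (modX_jetSeries_jetOf x))]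
  exact and_congr_left fun _ => forall_congr' fun i =>
    X_pow_dvd_congr ((hα i).trans (Nat.le_succ m)) (modX_jetSeries_jetOf x i)

theorem truncate_mem_onBranch {f : MvPolynomial (Fin 2) k} {b : MvPowerSeries (Fin 2) k}
    {α : ℕ × ℕ} (hα : ∀ i, vec α i ≤ m) {n : ℕ} (hn : m + 1 ≤ n) {Q : JetSpace k (m + 1)}
    (hQ : Q ∈ onBranch f b α n (m + 1)) : truncate m Q ∈ onBranch f b α (m + 1) m := by
  rw [truncate_eq_jetOf, jetOf_mem_onBranch_iff hα le_rfl]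
  exact ⟨hQ.1, hQ.2.1, hQ.2.2.1, (pow_dvd_pow _ hn).trans hQ.2.2.2⟩

theorem truncate_mem_closure {S : Set (JetSpace k (m + 1))} {V : Set (JetSpace k m)}
    (h : ∀ Q ∈ S, truncate m Q ∈ zariskiClosure V) :
    ∀ Q ∈ zariskiClosure S, truncate m Q ∈ zariskiClosure V := by
  let Θ : Fin 2 × Fin (m + 1) → MvPolynomial (Fin 2 × Fin (m + 1 + 1)) k :=
    fun c => MvPolynomial.X (c.1, c.2.castSucc)
  have e : ∀ Q : JetSpace k (m + 1), (fun c => MvPolynomial.eval Q (Θ c)) = truncate m Q := by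
    intro Q
    funext c
    simp only [Θ]
    rw [MvPolynomial.eval_X]
    exact (coeff_jetSeries_fin Q c.1 c.2.castSucc).symm
  intro Q hQ
  rw [← e]
  exact mem_zariskiClosure_of_map Θ (fun P hP => by rw [e]; exact h P hP) hQ

/-- A jet whose truncation is a limit of jets on a branch, is such a limit itself, without a
condition on the top coefficient of `f`. -/
theorem mem_closure_of_truncate_mem {f : MvPolynomial (Fin 2) k} {b : MvPowerSeries (Fin 2) k}
    {α : ℕ × ℕ} (hα : ∀ i, vec α i ≤ m) {Q : JetSpace k (m + 1)}
    (hQ : truncate m Q ∈ zariskiClosure (onBranch f b α (m + 1) m)) :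
    Q ∈ zariskiClosure (onBranch f b α (m + 1) (m + 1)) := by
  let Θ : Fin 2 × Fin (m + 1 + 1) → MvPolynomial (Fin 2 × Fin (m + 1)) k := fun c =>
    if h : (c.2 : ℕ) < m + 1 then MvPolynomial.X (c.1, ⟨c.2, h⟩) else MvPolynomial.C (Q c)
  let y : JetSpace k m → Fin 2 → PowerSeries k := fun P i =>
    jetSeries P i + X ^ (m + 1) * C (Q (i, Fin.last (m + 1)))
  have e : ∀ P : JetSpace k m, (fun c => MvPolynomial.eval P (Θ c)) = jetOf (m + 1) (y P) := by
    intro P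
    funext c
    simp only [Θ, jetOf, y]
    rw [map_add, PowerSeries.coeff_X_pow_mul']
    split_ifs with h h' h'
    · omega
    · rw [MvPolynomial.eval_X, add_zero, coeff_jetSeries, dif_pos h]
    · have hl : c = (c.1, Fin.last (m + 1)) :=
        Prod.ext rfl (Fin.ext (by have := c.2.2; simp; omega))
      have h2 : (c.2 : ℕ) = m + 1 := by rw [hl]; rfl
      rw [MvPolynomial.eval_C, coeff_jetSeries, dif_neg h, zero_add, h2, Nat.sub_self]
      rw [hl]
      simp
    · have := c.2.2
      omega
  have h := mem_zariskiClosure_of_map (T := onBranch f b α (m + 1) (m + 1)) Θ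
    (fun P (hP : P ∈ onBranch f b α (m + 1) m) => subset_zariskiClosure _ (by
      have hy : ∀ i, modX k (m + 1) (y P i) = modX k (m + 1) (jetSeries P i) := fun i => by
        rw [modX_eq_iff]
        simp [y]
      rw [e, jetOf_mem_onBranch_iff (fun i => (hα i).trans (Nat.le_succ m)) (Nat.le_succ _)]
      have hc : ∀ i, coeff (vec α i) (y P i) =
          coeff (vec α i) (jetSeries P i) := fun i =>
        modX_eq_iff_coeff.1 (hy i) _ (Nat.lt_succ_iff.2 (hα i))
      simp only [hc]
      rw [X_pow_dvd_congr le_rfl (modX_aeval f hy)]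
      exact ⟨fun i => (X_pow_dvd_congr ((hα i).trans (Nat.le_succ m)) (hy i)).2 (hP.1 i), hP.2⟩)) hQ
  convert h using 1
  rw [e]
  funext c
  simp only [jetOf, y]
  rw [map_add, PowerSeries.coeff_X_pow_mul', ← coeff_jetSeries_fin Q c.1 c.2, truncate_eq_jetOf,
    coeff_jetSeries_jetOf]
  split_ifs with h h' h'
  · omega
  · rw [add_zero]
  · have hl : c = (c.1, Fin.last (m + 1)) :=
      Prod.ext rfl (Fin.ext (by have := c.2.2; simp; omega))
    have h2 : (c.2 : ℕ) = m + 1 := by rw [hl]; rfl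
    rw [coeff_jetSeries_fin, zero_add, h2, Nat.sub_self]
    rw [hl]
    simp
  · have := c.2.2
    omega

end JetOf

section Smooth

variable {k : Type u} [Field k] {f : MvPolynomial (Fin 2) k} {w e : Fin 2 → ℕ} {c : k}
  {s n m M : ℕ} {i₀ i₁ : Fin 2}

theorem IsChartRoot.eq_of_modX (h : IsChartRoot f w e c) {ξ ξ' ζ ζ' : PowerSeries k}
    (hξ : constantCoeff ξ = 0) (h1 : modX k M ξ' = modX k M ξ)
    (hζ : constantCoeff ζ = c) (hζ' : constantCoeff ζ' = c)
    (h0 : (strict f w e ξ).eval ζ = 0) (h0' : (strict f w e ξ').eval ζ' = 0) :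
    modX k M ζ' = modX k M ζ := by
  rw [modX_eq_iff]
  refine (h.dvd_eval_iff hξ hζ hζ' h0 M).1 ?_
  rw [← modX_eq_zero_iff, ← modX_eval_strict f w e h1, h0', map_zero]

variable [Infinite k]

/-- The closure of the jets on a smooth branch. -/
theorem jetOf_mem_closure_smooth_iff (h : IsChartRoot f w e c) (hi : i₀ ≠ i₁) (hw : w i₀ = 1)
    (he : e i₀ = 0) (he' : e i₁ = 1) (hs : 0 < s) (hM0 : 0 < M) (hnm : n ≤ m + 1)
    (hM : n = s * ord ↟f w + M)
    (hle : ∀ i, w i ≤ ord ↟f w) {x : Fin 2 → PowerSeries k} :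
    jetOf m x ∈ zariskiClosure (chartSet f w e c s n m) ↔ X ^ s ∣ x i₀ ∧
      ∃ ζ, constantCoeff ζ = c ∧ (strict f w e (x i₀)).eval ζ = 0 ∧
        X ^ (s * w i₁ + M) ∣ x i₁ - x i₀ ^ w i₁ * ζ := by
  have hle' : ∀ i, s * w i + M ≤ m + 1 := fun i => by
    refine le_trans ?_ hnm
    rw [hM]
    exact Nat.add_le_add_right (Nat.mul_le_mul_left _ (hle i)) _
  have hl0 := hle' i₀
  have hl1 := hle' i₁
  rw [hw, mul_one] at hl0
  have hb0 : graphBound w s M i₀ i₀ = s := by simp [graphBound]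
  have hb1 : graphBound w s M i₀ i₁ = s * w i₁ + M := by simp [graphBound, hi.symm]
  have hx0 := modX_jetSeries_jetOf (m := m) x i₀
  have hconst : ∀ ξ : PowerSeries k, X ^ s ∣ ξ → constantCoeff ξ = 0 :=
    fun ξ hξ => PowerSeries.X_dvd_iff.1 ((dvd_pow_self _ hs.ne').trans hξ)
  obtain ⟨z, -, hspec, hcl⟩ := exists_graph (m := m) (n := n) h hi hw he he' hs hM0 hnm hM hle
  rw [hcl]
  constructor
  · rintro ⟨a, ha⟩
    have ha : ∀ p, jetOf m x p = _ := fun p => congrFun ha p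
    obtain ⟨s2, s3⟩ := hspec a
    set ζ := PowerSeries.map (MvPolynomial.eval a) z with hζ
    have hPa : ∀ p (h : graphBound w s M i₀ p.1 ≤ p.2), jetOf m x p = a ⟨p, h⟩ := fun p hp => by
      rw [ha, eval_graphJet, dif_pos hp]
    have hd0 : X ^ s ∣ jetSeries (jetOf m x) i₀ := by
      rw [PowerSeries.X_pow_dvd_iff]
      intro j hj
      rw [coeff_jetSeries, dif_pos (by omega), ha]
      rw [eval_graphJet, dif_neg (by simp only; omega), if_pos rfl]
    have hmap := map_graphSeries a hPa hd0
    have hd : X ^ s ∣ x i₀ := (X_pow_dvd_congr (by omega) hx0).1 hd0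
    obtain ⟨ζ₀, hζ₀, h0⟩ := h.exists_root (hconst _ hd)
    have hζ₀ : constantCoeff ζ₀ = c := hζ₀
    refine ⟨hd, ζ₀, hζ₀, h0, ?_⟩
    rw [hmap] at s3
    have e1 := h.eq_of_modX (hconst _ hd) hx0 hζ₀ s2 h0 s3
    rw [← modX_eq_iff, modX_eq_iff_coeff]
    intro j hj
    have hval : coeff j (x i₁) = jetOf m x (i₁, ⟨j, by omega⟩) := rfl
    rw [hval, ha, eval_graphJet, dif_neg (by simp only; omega), if_neg hi.symm, hmap, ← hζ]
    refine modX_eq_iff_coeff.1 ?_ j (show j < m + 1 by omega)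
    rw [map_mul, map_mul, map_pow, map_pow, hx0, e1]
  · rintro ⟨hd, ζ₀, hζ₀, h0, hdvd⟩
    let a : GraphIdx w s m M i₀ → k := fun p => jetOf m x p.1
    refine ⟨a, funext ?_⟩
    obtain ⟨s2, s3⟩ := hspec a
    have hd0 : X ^ s ∣ jetSeries (jetOf m x) i₀ :=
      (X_pow_dvd_congr (by omega) hx0).2 hd
    have hmap := map_graphSeries a (fun _ _ => rfl) hd0
    rw [hmap] at s3
    have e1 := h.eq_of_modX (hconst _ hd) hx0 hζ₀ s2 h0 s3
    rw [← modX_eq_iff, modX_eq_iff_coeff] at hdvd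
    rintro ⟨i, j⟩
    rw [eval_graphJet]
    split_ifs with h1 h2
    · rfl
    · simp only at h1 h2
      subst h2
      rw [hb0] at h1
      exact PowerSeries.X_pow_dvd_iff.1 hd _ (not_le.1 h1)
    · simp only at h1 h2
      obtain rfl : i = i₁ := (eq_or_eq_of_ne hi i).resolve_left h2
      have h1' : ¬ s * w i + M ≤ j := fun hh => h1 (hb1.trans_le hh)
      change coeff (j : ℕ) (x i) = _
      rw [hdvd j (not_le.1 h1'), hmap]
      refine (modX_eq_iff_coeff.1 ?_ j j.2).symm
      rw [map_mul, map_mul, map_pow, map_pow, hx0, e1]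

theorem embDim_closure_smooth (h : IsChartRoot f w e c) (hi : i₀ ≠ i₁) (hw : w i₀ = 1)
    (he : e i₀ = 0) (he' : e i₁ = 1) (hs : 0 < s) (hM0 : 0 < M) (hnm : n ≤ m + 1)
    (hM : n = s * ord ↟f w + M)
    (hle : ∀ i, w i ≤ ord ↟f w) {d : ℕ}
    (hd : ringKrullDim (CoordRing (zariskiClosure (chartSet f w e c s n m))) = d) :
    embDim (zariskiClosure (chartSet f w e c s n m)) = d := by
  obtain ⟨z, -, -, hcl⟩ := exists_graph (m := m) (n := n) h hi hw he he' hs hM0 hnm hM hle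
  obtain ⟨-, h1, h2⟩ := graph_facts (k := k) (σ := Fin 2 × Fin (m + 1))
    (fun i : GraphIdx w s m M i₀ => i.1) (graphJet z) (fun i => by rw [graphJet, dif_pos i.2]) hcl
  rw [h1] at hd
  rw [h2]
  exact_mod_cast hd

end Smooth

end

section

variable {k : Type u} [Field k] {m : ℕ} {f : MvPolynomial (Fin 2) k}

/-- A set of jets of order `γ`, containing a jet of exact order `γ`, lies over `H^δ` if and only if
`δ ≤ γ`. -/
theorem truncate_mem_hyp_iff {S : Set (JetSpace k (m + 1))} {γ δ : ℕ × ℕ} (hδ : ∀ i, vec δ i ≤ m + 1)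
    (hS : S ⊆ hyp γ (m + 1)) {x : Fin 2 → PowerSeries k} (hx : jetOf (m + 1) x ∈ S)
    (hc : ∀ i, coeff (vec γ i) (x i) ≠ 0) :
    (∀ P ∈ S, truncate m P ∈ hyp δ m) ↔ vec δ ≤ vec γ := by
  constructor
  · intro h i
    have h1 := h _ hx
    rw [truncate_jetOf (Nat.le_succ m), jetOf_mem_hyp_iff hδ] at h1
    by_contra hlt
    exact hc i (PowerSeries.X_pow_dvd_iff.1 (h1 i) _ (not_le.1 hlt))
  · intro h P hP
    rw [truncate_eq_jetOf, jetOf_mem_hyp_iff hδ]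
    exact fun i => (pow_dvd_pow _ (h i)).trans (mem_hyp_iff.1 (hS hP) i)

theorem truncate_hyp_mem_hyp_iff {γ δ : ℕ × ℕ} (hδ : ∀ i, vec δ i ≤ m + 1)
    (hγ : ∀ i, vec γ i ≤ m + 1 + 1) :
    (∀ P ∈ (hyp γ (m + 1) : Set (JetSpace k (m + 1))), truncate m P ∈ hyp δ m) ↔
      vec δ ≤ vec γ :=
  truncate_mem_hyp_iff hδ subset_rfl (x := fun i => X ^ vec γ i)
    ((jetOf_mem_hyp_iff hγ).2 fun i => dvd_rfl) fun i => by simp [PowerSeries.coeff_X_pow]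

theorem truncate_onBranch_mem_hyp_iff {b : MvPowerSeries (Fin 2) k} {β δ : ℕ × ℕ} {n : ℕ}
    (hδ : ∀ i, vec δ i ≤ m + 1)
    (hb : IsIrreducibleClosed (zariskiClosure (onBranch f b β n (m + 1)))) :
    (∀ P ∈ zariskiClosure (onBranch f b β n (m + 1)), truncate m P ∈ hyp δ m) ↔
      vec δ ≤ vec β := by
  obtain ⟨P, hP⟩ := nonempty_of_isIrreducibleClosed hb
  refine truncate_mem_hyp_iff hδ closure_onBranch_subset_hyp (x := jetSeries P) ?_ hP.2.1
  rw [jetOf_jetSeries]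
  exact subset_zariskiClosure _ hP

theorem IsBranch.homPart_smul_eq {b : MvPowerSeries (Fin 2) k} {w : Fin 2 → ℕ} {u : Fin 2 → k}
    (hb0 : b ≠ 0) (h : IsBranch b w u) {s : ℕ} (hs : 0 < s) (v : Fin 2 → k) :
    homPart b (s • w) (ord b (s • w)) v = homPart b w (ord b w) v := by
  rw [ord_smul hb0, homPart_smul_weight b h.pos hs]

theorem le_of_X_pow_dvd_mul {N n : ℕ} {a : PowerSeries k} (ha : constantCoeff a ≠ 0)
    (h : X ^ N ∣ X ^ n * a) : N ≤ n := by
  by_contra hlt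
  have := PowerSeries.X_pow_dvd_iff.1 h n (not_le.1 hlt)
  rw [PowerSeries.coeff_X_pow_mul', if_pos le_rfl, Nat.sub_self] at this
  exact ha (by simpa using this)

theorem le_of_X_pow_dvd_X_pow {N n : ℕ} (h : (X : PowerSeries k) ^ N ∣ X ^ n) :
    N ≤ n :=
  le_of_X_pow_dvd_mul (a := (1 : PowerSeries k)) (by rw [map_one]; exact one_ne_zero)
    (by rwa [mul_one])

section Smooth

variable [IsAlgClosed k]

/-- Equations of the closures of the jets on a smooth branch. -/
theorem IsNewtonPlaneCurve.exists_smooth (hf : IsNewtonPlaneCurve f) {b : MvPowerSeries (Fin 2) k}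
    (hbf : b ∣ ↟f) {w : Fin 2 → ℕ} {u : Fin 2 → k} (h : IsBranch b w u)
    {i₀ i₁ : Fin 2} (hi : i₀ ≠ i₁) (hw : w i₀ = 1) :
    ∃ (c : k) (Z : PowerSeries k → PowerSeries k), c ≠ 0 ∧
      (∀ v : Fin 2 → k, v i₀ ≠ 0 → v i₁ ≠ 0 → v i₁ = v i₀ ^ w i₁ * c →
        homPart b w (ord b w) v = 0) ∧
      (∀ ξ, X ∣ ξ → constantCoeff (Z ξ) = c) ∧
      ∀ {m s : ℕ} {α : ℕ × ℕ} {x : Fin 2 → PowerSeries k}, 0 < s → vec α = s • w →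
        ord ↟f (vec α) ≤ m →
        (jetOf m x ∈ zariskiClosure (onBranch f b α (m + 1) m) ↔ X ^ s ∣ x i₀ ∧
          X ^ (s * w i₁ + (m + 1 - ord ↟f (vec α))) ∣
            x i₁ - x i₀ ^ w i₁ * Z (x i₀)) := by
  have hf0 := coe_ne_zero hf.ne_zero
  let e : Fin 2 → ℕ := Pi.single i₁ 1
  have he : e i₀ = 0 := by simp [e, hi]
  have he' : e i₁ = 1 := by simp [e]
  obtain ⟨c, hc, hroot, hset⟩ := hf.exists_isChartRoot hbf h hi (e := e) (by rw [hw, he, he', mul_zero])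
  have hZ : ∀ ξ : PowerSeries k, ∃ ζ : PowerSeries k, X ∣ ξ →
      constantCoeff ζ = c ∧ (strict f w e ξ).eval ζ = 0 := fun ξ => by
    by_cases hξ : X ∣ ξ
    · obtain ⟨ζ, h1, h2⟩ := hc.exists_root (PowerSeries.X_dvd_iff.1 hξ)
      exact ⟨ζ, fun _ => ⟨h1, h2⟩⟩
    · exact ⟨0, fun h => absurd h hξ⟩
  choose Z hZ using hZ
  refine ⟨c, Z, hc.ne_zero, fun v h0 h1 hv => ?_, fun ξ hξ => (hZ ξ hξ).1, ?_⟩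
  · have : v = fun i => v i₀ ^ w i * c ^ e i :=
      funext_of_ne hi (by simp [hw, he]) (by simpa [he'] using hv)
    rw [this]
    exact (hroot _ _ h0 hc.ne_zero).2 rfl
  · intro m s α x hs hα hm
    have e1 : ord ↟f (vec α) =
        s * ord ↟f w := by rw [hα, ord_smul hf0]
    rw [hset hs hα, jetOf_mem_closure_smooth_iff hc hi hw he he' hs (Nat.sub_pos_of_lt
      (Nat.lt_succ_of_le hm)) le_rfl (by rw [← e1]; omega)
      fun i => (trop_of_dvd hf0 hbf h.trop).le_ord i]
    refine and_congr_right fun hd => ?_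
    have hd' : X ∣ x i₀ := (dvd_pow_self _ hs.ne').trans hd
    constructor
    · rintro ⟨ζ, h1, h2, h3⟩
      rwa [hc.root_unique (PowerSeries.X_dvd_iff.1 hd') h1 (hZ _ hd').1 h2 (hZ _ hd').2]
    · exact fun h3 => ⟨_, (hZ _ hd').1, (hZ _ hd').2, h3⟩

variable {r : ℕ} {b : Fin r → MvPowerSeries (Fin 2) k} {w : Fin 2 → ℕ} {u : Fin 2 → k} {i : Fin r}
  {i₀ i₁ : Fin 2} {s : ℕ} {α : ℕ × ℕ}

/-- The edges from a smooth branch to a coordinate subspace. -/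
theorem truncate_hyp_mem_smooth_iff (hf : IsNewtonPlaneCurve f) (hb : IsFactorization f b)
    (h : IsBranch (b i) w u) (hi : i₀ ≠ i₁) (hw : w i₀ = 1) (hs : 0 < s) (hα : vec α = s • w)
    (hm : ord ↟f (vec α) ≤ m) {γ : ℕ × ℕ}
    (hγ : ∀ i, vec γ i ≤ m + 1 + 1) (hγ0 : ∀ i, 0 < vec γ i) :
    (∀ P ∈ (hyp γ (m + 1) : Set (JetSpace k (m + 1))),
      truncate m P ∈ zariskiClosure (onBranch f (b i) α (m + 1) m)) ↔ s ≤ vec γ i₀ ∧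
      s * w i₁ + (m + 1 - ord ↟f (vec α)) ≤ vec γ i₁ ∧
      s * w i₁ + (m + 1 - ord ↟f (vec α)) ≤ vec γ i₀ * w i₁ := by
  obtain ⟨c, Z, hc, -, hZ, hcl⟩ := hf.exists_smooth (hb.dvd i) h hi hw
  set N := s * w i₁ + (m + 1 - ord ↟f (vec α))
  have hX : ∀ i, (X : PowerSeries k) ∣ X ^ vec γ i := fun i =>
    dvd_pow_self _ (hγ0 i).ne'
  constructor
  · intro hE
    have key : ∀ x : Fin 2 → PowerSeries k, (∀ i, X ^ vec γ i ∣ x i) →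
        X ^ s ∣ x i₀ ∧ X ^ N ∣ x i₁ - x i₀ ^ w i₁ * Z (x i₀) := by
      intro x hx
      have := hE _ ((jetOf_mem_hyp_iff hγ).2 hx)
      rwa [truncate_jetOf (Nat.le_succ m), hcl hs hα hm] at this
    have h1 := key (Pi.single i₀ (X ^ vec γ i₀)) ((forall_iff_of_ne hi).2
      ⟨by simp, by simp [hi.symm]⟩)
    have h2 := key (Pi.single i₁ (X ^ vec γ i₁)) ((forall_iff_of_ne hi).2
      ⟨by simp [hi], by simp⟩)
    simp only [Pi.single_eq_same, Pi.single_eq_of_ne hi, Pi.single_eq_of_ne hi.symm, zero_sub,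
      dvd_neg, ← pow_mul, zero_pow (h.pos i₁).ne', zero_mul, sub_zero] at h1 h2
    refine ⟨le_of_X_pow_dvd_X_pow h1.1,
      le_of_X_pow_dvd_X_pow h2.2,
      le_of_X_pow_dvd_mul (by rwa [hZ _ (hX i₀)]) h1.2⟩
  · rintro ⟨h1, h2, h3⟩ P hP
    rw [mem_hyp_iff] at hP
    rw [truncate_eq_jetOf, hcl hs hα hm]
    refine ⟨(pow_dvd_pow _ h1).trans (hP i₀), dvd_sub ((pow_dvd_pow _ h2).trans (hP i₁))
      (Dvd.dvd.mul_right ((pow_dvd_pow _ h3).trans ?_) _)⟩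
    rw [pow_mul]
    exact pow_dvd_pow_of_dvd (hP i₀) _

/-- The edges from a smooth branch to a branch. -/
theorem truncate_onBranch_mem_smooth_iff (hf : IsNewtonPlaneCurve f) (hb : IsFactorization f b)
    (h : IsBranch (b i) w u) (hi : i₀ ≠ i₁) (hw : w i₀ = 1) (hs : 0 < s) (hα : vec α = s • w)
    (hm : ord ↟f (vec α) ≤ m) {β : ℕ × ℕ} {j : Fin r}
    (hβ : Trop (b j) (vec β)) (hm' : ord ↟f (vec β) ≤ m + 1) :
    (∀ P ∈ zariskiClosure (onBranch f (b j) β (m + 1 + 1) (m + 1)),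
      truncate m P ∈ zariskiClosure (onBranch f (b i) α (m + 1) m)) ↔ s ≤ vec β i₀ ∧
      (s * w i₁ + (m + 1 - ord ↟f (vec α)) ≤ vec β i₁ ∧
        s * w i₁ + (m + 1 - ord ↟f (vec α)) ≤ vec β i₀ * w i₁ ∨
      i = j ∧ s * w i₁ + (m + 1 - ord ↟f (vec α)) ≤
        vec β i₁ + (m + 1 + 1 - ord ↟f (vec β))) := by
  obtain ⟨c, Z, hc, hroot, hZ, hcl⟩ := hf.exists_smooth (hb.dvd i) h hi hw
  set N := s * w i₁ + (m + 1 - ord ↟f (vec α))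
  set M := m + 1 + 1 - ord ↟f (vec β) with hM
  have hsmul : i = j → vec β = vec β i₀ • w := by
    rintro rfl
    obtain ⟨t, -, ht⟩ := (h.trop_iff _).1 hβ
    rw [ht]
    simp [hw]
  constructor
  · intro hE
    obtain ⟨P, hP⟩ := nonempty_of_isIrreducibleClosed
      (hf.onBranch_facts (hb.irreducible j) (hb.dvd j) hβ (Nat.lt_succ_of_le hm') le_rfl).1
    obtain ⟨h1, h2⟩ := (hcl hs hα hm).1 (hE P (subset_zariskiClosure _ hP))
    have hc0 : s ≤ vec β i₀ := by
      by_contra hlt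
      exact hP.2.1 i₀ (PowerSeries.X_pow_dvd_iff.1 h1 _ (not_le.1 hlt))
    refine ⟨hc0, ?_⟩
    obtain ⟨U, hU⟩ := hP.1 i₀
    obtain ⟨V, hV⟩ := hP.1 i₁
    have hU0 := hP.2.1 i₀
    have hV0 := hP.2.1 i₁
    have hUc := coeff_pow_of_X_pow_dvd hU
    have hVc := coeff_pow_of_X_pow_dvd hV
    have hXd : X ∣ jetSeries P i₀ := by
      rw [hU]; exact Dvd.dvd.mul_right (dvd_pow_self _ (hs.trans_le hc0).ne') _
    have hY : ∀ n, coeff n (jetSeries P i₀ ^ w i₁ * Z (jetSeries P i₀)) =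
        if vec β i₀ * w i₁ ≤ n then coeff (n - vec β i₀ * w i₁)
          (U ^ w i₁ * Z (jetSeries P i₀)) else 0 := fun n => by
      conv_lhs => rw [hU, mul_pow, ← pow_mul, mul_assoc, ← hU]
      rw [PowerSeries.coeff_X_pow_mul']
    have hV' : ∀ n, coeff n (jetSeries P i₁) =
        if vec β i₁ ≤ n then coeff (n - vec β i₁) V else 0 := fun n => by
      rw [hV, PowerSeries.coeff_X_pow_mul']
    have hcoef : ∀ n < N, coeff n (jetSeries P i₁) =
        coeff n (jetSeries P i₀ ^ w i₁ * Z (jetSeries P i₀)) := fun n hn =>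
      sub_eq_zero.1 (by rw [← map_sub]; exact PowerSeries.X_pow_dvd_iff.1 h2 n hn)
    have hne : constantCoeff (U ^ w i₁ * Z (jetSeries P i₀)) =
        coeff (vec β i₀) (jetSeries P i₀) ^ w i₁ * c := by
      rw [map_mul, map_pow, hZ _ hXd, hUc]
    by_cases hlt : N ≤ vec β i₁ ∧ N ≤ vec β i₀ * w i₁
    · exact Or.inl hlt
    have heq : vec β i₁ = vec β i₀ * w i₁ := by
      rcases lt_trichotomy (vec β i₁) (vec β i₀ * w i₁) with h3 | h3 | h3
      · have := hcoef (vec β i₁) (by omega)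
        rw [hY, if_neg (not_le.2 h3)] at this
        exact absurd this hV0
      · exact h3
      · have := hcoef (vec β i₀ * w i₁) (by omega)
        rw [hY, hV', if_neg (not_le.2 h3), if_pos le_rfl, Nat.sub_self,
          PowerSeries.coeff_zero_eq_constantCoeff_apply, hne] at this
        exact absurd this.symm (mul_ne_zero (pow_ne_zero _ hU0) hc)
    have hβw : vec β = vec β i₀ • w := funext_of_ne hi (by simp [hw]) (by simpa using heq)
    have hij : i = j := by
      refine hb.root_unique hf hβ.1 hP.2.1 ?_ hP.2.2.1
      have hlead := hcoef (vec β i₁) (by omega)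
      rw [hY, if_pos heq.ge, heq, Nat.sub_self, PowerSeries.coeff_zero_eq_constantCoeff_apply, hne,
        ← heq] at hlead
      have := hroot (fun l => coeff (vec β l) (jetSeries P l)) hU0 hV0 hlead
      rw [← h.homPart_smul_eq (hb.irreducible i).ne_zero (hβ.1 i₀), ← hβw] at this
      exact this
    refine Or.inr ⟨hij, ?_⟩
    subst hij
    let x : Fin 2 → PowerSeries k := fun l => if l = i₀ then X ^ vec β i₀ else
      (X ^ vec β i₀) ^ w i₁ * Z (X ^ vec β i₀) +
        X ^ (vec β i₀ * w i₁ + M)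
    have hx0 : x i₀ = X ^ vec β i₀ := if_pos rfl
    have hx1 : x i₁ = x i₀ ^ w i₁ * Z (x i₀) + X ^ (vec β i₀ * w i₁ + M) := by
      rw [hx0]; exact if_neg hi.symm
    have hx := hE _ ((hcl (x := x) (hβ.1 i₀) hβw hm').2 (by
      rw [← hM, hx1, add_sub_cancel_left, hx0]; exact ⟨dvd_rfl, dvd_rfl⟩))
    rw [truncate_jetOf (Nat.le_succ m), hcl hs hα hm, hx1, add_sub_cancel_left] at hx
    rw [heq]
    exact le_of_X_pow_dvd_X_pow hx.2
  · rintro ⟨h1, h2⟩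
    refine truncate_mem_closure fun P hP => ?_
    rw [truncate_eq_jetOf, hcl hs hα hm]
    refine ⟨(pow_dvd_pow _ h1).trans (hP.1 i₀), ?_⟩
    rcases h2 with ⟨h2, h3⟩ | ⟨rfl, h2⟩
    · refine dvd_sub ((pow_dvd_pow _ h2).trans (hP.1 i₁))
        (Dvd.dvd.mul_right ((pow_dvd_pow _ h3).trans ?_) _)
      rw [pow_mul]
      exact pow_dvd_pow_of_dvd (hP.1 i₀) _
    · have h3 := (hcl (x := jetSeries P) (hβ.1 i₀) (hsmul rfl) hm').1 (by
        rw [jetOf_jetSeries]; exact subset_zariskiClosure _ hP)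
      refine (pow_dvd_pow _ ?_).trans h3.2
      have h4 : vec β i₁ = vec β i₀ * w i₁ := congrFun (hsmul rfl) i₁
      rw [h4] at h2
      exact h2

end Smooth

end

section

variable {k : Type u} [Field k] {m : ℕ} {f : MvPolynomial (Fin 2) k}

theorem Trop.mul_le_ord {φ : MvPowerSeries (Fin 2) k} {w : Fin 2 → ℕ} (h : Trop φ w)
    (hcop : (w 0).Coprime (w 1)) : w 0 * w 1 ≤ ord φ w := by
  obtain ⟨hw, d, d', hne, hd, hd'⟩ := h
  have key : ∀ d d' : Fin 2 →₀ ℕ, IsMin φ w d → IsMin φ w d' → d' 0 < d 0 →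
      w 0 * w 1 ≤ ord φ w := by
    intro d d' hd hd' hlt
    obtain ⟨a, ha⟩ := Nat.exists_eq_add_of_lt hlt
    have e : w 0 * (a + 1) + w 1 * d 1 = w 1 * d' 1 := by
      have h1 := hd.2.trans hd'.2.symm
      simp only [dot] at h1
      rw [ha] at h1
      linarith
    have h2 : w 1 ∣ w 0 * (a + 1) :=
      (Nat.dvd_add_left (dvd_mul_right _ _)).1 (e ▸ dvd_mul_right _ _)
    have h3 := Nat.le_of_dvd (Nat.succ_pos _) (hcop.symm.dvd_of_dvd_mul_left h2)
    rw [← hd.2, dot]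
    exact (Nat.mul_le_mul_left _ (by omega)).trans (Nat.le_add_right _ _)
  rcases lt_trichotomy (d 0) (d' 0) with h0 | h0 | h0
  · exact key d' d hd' hd h0
  · refine absurd (finsupp_ext_of_ne (i₀ := 0) (i₁ := 1) (by decide) h0 ?_) hne
    have h1 := hd.2.trans hd'.2.symm
    simp only [dot, h0, add_right_inj] at h1
    exact Nat.eq_of_mul_eq_mul_left (hw 1) h1
  · exact key d d' hd hd' h0

theorem coeff_truncate {P : JetSpace k (m + 1)} {i : Fin 2} {j : ℕ} (hj : j ≤ m) :
    coeff j (jetSeries (truncate m P) i) = coeff j (jetSeries P i) := by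
  rw [truncate_eq_jetOf, coeff_jetSeries_jetOf, if_pos (Nat.lt_succ_of_le hj)]

variable {b : MvPowerSeries (Fin 2) k} {w : Fin 2 → ℕ} {u : Fin 2 → k}
  {α : ℕ × ℕ}

/-- The initial coefficients of a limit of jets on a branch are both zero or both nonzero. -/
theorem IsBranch.coeff_ne_zero (h : IsBranch b w u) (hb0 : b ≠ 0) (hα : Trop b (vec α)) {n : ℕ}
    (hm : ∀ i, vec α i ≤ m) {P : JetSpace k m} (hP : P ∈ zariskiClosure (onBranch f b α n m))
    {i₀ i₁ : Fin 2} (hi : i₀ ≠ i₁) (hc : coeff (vec α i₀) (jetSeries P i₀) ≠ 0) :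
    coeff (vec α i₁) (jetSeries P i₁) ≠ 0 := by
  intro h0
  obtain ⟨s, hs, hα'⟩ := (h.trop_iff _).1 hα
  have h1 := homPart_eq_zero_of_mem_closure hm hP
  rw [hα', h.homPart_smul_eq hb0 hs, h.root_iff_of_ne hi, ← hα', h0, zero_pow (h.pos i₀).ne',
    zero_mul] at h1
  exact mul_ne_zero (pow_ne_zero _ (h.torus i₁)) (pow_ne_zero _ hc) h1.symm

variable [IsAlgClosed k]

/-- A closed set of jets of higher order in the closure of the jets on a branch has smaller
dimension. -/
theorem IsNewtonPlaneCurve.add_lt_of_truncate_mem (hf : IsNewtonPlaneCurve f) (hb : Irreducible b)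
    (hbf : b ∣ ↟f) (hα : Trop b (vec α))
    (hm : ord ↟f (vec α) ≤ m) {W : Set (JetSpace k (m + 1))}
    (hW : zariskiClosure W = W)
    (hE : ∀ P ∈ W, truncate m P ∈ zariskiClosure (onBranch f b α (m + 1) m)) {β : ℕ × ℕ}
    (hβ : W ⊆ hyp β (m + 1)) {i : Fin 2} (hlt : vec α i < vec β i) {d : ℕ}
    (hd : ringKrullDim (CoordRing W) = d) :
    d + (m + 1) + vec α 0 + vec α 1 < 2 * (m + 1 + 1) +
      ord ↟f (vec α) := by
  have hle : ∀ i, vec α i ≤ m := fun i =>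
    ((trop_of_dvd (coe_ne_zero hf.ne_zero) hbf hα).le_ord i).trans hm
  obtain ⟨h1, d', h2, h3⟩ := hf.onBranch_facts (m := m + 1) hb hbf hα (Nat.lt_succ_of_le hm)
    (Nat.le_succ _)
  have hsub : W ⊆ zariskiClosure (onBranch f b α (m + 1) (m + 1)) := fun P hP =>
    mem_closure_of_truncate_mem hle (hE P hP)
  by_contra hc
  have heq := eq_of_subset_of_ringKrullDim_le h1 hW hsub hd h2 (by omega)
  obtain ⟨P, hP⟩ := nonempty_of_isIrreducibleClosed h1
  have := hβ (heq ▸ subset_zariskiClosure _ hP)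
  exact absurd (le_of_mem_hyp this (hP.2.1 i)) (not_le.2 hlt)

/-- The edges from a singular branch to a branch. -/
theorem truncate_onBranch_mem_singular_iff {r : ℕ} {b : Fin r → MvPowerSeries (Fin 2) k} {i j : Fin r}
    (hf : IsNewtonPlaneCurve f) (hb : IsFactorization f b) (h : IsBranch (b i) w u)
    (hw : ∀ l, 2 ≤ w l) (hα : Trop (b i) (vec α))
    (hm : ord ↟f (vec α) ≤ m) {β : ℕ × ℕ} (hβ : Trop (b j) (vec β))
    (hm' : ord ↟f (vec β) ≤ m + 1) :
    (∀ P ∈ zariskiClosure (onBranch f (b j) β (m + 1 + 1) (m + 1)),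
      truncate m P ∈ zariskiClosure (onBranch f (b i) α (m + 1) m)) ↔ β = α ∧ j = i := by
  have h01 : (0 : Fin 2) ≠ 1 := by decide
  have hf0 := coe_ne_zero hf.ne_zero
  have hle : ∀ i, vec α i ≤ m := fun l =>
    ((trop_of_dvd hf0 (hb.dvd i) hα).le_ord l).trans hm
  constructor
  · intro hE
    obtain ⟨hirr, d, hd, hd'⟩ := hf.onBranch_facts (hb.irreducible j) (hb.dvd j) hβ
      (Nat.lt_succ_of_le hm') le_rfl
    obtain ⟨P, hP⟩ := nonempty_of_isIrreducibleClosed hirr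
    have hP' := hE P (subset_zariskiClosure _ hP)
    have hαβ : vec α ≤ vec β := (truncate_onBranch_mem_hyp_iff (fun i => (hle i).trans
      (Nat.le_succ m)) hirr).1 fun P hP => closure_onBranch_subset_hyp (hE P hP)
    have heq : ∀ l l', l ≠ l' → vec α l = vec β l → vec β = vec α := by
      intro l l' hl h1
      refine funext_of_ne hl h1.symm (le_antisymm ?_ (hαβ l'))
      have h2 := h.coeff_ne_zero (hb.irreducible i).ne_zero hα hle hP' hl (by
        rw [coeff_truncate (hle l), h1]; exact hP.2.1 l)
      rw [coeff_truncate (hle l')] at h2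
      exact le_of_mem_hyp (onBranch_subset_hyp hP) h2
    have hfin : vec β = vec α → β = α ∧ j = i := by
      intro h1
      have h2 : β = α := Prod.ext (congrFun h1 0) (congrFun h1 1)
      subst h2
      refine ⟨rfl, hb.root_unique hf hα.1 hP.2.1 hP.2.2.1 ?_⟩
      have h3 := homPart_eq_zero_of_mem_closure hle hP'
      simpa only [coeff_truncate (hle _)] using h3
    by_cases h0 : vec α 0 = vec β 0
    · exact hfin (heq 0 1 h01 h0)
    by_cases h1 : vec α 1 = vec β 1
    · exact hfin (heq 1 0 h01.symm h1)
    have h0' : vec α 0 ≤ vec β 0 := hαβ 0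
    have h1' : vec α 1 ≤ vec β 1 := hαβ 1
    have hlt := hf.add_lt_of_truncate_mem (hb.irreducible i) (hb.dvd i) hα hm hirr.1 hE
      closure_onBranch_subset_hyp (i := 0) (lt_of_le_of_ne h0' h0) hd
    have := Trop.add_lt_ord (i₀ := 0) (i₁ := 1) h01 hw h.coprime
      (fun d hd => ((trop_of_dvd hf0 (hb.dvd i) h.trop).mul_le_ord h.coprime).trans (ord_le w hd))
      (trop_of_dvd hf0 (hb.dvd j) hβ) (α := vec α) (a := vec β 0 - vec α 0 - 1)
      (b := vec β 1 - vec α 1 - 1) (by omega) (by omega)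
    omega
  · rintro ⟨rfl, rfl⟩
    exact truncate_mem_closure fun P hP => subset_zariskiClosure _
      (truncate_mem_onBranch hle (Nat.le_succ _) hP)

/-- Necessary conditions for an edge from a singular branch to a coordinate subspace. -/
theorem IsNewtonPlaneCurve.lt_of_truncate_hyp_mem (hf : IsNewtonPlaneCurve f) (hb : Irreducible b)
    (hbf : b ∣ ↟f) (h : IsBranch b w u) (hα : Trop b (vec α))
    (hm : ord ↟f (vec α) ≤ m) {γ : ℕ × ℕ}
    (hγ : ∀ i, vec γ i ≤ m + 1 + 1)
    (hE : ∀ P ∈ (hyp γ (m + 1) : Set (JetSpace k (m + 1))),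
      truncate m P ∈ zariskiClosure (onBranch f b α (m + 1) m)) :
    (∀ i, vec α i < vec γ i) ∧ m + 1 + vec α 0 + vec α 1 <
      vec γ 0 + vec γ 1 + ord ↟f (vec α) := by
  have h01 : (0 : Fin 2) ≠ 1 := by decide
  have hle : ∀ i, vec α i ≤ m := fun l =>
    ((trop_of_dvd (coe_ne_zero hf.ne_zero) hbf hα).le_ord l).trans hm
  have hαγ : vec α ≤ vec γ := (truncate_hyp_mem_hyp_iff (fun i => (hle i).trans
    (Nat.le_succ m)) hγ).1 fun P hP => closure_onBranch_subset_hyp (hE P hP)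
  have key : ∀ l l', l ≠ l' → vec α l < vec γ l := by
    intro l l' hl
    refine lt_of_le_of_ne (hαγ l) fun h1 => ?_
    have h2 := hE _ ((jetOf_mem_hyp_iff (x := Pi.single l (X ^ vec γ l)) hγ).2
      ((forall_iff_of_ne hl).2 ⟨by simp, by simp [hl.symm]⟩))
    rw [truncate_jetOf (Nat.le_succ m)] at h2
    have h3 := h.coeff_ne_zero hb.ne_zero hα hle h2 hl (by
      rw [coeff_jetSeries_jetOf, if_pos (Nat.lt_succ_of_le (hle l)), h1]
      simp [PowerSeries.coeff_X_pow])
    rw [coeff_jetSeries_jetOf, if_pos (Nat.lt_succ_of_le (hle l'))] at h3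
    simp [hl.symm] at h3
  obtain ⟨h1, d, h2, -, h3⟩ := hyp_facts (k := k) hγ
  have hlt := hf.add_lt_of_truncate_mem hb hbf hα hm h1.1 hE subset_rfl (key 0 1 h01) h2
  exact ⟨(forall_iff_of_ne h01).2 ⟨key 0 1 h01, key 1 0 h01.symm⟩, by omega⟩

end

section

variable {k : Type u} [Field k]

/-- Substitution of a power series without constant term. -/
theorem exists_substHom {τ : PowerSeries k} (hτ : constantCoeff τ = 0) :
    ∃ S : PowerSeries k →ₐ[k] PowerSeries k, S X = τ ∧
      ∀ Z, constantCoeff (S Z) = constantCoeff Z := by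
  have h : PowerSeries.HasSubst τ := PowerSeries.HasSubst.of_constantCoeff_zero' hτ
  let S : PowerSeries k →ₐ[k] PowerSeries k := PowerSeries.substAlgHom h
  have hX : S X = τ := PowerSeries.substAlgHom_X h
  refine ⟨S, hX, fun Z => ?_⟩
  obtain ⟨Y, hY⟩ := PowerSeries.X_dvd_iff.2
    (show constantCoeff (Z - C (constantCoeff Z)) = 0 by simp)
  have hC : S (C (constantCoeff Z)) = C _ :=
    S.commutes (constantCoeff Z)
  rw [sub_eq_iff_eq_add.1 hY, map_add, map_add, map_mul, map_mul, hX, hτ, hC]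
  simp

theorem algHom_eval_strict (S : PowerSeries k →ₐ[k] PowerSeries k) (f : MvPolynomial (Fin 2) k)
    (w e : Fin 2 → ℕ) (ξ z : PowerSeries k) :
    S ((strict f w e ξ).eval z) = (strict f w e (S ξ)).eval (S z) := by
  rw [eval_strict, eval_strict, map_sum]
  refine Finset.sum_congr rfl fun d _ => ?_
  have hC : S (algebraMap k (PowerSeries k) (f.coeff d)) = algebraMap k _ (f.coeff d) := S.commutes _
  rw [map_mul, map_mul, map_pow, map_pow, hC]

theorem exists_pow_eq {n : ℕ} (hn : (n : k) ≠ 0) {U : PowerSeries k} {x : k} (hx0 : x ≠ 0)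
    (hx : x ^ n = constantCoeff U) :
    ∃ T : PowerSeries k, constantCoeff T = x ∧ T ^ n = U := by
  obtain ⟨T, h1, h2⟩ := hensel_exists (Polynomial.X ^ n - Polynomial.C U) (c := x)
    (by simp [hx]) (by
      simpa [Polynomial.derivative_X_pow] using ⟨hn, fun h => absurd h hx0⟩)
  exact ⟨T, h1, sub_eq_zero.1 (by simpa using h2)⟩

section Pure

variable {m : ℕ} {f g : MvPolynomial (Fin 2) k} {b b' : MvPowerSeries (Fin 2) k} {w e : Fin 2 → ℕ}
  {u u' : Fin 2 → k} {a j : Fin 2} {c c' : k}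

/-- A chart in which the coordinate `a` is a pure power of the parameter. -/
theorem IsNewtonPlaneCurve.exists_pureRoot [IsAlgClosed k] (hf : IsNewtonPlaneCurve f)
    (hbf : b ∣ ↟f) (h : IsBranch b w u) (haj : a ≠ j)
    (hk : (w a : k) ≠ 0) (he : e a = 0) (he' : e j = 1) :
    ∃ c, IsChartRoot f w e c ∧ homPart b w (ord b w) (fun i => c ^ e i) = 0 := by
  obtain ⟨c, hc⟩ := IsAlgClosed.exists_pow_nat_eq (u j ^ w a / u a ^ w j) (h.pos a)
  have hc0 : c ≠ 0 := by
    rintro rfl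
    rw [zero_pow (h.pos a).ne'] at hc
    exact div_ne_zero (pow_ne_zero _ (h.torus j)) (pow_ne_zero _ (h.torus a)) hc.symm
  have h0 : homPart b w (ord b w) (fun i => c ^ e i) = 0 := by
    rw [h.root_iff_of_ne haj, he, he', pow_one, pow_zero, one_pow, mul_one, hc,
      div_mul_cancel₀ _ (pow_ne_zero _ (h.torus a))]
  refine ⟨c, hf.nondegenerate.isChartRoot hf.ne_zero h.pos ?_ hc0
    (homPart_eq_zero_of_dvd (coe_ne_zero hf.ne_zero) hbf h.pos h0), h0⟩
  fin_cases a <;> fin_cases j <;> simp_all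

/-- The jets on a branch in a pure chart. -/
theorem IsBranch.exists_pure (h : IsBranch b w u) (hb0 : b ≠ 0) (haj : a ≠ j)
    (hk : (w a : k) ≠ 0) (he : e a = 0) (he' : e j = 1) (hc0 : c ≠ 0)
    (hc : homPart b w (ord b w) (fun i => c ^ e i) = 0) {s n : ℕ} (hs : 0 < s) {α : ℕ × ℕ}
    (hα : vec α = s • w) {P : JetSpace k m} (hP : P ∈ onBranch f b α n m) :
    ∃ T ζ : PowerSeries k, constantCoeff T ≠ 0 ∧ constantCoeff ζ = c ∧
      ∀ i, jetSeries P i = (X ^ s * T) ^ w i * ζ ^ e i := by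
  obtain ⟨h1, h2, h3, -⟩ := hP
  choose V hV using h1
  have hv : ∀ i, constantCoeff (V i) ≠ 0 := fun i => by
    rw [← coeff_pow_of_X_pow_dvd (hV i)]; exact h2 i
  have hv' : (fun i => coeff (vec α i) (jetSeries P i)) =
      fun i => constantCoeff (V i) := funext fun i => coeff_pow_of_X_pow_dvd (hV i)
  rw [hv', hα, h.homPart_smul_eq hb0 hs, h.root_iff_of_ne haj] at h3
  rw [h.root_iff_of_ne haj, he, he', pow_one, pow_zero, one_pow, mul_one] at hc
  have hcop : (w a).Coprime (w j) := by
    fin_cases a <;> fin_cases j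
    exacts [absurd rfl haj, h.coprime, h.coprime.symm, absurd rfl haj]
  obtain ⟨e', hdet⟩ := exists_det haj h.pos hcop
  let v : Fin 2 → kˣ := fun i =>
    Units.mk0 (constantCoeff (V i) / c ^ e i) (div_ne_zero (hv i) (pow_ne_zero _ hc0))
  obtain ⟨x, z, hxz⟩ := exists_chart haj hdet v
  have hz : z = 1 := by
    have h4 := (chart_eq hdet hxz).2
    have h5 : v j ^ w a = v a ^ w j := by
      refine Units.ext ?_
      simp only [v, Units.val_pow_eq_pow_val, Units.val_mk0, he, he', pow_one, pow_zero, div_one,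
        div_pow]
      rw [div_eq_iff (pow_ne_zero _ hc0)]
      refine mul_right_cancel₀ (pow_ne_zero (w j) (h.torus a)) ?_
      rw [h3, ← hc]
      ring
    rw [h5] at h4
    exact (mul_eq_right.1 h4.symm)
  have hx : ∀ i, constantCoeff (V i) = (x : k) ^ w i * c ^ e i := fun i => by
    have := congrArg Units.val (hxz i)
    rw [hz] at this
    simp only [v, one_pow, mul_one, Units.val_mk0, Units.val_pow_eq_pow_val] at this
    rw [← this, div_mul_cancel₀ _ (pow_ne_zero _ hc0)]
  obtain ⟨T, hT, hTV⟩ := exists_pow_eq hk x.ne_zero (U := V a) (by rw [hx, he, pow_zero, mul_one])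
  have hT0 : constantCoeff T ≠ 0 := hT ▸ x.ne_zero
  have hTi : T * T⁻¹ = 1 := PowerSeries.mul_inv_cancel T hT0
  have hs' : ∀ i, vec α i = s * w i := fun i => by rw [hα]; simp
  refine ⟨T, V j * (T⁻¹) ^ w j, hT0, ?_, (forall_iff_of_ne haj).2 ⟨?_, ?_⟩⟩
  · rw [map_mul, map_pow, PowerSeries.constantCoeff_inv, hT, hx, he', pow_one, inv_pow]
    field_simp
  · rw [hV, he, pow_zero, mul_one, mul_pow, hTV, hs', pow_mul]
  · rw [hV, he', pow_one, mul_pow, hs', pow_mul, mul_assoc, mul_left_comm _ (V j), ← mul_pow, hTi,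
      one_pow, mul_one]

/-- The jets on a branch agree with the branch up to some order. -/
theorem IsBranch.exists_arc (h : IsBranch b w u) (hb0 : b ≠ 0) (haj : a ≠ j) (hk : (w a : k) ≠ 0)
    (he : e a = 0) (he' : e j = 1) (hc : IsChartRoot f w e c)
    (hcb : homPart b w (ord b w) (fun i => c ^ e i) = 0) {s M : ℕ} (hs : 0 < s) {α : ℕ × ℕ}
    (hα : vec α = s • w) (hM : m + 1 = s * ord ↟f w + M)
    {Z : PowerSeries k} (hZ : constantCoeff Z = c)
    (hZ0 : (strict f w e X).eval Z = 0) {P : JetSpace k m}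
    (hP : P ∈ onBranch f b α (m + 1) m) :
    ∃ (T : PowerSeries k) (S : PowerSeries k →ₐ[k] PowerSeries k),
      constantCoeff T ≠ 0 ∧ S X = X ^ s * T ∧
      (∀ Z, constantCoeff (S Z) = constantCoeff Z) ∧
      jetSeries P a = (X ^ s * T) ^ w a ∧
      X ^ (s * w j + M) ∣ jetSeries P j - (X ^ s * T) ^ w j * S Z := by
  obtain ⟨T, ζ, hT, hζ, hx⟩ := h.exists_pure hb0 haj hk he he' hc.ne_zero hcb hs hα hP
  obtain ⟨S, hSX, hS⟩ := exists_substHom (τ := X ^ s * T) (by simp [hs.ne'])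
  have hS0 : (strict f w e (X ^ s * T)).eval (S Z) = 0 := by
    rw [← hSX, ← algHom_eval_strict, hZ0, map_zero]
  have hdvd := hP.2.2.2
  rw [show jetSeries P = fun i => (X ^ s * T) ^ w i * ζ ^ e i from funext hx,
    hc.dvd_aeval_iff hs hM hT rfl ((hS Z).trans hZ) hζ hS0, modX_eq_iff] at hdvd
  refine ⟨T, S, hT, hSX, hS, by rw [hx, he, pow_zero, mul_one], ?_⟩
  rw [hx, he', pow_one, ← mul_sub, pow_add]
  refine mul_dvd_mul ?_ hdvd
  rw [mul_pow, ← pow_mul]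
  exact dvd_mul_right _ _

/-- A polynomial map between two branches maps the jets on one branch to those on the other. -/
theorem IsBranch.jetOf_mem_onBranch (h : IsBranch b w u) (hb0 : b ≠ 0) (h' : IsBranch b' w u')
    (hb0' : b' ≠ 0) (haj : a ≠ j) (hk : (w a : k) ≠ 0) (he : e a = 0) (he' : e j = 1)
    (hc : IsChartRoot f w e c) (hcb : homPart b w (ord b w) (fun i => c ^ e i) = 0)
    (hc' : IsChartRoot g w e c') (hcb' : homPart b' w (ord b' w) (fun i => c' ^ e i) = 0)
    {s M : ℕ} (hs : 0 < s) (hM : 0 < M) {α : ℕ × ℕ} (hα : vec α = s • w)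
    (hle : ∀ i, vec α i ≤ m) (hMf : m + 1 = s * ord ↟f w + M)
    (hMg : m + 1 = s * ord ↟g w + M) {Z Z' : PowerSeries k}
    (hZ : constantCoeff Z = c) (hZ0 : (strict f w e X).eval Z = 0)
    (hZ' : constantCoeff Z' = c') (hZ0' : (strict g w e X).eval Z' = 0)
    {φ : Fin 2 → MvPolynomial (Fin 2) k} (hφ : φ a = MvPolynomial.X a)
    (hφ' : X ^ (w j + M) ∣
      MvPolynomial.aeval (fun i => X ^ w i * Z ^ e i) (φ j) - X ^ w j * Z')
    {P : JetSpace k m} (hP : P ∈ onBranch f b α (m + 1) m) :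
    jetOf m (fun i => MvPolynomial.aeval (jetSeries P) (φ i)) ∈ onBranch g b' α (m + 1) m := by
  obtain ⟨T, S, hT, hSX, hS, hxa, hxj⟩ :=
    h.exists_arc hb0 haj hk he he' hc hcb hs hα hMf hZ hZ0 hP
  have hTi : T * T⁻¹ = 1 := PowerSeries.mul_inv_cancel T hT
  set τ := X ^ s * T with hτ
  have hS0 : (strict g w e τ).eval (S Z') = 0 := by
    rw [← hSX, ← algHom_eval_strict, hZ0', map_zero]
  have hτX : ∀ n, X ^ (s * n) ∣ τ ^ n := fun n => by
    rw [hτ, mul_pow, ← pow_mul]; exact dvd_mul_right _ _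
  have h1 : modX k (s * w j + M) (MvPolynomial.aeval (jetSeries P) (φ j)) =
      modX k (s * w j + M) (MvPolynomial.aeval (fun i => τ ^ w i * S Z ^ e i) (φ j)) := by
    refine modX_aeval _ ((forall_iff_of_ne haj).2 ⟨?_, ?_⟩)
    · rw [hxa, he, pow_zero, mul_one]
    · rwa [modX_eq_iff, he', pow_one]
  have h2 : X ^ (s * w j + M) ∣
      MvPolynomial.aeval (fun i => τ ^ w i * S Z ^ e i) (φ j) - τ ^ w j * S Z' := by
    have h3 := map_dvd S hφ'
    rw [map_sub, map_mul, map_pow, map_pow, hSX, MvPolynomial.comp_aeval_apply] at h3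
    simp only [map_mul, map_pow, hSX] at h3
    refine dvd_trans (dvd_trans (pow_dvd_pow _ ?_) (hτX _)) h3
    rw [mul_add]
    exact Nat.add_le_add_left (Nat.le_mul_of_pos_left _ hs) _
  rw [← modX_eq_iff, ← h1, modX_eq_iff] at h2
  obtain ⟨R, hR⟩ := h2
  let ζ' := S Z' + X ^ M * (R * (T⁻¹) ^ w j)
  have hζ' : constantCoeff ζ' = c' := by simp [ζ', hM.ne', hS, hZ']
  have hy : (fun i => MvPolynomial.aeval (jetSeries P) (φ i)) = fun i => τ ^ w i * ζ' ^ e i := by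
    refine funext_of_ne haj ?_ ?_
    · simp only [hφ, MvPolynomial.aeval_X, hxa, he, pow_zero, mul_one]
    · simp only [he', pow_one]
      rw [sub_eq_iff_eq_add.1 hR]
      simp only [ζ']
      have hTw : T ^ w j * (T⁻¹) ^ w j = 1 := by rw [← mul_pow, hTi, one_pow]
      rw [hτ, mul_pow, ← pow_mul, pow_add]
      linear_combination (-(X ^ (s * w j) * X ^ M * R)) * hTw
  have hv : ∀ i, τ ^ w i * ζ' ^ e i = X ^ vec α i * (T ^ w i * ζ' ^ e i) := fun i => by
    rw [hα, hτ, mul_pow, ← pow_mul, mul_assoc]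
    rfl
  have hlead : ∀ i, coeff (vec α i) (τ ^ w i * ζ' ^ e i) =
      constantCoeff T ^ w i * c' ^ e i := fun i => by
    rw [coeff_pow_of_X_pow_dvd (hv i), map_mul, map_pow, map_pow, hζ']
  rw [hy, jetOf_mem_onBranch_iff hle le_rfl]
  refine ⟨fun i => ⟨_, hv i⟩, fun i => ?_, ?_, ?_⟩
  · rw [hlead]
    exact mul_ne_zero (pow_ne_zero _ hT) (pow_ne_zero _ hc'.ne_zero)
  · simp only [hlead]
    rw [hα, h'.homPart_smul_eq hb0' hs, homPart_smul b' h'.pos, hcb', mul_zero]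
  · rw [hc'.dvd_aeval_iff hs hMg hT rfl ((hS Z').trans hZ') hζ' hS0,
      modX_eq_iff]
    simp [ζ']

end Pure

/-- An edge to a coordinate subspace is preserved by a polynomial map. -/
theorem truncate_hyp_mem_of_map {m : ℕ} {γ : ℕ × ℕ} {S T : Set (JetSpace k m)}
    {φ : Fin 2 → MvPolynomial (Fin 2) k} (hγ : ∀ i, vec γ i ≤ m + 1 + 1)
    (hE : ∀ P ∈ (hyp γ (m + 1) : Set (JetSpace k (m + 1))), truncate m P ∈ zariskiClosure S)
    (hmap : ∀ P ∈ S, jetOf m (fun i => MvPolynomial.aeval (jetSeries P) (φ i)) ∈ T)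
    (hsurj : ∀ y : Fin 2 → PowerSeries k, (∀ i, X ^ vec γ i ∣ y i) →
      ∃ x : Fin 2 → PowerSeries k, (∀ i, X ^ vec γ i ∣ x i) ∧
        ∀ i, MvPolynomial.aeval x (φ i) = y i) :
    ∀ P ∈ (hyp γ (m + 1) : Set (JetSpace k (m + 1))), truncate m P ∈ zariskiClosure T := by
  intro P hP
  obtain ⟨x, hx, hxy⟩ := hsurj _ (mem_hyp_iff.1 hP)
  have h1 := hE _ ((jetOf_mem_hyp_iff hγ).2 hx)
  rw [truncate_jetOf (Nat.le_succ m)] at h1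
  have hΘ : ∀ Q : JetSpace k m, (fun c : Fin 2 × Fin (m + 1) => MvPolynomial.eval Q
      (coeff (c.2 : ℕ) (MvPolynomial.aeval (univSeries k m) (φ c.1) :
        PowerSeries (MvPolynomial (Fin 2 × Fin (m + 1)) k)))) =
      jetOf m (fun i => MvPolynomial.aeval (jetSeries Q) (φ i)) := fun Q =>
    funext fun c => eval_coeff_aeval_univSeries _ _ _
  have h2 := mem_zariskiClosure_of_map (T := T) _ (fun Q (hQ : Q ∈ S) => by
    rw [hΘ]; exact subset_zariskiClosure _ (hmap Q hQ)) h1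
  rw [hΘ] at h2
  convert h2 using 1
  funext c
  rw [truncate_eq_jetOf]
  simp only [jetOf]
  rw [← hxy]
  exact (modX_eq_iff_coeff.1 (modX_aeval (φ c.1) (modX_jetSeries_jetOf x)) _ c.2.2).symm

end

section

variable {k : Type u} [Field k]

section Polynomials

/-- A power series as an element of a free module over the series in `X ^ 2`. -/
theorem exists_even_odd {Z : PowerSeries k} (hZ : constantCoeff Z ≠ 0)
    (Z' : PowerSeries k) (M : ℕ) : ∃ U A : Polynomial k, X ^ M ∣
      Z * Polynomial.aeval (X ^ 2 : PowerSeries k) U +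
        X * Polynomial.aeval (X ^ 2 : PowerSeries k) A - Z' := by
  induction M with
  | zero => exact ⟨0, 0, by simp⟩
  | succ M ih =>
    obtain ⟨U, A, E, hE⟩ := ih
    have key : ∀ F : PowerSeries k, constantCoeff F = -constantCoeff E →
        X ^ (M + 1) ∣ X ^ M * E + X ^ M * F := fun F hF => by
      rw [← mul_add, pow_succ]
      exact mul_dvd_mul_left _ (PowerSeries.X_dvd_iff.2 (by simp [hF]))
    rcases Nat.even_or_odd' M with ⟨l, rfl | rfl⟩
    · refine ⟨U + Polynomial.C (-constantCoeff E / constantCoeff Z) *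
        Polynomial.X ^ l, A, ?_⟩
      convert key (Z * C (-constantCoeff E / constantCoeff Z))
        (by simp only [map_mul, PowerSeries.constantCoeff_C]; field_simp) using 1
      rw [← hE, map_add, map_mul, map_pow, Polynomial.aeval_X, Polynomial.aeval_C, ← pow_mul,
        PowerSeries.algebraMap_apply, Algebra.algebraMap_self_apply]
      ring
    · refine ⟨U, A + Polynomial.C (-constantCoeff E) * Polynomial.X ^ l, ?_⟩
      convert key (C (-constantCoeff E)) (by simp) using 1
      rw [← hE, map_add, map_mul, map_pow, Polynomial.aeval_X, Polynomial.aeval_C, ← pow_mul,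
        PowerSeries.algebraMap_apply, Algebra.algebraMap_self_apply, pow_succ]
      ring

theorem constantCoeff_aeval (U : Polynomial k) {y : PowerSeries k}
    (hy : constantCoeff y = 0) :
    constantCoeff (Polynomial.aeval y U) = U.coeff 0 := by
  rw [Polynomial.aeval_def, Polynomial.hom_eval₂, hy, Polynomial.eval₂_at_zero]
  simp

theorem exists_eq_shift_three (Z : PowerSeries k) : ∃ R, Z = C (coeff 0 Z) +
    C (coeff 1 Z) * X +
    C (coeff 2 Z) * X ^ 2 + X ^ 3 * R := by
  obtain ⟨R, hR⟩ := PowerSeries.X_pow_dvd_iff (n := 3) (φ := Z - (C (coeff 0 Z) +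
    C (coeff 1 Z) * X +
    C (coeff 2 Z) * X ^ 2)).2 fun j hj => by
      interval_cases j <;> simp [PowerSeries.coeff_X_pow, PowerSeries.coeff_C]
  exact ⟨R, by rw [← hR]; ring⟩

/-- A polynomial map relating two cusps in a characteristic different from two. -/
theorem exists_map_two {a j : Fin 2} (haj : a ≠ j) {w e : Fin 2 → ℕ} (hw : w a = 2) (he : e a = 0)
    (he' : e j = 1) {h M : ℕ} (hh : w j + 1 = 2 * h) (hM : 0 < M) {γ : Fin 2 → ℕ}
    (hγ : ∀ i, 0 < γ i) (hγh : γ j ≤ γ a * h) {Z Z' : PowerSeries k}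
    (hZ : constantCoeff Z ≠ 0) (hZ' : constantCoeff Z' ≠ 0) :
    ∃ φ : Fin 2 → MvPolynomial (Fin 2) k, φ a = MvPolynomial.X a ∧
      X ^ (w j + M) ∣ MvPolynomial.aeval (fun i => X ^ w i * Z ^ e i) (φ j) -
        X ^ w j * Z' ∧
      ∀ y : Fin 2 → PowerSeries k, (∀ i, X ^ γ i ∣ y i) →
        ∃ x : Fin 2 → PowerSeries k, (∀ i, X ^ γ i ∣ x i) ∧
          ∀ i, MvPolynomial.aeval x (φ i) = y i := by
  obtain ⟨U, A, hUA⟩ := exists_even_odd hZ Z' M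
  have hU0 : U.coeff 0 ≠ 0 := by
    intro h0
    have := PowerSeries.X_dvd_iff.1 ((dvd_pow_self _ hM.ne').trans hUA)
    rw [map_sub, map_add, map_mul, map_mul, constantCoeff_aeval U (by simp), h0] at this
    exact hZ' (by simpa using this)
  let φ : Fin 2 → MvPolynomial (Fin 2) k := fun i => if i = a then MvPolynomial.X a else
    MvPolynomial.X j * Polynomial.aeval (MvPolynomial.X a) U +
      MvPolynomial.X a ^ h * Polynomial.aeval (MvPolynomial.X a) A
  have ha : φ a = MvPolynomial.X a := if_pos rfl
  have hev : ∀ x : Fin 2 → PowerSeries k, MvPolynomial.aeval x (φ j) =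
      x j * Polynomial.aeval (x a) U + x a ^ h * Polynomial.aeval (x a) A := fun x => by
    simp only [φ, if_neg haj.symm, map_add, map_mul, map_pow, ← Polynomial.aeval_algHom_apply,
      MvPolynomial.aeval_X]
  refine ⟨φ, ha, ?_, fun y hy => ?_⟩
  · rw [hev, he, he', hw, pow_zero, mul_one, pow_one, pow_add, ← pow_mul, ← hh, pow_succ]
    convert mul_dvd_mul_left (X ^ w j) hUA using 1
    ring_nf
  · have hya : constantCoeff (y a) = 0 :=
      PowerSeries.X_dvd_iff.1 ((dvd_pow_self _ (hγ a).ne').trans (hy a))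
    have hu : Polynomial.aeval (y a) U * (Polynomial.aeval (y a) U)⁻¹ = 1 :=
      PowerSeries.mul_inv_cancel _ (by rwa [constantCoeff_aeval U hya])
    let x : Fin 2 → PowerSeries k := fun i => if i = a then y a else
      (y j - y a ^ h * Polynomial.aeval (y a) A) * (Polynomial.aeval (y a) U)⁻¹
    have hxa : x a = y a := if_pos rfl
    have hxj : x j = (y j - y a ^ h * Polynomial.aeval (y a) A) * (Polynomial.aeval (y a) U)⁻¹ :=
      if_neg haj.symm
    refine ⟨x, (forall_iff_of_ne haj).2 ⟨by rw [hxa]; exact hy a, ?_⟩,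
      (forall_iff_of_ne haj).2 ⟨by rw [ha, MvPolynomial.aeval_X, hxa], ?_⟩⟩
    · rw [hxj]
      refine Dvd.dvd.mul_right (dvd_sub (hy j) (Dvd.dvd.mul_right ?_ _)) _
      refine (pow_dvd_pow _ hγh).trans ?_
      rw [pow_mul]
      exact pow_dvd_pow_of_dvd (hy a) _
    · rw [hev, hxa, hxj]
      linear_combination (y j - y a ^ h * Polynomial.aeval (y a) A) * hu

/-- A polynomial map relating two ordinary cusps up to order three. -/
theorem exists_map_three {a j : Fin 2} (haj : a ≠ j) {w e : Fin 2 → ℕ} (hw : w a = 3) (hw' : w j = 2)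
    (he : e a = 0) (he' : e j = 1) {γ : Fin 2 → ℕ} (hγ : ∀ i, 0 < γ i) (hγh : γ j ≤ γ a)
    {Z Z' : PowerSeries k} (hZ : constantCoeff Z ≠ 0)
    (hZ' : constantCoeff Z' ≠ 0) :
    ∃ φ : Fin 2 → MvPolynomial (Fin 2) k, φ a = MvPolynomial.X a ∧
      X ^ (w j + 3) ∣ MvPolynomial.aeval (fun i => X ^ w i * Z ^ e i) (φ j) -
        X ^ w j * Z' ∧
      ∀ y : Fin 2 → PowerSeries k, (∀ i, X ^ γ i ∣ y i) →
        ∃ x : Fin 2 → PowerSeries k, (∀ i, X ^ γ i ∣ x i) ∧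
          ∀ i, MvPolynomial.aeval x (φ i) = y i := by
  obtain ⟨R, hR⟩ := exists_eq_shift_three Z
  obtain ⟨R', hR'⟩ := exists_eq_shift_three Z'
  rw [← PowerSeries.coeff_zero_eq_constantCoeff_apply] at hZ hZ'
  set z := coeff 0 Z
  set z' := coeff 0 Z'
  obtain ⟨p, hp⟩ : ∃ p, p * z = z' := ⟨z' / z, div_mul_cancel₀ _ hZ⟩
  have hp0 : p ≠ 0 := by rintro rfl; exact hZ' (by rw [← hp, zero_mul])
  obtain ⟨q, hq⟩ : ∃ q, p * coeff 1 Z + q = coeff 1 Z' :=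
    ⟨_, add_sub_cancel _ _⟩
  obtain ⟨r, hr⟩ : ∃ r, p * coeff 2 Z + r * z ^ 2 = coeff 2 Z' :=
    ⟨(coeff 2 Z' - p * coeff 2 Z) / z ^ 2,
      by rw [div_mul_cancel₀ _ (pow_ne_zero 2 hZ)]; ring⟩
  let φ : Fin 2 → MvPolynomial (Fin 2) k := fun i => if i = a then MvPolynomial.X a else
    MvPolynomial.C p * MvPolynomial.X j + MvPolynomial.C q * MvPolynomial.X a +
      MvPolynomial.C r * MvPolynomial.X j ^ 2
  have ha : φ a = MvPolynomial.X a := if_pos rfl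
  have hev : ∀ x : Fin 2 → PowerSeries k, MvPolynomial.aeval x (φ j) =
      C p * x j + C q * x a + C r * x j ^ 2 := fun x => by
    simp [φ, if_neg haj.symm]
  refine ⟨φ, ha, ?_, fun y hy => ?_⟩
  · have hp' := congrArg (C (R := k)) hp
    have hq' := congrArg (C (R := k)) hq
    have hr' := congrArg (C (R := k)) hr
    simp only [map_mul, map_add, map_pow] at hp' hq' hr'
    rw [hev, he, he', hw, hw', pow_zero, mul_one, pow_one]
    obtain ⟨Q, hQ⟩ : X ∣ Z ^ 2 - C (z ^ 2) :=
      PowerSeries.X_dvd_iff.2 (by simp [z])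
    rw [map_pow] at hQ
    refine ⟨C p * R - R' + C r * Q, ?_⟩
    linear_combination (X ^ 2 * C p) * hR - X ^ 2 * hR' +
      (C r * X ^ 4) * hQ + X ^ 2 * hp' +
      X ^ 3 * hq' + X ^ 4 * hr'
  · have hy0 : ∀ i, constantCoeff (y i) = 0 := fun i =>
      PowerSeries.X_dvd_iff.1 ((dvd_pow_self _ (hγ i).ne').trans (hy i))
    obtain ⟨x₁, h1, h2⟩ := hensel_exists (Polynomial.C (C r) * Polynomial.X ^ 2 +
      Polynomial.C (C p) * Polynomial.X -
      Polynomial.C (y j - C q * y a)) (c := 0) (by simp [hy0]) (by simpa using hp0)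
    simp only [Polynomial.eval_sub, Polynomial.eval_add, Polynomial.eval_mul, Polynomial.eval_C,
      Polynomial.eval_pow, Polynomial.eval_X] at h2
    let x : Fin 2 → PowerSeries k := fun i => if i = a then y a else x₁
    have hxa : x a = y a := if_pos rfl
    have hxj : x j = x₁ := if_neg haj.symm
    refine ⟨x, (forall_iff_of_ne haj).2 ⟨by rw [hxa]; exact hy a, ?_⟩,
      (forall_iff_of_ne haj).2 ⟨by rw [ha, MvPolynomial.aeval_X, hxa], ?_⟩⟩
    · have hu : IsUnit (C r * x₁ + C p) :=
        PowerSeries.isUnit_iff_constantCoeff.2 (by simpa [h1] using hp0)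
      rw [hxj, ← hu.dvd_mul_right]
      convert dvd_sub (hy j) (((pow_dvd_pow _ hγh).trans (hy a)).mul_left (C q)) using 1
      linear_combination h2
    · rw [hev, hxa, hxj]
      linear_combination h2

theorem coeff_sq_eq_zero (h2 : (2 : k) = 0) (a : PowerSeries k) {n : ℕ} (hn : Odd n) :
    coeff n (a ^ 2) = 0 := by
  obtain ⟨l, rfl⟩ := hn
  have h := PowerSeries.coeff_derivative (a ^ 2) (2 * l)
  have h3 : (C (2 : k)) = 0 := by rw [h2, map_zero]
  have h4 : (2 : PowerSeries k) = 0 := by rw [← h3]; exact (map_ofNat _ 2).symm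
  have h0 : PowerSeries.derivative (R := k) (a ^ 2) = 0 := by
    rw [sq, Derivation.leibniz, smul_eq_mul, ← two_mul, h4, zero_mul]
  rw [h0, map_zero] at h
  push_cast at h
  rw [h2] at h
  simpa using h.symm

end Polynomials

end

section

variable {k : Type u} [Field k] [IsAlgClosed k] {m : ℕ} {f g : MvPolynomial (Fin 2) k}
  {b b' : MvPowerSeries (Fin 2) k} {w : Fin 2 → ℕ} {u u' : Fin 2 → k} {α γ : ℕ × ℕ}

/-- An edge from a branch to a coordinate subspace carries over to another curve, if there are
enough polynomial maps between the branches. -/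
theorem IsBranch.truncate_hyp_mem_of_forall (hf : IsNewtonPlaneCurve f) (hg : IsNewtonPlaneCurve g)
    (hbf : b ∣ ↟f) (hbg : b' ∣ ↟g)
    (h : IsBranch b w u) (h' : IsBranch b' w u') {s : ℕ} (hs : 0 < s) (hα : vec α = s • w)
    (hord : ord ↟f (vec α) = ord ↟g (vec α))
    (hm : ord ↟f (vec α) ≤ m) (hγ : ∀ i, vec γ i ≤ m + 1 + 1)
    {a j : Fin 2} (haj : a ≠ j) (hk : (w a : k) ≠ 0) {e : Fin 2 → ℕ} (he : e a = 0) (he' : e j = 1)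
    (H : ∀ Z Z' : PowerSeries k, constantCoeff Z ≠ 0 →
      constantCoeff Z' ≠ 0 → ∃ φ : Fin 2 → MvPolynomial (Fin 2) k,
        φ a = MvPolynomial.X a ∧
        X ^ (w j + (m + 1 - ord ↟f (vec α))) ∣
          MvPolynomial.aeval (fun i => X ^ w i * Z ^ e i) (φ j) -
            X ^ w j * Z' ∧
        ∀ y : Fin 2 → PowerSeries k, (∀ i, X ^ vec γ i ∣ y i) →
          ∃ x : Fin 2 → PowerSeries k, (∀ i, X ^ vec γ i ∣ x i) ∧
            ∀ i, MvPolynomial.aeval x (φ i) = y i)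
    (hE : ∀ P ∈ (hyp γ (m + 1) : Set (JetSpace k (m + 1))),
      truncate m P ∈ zariskiClosure (onBranch f b α (m + 1) m)) :
    ∀ P ∈ (hyp γ (m + 1) : Set (JetSpace k (m + 1))),
      truncate m P ∈ zariskiClosure (onBranch g b' α (m + 1) m) := by
  have hf0 := coe_ne_zero hf.ne_zero
  have hg0 := coe_ne_zero hg.ne_zero
  obtain ⟨c, hc, hcb⟩ := hf.exists_pureRoot hbf h haj hk he he'
  obtain ⟨c', hc', hcb'⟩ := hg.exists_pureRoot hbg h' haj hk he he'
  obtain ⟨Z, hZ, hZ0⟩ := hc.exists_root (R := k) (ξ := X) PowerSeries.constantCoeff_X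
  obtain ⟨Z', hZ', hZ0'⟩ := hc'.exists_root (R := k) (ξ := X)
    PowerSeries.constantCoeff_X
  rw [Algebra.algebraMap_self_apply] at hZ hZ'
  obtain ⟨φ, h1, h2, h3⟩ := H Z Z' (hZ ▸ hc.ne_zero) (hZ' ▸ hc'.ne_zero)
  have hle : ∀ i, vec α i ≤ m := fun i => by
    refine (Trop.le_ord (φ := ↟f) ?_ i).trans hm
    exact trop_of_dvd hf0 hbf ((h.trop_iff _).2 ⟨s, hs, hα⟩)
  have e1 : ord ↟f (vec α) =
      s * ord ↟f w := by rw [hα, ord_smul hf0]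
  have e2 : ord ↟g (vec α) =
      s * ord ↟g w := by rw [hα, ord_smul hg0]
  exact truncate_hyp_mem_of_map hγ hE (fun P hP => h.jetOf_mem_onBranch
    (ne_zero_of_dvd_ne_zero hf0 hbf) h' (ne_zero_of_dvd_ne_zero hg0 hbg) haj hk he he' hc hcb hc'
    hcb' hs (Nat.sub_pos_of_lt (Nat.lt_succ_of_le hm)) hα hle (by omega) (by omega) hZ hZ0 hZ' hZ0'
    h1 h2 hP) h3

/-- An obstruction to edges from a cusp to a coordinate subspace in characteristic two. -/
theorem IsBranch.not_truncate_hyp_mem (hf : IsNewtonPlaneCurve f)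
    (hbf : b ∣ ↟f) (h : IsBranch b w u) {s : ℕ} (hs : 0 < s)
    (hα : vec α = s • w) (hm : ord ↟f (vec α) ≤ m)
    (hγ : ∀ i, vec γ i ≤ m + 1 + 1) {a j : Fin 2} (haj : a ≠ j) (hw : w j = 2)
    (h2 : (2 : k) = 0) (hk : (w a : k) ≠ 0) {l : ℕ} (hl : Odd l)
    (hlm : l + ord ↟f (vec α) ≤ m) (hγl : vec γ j ≤ 2 * s + l)
    (H : ∀ Z : PowerSeries k, ∃ (G R : PowerSeries k) (κ z : k), X ^ 2 * Z =
      G ^ 2 + C κ * X ^ w a + C z * X ^ (l + 2) +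
        X ^ (l + 3) * R)
    (hE : ∀ P ∈ (hyp γ (m + 1) : Set (JetSpace k (m + 1))),
      truncate m P ∈ zariskiClosure (onBranch f b α (m + 1) m)) : False := by
  have hf0 := coe_ne_zero hf.ne_zero
  have he : (Pi.single j 1 : Fin 2 → ℕ) a = 0 := by simp [haj]
  have he' : (Pi.single j 1 : Fin 2 → ℕ) j = 1 := by simp
  obtain ⟨c, hc, hcb⟩ := hf.exists_pureRoot hbf h haj hk he he'
  obtain ⟨Z, hZ, hZ0⟩ := hc.exists_root (R := k) (ξ := X) PowerSeries.constantCoeff_X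
  rw [Algebra.algebraMap_self_apply] at hZ
  obtain ⟨G, R, κ, z, hdec⟩ := H Z
  have e1 : ord ↟f (vec α) =
      s * ord ↟f w := by rw [hα, ord_smul hf0]
  have h2s : 2 * s ≤ ord ↟f (vec α) := by
    have h5 := (trop_of_dvd hf0 hbf ((h.trop_iff _).2 ⟨s, hs, hα⟩)).le_ord j
    have h6 : vec α j = s * 2 := by rw [hα]; simp [hw]
    omega
  let v : Fin 2 → ℕ → MvPolynomial (Fin 2 × Fin (m + 1)) k := fun i n =>
    if h : n < m + 1 then MvPolynomial.X (i, ⟨n, h⟩) else 0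
  have hv : ∀ (Q : JetSpace k m) i n, MvPolynomial.eval Q (v i n) =
      coeff n (jetSeries Q i) := fun Q i n => by
    rw [coeff_jetSeries]
    simp only [v]
    split_ifs <;> simp
  let C₀ : k := if s = 1 then z ^ 2 else 0
  let p : MvPolynomial (Fin 2 × Fin (m + 1)) k :=
    (v j (2 * s + l) - MvPolynomial.C κ * v a (2 * s + l)) ^ 2 * MvPolynomial.C (c ^ (l + 2)) -
      MvPolynomial.C C₀ * v j (2 * s) ^ (l + 2)
  have hp : ∀ Q : JetSpace k m, MvPolynomial.eval Q p =
      (coeff (2 * s + l) (jetSeries Q j) - κ *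
        coeff (2 * s + l) (jetSeries Q a)) ^ 2 * c ^ (l + 2) -
        C₀ * coeff (2 * s) (jetSeries Q j) ^ (l + 2) := fun Q => by
    simp only [p, map_sub, map_mul, map_pow, MvPolynomial.eval_C, hv]
  have hvan : ∀ Q ∈ onBranch f b α (m + 1) m, MvPolynomial.eval Q p = 0 := by
    intro Q hQ
    obtain ⟨T, S, hT, hSX, hS, hxa, hxj⟩ := h.exists_arc (ne_zero_of_dvd_ne_zero hf0 hbf) haj hk he
      he' hc hcb hs hα (M := m + 1 - ord ↟f (vec α)) (by omega) hZ hZ0 hQ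
    rw [hw, ← modX_eq_iff, modX_eq_iff_coeff] at hxj
    have hcX : ∀ n d (Y : PowerSeries k), coeff n ((X ^ s * T) ^ d * Y) =
        if s * d ≤ n then coeff (n - s * d) (T ^ d * Y) else 0 := fun n d Y => by
      rw [mul_pow, ← pow_mul, mul_assoc, PowerSeries.coeff_X_pow_mul']
    have hu0 : coeff (2 * s) (jetSeries Q j) = constantCoeff T ^ 2 * c := by
      rw [hxj _ (by omega), hcX, if_pos (by omega), mul_comm 2 s, Nat.sub_self]
      simp [hS, hZ]
    have hS2 := congrArg S hdec
    simp only [map_mul, map_add, map_pow, hSX] at hS2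
    have hC : ∀ x : k, S (C x) = C x := S.commutes
    have h3 : l + 2 ≤ s * (l + 2) := Nat.le_mul_of_pos_left _ hs
    have hul : coeff (2 * s + l) (jetSeries Q j) =
        κ * coeff (2 * s + l) (jetSeries Q a) +
          if s = 1 then z * constantCoeff T ^ (l + 2) else 0 := by
      rw [hxj _ (by omega), hS2, hC, hC, map_add, map_add, map_add,
        coeff_sq_eq_zero h2 _ ((even_two_mul s).add_odd hl), PowerSeries.coeff_C_mul,
        PowerSeries.coeff_C_mul, ← hxa, hcX (2 * s + l) (l + 3), if_neg (by nlinarith), zero_add,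
        add_zero, ← mul_one ((X ^ s * T) ^ (l + 2)), hcX]
      congr 1
      by_cases h1 : s = 1
      · subst h1
        rw [if_pos (by omega), if_pos rfl, show 2 * 1 + l - 1 * (l + 2) = 0 by omega]
        simp
      · have : 2 ≤ s := by omega
        rw [if_neg (not_le.2 (by nlinarith [Nat.mul_le_mul_right l this, hl.pos])), if_neg h1,
          mul_zero]
    rw [hp, hul, hu0, add_sub_cancel_left]
    simp only [C₀]
    split_ifs
    · ring
    · simp
  have hx := hE _ ((jetOf_mem_hyp_iff (x := Pi.single j (X ^ (2 * s + l))) hγ).2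
    ((forall_iff_of_ne haj).2 ⟨by simp [haj], by simpa using pow_dvd_pow _ hγl⟩))
  rw [truncate_jetOf (Nat.le_succ m)] at hx
  have h0 := mem_zariskiClosure.1 hx p hvan
  rw [hp, coeff_jetSeries_jetOf, coeff_jetSeries_jetOf, coeff_jetSeries_jetOf,
    if_pos (show 2 * s + l < m + 1 by omega), if_pos (show 2 * s + l < m + 1 by omega),
    if_pos (show 2 * s < m + 1 by omega)] at h0
  simp only [Pi.single_eq_same, Pi.single_eq_of_ne haj, map_zero, mul_zero, sub_zero,
    PowerSeries.coeff_X_pow, if_true, one_pow, one_mul] at h0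
  rw [if_neg (by have := hl.pos; omega), zero_pow (by omega), mul_zero, sub_zero] at h0
  exact pow_ne_zero _ hc.ne_zero h0

theorem exists_cusp_decomposition_one (Z : PowerSeries k) (n : ℕ) :
    ∃ (G R : PowerSeries k) (κ z : k), X ^ 2 * Z =
      G ^ 2 + C κ * X ^ n + C z * X ^ (1 + 2) +
        X ^ (1 + 3) * R := by
  obtain ⟨R, hR⟩ := exists_eq_shift_three Z
  obtain ⟨x, hx⟩ := IsAlgClosed.exists_pow_nat_eq (coeff 0 Z) two_pos
  have hx' := congrArg (C (R := k)) hx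
  rw [map_pow] at hx'
  refine ⟨C x * X, C (coeff 2 Z) + X * R,
    0, coeff 1 Z, ?_⟩
  rw [map_zero]
  linear_combination X ^ 2 * hR - X ^ 2 * hx'

theorem exists_cusp_decomposition_three (h2 : (2 : k) = 0) (Z : PowerSeries k) :
    ∃ (G R : PowerSeries k) (κ z : k), X ^ 2 * Z =
      G ^ 2 + C κ * X ^ 3 + C z * X ^ (3 + 2) +
        X ^ (3 + 3) * R := by
  obtain ⟨R, hR⟩ := exists_eq_shift_three Z
  obtain ⟨Q, hQ⟩ := PowerSeries.X_dvd_iff.2 (show constantCoeff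
    (R - C (constantCoeff R)) = 0 by simp)
  obtain ⟨x, hx⟩ := IsAlgClosed.exists_pow_nat_eq (coeff 0 Z) two_pos
  obtain ⟨y, hy⟩ := IsAlgClosed.exists_pow_nat_eq (coeff 2 Z) two_pos
  have hx' := congrArg (C (R := k)) hx
  have hy' := congrArg (C (R := k)) hy
  have h2' : (2 : PowerSeries k) = 0 := by
    rw [← map_ofNat (C (R := k)) 2, h2, map_zero]
  rw [map_pow] at hx' hy'
  refine ⟨C x * X + C y * X ^ 2, Q,
    coeff 1 Z, constantCoeff R, ?_⟩
  linear_combination X ^ 2 * hR - X ^ 2 * hx' - X ^ 4 * hy' +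
    X ^ 5 * hQ - (C x * C y * X ^ 3) * h2'

end

section

section Cusp

theorem eq_zero_one_or_of_ne {i₀ i₁ : Fin 2} (hi : i₀ ≠ i₁) :
    (i₀ = 0 ∧ i₁ = 1) ∨ (i₀ = 1 ∧ i₁ = 0) := by
  decide +revert

variable {k : Type u} [Field k] {φ : MvPowerSeries (Fin 2) k} {w : Fin 2 → ℕ}

/-- Singular branches of curves of multiplicity two are cusps. -/
theorem exists_cusp (h : Trop φ w) (hcop : (w 0).Coprime (w 1)) (hw : ∀ i, 2 ≤ w i)
    {d : Fin 2 →₀ ℕ} (hd : MvPowerSeries.coeff d φ ≠ 0) (hd2 : d 0 + d 1 < 3) :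
    ∃ i₀ i₁ : Fin 2, i₀ ≠ i₁ ∧ w i₀ = 2 ∧ Odd (w i₁) ∧
      MvPowerSeries.coeff (Finsupp.single i₁ 2) φ ≠ 0 := by
  have h1 := (h.mul_le_ord hcop).trans (ord_le w hd)
  have h0 := hw 0
  have h0' := hw 1
  have key : ∀ i₀ i₁ : Fin 2, i₀ ≠ i₁ → (w i₀).Coprime (w i₁) → 2 ≤ w i₀ → w i₀ * w i₁ ≤ 2 * w i₁ →
      2 ≤ w i₁ → d i₀ = 0 → d i₁ = 2 → ∃ i₀ i₁ : Fin 2, i₀ ≠ i₁ ∧ w i₀ = 2 ∧ Odd (w i₁) ∧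
      MvPowerSeries.coeff (Finsupp.single i₁ 2) φ ≠ 0 := by
    intro i₀ i₁ hi hc h2 hle h3 e0 e1
    have h4 : w i₀ = 2 := le_antisymm (Nat.le_of_mul_le_mul_right hle (by omega)) h2
    refine ⟨i₀, i₁, hi, h4, ?_, ?_⟩
    · rw [h4] at hc
      exact Nat.coprime_two_left.1 hc
    · rwa [show Finsupp.single i₁ 2 = d from finsupp_ext_of_ne hi (by simp [hi.symm, e0])
        (by simp [e1])]
  have hne : w 0 ≠ w 1 := fun he => by
    rw [he, Nat.coprime_self] at hcop
    omega
  simp only [dot] at h1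
  have ha : d 0 ≤ 2 := by omega
  have hb : d 1 ≤ 2 := by omega
  interval_cases e0 : d 0 <;> interval_cases e1 : d 1 <;> try omega
  all_goals first
    | exact key 0 1 (by decide) hcop h0 (by omega) h0' e0 e1
    | exact key 1 0 (by decide) hcop.symm h0' (by rw [mul_comm]; omega) h0 e1 e0
    | exact absurd h1 (by
        rcases lt_or_gt_of_ne hne with h | h <;> nlinarith)

/-- The arithmetic of points of the walk in the case of a cusp. -/
theorem Pres.cusp {i₀ i₁ : Fin 2} (hi : i₀ ≠ i₁) (hφ : φ ≠ 0) (h : Trop φ w)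
    (hcop : (w 0).Coprime (w 1)) (hw : w i₀ = 2) (hodd : Odd (w i₁))
    (hd : MvPowerSeries.coeff (Finsupp.single i₁ 2) φ ≠ 0) {m : ℕ} {γ : Fin 2 → ℕ}
    (hγ : Pres φ m γ) (hγ2 : ∀ i, 2 ≤ γ i) :
    m < 2 * γ i₁ ∧ m < w i₁ * γ i₀ ∧ 2 * γ i₁ < w i₁ * γ i₀ + 2 ∧ 2 * γ i₁ ≤ m + 2 ∧
      w i₁ * γ i₀ ≤ m + w i₁ ∧ (2 * γ i₁ < m + 2 ∨ w i₁ * γ i₀ < m + w i₁) := by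
  set q := w i₁ with hq
  have hq2 : q % 2 = 1 := Nat.odd_iff.1 hodd
  have hq0 : 0 < q := by omega
  have hlow : ∀ d, MvPowerSeries.coeff d φ ≠ 0 → 2 * q ≤ 2 * d i₀ + q * d i₁ := fun d hd => by
    have h1 := (h.mul_le_ord hcop).trans (ord_le w hd)
    rw [dot_eq hi, hw] at h1
    have h2 : w 0 * w 1 = w i₀ * w i₁ := by
      rcases eq_zero_one_or_of_ne hi with ⟨rfl, rfl⟩ | ⟨rfl, rfl⟩
      exacts [rfl, mul_comm _ _]
    rwa [h2, hw] at h1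
  have hpure : MvPowerSeries.coeff (Finsupp.single i₀ q) φ ≠ 0 := by
    have hmin : ∀ d, IsMin φ w d → 2 * d i₀ + q * d i₁ = 2 * q := fun d hd' => by
      refine le_antisymm ?_ (hlow d hd'.1)
      have := hd'.le hd
      rw [dot_eq hi, dot_eq hi, hw] at this
      simpa [hi, mul_comm] using this
    have hcase : ∀ d, IsMin φ w d → d = Finsupp.single i₀ q ∨ d = Finsupp.single i₁ 2 := by
      intro d hd'
      have h1 := hmin d hd'
      have h3 : d i₁ ≤ 2 := by
        by_contra hc
        have := Nat.mul_le_mul_left q (not_le.1 hc)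
        simp only [Nat.succ_eq_add_one] at this
        omega
      interval_cases h4 : d i₁
      · exact Or.inl (finsupp_ext_of_ne hi (by simp; omega) (by simp [hi, h4]))
      · omega
      · exact Or.inr (finsupp_ext_of_ne hi (by simp [hi.symm]; omega) (by simp [h4]))
    obtain ⟨-, d, d', hne, h1, h2⟩ := h
    rcases hcase d h1 with rfl | rfl
    · exact h1.1
    · rcases hcase d' h2 with rfl | rfl
      · exact h2.1
      · exact absurd rfl hne
  have hb1 : ∀ β : Fin 2 → ℕ, 2 * β i₁ ≤ q * β i₀ → ∀ d, MvPowerSeries.coeff d φ ≠ 0 →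
      2 * β i₁ ≤ dot β d := fun β hβ d hd => by
    rw [dot_eq hi]
    have h1 := Nat.mul_le_mul_right (d i₀) hβ
    have h2 := Nat.mul_le_mul_left (β i₁) (hlow d hd)
    refine le_of_mul_le_mul_left (?_ : q * _ ≤ q * _) hq0
    nlinarith
  have hb0 : ∀ β : Fin 2 → ℕ, q * β i₀ ≤ 2 * β i₁ → ∀ d, MvPowerSeries.coeff d φ ≠ 0 →
      q * β i₀ ≤ dot β d := fun β hβ d hd => by
    rw [dot_eq hi]
    have h1 := Nat.mul_le_mul_right (d i₁) hβ
    have h2 := Nat.mul_le_mul_left (β i₀) (hlow d hd)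
    refine le_of_mul_le_mul_left (?_ : 2 * _ ≤ 2 * _) two_pos
    nlinarith
  have e1 : ∀ β : Fin 2 → ℕ, dot β (Finsupp.single i₁ 2) = 2 * β i₁ := fun β => by
    rw [dot_eq hi]; simp [hi, mul_comm]
  have e0 : ∀ β : Fin 2 → ℕ, dot β (Finsupp.single i₀ q) = q * β i₀ := fun β => by
    rw [dot_eq hi]; simp [hi.symm, mul_comm]
  have hlt1 := hγ.lt.trans_le (ord_le γ hd)
  have hlt0 := hγ.lt.trans_le (ord_le γ hpure)
  rw [e1] at hlt1
  rw [e0] at hlt0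
  obtain ⟨β, hβ, p1, p0, p2, p3⟩ := hγ.exists_pred hi.symm (hγ2 i₁)
  have hs1 : 2 * β i₁ < q * β i₀ := by
    by_contra hc
    have := p2 _ (isMin_of_le hpure fun d hd => by rw [e0]; exact hb0 β (not_lt.1 hc) d hd)
    simp [hi] at this
  have hs2 := (le_ord hφ (hb1 β hs1.le)).trans p3
  obtain ⟨β', hβ', p1', p0', p2', p3'⟩ := hγ.exists_pred hi (hγ2 i₀)
  have hs1' : q * β' i₀ < 2 * β' i₁ := by
    by_contra hc
    have := p2' _ (isMin_of_le hd fun d hd => by rw [e1]; exact hb1 β' (not_lt.1 hc) d hd)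
    simp [hi.symm] at this
  have hs2' := (le_ord hφ (hb0 β' hs1'.le)).trans p3'
  obtain ⟨δ, d0, d1, d2⟩ := hγ.exists_diag hi (hγ2 i₀) (hγ2 i₁)
  have hq' : q * γ i₀ = q * β' i₀ + q := by rw [← p1', mul_add, mul_one]
  have hδ : q * δ i₀ = q * β' i₀ := by rw [show δ i₀ = β' i₀ by omega]
  rw [p0] at hs1
  refine ⟨hlt1, hlt0, by omega, by omega, by omega, ?_⟩
  rcases le_total (2 * δ i₁) (q * δ i₀) with hc | hc
  · have := le_ord hφ (hb1 δ hc)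
    omega
  · have := le_ord hφ (hb0 δ hc)
    omega

/-- The numerical cases in which a coordinate subspace may follow the branch of a cusp. -/
theorem cusp_cases {q D₀ D₁ M : ℕ} (hq : q % 2 = 1) (hq' : 2 ≤ q) (hM : 0 < M) (h1 : M < 2 * D₁)
    (h2 : M < q * D₀) (h3 : 2 * D₁ ≤ M + 2) (h4 : q * D₀ ≤ M + q)
    (h5 : 2 * D₁ < M + 2 ∨ q * D₀ < M + q) (h6 : M < D₀ + D₁) :
    (D₀ = 1 ∧ D₁ = 1 ∧ M = 1) ∨ (D₀ = 1 ∧ D₁ = 2 ∧ M = 2) ∨ (q = 3 ∧ D₀ = 2 ∧ D₁ = 2 ∧ M = 3) ∨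
      (q = 3 ∧ D₀ = 2 ∧ D₁ = 3 ∧ M = 4) := by
  rcases D₀ with - | - | D
  · omega
  · omega
  · rcases eq_or_ne q 3 with rfl | hne
    · omega
    · have h7 := Nat.mul_le_mul_right (D + 1) (show 5 ≤ q by omega)
      have h8 : q * (D + 1 + 1) = q * (D + 1) + q := by ring
      omega

end Cusp

variable {k : Type u} [Field k] [IsAlgClosed k] {m : ℕ} {f g : MvPolynomial (Fin 2) k}
  {b b' : MvPowerSeries (Fin 2) k} {w : Fin 2 → ℕ} {u u' : Fin 2 → k} {α γ : ℕ × ℕ}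

/-- The edges from a singular branch to a coordinate subspace only depend on the walk. -/
theorem IsBranch.truncate_hyp_mem_of_singular (hf : IsNewtonPlaneCurve f) (hg : IsNewtonPlaneCurve g)
    (hb : Irreducible b) (hbf : b ∣ ↟f)
    (hbg : b' ∣ ↟g) (h : IsBranch b w u) (h' : IsBranch b' w u')
    (hw : ∀ i, 2 ≤ w i) (hα : Trop b (vec α))
    (hord : ord ↟f (vec α) = ord ↟g (vec α))
    (hm : ord ↟f (vec α) ≤ m)
    (hγ : Pres ↟f (m + 1) (vec γ))
    (hE : ∀ P ∈ (hyp γ (m + 1) : Set (JetSpace k (m + 1))),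
      truncate m P ∈ zariskiClosure (onBranch f b α (m + 1) m)) :
    ∀ P ∈ (hyp γ (m + 1) : Set (JetSpace k (m + 1))),
      truncate m P ∈ zariskiClosure (onBranch g b' α (m + 1) m) := by
  have h01 : (0 : Fin 2) ≠ 1 := by decide
  have hf0 := coe_ne_zero hf.ne_zero
  obtain ⟨s, hs, hα'⟩ := (h.trop_iff _).1 hα
  have hγ1 : ∀ i, vec γ i ≤ m + 1 + 1 := hγ.le_add_one hf0
  obtain ⟨hlt, hdim⟩ := hf.lt_of_truncate_hyp_mem hb hbf h hα hm hγ1 hE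
  have hv : ∀ i, vec α i = s * w i := fun i => by rw [hα']; simp
  have hpos := hα.1
  have hdiag : vec γ = vec (α + (1, 1)) → ord ↟f (vec α) = m →
      ∀ P ∈ (hyp γ (m + 1) : Set (JetSpace k (m + 1))),
        truncate m P ∈ zariskiClosure (onBranch g b' α (m + 1) m) := fun hγα hM P hP => by
    refine hg.hyp_subset_closure hbg ((h'.trop_iff _).2 ⟨s, hs, hα'⟩) (hord ▸ hM) ?_
    refine (truncate_hyp_mem_hyp_iff (fun i => ?_) hγ1).2 hγα.ge P hP
    rw [← hγα]
    have h3 := (trop_of_dvd hf0 hbf hα).le_ord i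
    have h4 : vec γ i = vec α i + 1 := by rw [hγα]; fin_cases i <;> rfl
    omega
  have hvec : ∀ i : Fin 2, vec (α + (1, 1)) i = vec α i + 1 := fun i => by fin_cases i <;> rfl
  by_cases h3 : ∀ d, MvPowerSeries.coeff d ↟f ≠ 0 → 3 ≤ d 0 + d 1
  · have hl0 := hlt 0
    have hl1 := hlt 1
    have := hγ.eq_add_one_of_lt h01 hf0 h3 hpos (a := vec γ 0 - vec α 0 - 1)
      (b := vec γ 1 - vec α 1 - 1) (by omega) (by omega) (by omega)
    exact hdiag (funext_of_ne h01 (by rw [hvec]; omega) (by rw [hvec]; omega)) (by omega)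
  · push Not at h3
    obtain ⟨d, hd, hd2⟩ := h3
    have ht := trop_of_dvd hf0 hbf h.trop
    obtain ⟨i₀, i₁, hi, hw0, hodd, hcoef⟩ := exists_cusp ht h.coprime hw hd hd2
    obtain ⟨n, hn⟩ : ∃ n, w i₁ + 1 = 2 * n := by
      obtain ⟨n, hn⟩ := hodd
      exact ⟨n + 1, by omega⟩
    have hw1 := hw i₁
    have hl0 := hlt i₀
    have hl1 := hlt i₁
    have hp0 := hpos i₀
    have hp1 := hpos i₁
    have hγ0 : ∀ i, 0 < vec γ i := fun i => (Nat.zero_le _).trans_lt (hlt i)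
    obtain ⟨c1, c0, c2, c3, c4, c5⟩ := hγ.cusp hi hf0 ht h.coprime hw0 hodd hcoef
      fun i => (Nat.succ_le_of_lt (hpos i)).trans_lt (hlt i)
    have hν : ord ↟f (vec α) = 2 * (s * w i₁) := by
      rw [hα', ord_smul hf0, mul_left_comm]
      congr 1
      refine le_antisymm ((ord_le w hcoef).trans_eq ?_) (le_trans ?_ (ht.mul_le_ord h.coprime))
      · rw [dot_eq hi]
        simp [hi, mul_comm]
      · have h3 := Nat.mul_le_mul_right (w i₁) hw0.ge
        rcases eq_zero_one_or_of_ne hi with ⟨rfl, rfl⟩ | ⟨rfl, rfl⟩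
        exacts [h3, h3.trans_eq (mul_comm _ _)]
    have hsum : ∀ β : Fin 2 → ℕ, β 0 + β 1 = β i₀ + β i₁ := fun β => by
      rcases eq_zero_one_or_of_ne hi with ⟨rfl, rfl⟩ | ⟨rfl, rfl⟩
      exacts [rfl, add_comm _ _]
    have hγs := hsum (vec γ)
    have hαs := hsum (vec α)
    have hv0 := hv i₀
    have hv1 := hv i₁
    rw [hw0] at hv0
    by_cases h2 : (2 : k) = 0
    · have hk : (w i₁ : k) ≠ 0 := by
        have h4 := congrArg (Nat.cast (R := k)) hn
        push_cast at h4
        rw [h2, zero_mul] at h4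
        exact fun h0 => one_ne_zero (by rwa [h0, zero_add] at h4)
      obtain ⟨D₀, hD₀⟩ := Nat.exists_eq_add_of_le hl0.le
      obtain ⟨D₁, hD₁⟩ := Nat.exists_eq_add_of_le hl1.le
      obtain ⟨M, hM⟩ := Nat.exists_eq_add_of_le (hm.trans m.le_succ)
      rw [hν] at hM hm hdim
      have hr : w i₁ * vec γ i₀ = 2 * (s * w i₁) + w i₁ * D₀ := by
        rw [hD₀, hv0]; ring
      rcases cusp_cases (Nat.odd_iff.1 hodd) hw1 (D₀ := D₀) (D₁ := D₁) (M := M) (by omega) (by omega)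
        (by omega) (by omega) (by omega) (by omega) (by omega) with
        ⟨rfl, rfl, rfl⟩ | ⟨rfl, rfl, rfl⟩ | ⟨hq, rfl, rfl, rfl⟩ | ⟨hq, rfl, rfl, rfl⟩
      · exact hdiag (funext_of_ne hi (by rw [hvec]; omega) (by rw [hvec]; omega)) (by omega)
      · exact (h.not_truncate_hyp_mem hf hbf hs hα' (hν ▸ hm) hγ1 hi.symm hw0 h2 hk odd_one
          (by omega) (by omega) (fun Z => exists_cusp_decomposition_one Z _) hE).elim
      · refine h.truncate_hyp_mem_of_forall hf hg hbf hbg h' hs hα' hord (hν ▸ hm) hγ1 hi.symm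
          (e := Pi.single i₀ 1) hk (by simp [hi]) (by simp) ?_ hE
        rw [show m + 1 - ord ↟f (vec α) = 3 by omega]
        exact fun Z Z' hZ hZ' => exists_map_three hi.symm hq hw0 (by simp [hi.symm]) (by simp) hγ0
          (by rw [hq] at hv1; omega) hZ hZ'
      · exact (h.not_truncate_hyp_mem hf hbf hs hα' (hν ▸ hm) hγ1 hi.symm hw0 h2 hk
          (show Odd 3 by decide) (by omega) (by omega)
          (fun Z => by rw [hq]; exact exists_cusp_decomposition_three h2 Z) hE).elim
    · refine h.truncate_hyp_mem_of_forall hf hg hbf hbg h' hs hα' hord hm hγ1 hi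
        (e := Pi.single i₁ 1) (by rw [hw0]; exact_mod_cast h2) (by simp [hi]) (by simp) ?_ hE
      intro Z Z' hZ hZ'
      refine exists_map_two hi hw0 (by simp [hi]) (by simp) hn (by omega) hγ0 ?_ hZ hZ'
      refine not_lt.1 fun hc => ?_
      have h3 : w i₁ * vec γ i₀ + vec γ i₀ = 2 * (vec γ i₀ * n) := by
        rw [← Nat.succ_mul, Nat.succ_eq_add_one, hn]; ring
      omega

end

section

section Linear

variable {k : Type u} [Field k] {σ : Type} [Fintype σ]

/-- The coefficient of `z ^ N` in `p(Θ)` only involves the linear part of `p` when `N` is not a sum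
of nonzero exponents that occur in `Θ`. -/
theorem coeff_aeval_of_indecomposable (J : AddSubmonoid ℕ) {N : ℕ} (hN : N ≠ 0)
    (hJ : ∀ a ∈ J, ∀ b ∈ J, a + b = N → a = 0 ∨ b = 0) {Θ : σ → Polynomial k}
    (hΘ : ∀ c n, (Θ c).coeff n ≠ 0 → n ∈ J) (hΘ0 : ∀ c, (Θ c).coeff 0 = 0)
    (p : MvPolynomial σ k) : (MvPolynomial.aeval Θ p).coeff N =
      ∑ c, (Θ c).coeff N * MvPolynomial.eval 0 (MvPolynomial.pderiv c p) := by
  classical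
  have hmul : ∀ P Q : Polynomial k, (∀ n, P.coeff n ≠ 0 → n ∈ J) → (∀ n, Q.coeff n ≠ 0 → n ∈ J) →
      (P * Q).coeff N = P.coeff 0 * Q.coeff N + P.coeff N * Q.coeff 0 := fun P Q hP hQ => by
    rw [Polynomial.coeff_mul, ← Finset.sum_pair (f := fun x : ℕ × ℕ => P.coeff x.1 * Q.coeff x.2)
      (a := (0, N)) (b := (N, 0)) (by simpa using fun h => absurd h.symm hN)]
    refine (Finset.sum_subset (fun x hx => ?_) fun x hx hx' => ?_).symm
    · rcases Finset.mem_insert.1 hx with rfl | hx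
      · simp
      · simp [Finset.mem_singleton.1 hx]
    · by_contra hne
      have hx := Finset.HasAntidiagonal.mem_antidiagonal.1 hx
      refine hx' ?_
      rcases hJ _ (hP _ (left_ne_zero_of_mul hne)) _ (hQ _ (right_ne_zero_of_mul hne)) hx with h | h
      · simp [Prod.ext_iff, h, show x.2 = N by omega]
      · simp [Prod.ext_iff, h, show x.1 = N by omega]
  have key : (∀ n, (MvPolynomial.aeval Θ p).coeff n ≠ 0 → n ∈ J) ∧
      (MvPolynomial.aeval Θ p).coeff 0 = MvPolynomial.eval 0 p ∧ (MvPolynomial.aeval Θ p).coeff N =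
      ∑ c, (Θ c).coeff N * MvPolynomial.eval 0 (MvPolynomial.pderiv c p) := by
    induction p using MvPolynomial.induction_on with
    | C a =>
      refine ⟨fun n hn => ?_, by simp, ?_⟩
      · rw [MvPolynomial.aeval_C, Polynomial.algebraMap_apply, Polynomial.coeff_C] at hn
        split_ifs at hn with h
        · exact h ▸ J.zero_mem
        · exact absurd rfl hn
      · simp [Polynomial.coeff_C, hN]
    | add p q hp hq =>
      refine ⟨fun n hn => ?_, by simp [hp.2.1, hq.2.1], ?_⟩
      · by_contra hnJ
        refine hn ?_
        rw [map_add, Polynomial.coeff_add, not_not.1 fun h => hnJ (hp.1 n h),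
          not_not.1 fun h => hnJ (hq.1 n h), add_zero]
      · simp only [map_add, Polynomial.coeff_add, hp.2.2, hq.2.2, mul_add, Finset.sum_add_distrib]
    | mul_X p c hp =>
      rw [map_mul, MvPolynomial.aeval_X]
      refine ⟨fun n hn => ?_, by simp [Polynomial.mul_coeff_zero, hΘ0], ?_⟩
      · rw [Polynomial.coeff_mul] at hn
        obtain ⟨x, hx, hne⟩ := Finset.exists_ne_zero_of_sum_ne_zero hn
        rw [← Finset.HasAntidiagonal.mem_antidiagonal.1 hx]
        exact J.add_mem (hp.1 _ (left_ne_zero_of_mul hne)) (hΘ _ _ (right_ne_zero_of_mul hne))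
      · rw [hmul _ _ hp.1 (hΘ c), hΘ0, mul_zero, add_zero, hp.2.1]
        simp [MvPolynomial.pderiv_X, Pi.single_apply, apply_ite, mul_comm]
  exact key.2.2

end Linear

section Closed

variable {k : Type u} [Field k] {σ : Type} [Finite σ]

theorem embDim_mono {V W : Set (σ → k)} (h : V ⊆ W) : embDim V ≤ embDim W := by
  obtain ⟨φ, hφ⟩ := exists_embDim W
  have hle : MvPolynomial.vanishingIdeal k W ≤ MvPolynomial.vanishingIdeal k V :=
    MvPolynomial.vanishingIdeal_anti_mono h
  simpa using embDim_le ((Ideal.Quotient.factorₐ k hle).comp φ)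
    ((Ideal.Quotient.factor_surjective hle).comp hφ)

end Closed

section Emb

variable {k : Type u} [Field k] {m : ℕ} {f : MvPolynomial (Fin 2) k} {b : MvPowerSeries (Fin 2) k}
  {w e : Fin 2 → ℕ} {u : Fin 2 → k} {α : ℕ × ℕ} {a j : Fin 2} {c : k}

/-- Arcs on a branch in a chart with a pure coordinate. -/
theorem IsBranch.arc_mem_onBranch (h : IsBranch b w u) (hb0 : b ≠ 0) (hc : IsChartRoot f w e c)
    (hcb : homPart b w (ord b w) (fun i => c ^ e i) = 0) {s : ℕ} (hs : 0 < s) (hα : vec α = s • w)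
    (hle : ∀ i, vec α i ≤ m) {Z : PowerSeries k} (hZ : constantCoeff Z = c)
    (hZ0 : (strict f w e X).eval Z = 0) {T : PowerSeries k} (hT : constantCoeff T ≠ 0)
    {S : PowerSeries k →ₐ[k] PowerSeries k} (hSX : S X = X ^ s * T)
    (hS : ∀ Z, constantCoeff (S Z) = constantCoeff Z) :
    jetOf m (fun i => (X ^ s * T) ^ w i * S Z ^ e i) ∈ onBranch f b α (m + 1) m := by
  have hv : ∀ i, (X ^ s * T) ^ w i * S Z ^ e i = X ^ vec α i * (T ^ w i * S Z ^ e i) := fun i => by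
    rw [hα, mul_pow, ← pow_mul, mul_assoc]
    rfl
  have hlead : ∀ i, coeff (vec α i) ((X ^ s * T) ^ w i * S Z ^ e i) =
      constantCoeff T ^ w i * c ^ e i := fun i => by
    rw [coeff_pow_of_X_pow_dvd (hv i), map_mul, map_pow, map_pow, hS, hZ]
  rw [jetOf_mem_onBranch_iff hle le_rfl]
  refine ⟨fun i => ⟨_, hv i⟩, fun i => ?_, ?_, ?_⟩
  · rw [hlead]
    exact mul_ne_zero (pow_ne_zero _ hT) (pow_ne_zero _ hc.ne_zero)
  · simp only [hlead]
    rw [hα, h.homPart_smul_eq hb0 hs, homPart_smul b h.pos, hcb, mul_zero]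
  · rw [aeval_chart, ← hSX, ← algHom_eval_strict, hZ0, map_zero, mul_zero]
    exact dvd_zero _

/-- Linear functionals that vanish on all powers of power series of order `s`. -/
theorem eq_zero_of_sum_coeff_pow [Infinite k] {n s : ℕ} (hn : (n : k) ≠ 0) {l : Fin (m + 1) → k}
    (H : ∀ T : PowerSeries k, constantCoeff T ≠ 0 →
      ∑ i : Fin (m + 1), coeff (i : ℕ) ((X ^ s * T) ^ n) * l i = 0) (i : Fin (m + 1))
    (hi : s * n ≤ i) : l i = 0 := by
  let L : PowerSeries k →ₗ[k] k := ∑ i : Fin (m + 1), l i • coeff (i : ℕ)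
  have hL : ∀ F, L F = ∑ i : Fin (m + 1), coeff (i : ℕ) F * l i := fun F => by
    simp [L, mul_comm]
  have hunit : ∀ U : PowerSeries k, constantCoeff U = 1 → L (X ^ (s * n) * U) = 0 := fun U hU => by
    obtain ⟨T, h1, h2⟩ := exists_pow_eq hn (U := U) one_ne_zero (by rw [one_pow, hU])
    rw [hL, ← h2, pow_mul, ← mul_pow]
    exact H T (by simp [h1])
  obtain ⟨l', hl'⟩ := Nat.exists_eq_add_of_le hi
  have h1 : L (X ^ (i : ℕ)) = l i := by
    rw [hL, Finset.sum_eq_single i]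
    · simp
    · intro q _ hq
      rw [PowerSeries.coeff_X_pow, if_neg fun h => hq (Fin.ext h), zero_mul]
    · simp
  rw [← h1]
  rcases Nat.eq_zero_or_pos l' with rfl | hl0
  · rw [hl', add_zero, ← mul_one (X ^ (s * n))]
    exact hunit 1 (by simp)
  · have h2 := hunit (1 + X ^ l') (by simp [hl0.ne'])
    have h3 := hunit 1 (by simp)
    rw [mul_one] at h3
    rwa [mul_add, mul_one, map_add, h3, zero_add, ← pow_add, ← hl'] at h2

/-- The coordinates of the jets of the arcs with parameter `z * Y`, as polynomials in `z`. -/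
theorem exists_scaling (haj : a ≠ j) (he : e a = 0) (he' : e j = 1) (m : ℕ)
    (Y Z : PowerSeries k) (hY : X ∣ Y) : ∃ Θ : Fin 2 × Fin (m + 1) → Polynomial k,
      (∀ c n, (Θ c).coeff n ≠ 0 → n = w a ∨ w j ≤ n) ∧
      (∀ i, (Θ (a, i)).coeff (w a) = coeff (i : ℕ) (Y ^ w a)) ∧
      (∀ i n, n < w j → (Θ (j, i)).coeff n = 0) ∧ (∀ i, w a ≠ w j → (Θ (a, i)).coeff (w j) = 0) ∧
      (∀ i, (Θ (j, i)).coeff (w j) = constantCoeff Z * coeff (i : ℕ) (Y ^ w j)) ∧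
      ∀ (z : k) (S : PowerSeries k →ₐ[k] PowerSeries k), S X = C z * Y →
        jetOf m (fun i => (C z * Y) ^ w i * S Z ^ e i) = fun c => (Θ c).eval z := by
  have hc : ∀ (n l : ℕ) (x : k), (Polynomial.monomial l x).coeff n = if l = n then x else 0 :=
    fun n l x => Polynomial.coeff_monomial
  let Θ : Fin 2 × Fin (m + 1) → Polynomial k := fun c =>
    if c.1 = a then Polynomial.monomial (w a) (coeff (c.2 : ℕ) (Y ^ w a)) else
      ∑ l ∈ Finset.range (m + 1),
        Polynomial.monomial (w j + l) (coeff l Z * coeff (c.2 : ℕ) (Y ^ (w j + l)))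
  have hΘa : ∀ i, Θ (a, i) = Polynomial.monomial (w a) (coeff (i : ℕ) (Y ^ w a)) := fun i => if_pos rfl
  have hΘj : ∀ i, Θ (j, i) = ∑ l ∈ Finset.range (m + 1),
      Polynomial.monomial (w j + l) (coeff l Z * coeff (i : ℕ) (Y ^ (w j + l))) :=
    fun i => if_neg haj.symm
  have hlt : ∀ i n, n < w j → (Θ (j, i)).coeff n = 0 := fun i n hn => by
    rw [hΘj, Polynomial.finsetSum_coeff]
    exact Finset.sum_eq_zero fun l _ => by rw [hc, if_neg (by omega)]
  refine ⟨Θ, ?_, fun i => ?_, hlt, fun i hne => ?_, fun i => ?_, fun z S hS => ?_⟩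
  · rintro ⟨i, q⟩ n hn
    rcases eq_or_eq_of_ne haj i with rfl | rfl
    · rw [hΘa, hc] at hn
      exact Or.inl (not_not.1 fun h => hn (if_neg fun h' => h h'.symm))
    · exact Or.inr (not_lt.1 fun h => hn (hlt q n h))
  · rw [hΘa, hc, if_pos rfl]
  · rw [hΘa, hc, if_neg hne]
  · rw [hΘj, Polynomial.finsetSum_coeff, Finset.sum_eq_single 0]
    · simp
    · intro l _ hl
      rw [hc, if_neg (by omega)]
    · simp
  · refine funext fun c => ?_
    obtain ⟨i, q⟩ := c
    rcases eq_or_eq_of_ne haj i with rfl | rfl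
    · rw [hΘa, jetOf, Polynomial.eval_monomial]
      simp only [he, pow_zero, mul_one, mul_pow]
      rw [← map_pow, PowerSeries.coeff_C_mul, mul_comm]
    · obtain ⟨R, hR⟩ := PowerSeries.X_pow_dvd_iff (n := m + 1)
        (φ := Z - ∑ l ∈ Finset.range (m + 1), C (coeff l Z) * X ^ l).2 fun l hl => by
          simp [PowerSeries.coeff_X_pow, Finset.mem_range.2 hl]
      have hCS : ∀ x : k, S (C x) = C x := fun x => S.commutes x
      have hSZ := congrArg S (sub_eq_iff_eq_add.1 hR)
      simp only [map_add, map_mul, map_pow, map_sum, hS, hCS] at hSZ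
      obtain ⟨Y', hY'⟩ := pow_dvd_pow_of_dvd hY (m + 1)
      rw [hΘj, jetOf, Polynomial.eval_finsetSum]
      simp only [he', pow_one]
      rw [hSZ, mul_add, map_add, Finset.mul_sum, map_sum]
      have h0 : coeff (q : ℕ) ((C z * Y) ^ w i * ((C z * Y) ^ (m + 1) * S R)) = 0 := by
        refine PowerSeries.X_pow_dvd_iff.1 ?_ _ q.2
        rw [mul_pow _ _ (m + 1), hY']
        exact ⟨(C z * Y) ^ w i * (C z ^ (m + 1) * Y' * S R), by ring⟩
      rw [h0, zero_add]
      refine Finset.sum_congr rfl fun l _ => ?_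
      rw [Polynomial.eval_monomial, mul_left_comm, ← pow_add, mul_pow, ← map_pow,
        PowerSeries.coeff_C_mul, PowerSeries.coeff_C_mul]
      ring

/-- In characteristic zero the embedding dimension of the jets on a singular branch is that of the
coordinate subspace. -/
theorem IsNewtonPlaneCurve.embDim_onBranch [IsAlgClosed k] [CharZero k] (hf : IsNewtonPlaneCurve f)
    (hb : Irreducible b) (hbf : b ∣ ↟f) (h : IsBranch b w u)
    (hw : ∀ i, 2 ≤ w i) (hα : Trop b (vec α)) (hle : ∀ i, vec α i ≤ m) :
    embDim (zariskiClosure (onBranch f b α (m + 1) m)) = embDim (hyp α m : Set (JetSpace k m)) := by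
  classical
  have hle' : ∀ i, vec α i ≤ m + 1 := fun i => (hle i).trans m.le_succ
  obtain ⟨s, hs, hα'⟩ := (h.trop_iff _).1 hα
  refine le_antisymm (embDim_mono ?_) ?_
  · rw [← (hyp_facts hle').1.1]
    exact zariskiClosure_mono fun P hP => mem_hyp_iff.2 hP.1
  obtain ⟨a, j, haj, hlt, hnd⟩ : ∃ a j : Fin 2, a ≠ j ∧ w a < w j ∧ ¬ w a ∣ w j := by
    have hcop := h.coprime
    have h0 := hw 0
    have h1 := hw 1
    rcases lt_trichotomy (w 0) (w 1) with hlt | heq | hlt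
    · exact ⟨0, 1, by decide, hlt, fun hd => by have := hcop.eq_one_of_dvd hd; omega⟩
    · rw [heq, Nat.coprime_self] at hcop
      omega
    · exact ⟨1, 0, by decide, hlt, fun hd => by have := hcop.symm.eq_one_of_dvd hd; omega⟩
  have hwk : ∀ i, (w i : k) ≠ 0 := fun i => Nat.cast_ne_zero.2 (h.pos i).ne'
  obtain ⟨c, hc, hcb⟩ := hf.exists_pureRoot hbf h haj (hwk a) (e := Pi.single j 1) (by simp [haj])
    (by simp)
  obtain ⟨Z, hZ, hZ0⟩ := hc.exists_root (R := k) (ξ := X) PowerSeries.constantCoeff_X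
  rw [Algebra.algebraMap_self_apply] at hZ
  obtain ⟨-, d, -, hd, hcard⟩ := hyp_facts (k := k) hle'
  have hcard' := card_idx hle'
  rw [Fintype.card_subtype] at hcard'
  suffices hT : (Finset.univ.filter fun p : Fin 2 × Fin (m + 1) => vec α p.1 ≤ p.2).card ≤
      embDim (zariskiClosure (onBranch f b α (m + 1) m)) by omega
  refine card_le_embDim _ fun p hp => ?_
  have hsum : ∀ F : Fin 2 → k, ∑ i, F i = F a + F j := fun F => by
    rw [Fin.sum_univ_two]
    rcases eq_zero_one_or_of_ne haj with ⟨rfl, rfl⟩ | ⟨rfl, rfl⟩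
    exacts [rfl, add_comm _ _]
  have hwa := h.pos a
  let J : AddSubmonoid ℕ :=
    { carrier := {n | w a ∣ n ∨ w j ≤ n}
      zero_mem' := Or.inl (dvd_zero _)
      add_mem' := by
        rintro x y (hx | hx) (hy | hy)
        exacts [Or.inl (dvd_add hx hy), Or.inr (by omega), Or.inr (by omega), Or.inr (by omega)] }
  have hJa : ∀ x ∈ J, ∀ y ∈ J, x + y = w a → x = 0 ∨ y = 0 := by
    have hJ0 : ∀ x ∈ J, x = 0 ∨ w a ≤ x := fun x hx => by
      rcases hx with hx | hx
      · exact (Nat.eq_zero_or_pos x).imp_right fun h0 => Nat.le_of_dvd h0 hx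
      · omega
    intro x hx y hy hxy
    have := hJ0 x hx
    have := hJ0 y hy
    omega
  have hJj : ∀ x ∈ J, ∀ y ∈ J, x + y = w j → x = 0 ∨ y = 0 := by
    rintro x (hx | hx) y (hy | hy) hxy
    exacts [absurd (hxy ▸ dvd_add hx hy) hnd, by omega, by omega, by omega]
  have key : ∀ T : PowerSeries k, constantCoeff T ≠ 0 → ∀ q ∈ ({a, j} : Set (Fin 2)),
      ∑ i : Fin (m + 1), coeff (i : ℕ) ((X ^ s * T) ^ w q) *
        MvPolynomial.eval 0 (MvPolynomial.pderiv (q, i) p) = 0 := by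
    intro T hT
    have hY : X ∣ X ^ s * T := (dvd_pow_self _ hs.ne').mul_right _
    obtain ⟨Θ, t1, t2, t3, t4, t5, t6⟩ := exists_scaling (w := w) (e := Pi.single j 1) haj
      (by simp [haj]) (by simp) m (X ^ s * T) Z hY
    have hΘ : MvPolynomial.aeval Θ p = 0 := by
      refine (mul_eq_zero.1 (?_ : Polynomial.X * _ = 0)).resolve_left Polynomial.X_ne_zero
      refine Polynomial.funext fun z => ?_
      rw [Polynomial.eval_mul, Polynomial.eval_X, Polynomial.eval_zero, mul_eq_zero]
      refine or_iff_not_imp_left.2 fun hz => ?_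
      have hCY : X ^ s * (C z * T) = C z * (X ^ s * T) := mul_left_comm _ _ _
      obtain ⟨S, hSX, hS⟩ := exists_substHom (τ := X ^ s * (C z * T)) (by simp [hs.ne'])
      have hmem := h.arc_mem_onBranch hb.ne_zero hc hcb hs hα' hle hZ hZ0 (T := C z * T)
        (by simp [hz, hT]) hSX hS
      rw [hCY] at hSX hmem
      rw [t6 z S hSX] at hmem
      have := hp _ (subset_zariskiClosure _ hmem)
      rwa [← Polynomial.coe_evalRingHom, MvPolynomial.aeval_def, MvPolynomial.hom_eval₂,
        show (Polynomial.evalRingHom z).comp (algebraMap k (Polynomial k)) = RingHom.id k from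
          RingHom.ext fun x => by simp]
    have hΘJ : ∀ c n, (Θ c).coeff n ≠ 0 → n ∈ J := fun c n hn => (t1 c n hn).imp_left (·.symm.dvd)
    have hΘ0 : ∀ c, (Θ c).coeff 0 = 0 := fun c => not_not.1 fun hn => by
      have := t1 c 0 hn
      omega
    have ha := coeff_aeval_of_indecomposable J hwa.ne' hJa hΘJ hΘ0 p
    have hj := coeff_aeval_of_indecomposable J (hwa.trans hlt).ne' hJj hΘJ hΘ0 p
    rw [hΘ, Polynomial.coeff_zero, Fintype.sum_prod_type, hsum] at ha hj
    rintro q (rfl | rfl)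
    · simpa [t2, t3 _ _ hlt] using ha.symm
    · simp only [t4 _ hlt.ne, t5, hZ, zero_mul, Finset.sum_const_zero, zero_add, mul_assoc,
        ← Finset.mul_sum] at hj
      exact (mul_eq_zero.1 hj.symm).resolve_left hc.ne_zero
  rintro ⟨q, i⟩ hqi
  have hqi' : s * w q ≤ i := by simpa [hα'] using hqi
  have hq : q ∈ ({a, j} : Set (Fin 2)) := eq_or_eq_of_ne haj q
  exact eq_zero_of_sum_coeff_pow (l := fun i => MvPolynomial.eval 0 (MvPolynomial.pderiv (q, i) p))
    (hwk q) (fun T hT => key T hT q hq) i hqi'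

end Emb

end

section

variable {k : Type u} [Field k] {f : MvPolynomial (Fin 2) k} {i₀ i₁ : Fin 2}

section Section

variable {R : Type u} [CommRing R] [Algebra k R]

/-- `f` as a polynomial in `x_{i₁}`, when a power series is substituted for `x_{i₀}`. -/
noncomputable def slice (f : MvPolynomial (Fin 2) k) (i₀ : Fin 2) (ξ : PowerSeries R) :
    Polynomial (PowerSeries R) :=
  MvPolynomial.aeval (fun i => if i = i₀ then Polynomial.C ξ else Polynomial.X) f

theorem eval_slice (ξ y : PowerSeries R) : (slice f i₀ ξ).eval y =
    MvPolynomial.aeval (fun i => if i = i₀ then ξ else y) f := by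
  rw [slice, ← Polynomial.coe_evalRingHom, MvPolynomial.aeval_def, MvPolynomial.hom_eval₂,
    MvPolynomial.aeval_def]
  congr 1
  · ext x; simp
  · funext i
    split_ifs <;> simp

theorem derivative_slice (hi : i₀ ≠ i₁) (ξ : PowerSeries R) :
    (slice f i₀ ξ).derivative = slice (MvPolynomial.pderiv i₁ f) i₀ ξ := by
  induction f using MvPolynomial.induction_on with
  | C a => simp [slice, IsScalarTower.algebraMap_apply k (PowerSeries R) (Polynomial _)]
  | add p q hp hq => simp only [slice, map_add] at hp hq ⊢; rw [hp, hq]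
  | mul_X p i hp =>
    simp only [slice, map_mul, MvPolynomial.aeval_X, Polynomial.derivative_mul,
      Derivation.leibniz, map_add, smul_eq_mul, MvPolynomial.pderiv_X] at hp ⊢
    rw [hp]
    rcases eq_or_eq_of_ne hi i with rfl | rfl
    · simp [hi.symm, mul_comm]
    · simp [hi.symm, mul_comm, add_comm]

theorem constantCoeff_eval_slice {ξ : PowerSeries R} (hξ : constantCoeff ξ = 0)
    {y : PowerSeries R} (hy : constantCoeff y = 0) :
    constantCoeff ((slice f i₀ ξ).eval y) = algebraMap k R (MvPolynomial.eval 0 f) := by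
  rw [eval_slice, MvPolynomial.aeval_def, MvPolynomial.hom_eval₂]
  have : (fun i => constantCoeff (if i = i₀ then ξ else y)) = 0 := by
    funext i
    split_ifs <;> simpa
  rw [this, MvPolynomial.eval₂_zero_apply, MvPolynomial.eval_zero, RingHom.comp_apply,
    PowerSeries.algebraMap_apply, PowerSeries.constantCoeff_C]

/-- The implicit function theorem for jets. -/
theorem exists_slice_root (h0 : MvPolynomial.eval 0 f = 0) (hi : i₀ ≠ i₁)
    (h1 : MvPolynomial.eval 0 (MvPolynomial.pderiv i₁ f) ≠ 0) {ξ : PowerSeries R}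
    (hξ : constantCoeff ξ = 0) : ∃ y, constantCoeff y = 0 ∧ (slice f i₀ ξ).eval y = 0 ∧
      ∀ y', constantCoeff y' = 0 → ∀ n, X ^ n ∣ (slice f i₀ ξ).eval y' ↔ X ^ n ∣ y' - y := by
  have hu : IsUnit (((slice f i₀ ξ).map constantCoeff).derivative.eval 0) := by
    rw [Polynomial.derivative_map, Polynomial.eval_zero_map, derivative_slice hi,
      constantCoeff_eval_slice hξ (map_zero _)]
    exact (IsUnit.mk0 _ h1).map _
  obtain ⟨y, hy, hy0⟩ := hensel_exists (slice f i₀ ξ) (c := 0)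
    (by rw [Polynomial.eval_zero_map, constantCoeff_eval_slice hξ (map_zero _), h0, map_zero]) hu
  exact ⟨y, hy, hy0, fun y' hy' n => dvd_eval_iff _ hy hy' hu hy0 n⟩

end Section

/-- The jets of a nonsingular curve form a single component. -/
theorem exists_jets_nonsingular [Infinite k] (h0 : MvPolynomial.eval 0 f = 0)
    (hs : ¬ IsSingularAtOrigin f) (m : ℕ) : irr (jetsAtOrigin f m) = {jetsAtOrigin f m} ∧
      ringKrullDim (CoordRing (jetsAtOrigin f m)) = m ∧ embDim (jetsAtOrigin f m) = m := by
  obtain ⟨i₁, h1⟩ : ∃ i, MvPolynomial.eval 0 (MvPolynomial.pderiv i f) ≠ 0 := by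
    by_contra! hc
    exact hs ⟨h0, hc⟩
  obtain ⟨i₀, hi⟩ : ∃ i₀ : Fin 2, i₀ ≠ i₁ := exists_ne i₁
  let ξ : PowerSeries (MvPolynomial (Fin m) k) :=
    PowerSeries.mk fun n => if h : 0 < n ∧ n ≤ m then MvPolynomial.X ⟨n - 1, by omega⟩ else 0
  have hξ : constantCoeff ξ = 0 := by
    rw [← PowerSeries.coeff_zero_eq_constantCoeff_apply, PowerSeries.coeff_mk, dif_neg (by simp)]
  obtain ⟨y, hy, hy0, -⟩ := exists_slice_root (f := f) h0 hi h1 hξ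
  let Θ : Fin 2 × Fin (m + 1) → MvPolynomial (Fin m) k := fun c =>
    coeff (c.2 : ℕ) (if c.1 = i₀ then ξ else y)
  have hΘ : ∀ l : Fin m, Θ (i₀, l.succ) = MvPolynomial.X l := fun l => by
    simp only [Θ, if_true, ξ, PowerSeries.coeff_mk, Fin.val_succ]
    rw [dif_pos ⟨Nat.succ_pos _, l.2⟩]
    rfl
  have hV : jetsAtOrigin f m = {P | ∃ a : Fin m → k, P = fun c => MvPolynomial.eval a (Θ c)} := by
    have hspec : ∀ (a : Fin m → k) (P : JetSpace k m), (∀ l : Fin m, P (i₀, l.succ) = a l) →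
        P (i₀, 0) = 0 → P (i₁, 0) = 0 →
        (P ∈ jetsAtOrigin f m ↔ P = fun c => MvPolynomial.eval a (Θ c)) := by
      intro a P hP hP0 hP1
      let φ : PowerSeries (MvPolynomial (Fin m) k) →ₐ[k] PowerSeries k :=
        PowerSeries.mapAlgHom (MvPolynomial.aeval a)
      have hφ : ∀ F n, coeff n (φ F) = MvPolynomial.eval a (coeff n F) := fun F n => by
        exact PowerSeries.coeff_map _ _ _
      have hξP : φ ξ = jetSeries P i₀ := by
        ext n
        rw [hφ, coeff_jetSeries, PowerSeries.coeff_mk]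
        rcases n with - | n
        · simp [hP0]
        · split_ifs with h2 h3 h3
          · rw [MvPolynomial.eval_X]
            exact (hP ⟨n, by omega⟩).symm
          · omega
          · omega
          · simp
      have hcc : ∀ i, constantCoeff (jetSeries P i) = 0 := (forall_iff_of_ne hi).2 (by
        simp only [← PowerSeries.coeff_zero_eq_constantCoeff_apply]
        exact ⟨(coeff_jetSeries_fin P i₀ 0).trans hP0, (coeff_jetSeries_fin P i₁ 0).trans hP1⟩)
      obtain ⟨y₁, -, -, hy₁⟩ := exists_slice_root (f := f) h0 hi h1 (hcc i₀)
      have hφy : constantCoeff (φ y) = 0 := by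
        rw [← PowerSeries.coeff_zero_eq_constantCoeff_apply, hφ,
          PowerSeries.coeff_zero_eq_constantCoeff_apply, hy, map_zero]
      have hφ0 : (slice f i₀ (jetSeries P i₀)).eval (φ y) = 0 := by
        have := congrArg φ hy0
        rw [eval_slice, MvPolynomial.comp_aeval_apply, map_zero] at this
        rw [eval_slice, ← this]
        congr 2
        funext i
        rw [← hξP, apply_ite φ]
      have h2 := (hy₁ _ hφy (m + 1)).1 (hφ0 ▸ dvd_zero _)
      have h3 := hy₁ _ (hcc i₁) (m + 1)
      have hxi : (fun i => if i = i₀ then jetSeries P i₀ else jetSeries P i₁) = jetSeries P :=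
        funext_of_ne hi (if_pos rfl) (if_neg hi.symm)
      rw [eval_slice, hxi, ← sub_add_sub_cancel (jetSeries P i₁) (φ y) y₁, dvd_add_left h2,
        ← modX_eq_iff, modX_eq_iff_coeff] at h3
      rw [mem_jetsAtOrigin_iff, h3, and_iff_right fun i => PowerSeries.X_dvd_iff.2 (hcc i),
        funext_iff]
      constructor
      · rintro h4 ⟨i, q⟩
        rcases eq_or_eq_of_ne hi i with rfl | rfl
        · simp only [Θ, if_true]
          rw [← hφ, hξP, coeff_jetSeries_fin]
        · simp only [Θ, hi.symm, if_false]
          rw [← hφ, ← h4 q q.2, coeff_jetSeries_fin]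
      · intro h4 q hq
        have h5 := h4 (i₁, ⟨q, hq⟩)
        simp only [Θ, hi.symm, if_false] at h5
        rw [← hφ] at h5
        rw [← h5, coeff_jetSeries, dif_pos hq]
    have hz : ∀ (a : Fin m → k) i, MvPolynomial.eval a (Θ (i, 0)) = 0 := fun a i => by
      simp only [Θ, Fin.val_zero, PowerSeries.coeff_zero_eq_constantCoeff_apply]
      split_ifs <;> simp [hξ, hy]
    ext P
    constructor
    · intro hP
      have h2 : ∀ i, P (i, 0) = 0 := fun i => (coeff_jetSeries_fin P i 0).symm.trans
        (hP.1 i)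
      exact ⟨fun l => P (i₀, l.succ), (hspec _ P (fun _ => rfl) (h2 _) (h2 _)).1 hP⟩
    · rintro ⟨a, rfl⟩
      exact (hspec a _ (fun l => by rw [hΘ, MvPolynomial.eval_X]) (hz a _) (hz a _)).2 rfl
  obtain ⟨t1, t2, t3⟩ := graph_facts (fun l : Fin m => (i₀, l.succ)) Θ hΘ hV
  refine ⟨Set.ext fun W => ⟨fun hW => ?_, ?_⟩, by simpa using t2, by simpa using t3⟩
  · exact subset_antisymm hW.1.2 (hW.2 ⟨t1, subset_rfl⟩ hW.1.2)
  · rintro rfl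
    exact ⟨⟨t1, subset_rfl⟩, fun W hW _ => hW.2⟩

end

section

variable {k : Type u} [Field k] {f g : MvPolynomial (Fin 2) k} {r r' m : ℕ}
  {b : Fin r → MvPowerSeries (Fin 2) k} {b' : Fin r' → MvPowerSeries (Fin 2) k}
  {σ : Fin r ≃ Fin r'}

/-- Two curves with the same staircase walk, and a bijection between their branches that preserves
the rays. -/
structure Comparison (f g : MvPolynomial (Fin 2) k) (b : Fin r → MvPowerSeries (Fin 2) k)
    (b' : Fin r' → MvPowerSeries (Fin 2) k) (σ : Fin r ≃ Fin r') : Prop where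
  left : IsNewtonPlaneCurve f
  right : IsNewtonPlaneCurve g
  factorization : IsFactorization f b
  factorization' : IsFactorization g b'
  walk : JSC f = JSC g
  weights : ∀ i, ∃ w u u', IsBranch (b i) w u ∧ IsBranch (b' (σ i)) w u'

theorem IsNewtonPlaneCurve.ord_eq (hf : IsNewtonPlaneCurve f) (hg : IsNewtonPlaneCurve g)
    (hJ : JSC f = JSC g) {α : ℕ × ℕ} (hα : α ∈ (JSC f).points) :
    ord ↟f (vec α) = ord ↟g (vec α) := by
  rw [← hf.weight_add_one hα, ← hg.weight_add_one (hJ ▸ hα), hJ]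

theorem IsNewtonPlaneCurve.isSingularAtOrigin_iff (hf : IsNewtonPlaneCurve f) :
    IsSingularAtOrigin f ↔ 2 ≤ ord ↟f (vec (1, 1)) := by
  have hf0 := coe_ne_zero hf.ne_zero
  have hv : ∀ d : Fin 2 →₀ ℕ, dot (vec (1, 1)) d = d 0 + d 1 := fun d => by simp [dot]
  refine ⟨fun h => le_ord hf0 fun d hd => (h.two_le d hd).trans_eq (hv d).symm, fun h =>
    ⟨hf.origin, fun i => ?_⟩⟩
  rw [MvPolynomial.eval_zero, MvPolynomial.constantCoeff_eq, MvPolynomial.coeff_pderiv]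
  by_contra hne
  have h1 := h.trans (ord_le (vec (1, 1)) (d := Finsupp.single i 1)
    (by rw [MvPolynomial.coeff_coe]; simpa using hne))
  rw [hv] at h1
  fin_cases i <;> simp at h1

theorem IsNewtonPlaneCurve.one_one_mem_points (hf : IsNewtonPlaneCurve f) :
    (1, 1) ∈ (JSC f).points := by
  refine (hf.mem_points_iff _).2 ⟨fun i => by fin_cases i <;> simp, fun i β hβ h => ?_⟩
  have h1 := congrFun h i
  have h2 := hβ i
  have h3 : vec (1, 1) i = 1 := by fin_cases i <;> rfl
  rw [Pi.add_apply, Pi.single_eq_same, h3] at h1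
  omega

theorem IsNewtonPlaneCurve.isSingularAtOrigin_congr (hf : IsNewtonPlaneCurve f)
    (hg : IsNewtonPlaneCurve g) (hJ : JSC f = JSC g) :
    IsSingularAtOrigin f ↔ IsSingularAtOrigin g := by
  rw [hf.isSingularAtOrigin_iff, hg.isSingularAtOrigin_iff, hf.ord_eq hg hJ hf.one_one_mem_points]

theorem IsBranch.weight_unique {c : MvPowerSeries (Fin 2) k} {w w' : Fin 2 → ℕ} {u : Fin 2 → k}
    (h : IsBranch c w u) (hcop : (w' 0).Coprime (w' 1)) : Trop c w' ↔ w = w' := by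
  rw [h.trop_iff]
  constructor
  · rintro ⟨s, -, rfl⟩
    obtain rfl : s = 1 := Nat.eq_one_of_dvd_coprimes hcop (dvd_mul_right _ _) (dvd_mul_right _ _)
    exact (one_smul _ _).symm
  · rintro rfl
    exact ⟨1, one_pos, (one_smul _ _).symm⟩

namespace Comparison

theorem symm (h : Comparison f g b b' σ) : Comparison g f b' b σ.symm :=
  ⟨h.right, h.left, h.factorization', h.factorization, h.walk.symm, fun i => by
    obtain ⟨w, u, u', h1, h2⟩ := h.weights (σ.symm i)
    exact ⟨w, u', u, by simpa using h2, h1⟩⟩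

theorem trop_iff (h : Comparison f g b b' σ) (i : Fin r) (α : Fin 2 → ℕ) :
    Trop (b' (σ i)) α ↔ Trop (b i) α := by
  obtain ⟨w, u, u', h1, h2⟩ := h.weights i
  rw [h1.trop_iff, h2.trop_iff]

end Comparison

variable [IsAlgClosed k]

theorem exists_comparison (hf : IsNewtonPlaneCurve f) (hg : IsNewtonPlaneCurve g)
    (hb : IsFactorization f b) (hb' : IsFactorization g b') (hJ : JSC f = JSC g) :
    ∃ σ : Fin r ≃ Fin r', Comparison f g b b' σ := by
  choose W U hW using fun i => hf.exists_isBranch (hb.irreducible i) (hb.dvd i)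
  choose W' U' hW' using fun i => hg.exists_isBranch (hb'.irreducible i) (hb'.dvd i)
  have hcard : ∀ w, Nat.card {i // W i = w} = Nat.card {i // W' i = w} := fun w => by
    by_cases hcop : (w 0).Coprime (w 1)
    · have e1 : ∀ i, W i = w ↔ (w 0, w 1) ∈ trop (b i) := fun i => by
        rw [mem_trop_iff, show vec (w 0, w 1) = w from funext_of_ne (i₀ := 0) (i₁ := 1)
          (by decide) rfl rfl, (hW i).weight_unique hcop]
      have e2 : ∀ i, W' i = w ↔ (w 0, w 1) ∈ trop (b' i) := fun i => by
        rw [mem_trop_iff, show vec (w 0, w 1) = w from funext_of_ne (i₀ := 0) (i₁ := 1)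
          (by decide) rfl rfl, (hW' i).weight_unique hcop]
      have e3 : branchCount f (w 0, w 1) = branchCount g (w 0, w 1) := by
        by_cases hw : (w 0, w 1) ∈ (JSC f).points
        · have h1 : (JSC f).arrows (w 0, w 1) = branchCount f (w 0, w 1) := if_pos hw
          have h2 : (JSC g).arrows (w 0, w 1) = branchCount g (w 0, w 1) := if_pos (by rw [hJ] at hw; exact hw)
          rw [← h1, ← h2, hJ]
        · have h0 : ∀ i, (w 0, w 1) ∉ trop (b i) := fun i hi => hw (hf.isFan.mem_walkPoints
            (mem_trop_iff.2 (trop_of_dvd (coe_ne_zero hf.ne_zero) (hb.dvd i) (mem_trop_iff.1 hi))))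
          have h0' : ∀ i, (w 0, w 1) ∉ trop (b' i) := fun i hi => hw (by
            rw [hJ]
            exact hg.isFan.mem_walkPoints (mem_trop_iff.2
              (trop_of_dvd (coe_ne_zero hg.ne_zero) (hb'.dvd i) (mem_trop_iff.1 hi))))
          rw [hb.branchCount_eq hf, hb'.branchCount_eq hg]
          simp [h0, h0']
      rw [hb.branchCount_eq hf, hb'.branchCount_eq hg] at e3
      simp only [e1, e2]
      exact e3
    · have h1 : IsEmpty {i // W i = w} := ⟨fun i => hcop (i.2 ▸ (hW i).coprime)⟩
      have h2 : IsEmpty {i // W' i = w} := ⟨fun i => hcop (i.2 ▸ (hW' i).coprime)⟩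
      simp
  let σ : Fin r ≃ Fin r' := Equiv.ofFiberEquiv fun w =>
    (Finite.card_eq.1 (hcard w)).some
  have hσ : ∀ i, W' (σ i) = W i := fun i => Equiv.ofFiberEquiv_map _ i
  exact ⟨σ, hf, hg, hb, hb', hJ, fun i => ⟨W i, U i, U' (σ i), hW i, hσ i ▸ hW' (σ i)⟩⟩

/-- The action on labels of a bijection between the branches. -/
def labelEquiv (σ : Fin r ≃ Fin r') : (ℕ × ℕ) ⊕ (ℕ × ℕ) × Fin r ≃ (ℕ × ℕ) ⊕ (ℕ × ℕ) × Fin r' :=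
  Equiv.sumCongr (Equiv.refl _) (Equiv.prodCongr (Equiv.refl _) σ)

namespace Comparison

theorem ord_eq (h : Comparison f g b b' σ) {i : Fin r} {α : ℕ × ℕ} (hα : Trop (b i) (vec α)) :
    ord ↟f (vec α) = ord ↟g (vec α) :=
  h.left.ord_eq h.right h.walk (h.left.isFan.mem_walkPoints (mem_trop_iff.2
    (trop_of_dvd (coe_ne_zero h.left.ne_zero) (h.factorization.dvd i) hα)))

theorem mem_labels_iff (h : Comparison f g b b' σ) (l : (ℕ × ℕ) ⊕ (ℕ × ℕ) × Fin r) :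
    l ∈ labels f b m ↔ labelEquiv σ l ∈ labels g b' m := by
  rcases l with γ | ⟨α, i⟩
  · change _ ↔ Sum.inl γ ∈ _
    rw [mem_labels_inl h.left, mem_labels_inl h.right, ← h.left.present_iff, ← h.right.present_iff,
      h.walk]
  · change _ ↔ Sum.inr (α, σ i) ∈ _
    rw [mem_labels_inr h.left h.factorization, mem_labels_inr h.right h.factorization',
      h.trop_iff]
    exact and_congr_right fun hα => by rw [h.ord_eq hα]

end Comparison

end

section

variable {k : Type u} [Field k] [IsAlgClosed k] {f g : MvPolynomial (Fin 2) k} {r r' m : ℕ}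
  {b : Fin r → MvPowerSeries (Fin 2) k} {b' : Fin r' → MvPowerSeries (Fin 2) k}
  {σ : Fin r ≃ Fin r'}

theorem IsNewtonPlaneCurve.embDim_onBranch_smooth (hf : IsNewtonPlaneCurve f)
    {c : MvPowerSeries (Fin 2) k} (hcf : c ∣ ↟f) {w : Fin 2 → ℕ}
    {u : Fin 2 → k} (h : IsBranch c w u) {i₀ : Fin 2} (hw : w i₀ = 1) {α : ℕ × ℕ}
    (hα : Trop c (vec α)) (hm : ord ↟f (vec α) ≤ m) {d : ℕ}
    (hd : ringKrullDim (CoordRing (zariskiClosure (onBranch f c α (m + 1) m))) = d) :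
    embDim (zariskiClosure (onBranch f c α (m + 1) m)) = d := by
  have hf0 := coe_ne_zero hf.ne_zero
  obtain ⟨i₁, hi⟩ : ∃ i₁ : Fin 2, i₁ ≠ i₀ := exists_ne i₀
  have he : (Pi.single i₁ 1 : Fin 2 → ℕ) i₀ = 0 := by simp [hi.symm]
  have he' : (Pi.single i₁ 1 : Fin 2 → ℕ) i₁ = 1 := by simp
  obtain ⟨x, hx, -, hset⟩ := hf.exists_isChartRoot hcf h hi.symm (e := Pi.single i₁ 1)
    (by rw [hw, he, he', mul_zero])
  obtain ⟨s, hs, hs'⟩ := (h.trop_iff _).1 hα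
  rw [hset hs hs'] at hd ⊢
  rw [hs', ord_smul hf0] at hm
  exact embDim_closure_smooth hx hi.symm hw he he' hs
    (M := m + 1 - s * ord ↟f w) (by omega) le_rfl (by omega)
    (fun i => (trop_of_dvd hf0 hcf h.trop).le_ord i) hd

namespace Comparison

theorem dim_eq (h : Comparison f g b b' σ) {l : (ℕ × ℕ) ⊕ (ℕ × ℕ) × Fin r}
    (hl : l ∈ labels f b m) : ringKrullDim (CoordRing (component g b' m (labelEquiv σ l))) =
      ringKrullDim (CoordRing (component f b m l)) ∧ (CharZero k →
        embDim (component g b' m (labelEquiv σ l)) = embDim (component f b m l)) := by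
  have hl' := (h.mem_labels_iff l).1 hl
  rcases l with γ | ⟨α, i⟩
  · exact ⟨rfl, fun _ => rfl⟩
  change Sum.inr (α, σ i) ∈ _ at hl'
  change ringKrullDim (CoordRing (component g b' m (Sum.inr (α, σ i)))) = _ ∧ (CharZero k →
    embDim (component g b' m (Sum.inr (α, σ i))) = _)
  rw [component_inr h.left h.factorization hl, component_inr h.right h.factorization' hl']
  rw [mem_labels_inr h.left h.factorization] at hl
  rw [mem_labels_inr h.right h.factorization'] at hl'
  obtain ⟨d, hd, hd'⟩ := (h.left.onBranch_facts (h.factorization.irreducible i)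
    (h.factorization.dvd i) hl.1 (Nat.lt_succ_of_le hl.2) le_rfl).2
  obtain ⟨d₂, hd₂, hd₂'⟩ := (h.right.onBranch_facts (h.factorization'.irreducible (σ i))
    (h.factorization'.dvd _) hl'.1 (Nat.lt_succ_of_le hl'.2) le_rfl).2
  have ho := h.ord_eq hl.1
  obtain rfl : d = d₂ := by omega
  refine ⟨hd₂.trans hd.symm, fun _ => ?_⟩
  obtain ⟨w, u, u', hb, hb'⟩ := h.weights i
  by_cases hw : ∃ i₀, w i₀ = 1
  · obtain ⟨i₀, hw⟩ := hw
    rw [h.left.embDim_onBranch_smooth (h.factorization.dvd i) hb hw hl.1 hl.2 hd,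
      h.right.embDim_onBranch_smooth (h.factorization'.dvd _) hb' hw hl'.1 hl'.2 hd₂]
  · have hw2 : ∀ j, 2 ≤ w j := fun j => by
      have := hb.pos j
      have := not_exists.1 hw j
      omega
    have hle : ∀ j, vec α j ≤ m := fun j => ((trop_of_dvd (coe_ne_zero h.left.ne_zero)
      (h.factorization.dvd i) hl.1).le_ord j).trans hl.2
    rw [h.left.embDim_onBranch (h.factorization.irreducible i) (h.factorization.dvd i) hb hw2 hl.1
      hle, h.right.embDim_onBranch (h.factorization'.irreducible _) (h.factorization'.dvd _) hb' hw2
      hl'.1 hle]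

theorem truncate_mem_component (h : Comparison f g b b' σ) {l l' : (ℕ × ℕ) ⊕ (ℕ × ℕ) × Fin r}
    (hl : l ∈ labels f b m) (hl' : l' ∈ labels f b (m + 1))
    (hE : ∀ P ∈ component f b (m + 1) l', truncate m P ∈ component f b m l) :
    ∀ P ∈ component g b' (m + 1) (labelEquiv σ l'),
      truncate m P ∈ component g b' m (labelEquiv σ l) := by
  have hf0 := coe_ne_zero h.left.ne_zero
  have hg := (h.mem_labels_iff l).1 hl
  have hg' := (h.mem_labels_iff l').1 hl'
  have hirr := isIrreducibleClosed_component h.left h.factorization hl'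
  have hirr' := isIrreducibleClosed_component h.right h.factorization' hg'
  rcases l with δ | ⟨α, i⟩
  · rcases l' with γ | ⟨β, j⟩
    · exact hE
    · change Sum.inr (β, σ j) ∈ _ at hg'
      change IsIrreducibleClosed (component g b' _ (Sum.inr (β, σ j))) at hirr'
      change ∀ P ∈ component g b' _ (Sum.inr (β, σ j)), truncate m P ∈ hyp δ m
      change ∀ P ∈ _, truncate m P ∈ hyp δ m at hE
      rw [component_inr h.left h.factorization hl'] at hE hirr
      rw [component_inr h.right h.factorization' hg'] at hirr' ⊢
      rw [mem_labels_inl h.left] at hl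
      have hδ : ∀ i, vec δ i ≤ m + 1 := hl.le_add_one hf0
      rw [truncate_onBranch_mem_hyp_iff hδ hirr] at hE
      rwa [truncate_onBranch_mem_hyp_iff hδ hirr']
  · change Sum.inr (α, σ i) ∈ _ at hg
    change ∀ P ∈ _, truncate m P ∈ component g b' m (Sum.inr (α, σ i))
    rw [component_inr h.left h.factorization hl] at hE
    rw [component_inr h.right h.factorization' hg]
    rw [mem_labels_inr h.left h.factorization] at hl
    rw [mem_labels_inr h.right h.factorization'] at hg
    have ho := h.ord_eq hl.1
    obtain ⟨w, u, u', hb, hb'⟩ := h.weights i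
    obtain ⟨s, hs, hα⟩ := (hb.trop_iff _).1 hl.1
    rcases l' with γ | ⟨β, j⟩
    · rw [mem_labels_inl h.left] at hl'
      change ∀ P ∈ hyp γ (m + 1), truncate m P ∈ _ at hE
      change ∀ P ∈ hyp γ (m + 1), truncate m P ∈ _
      by_cases hw : ∃ i₀, w i₀ = 1
      · obtain ⟨i₀, hw⟩ := hw
        obtain ⟨i₁, hi⟩ : ∃ i₁ : Fin 2, i₁ ≠ i₀ := exists_ne i₀
        rw [truncate_hyp_mem_smooth_iff h.left h.factorization hb hi.symm hw hs hα hl.2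
          (hl'.le_add_one hf0) hl'.pos, ho] at hE
        rwa [truncate_hyp_mem_smooth_iff h.right h.factorization' hb' hi.symm hw hs hα hg.2
          (hl'.le_add_one hf0) hl'.pos]
      · have hw2 : ∀ j, 2 ≤ w j := fun j => by
          have := hb.pos j
          have := not_exists.1 hw j
          omega
        exact hb.truncate_hyp_mem_of_singular h.left h.right (h.factorization.irreducible i)
          (h.factorization.dvd i) (h.factorization'.dvd _) hb' hw2 hl.1 ho hl.2 hl' hE
    · change Sum.inr (β, σ j) ∈ _ at hg'
      change ∀ P ∈ component g b' _ (Sum.inr (β, σ j)), truncate m P ∈ _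
      rw [component_inr h.left h.factorization hl'] at hE
      rw [component_inr h.right h.factorization' hg']
      rw [mem_labels_inr h.left h.factorization] at hl'
      rw [mem_labels_inr h.right h.factorization'] at hg'
      by_cases hw : ∃ i₀, w i₀ = 1
      · obtain ⟨i₀, hw⟩ := hw
        obtain ⟨i₁, hi⟩ : ∃ i₁ : Fin 2, i₁ ≠ i₀ := exists_ne i₀
        rw [truncate_onBranch_mem_smooth_iff h.left h.factorization hb hi.symm hw hs hα hl.2
          hl'.1 hl'.2, ho, h.ord_eq hl'.1] at hE
        rwa [truncate_onBranch_mem_smooth_iff h.right h.factorization' hb' hi.symm hw hs hα hg.2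
          hg'.1 hg'.2, σ.injective.eq_iff]
      · have hw2 : ∀ j, 2 ≤ w j := fun j => by
          have := hb.pos j
          have := not_exists.1 hw j
          omega
        rw [truncate_onBranch_mem_singular_iff h.left h.factorization hb hw2 hl.1 hl.2 hl'.1
          hl'.2] at hE
        rwa [truncate_onBranch_mem_singular_iff h.right h.factorization' hb' hw2 hg.1 hg.2 hg'.1
          hg'.2, σ.injective.eq_iff]

end Comparison

end

section

variable {k : Type u} [Field k] {f g : MvPolynomial (Fin 2) k}

/-- An isomorphism of the graphs of jet components. -/
def IsJetIso (e : JetVertex f ≃ JetVertex g) : Prop :=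
  (∀ v, (e v).1 = v.1) ∧ (∀ v w, JetEdge (e v) (e w) ↔ JetEdge v w) ∧ (∀ v, (e v).dim = v.dim) ∧
    (CharZero k → ∀ v, (e v).emb = v.emb)

theorem labelEquiv_symm_apply {r r' : ℕ} (σ : Fin r ≃ Fin r') (l : (ℕ × ℕ) ⊕ (ℕ × ℕ) × Fin r) :
    labelEquiv σ.symm (labelEquiv σ l) = l := by
  rcases l with γ | ⟨α, i⟩ <;> simp [labelEquiv]

theorem truncate_mem_jetsAtOrigin {m : ℕ} {P : JetSpace k (m + 1)}
    (hP : P ∈ jetsAtOrigin f (m + 1)) : truncate m P ∈ jetsAtOrigin f m := by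
  have h2 : ∀ i, modX k (m + 1) (jetSeries (truncate m P) i) = modX k (m + 1) (jetSeries P i) :=
    modX_jetSeries_jetOf (jetSeries P)
  rw [mem_jetsAtOrigin_iff] at hP ⊢
  refine ⟨fun i => ?_, (X_pow_dvd_congr le_rfl (modX_aeval f h2)).2
    ((pow_dvd_pow _ (Nat.le_succ _)).trans hP.2)⟩
  have := (X_pow_dvd_congr (M := 1) (Nat.succ_pos m) (h2 i)).2 (by rw [pow_one]; exact hP.1 i)
  rwa [pow_one] at this

theorem JetVertex.eq_of_nonsingular [Infinite k] (h0 : MvPolynomial.eval 0 f = 0)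
    (hs : ¬ IsSingularAtOrigin f) (v : JetVertex f) : v.2.1 = jetsAtOrigin f v.1 :=
  Set.mem_singleton_iff.1 ((exists_jets_nonsingular h0 hs v.1).1.subset v.2.2)

theorem jetEdge_iff_of_nonsingular [Infinite k] (h0 : MvPolynomial.eval 0 f = 0)
    (hs : ¬ IsSingularAtOrigin f) (v w : JetVertex f) : JetEdge v w ↔ w.1 = v.1 + 1 := by
  have h1 := v.eq_of_nonsingular h0 hs
  have h2 := w.eq_of_nonsingular h0 hs
  rcases v with ⟨m, V⟩
  rcases w with ⟨n, W⟩
  refine and_iff_left_of_imp fun hmn => ?_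
  obtain rfl : n = m + 1 := hmn
  intro P hP
  simp only at h1 h2
  rw [h1]
  exact truncate_mem_jetsAtOrigin (h2 ▸ hP)

theorem exists_isJetIso_nonsingular [Infinite k] (hf : MvPolynomial.eval 0 f = 0)
    (hg : MvPolynomial.eval 0 g = 0) (hs : ¬ IsSingularAtOrigin f) (hs' : ¬ IsSingularAtOrigin g) :
    ∃ e : JetVertex f ≃ JetVertex g, IsJetIso e := by
  let E : ∀ m, irr (jetsAtOrigin f m) ≃ irr (jetsAtOrigin g m) := fun m =>
    ((Equiv.setCongr (exists_jets_nonsingular hf hs m).1).trans (Equiv.ofUnique _ _)).trans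
      (Equiv.setCongr (exists_jets_nonsingular hg hs' m).1).symm
  let e : JetVertex f ≃ JetVertex g := Equiv.sigmaCongrRight E
  have he : ∀ v, (e v).1 = v.1 := fun _ => rfl
  refine ⟨e, he, fun v w => ?_, fun v => ?_, fun _ v => ?_⟩
  · rw [jetEdge_iff_of_nonsingular hf hs, jetEdge_iff_of_nonsingular hg hs', he, he]
  · rw [JetVertex.dim, JetVertex.dim, v.eq_of_nonsingular hf hs, (e v).eq_of_nonsingular hg hs',
      (exists_jets_nonsingular hf hs _).2.1, (exists_jets_nonsingular hg hs' _).2.1, he]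
  · rw [JetVertex.emb, JetVertex.emb, v.eq_of_nonsingular hf hs, (e v).eq_of_nonsingular hg hs',
      (exists_jets_nonsingular hf hs _).2.2, (exists_jets_nonsingular hg hs' _).2.2, he]

variable [IsAlgClosed k] {r r' : ℕ} {b : Fin r → MvPowerSeries (Fin 2) k}
  {b' : Fin r' → MvPowerSeries (Fin 2) k} {σ : Fin r ≃ Fin r'}

theorem Comparison.exists_isJetIso (h : Comparison f g b b' σ) (hs : IsSingularAtOrigin f) :
    ∃ e : JetVertex f ≃ JetVertex g, IsJetIso e := by
  have hs' := (h.left.isSingularAtOrigin_congr h.right h.walk).1 hs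
  let B := fun m => (bijOn_component h.left h.factorization hs m).equiv
  let B' := fun m => (bijOn_component h.right h.factorization' hs' m).equiv
  let L : ∀ m, labels f b m ≃ labels g b' m := fun m =>
    (labelEquiv σ).subtypeEquiv fun l => h.mem_labels_iff l
  let e : JetVertex f ≃ JetVertex g := Equiv.sigmaCongrRight fun m =>
    (B m).symm.trans ((L m).trans (B' m))
  have hrep : ∀ m (V : irr (jetsAtOrigin f m)), ∃ l ∈ labels f b m, V.1 = component f b m l ∧
      (e ⟨m, V⟩).2.1 = component g b' m (labelEquiv σ l) := fun m V => by
    obtain ⟨l, rfl⟩ := (B m).surjective V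
    refine ⟨l.1, l.2, rfl, ?_⟩
    change ((B' m) ((L m) ((B m).symm ((B m) l)))).1 = _
    rw [Equiv.symm_apply_apply]
    rfl
  refine ⟨e, fun _ => rfl, ?_, ?_, ?_⟩
  · rintro ⟨m, V⟩ ⟨n, W⟩
    refine and_congr_right fun hmn => ?_
    obtain rfl : n = m + 1 := hmn
    obtain ⟨l, hl, e1, e2⟩ := hrep m V
    obtain ⟨l', hl', e3, e4⟩ := hrep (m + 1) W
    rw [e2, e4]
    change _ ↔ ∀ P ∈ W.1, truncate m P ∈ V.1
    rw [e1, e3]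
    refine ⟨fun H => ?_, h.truncate_mem_component hl hl'⟩
    have := h.symm.truncate_mem_component ((h.mem_labels_iff l).1 hl) ((h.mem_labels_iff l').1 hl') H
    rwa [labelEquiv_symm_apply, labelEquiv_symm_apply] at this
  · rintro ⟨m, V⟩
    obtain ⟨l, hl, e1, e2⟩ := hrep m V
    rw [JetVertex.dim, JetVertex.dim, e2, e1]
    exact (h.dim_eq hl).1
  · rintro hk ⟨m, V⟩
    obtain ⟨l, hl, e1, e2⟩ := hrep m V
    rw [JetVertex.emb, JetVertex.emb, e2, e1]
    exact (h.dim_eq hl).2 hk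

/-- The staircase walk determines the graph of jet components. -/
theorem exists_isJetIso (hf : IsNewtonPlaneCurve f) (hg : IsNewtonPlaneCurve g)
    (hJ : JSC f = JSC g) : ∃ e : JetVertex f ≃ JetVertex g, IsJetIso e := by
  by_cases hs : IsSingularAtOrigin f
  · obtain ⟨r, b, hb⟩ := hf.exists_factorization
    obtain ⟨r', b', hb'⟩ := hg.exists_factorization
    obtain ⟨σ, h⟩ := exists_comparison hf hg hb hb' hJ
    exact h.exists_isJetIso hs
  · exact exists_isJetIso_nonsingular hf.origin hg.origin hs
      (mt (hf.isSingularAtOrigin_congr hg hJ).2 hs)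

end

end NewtonJets

theorem mainTheorem7 {k : Type*} [Field k] [IsAlgClosed k] (f : MvPolynomial (Fin 2) k)
    (hf : NewtonJets.IsNewtonPlaneCurve f) :
    -- for a singular curve, the components of every `C^0_m` are read off from `J_SC(f)`
    (NewtonJets.IsSingularAtOrigin f →
      ∃ (r : ℕ) (b : Fin r → MvPowerSeries (Fin 2) k),
        (∀ i, Irreducible (b i)) ∧
        (Pairwise fun i j => ¬ Associated (b i) (b j)) ∧
        Associated (f : MvPowerSeries (Fin 2) k) (∏ i, b i) ∧
        (∀ α ∈ (NewtonJets.JSC f).points,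
          (NewtonJets.JSC f).arrows α = Set.ncard {i | α ∈ NewtonJets.trop (b i)}) ∧
        ∀ m : ℕ, Set.BijOn (NewtonJets.component f b m) (NewtonJets.labels f b m)
          (NewtonJets.irr (NewtonJets.jetsAtOrigin f m))) ∧
    -- `J_SC(f)` determines the weighted graph `Jet(f)`
    (∀ g : MvPolynomial (Fin 2) k, NewtonJets.IsNewtonPlaneCurve g →
      NewtonJets.JSC f = NewtonJets.JSC g →
      ∃ e : NewtonJets.JetVertex f ≃ NewtonJets.JetVertex g,
        (∀ v, (e v).1 = v.1) ∧
        (∀ v w, NewtonJets.JetEdge (e v) (e w) ↔ NewtonJets.JetEdge v w) ∧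
        (∀ v, (e v).dim = v.dim) ∧
        (CharZero k → ∀ v, (e v).emb = v.emb)) := by
  refine ⟨fun hs => ?_, fun g hg hJ => NewtonJets.exists_isJetIso hf hg hJ⟩
  obtain ⟨r, b, hb⟩ := hf.exists_factorization
  exact ⟨r, b, hb.irreducible, hb.pairwise, hb.associated, fun α hα =>
    (if_pos hα).trans (hb.branchCount_eq hf α), fun m => NewtonJets.bijOn_component hf hb hs m⟩
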